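/- **Setting.** Let $n\ge 1$ and let $(M,\langle\cdot,\cdot\rangle,\varphi,\zeta)$ be a $(2n+1)$-dimensional almost contact metric manifold: a smooth Riemannian manifold with a smooth $(1,1)$-tensor field $\varphi$ and a smooth unit vector field $\zeta$ such that $\varphi^2=-I+\eta\otimes\zeta$ and $\langle\varphi X,\varphi Y\rangle=\langle X,Y\rangle-\eta(X)\eta(Y)$, where $\eta=\zeta^\flat$. Put $F(X,Y)=\langle X,\varphi Y\rangle$. Let $\nabla$ be the Levi-Civita connection, $R_{X,Y}=\nabla_{[X,Y]}-[\nabla_X,\nabla_Y]$, and let $$\xi_X=-\tfrac12\varphi\circ\nabla_X\varphi+\nabla_X\eta\otimes\zeta-\tfrac12\eta\otimes\nabla_X\zeta$$ be the intrinsic torsion. Repeated indices are summed over a local orthonormal frame $e_1,\dots,e_{2n},e_{2n+1}=\zeta$; scalar products of tensors are the full contractions, and $\xi^\flat_X(Y,Z)=\langle\xi_XY,Z\rangle$. Put $\mathrm{Ric}(X,Y)=\langle R_{e_i,X}e_i,Y\rangle$, $\mathrm{Ric}^*(X,Y)=\langle R_{e_i,X}\varphi e_i,\varphi Y\rangle$,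 $(\mathrm{Ric}^*)^t(X,Y)=\mathrm{Ric}^*(Y,X)$, $s^*=\mathrm{Ric}^*(e_i,e_i)$, and let $d^*$ be the coderivative, $d^*\Psi=-(\nabla_{e_i}\Psi)(e_i,\cdot)$. The Lee form $\theta$ is given by $(n-1)\theta^\sharp=-\varphi(d^*F)^\sharp+\nabla_\zeta\zeta$ if $n>1$, and $\theta=0$ if $n=1$. The manifold is *weakly-ac-Einstein* if $\mathrm{Ric}^*=\frac{s^*}{2n}(\langle\cdot,\cdot\rangle-\eta\otimes\eta)$. *Types.* At each point $\xi$ lies in the space of those $\xi\in T^*M\otimes\mathfrak{so}(TM)$ with $\varphi\xi_XY+\xi_X\varphi Y=\eta(Y)\varphi\xi_X\zeta+\eta(\xi_X\varphi Y)\zeta$. This space is the direct sum of the modules $\mathcal C_1,\dots,\mathcal C_{12}$ of Chinea and González-Dávila: - $\mathcal C_1,\mathcal C_2,\mathcal C_3$: $\xi_\zeta=0$, $\xi_X\zeta=0$, and, respectively: $\xi_XY=-\xi_YX$; the cyclic sum of $\langle\xi_XY,\varphi Z\rangle$ vanishes; $\xi_{\varphi X}\varphi Y=\xi_XY$ and $\xi_{e_i}e_i=0$;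 - $\mathcal C_4$: $4\xi_X=X_\perp^\flat\otimes\vartheta-\vartheta^\flat\otimes X_\perp-(\varphi X)^\flat\otimes\varphi\vartheta+(\varphi\vartheta)^\flat\otimes\varphi X$ for some $\vartheta\perp\zeta$, where $X_\perp=X-\eta(X)\zeta$; - $\mathcal C_5,\dots,\mathcal C_{10}$: $\xi_\zeta=0$, $\langle\xi_XY,Z\rangle=0$ for $Y,Z\perp\zeta$, and the bilinear form $\beta(X,Y)=\eta(\xi_XY)$ on $\zeta^\perp$ is, respectively: a multiple of $\langle\cdot,\cdot\rangle$; a multiple of $F$; Hermitian, skew-symmetric and orthogonal to $F$; Hermitian, symmetric and trace-free; anti-Hermitian and symmetric; anti-Hermitian and skew-symmetric (Hermitian: $\beta(\varphi X,\varphi Y)=\beta(X,Y)$; anti-Hermitian: $\beta(\varphi X,\varphi Y)=-\beta(X,Y)$); - $\mathcal C_{11}$: $\xi_X=\eta(X)\xi_\zeta$ and $\xi_\zeta\zeta=0$; $\mathcal C_{12}$: $\xi_X=\eta(X)\xi_\zeta$ and $\langle\xi_\zeta Y,Z\rangle=0$ for $Y,Z\perp\zeta$. $M$ is of type $\mathcal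 C_{i_1}\oplus\dots\oplus\mathcal C_{i_k}$ if $\xi$ lies in that sum at every point. *Harmonicity.* The structure is *harmonic* if $d^*\xi=-(\nabla_{e_i}\xi)_{e_i}=0$. Let $\mathcal{SO}(M)$ be the bundle of oriented orthonormal frames, $M$ being oriented by $F^n\wedge\eta$, and consider the structure as the section $\sigma:M\to\mathcal{SO}(M)/(\mathrm U(n)\times1)$. The target is the bundle of those pairs $(\varphi',\zeta')$ at points $m$ of $M$ that lie in the $\mathrm{SO}(T_mM)$-orbit of $(\varphi_m,\zeta_m)$. Its metric is $\langle A,B\rangle=\langle\pi_*A,\pi_*B\rangle+\langle\phi(A),\phi(B)\rangle$, where $\pi$ is the projection to $M$ and, for a tangent vector $A$ at $(\varphi',\zeta')$, $\phi(A)$ is the unique skew-symmetric endomorphism $a$ of $T_mM$ orthogonal to the stabilizer algebra of $(\varphi',\zeta')$ such that the covariant derivatives of $\varphi'$ and $\zeta'$ in the direction $A$ are $[a,\varphi']$ and $a\zeta'$. The structure is a *harmonic map* if the tension field of $\sigma$ for these metrics vanishes. **Theorem.** (In all displayed conditions $X$ runs over all vector fields.) (i) If $M$ is of type $\mathcal C_1\oplus\mathcal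 C_2\oplus\mathcal C_4\oplus\mathcal C_5\oplus\mathcal C_6\oplus\mathcal C_7\oplus\mathcal C_8\oplus\mathcal C_{11}\oplus\mathcal C_{12}$, then the structure is a harmonic map if and only if it is harmonic and $$\begin{aligned}d^*(\mathrm{Ric}^*)^t(X)+\tfrac12ds^*(X)={}&\mathrm{Ric}(X,\theta^\sharp)-n\,\mathrm{Ric}^*(X,\theta^\sharp)+2\langle\mathrm{Ric}^*,\xi^\flat_X\rangle-d^*F(\zeta)\,\mathrm{Ric}^*(\zeta,\varphi X)-\mathrm{Ric}^*(X,\xi_\zeta\zeta)\\&-\langle R_{\zeta,X}\zeta,\theta^\sharp\rangle+3\textstyle\sum_{i=1}^{2n}\langle R_{e_i,X}\zeta,\xi_{e_i}\zeta\rangle+\langle R_{\zeta,X},\xi_\zeta\rangle.\end{aligned}$$ (ii) If $M$ is of type $\mathcal C_1\oplus\mathcal C_2\oplus\mathcal C_4\oplus\mathcal C_9\oplus\mathcal C_{10}\oplus\mathcal C_{11}\oplus\mathcal C_{12}$, then the structure is a harmonic map if and only if it is harmonic and $$\begin{aligned}d^*(\mathrm{Ric}^*)^t(X)+\tfrac12ds^*(X)={}&\mathrm{Ric}(X,\theta^\sharp)-n\,\mathrm{Ric}^*(X,\theta^\sharp)+2\langle\mathrm{Ric}^*,\xi^\flat_X\rangle-\mathrm{Ric}^*(X,\xi_\zeta\zeta)\\&-\langle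 R_{\zeta,X}\zeta,\theta^\sharp\rangle+\textstyle\sum_{i=1}^{2n}\langle R_{e_i,X}\zeta,\xi_{e_i}\zeta\rangle+\langle R_{\zeta,X},\xi_\zeta\rangle.\end{aligned}$$ (iii) If $M$ is of type $\mathcal C_1\oplus\mathcal C_2\oplus\mathcal C_5\oplus\mathcal C_6\oplus\mathcal C_7\oplus\mathcal C_8$, then the structure is a harmonic map if and only if $\mathrm{Ric}^*$ is symmetric and $(d^*\mathrm{Ric}^*+\tfrac12ds^*)(X)=3\langle R_{e_i,X}\zeta,\xi_{e_i}\zeta\rangle$. Furthermore: (a) if $M$ is nearly-K-cosymplectic (type $\mathcal C_1$), then the structure is a harmonic map; (b) if $M$ is of the type in (iii) and weakly-ac-Einstein and $n\ge2$, then the structure is a harmonic map if and only if $$(n-1)ds^*=6n\langle R_{e_i,\cdot}\zeta,\xi_{e_i}\zeta\rangle+\left(\tfrac{n-1}{n}s^*d^*\eta-6\langle R_{e_i,\zeta}\zeta,\xi_{e_i}\zeta\rangle\right)\eta.$$ (iv) If $M$ is of type $\mathcal C_1\oplus\mathcal C_2\oplus\mathcal C_9\oplus\mathcal C_{10}$,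 then the structure is a harmonic map if and only if it is harmonic and $$d^*(\mathrm{Ric}^*)^t(X)+\tfrac12ds^*(X)=2\,\mathrm{Ric}^*(\zeta,\xi_X\zeta)+\langle R_{e_i,X}\zeta,\xi_{e_i}\zeta\rangle.$$ In particular, if moreover $M$ is weakly-ac-Einstein and $n\ge2$, then the structure is a harmonic map if and only if it is harmonic and $$(n-1)ds^*=2n\langle R_{e_i,\cdot}\zeta,\xi_{e_i}\zeta\rangle-2\langle R_{e_i,\zeta}\zeta,\xi_{e_i}\zeta\rangle\,\eta.$$ (v) If $M$ is of type $\mathcal C_3\oplus\mathcal C_4\oplus\mathcal C_5\oplus\mathcal C_6\oplus\mathcal C_7\oplus\mathcal C_8\oplus\mathcal C_{11}\oplus\mathcal C_{12}$, then the structure is a harmonic map if and only if it is harmonic and $$\begin{aligned}d^*(\mathrm{Ric}^*)^t(X)+\tfrac12ds^*(X)={}&-(n-1)\mathrm{Ric}^*(X,\theta^\sharp)+2\langle\mathrm{Ric}^*,\xi^\flat_X\rangle-d^*F(\zeta)\,\mathrm{Ric}^*(\zeta,\varphi X)-\mathrm{Ric}^*(X,\xi_\zeta\zeta)\\&-\textstyle\sum_{i=1}^{2n}\langle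 R_{e_i,X}\zeta,\xi_{e_i}\zeta\rangle-\langle R_{\zeta,X},\xi_\zeta\rangle.\end{aligned}$$ (vi) If $M$ is of type $\mathcal C_3\oplus\mathcal C_4\oplus\mathcal C_5\oplus\mathcal C_6\oplus\mathcal C_7\oplus\mathcal C_8$, then the structure is a harmonic map if and only if it is harmonic and $$d^*(\mathrm{Ric}^*)^t(X)+\tfrac12ds^*(X)=-(n-1)\mathrm{Ric}^*(X,\theta^\sharp)+2\langle\mathrm{Ric}^*,\xi^\flat_X\rangle-d^*F(\zeta)\,\mathrm{Ric}^*(\zeta,\varphi X)-\langle R_{e_i,X}\zeta,\xi_{e_i}\zeta\rangle.$$ In particular, if moreover $M$ is weakly-ac-Einstein and $n\ge2$, then the structure is a harmonic map if and only if it is harmonic and $$(n-1)ds^*=-(n-1)s^*\theta-2n\langle R_{e_i,\cdot}\zeta,\xi_{e_i}\zeta\rangle+\left(\tfrac{n-1}{n}s^*d^*\eta+2\langle R_{e_i,\zeta}\zeta,\xi_{e_i}\zeta\rangle\right)\eta.$$ (vii) If $M$ is of type $\mathcal C_3\oplus\mathcal C_4\oplus\mathcal C_9\oplus\mathcal C_{10}\oplus\mathcal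 C_{11}\oplus\mathcal C_{12}$, then the structure is a harmonic map if and only if it is harmonic and $$\begin{aligned}d^*(\mathrm{Ric}^*)^t(X)+\tfrac12ds^*(X)={}&-(n-1)\mathrm{Ric}^*(X,\theta^\sharp)+2\langle\mathrm{Ric}^*,\xi^\flat_X\rangle-\mathrm{Ric}^*(X,\xi_\zeta\zeta)\\&-3\textstyle\sum_{i=1}^{2n}\langle R_{e_i,X}\zeta,\xi_{e_i}\zeta\rangle-\langle R_{\zeta,X},\xi_\zeta\rangle.\end{aligned}$$ (viii) If $M$ is of type $\mathcal C_3\oplus\mathcal C_4\oplus\mathcal C_9\oplus\mathcal C_{10}$, then the structure is a harmonic map if and only if it is harmonic and $$d^*(\mathrm{Ric}^*)^t(X)+\tfrac12ds^*(X)=-(n-1)\mathrm{Ric}^*(X,\theta^\sharp)+2\langle\mathrm{Ric}^*,\xi^\flat_X\rangle-3\langle R_{e_i,X}\zeta,\xi_{e_i}\zeta\rangle.$$ In particular: (a) if moreover $\mathrm{Ric}^*$ is symmetric, then the structure is a harmonic map if and only if $\xi_{\theta^\sharp}=0$ and $d^*\mathrm{Ric}^*+\tfrac12ds^*=-(n-1)\,\theta^\sharp\lrcorner\mathrm{Ric}^*-3\langle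 R_{e_i,\cdot}\zeta,\xi_{e_i}\zeta\rangle$; if moreover $M$ is weakly-ac-Einstein and $n\ge2$, then the structure is a harmonic map if and only if $\xi_{\theta^\sharp}=0$ and $$(n-1)ds^*=-(n-1)s^*\theta-6n\langle R_{e_i,\cdot}\zeta,\xi_{e_i}\zeta\rangle+6\langle R_{e_i,\zeta}\zeta,\xi_{e_i}\zeta\rangle\,\eta;$$ (b) if $M$ is of type $\mathcal C_3\oplus\mathcal C_9\oplus\mathcal C_{10}$, then the structure is a harmonic map if and only if $\mathrm{Ric}^*$ is symmetric and $d^*\mathrm{Ric}^*+\tfrac12ds^*=-3\langle R_{e_i,\cdot}\zeta,\xi_{e_i}\zeta\rangle$; if moreover $M$ is weakly-ac-Einstein and $n\ge2$, then the structure is a harmonic map if and only if $$(n-1)ds^*=-6n\langle R_{e_i,\cdot}\zeta,\xi_{e_i}\zeta\rangle+6\langle R_{e_i,\zeta}\zeta,\xi_{e_i}\zeta\rangle\,\eta.$$ -/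

import Mathlib

open scoped Manifold ContDiff

noncomputable section

namespace AlmostContact

/-- The model space `ℝ^{2n+1}`. -/
abbrev Model (n : ℕ) : Type := EuclideanSpace ℝ (Fin (2 * n + 1))

/-- Bilinear forms on the model space. -/
abbrev Form (n : ℕ) : Type := Model n →L[ℝ] Model n →L[ℝ] ℝ

/-- Bilinear maps `(X, Y) ↦ ξ X Y`, i.e. `ξ_X Y`. -/
abbrev Tors (n : ℕ) : Type := Model n →ₗ[ℝ] Model n →ₗ[ℝ] Model n

/-- The `i`-th standard basis vector. -/
def stdVec {n : ℕ} (i : Fin (2 * n + 1)) : Model n := EuclideanSpace.single i 1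

/-- The inverse Gram matrix `G^{ij}` of a scalar product `G`. -/
def gramInv {n : ℕ} (G : Form n) : Matrix (Fin (2 * n + 1)) (Fin (2 * n + 1)) ℝ :=
  (Matrix.of fun i j => G (stdVec i) (stdVec j))⁻¹

/-- Metric contraction `∑_{i,j} G^{ij} B(b_i, b_j)` in the standard basis. For a scalar product `G`
and a bilinear `B` this is `∑_i B(e_i, e_i)` for every `G`-orthonormal basis `(e_i)`. -/
def contract {n : ℕ} {W : Type*} [AddCommGroup W] [Module ℝ W] (G : Form n)
    (B : Model n → Model n → W) : W :=
  ∑ i, ∑ j, gramInv G i j • B (stdVec i) (stdVec j)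

/-- The vector `α^♯` that is metrically equivalent to the one-form `α`. -/
def sharp {n : ℕ} (G : Form n) (α : Model n → ℝ) : Model n :=
  contract G fun a b => α a • b

/-- The scalar product `∑_{j,k} A(e_j, e_k) B(e_j, e_k)` of `(0,2)`-tensors. -/
def innerForm {n : ℕ} (G : Form n) (A B : Model n → Model n → ℝ) : ℝ :=
  contract G fun a a' => contract G fun b b' => A a b * B a' b'

/-- The scalar product `∑_j ⟨A e_j, B e_j⟩` of `(1,1)`-tensors. -/
def innerEnd {n : ℕ} (G : Form n) (A B : Model n → Model n) : ℝ :=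
  contract G fun a b => G (A a) (B b)

/-! ### The twelve modules of intrinsic torsions

In this section `G` is the scalar product, `φ` the endomorphism and `ζ` the Reeb vector of an
almost contact metric structure on one tangent space, and `η = G ζ`. -/

section Modules

variable {n : ℕ} (G : Form n) (φ : Model n →L[ℝ] Model n) (ζ : Model n)

/-- The space `T^* ⊗ 𝔲(n)^⊥` of possible intrinsic torsions: every `ξ_X` is skew-symmetric and
`φ ξ_X Y + ξ_X φ Y = η(Y) φ ξ_X ζ + η(ξ_X φ Y) ζ`. -/
def torsionSpace : Submodule ℝ (Tors n) where
  carrier := {ξ | (∀ X Y Z, G (ξ X Y) Z = -G Y (ξ X Z)) ∧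
    ∀ X Y, φ (ξ X Y) + ξ X (φ Y) = G ζ Y • φ (ξ X ζ) + G ζ (ξ X (φ Y)) • ζ}
  zero_mem' := by simp
  add_mem' := by
    rintro a b ⟨h1, h2⟩ ⟨k1, k2⟩
    refine ⟨fun X Y Z => ?_, fun X Y => ?_⟩
    · simp only [LinearMap.add_apply, map_add, add_apply, h1, k1]; ring
    · have := congrArg₂ (· + ·) (h2 X Y) (k2 X Y)
      simp only [LinearMap.add_apply, map_add, smul_add, add_smul] at this ⊢
      rw [add_add_add_comm, this]; abel
  smul_mem' := by
    rintro c a ⟨h1, h2⟩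
    refine ⟨fun X Y Z => ?_, fun X Y => ?_⟩
    · simp only [LinearMap.smul_apply, map_smul, smul_apply, h1, smul_neg]
    · have := congrArg (c • ·) (h2 X Y)
      simp only [LinearMap.smul_apply, map_smul, smul_add, smul_assoc] at this ⊢
      rw [this, smul_comm]

/-- The summand `η^⊥ ⊗ 𝔲(n)^⊥_{|ζ^⊥}`: `ξ_ζ = 0` and `ξ_X ζ = 0`. -/
def horizontalPart : Submodule ℝ (Tors n) where
  carrier := {ξ | ξ ∈ torsionSpace G φ ζ ∧ ξ ζ = 0 ∧ ∀ X, ξ X ζ = 0}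
  zero_mem' := by simp
  add_mem' := by
    rintro a b ⟨h1, h2, h3⟩ ⟨k1, k2, k3⟩
    exact ⟨add_mem h1 k1, by simp [h2, k2], fun X => by simp [h3, k3]⟩
  smul_mem' := by
    rintro c a ⟨h1, h2, h3⟩
    exact ⟨Submodule.smul_mem _ c h1, by simp [h2], fun X => by simp [h3]⟩

/-- The summand `η^⊥ ⊗ (η^⊥ ∧ η)`: `ξ_ζ = 0`, and `⟨ξ_X Y, Z⟩ = 0` for `Y, Z ⊥ ζ`. Such a `ξ` is
determined by the bilinear form `(∇_X η)(Y) = -(ξ_X η)(Y) = η(ξ_X Y)` on `ζ^⊥`. -/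
def mixedPart : Submodule ℝ (Tors n) where
  carrier := {ξ | ξ ∈ torsionSpace G φ ζ ∧ ξ ζ = 0 ∧
    ∀ X Y Z, G ζ Y = 0 → G ζ Z = 0 → G (ξ X Y) Z = 0}
  zero_mem' := by simp
  add_mem' := by
    rintro a b ⟨h1, h2, h3⟩ ⟨k1, k2, k3⟩
    exact ⟨add_mem h1 k1, by simp [h2, k2], fun X Y Z hY hZ => by
      simp [h3 X Y Z hY hZ, k3 X Y Z hY hZ]⟩
  smul_mem' := by
    rintro c a ⟨h1, h2, h3⟩
    exact ⟨Submodule.smul_mem _ c h1, by simp [h2], fun X Y Z hY hZ => by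
      simp [h3 X Y Z hY hZ]⟩

/-- The summand `η ⊗ 𝔲(n)^⊥`: `ξ_X = η(X) ξ_ζ`. -/
def verticalPart : Submodule ℝ (Tors n) where
  carrier := {ξ | ξ ∈ torsionSpace G φ ζ ∧ ∀ X Y, ξ X Y = G ζ X • ξ ζ Y}
  zero_mem' := by simp
  add_mem' := by
    rintro a b ⟨h1, h2⟩ ⟨k1, k2⟩
    exact ⟨add_mem h1 k1, fun X Y => by
      rw [LinearMap.add_apply, LinearMap.add_apply, h2 X Y, k2 X Y]; simp⟩
  smul_mem' := by
    rintro c a ⟨h1, h2⟩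
    exact ⟨Submodule.smul_mem _ c h1, fun X Y => by
      rw [LinearMap.smul_apply, LinearMap.smul_apply, h2 X Y]; simp [smul_comm c]⟩

/-- `ξ_X Y = - ξ_Y X` on `ζ^⊥`. -/
def C1 : Submodule ℝ (Tors n) where
  carrier := {ξ | ξ ∈ horizontalPart G φ ζ ∧ ∀ X Y, ξ X Y = -ξ Y X}
  zero_mem' := by simp
  add_mem' := by
    rintro a b ⟨h1, h2⟩ ⟨k1, k2⟩
    exact ⟨add_mem h1 k1, fun X Y => by
      rw [LinearMap.add_apply, LinearMap.add_apply, h2 X Y, k2 X Y]; simp [add_comm]⟩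
  smul_mem' := by
    rintro c a ⟨h1, h2⟩
    exact ⟨Submodule.smul_mem _ c h1, fun X Y => by
      rw [LinearMap.smul_apply, LinearMap.smul_apply, h2 X Y]; simp⟩

/-- The cyclic sum of `⟨ξ_X Y, φ Z⟩` vanishes; for the intrinsic torsion this is the vanishing of
the cyclic sum of `(∇_X F)(Y, Z)` on `ζ^⊥`. -/
def C2 : Submodule ℝ (Tors n) where
  carrier := {ξ | ξ ∈ horizontalPart G φ ζ ∧
    ∀ X Y Z, G (ξ X Y) (φ Z) + G (ξ Y Z) (φ X) + G (ξ Z X) (φ Y) = 0}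
  zero_mem' := by simp
  add_mem' := by
    rintro a b ⟨h1, h2⟩ ⟨k1, k2⟩
    refine ⟨add_mem h1 k1, fun X Y Z => ?_⟩
    simp only [LinearMap.add_apply, map_add, add_apply]
    linear_combination h2 X Y Z + k2 X Y Z
  smul_mem' := by
    rintro c a ⟨h1, h2⟩
    refine ⟨Submodule.smul_mem _ c h1, fun X Y Z => ?_⟩
    simp only [LinearMap.smul_apply, map_smul, smul_apply, smul_eq_mul]
    linear_combination c * h2 X Y Z

/-- `ξ_{φ X} φ Y = ξ_X Y` and `∑_i ξ_{e_i} e_i = 0`. -/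
def C3 : Submodule ℝ (Tors n) where
  carrier := {ξ | ξ ∈ horizontalPart G φ ζ ∧ (∀ X Y, ξ (φ X) (φ Y) = ξ X Y) ∧
    contract G (fun a b => ξ a b) = 0}
  zero_mem' := by simp [contract]
  add_mem' := by
    rintro a b ⟨h1, h2, h3⟩ ⟨k1, k2, k3⟩
    refine ⟨add_mem h1 k1, fun X Y => by simp [h2, k2], ?_⟩
    simp only [contract] at h3 k3
    simp only [contract, LinearMap.add_apply, smul_add, Finset.sum_add_distrib, h3, k3, add_zero]
  smul_mem' := by
    rintro c a ⟨h1, h2, h3⟩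
    refine ⟨Submodule.smul_mem _ c h1, fun X Y => by simp [h2], ?_⟩
    simp only [contract] at h3
    simp only [contract, LinearMap.smul_apply, smul_comm _ c, ← Finset.smul_sum, h3, smul_zero]

/-- With `X_⊥ = X - η(X) ζ`, there is a vector `θ ⊥ ζ` such that
`4 ξ_X = X_⊥^♭ ⊗ θ - θ^♭ ⊗ X_⊥ - (φ X)^♭ ⊗ φ θ + (φ θ)^♭ ⊗ φ X`. -/
def C4 : Submodule ℝ (Tors n) where
  carrier := {ξ | ξ ∈ torsionSpace G φ ζ ∧ ∃ θ, G ζ θ = 0 ∧ ∀ X Y,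
    (4 : ℝ) • ξ X Y = G (X - G ζ X • ζ) Y • θ - G θ Y • (X - G ζ X • ζ)
      - G (φ X) Y • φ θ + G (φ θ) Y • φ X}
  zero_mem' := ⟨zero_mem _, 0, by simp, by simp⟩
  add_mem' := by
    rintro a b ⟨h1, θ, h2, h3⟩ ⟨k1, θ', k2, k3⟩
    refine ⟨add_mem h1 k1, θ + θ', by simp [h2, k2], fun X Y => ?_⟩
    rw [LinearMap.add_apply, LinearMap.add_apply, smul_add, h3, k3]
    simp only [map_add, add_apply, smul_add, add_smul]
    abel
  smul_mem' := by
    rintro c a ⟨h1, θ, h2, h3⟩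
    refine ⟨Submodule.smul_mem _ c h1, c • θ, by simp [h2], fun X Y => ?_⟩
    rw [LinearMap.smul_apply, LinearMap.smul_apply, smul_comm, h3]
    simp only [map_smul, smul_apply, smul_add, smul_sub, smul_eq_mul, mul_smul,
      smul_comm _ c]

/-- `(∇_X η)(Y) = a ⟨X, Y⟩` on `ζ^⊥` for some `a : ℝ`. -/
def C5 : Submodule ℝ (Tors n) where
  carrier := {ξ | ξ ∈ mixedPart G φ ζ ∧ ∃ a : ℝ, ∀ X Y, G ζ X = 0 → G ζ Y = 0 →
    G ζ (ξ X Y) = a * G X Y}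
  zero_mem' := ⟨zero_mem _, 0, by simp⟩
  add_mem' := by
    rintro a b ⟨h1, s, h2⟩ ⟨k1, t, k2⟩
    exact ⟨add_mem h1 k1, s + t, fun X Y hX hY => by simp [h2 X Y hX hY, k2 X Y hX hY, add_mul]⟩
  smul_mem' := by
    rintro c a ⟨h1, s, h2⟩
    exact ⟨Submodule.smul_mem _ c h1, c * s, fun X Y hX hY => by simp [h2 X Y hX hY, mul_assoc]⟩

/-- `(∇_X η)(Y) = a F(X, Y)` on `ζ^⊥` for some `a : ℝ`, where `F(X, Y) = ⟨X, φ Y⟩`. -/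
def C6 : Submodule ℝ (Tors n) where
  carrier := {ξ | ξ ∈ mixedPart G φ ζ ∧ ∃ a : ℝ, ∀ X Y, G ζ X = 0 → G ζ Y = 0 →
    G ζ (ξ X Y) = a * G X (φ Y)}
  zero_mem' := ⟨zero_mem _, 0, by simp⟩
  add_mem' := by
    rintro a b ⟨h1, s, h2⟩ ⟨k1, t, k2⟩
    exact ⟨add_mem h1 k1, s + t, fun X Y hX hY => by simp [h2 X Y hX hY, k2 X Y hX hY, add_mul]⟩
  smul_mem' := by
    rintro c a ⟨h1, s, h2⟩
    exact ⟨Submodule.smul_mem _ c h1, c * s, fun X Y hX hY => by simp [h2 X Y hX hY, mul_assoc]⟩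

/-- Elements of `η^⊥ ⊗ (η^⊥ ∧ η)` whose form `β(X, Y) = (∇_X η)(Y)` on `ζ^⊥` satisfies
`β(φ X, φ Y) = ε β(X, Y)` and `β(Y, X) = δ β(X, Y)`. -/
def mixedSym (ε δ : ℝ) : Submodule ℝ (Tors n) where
  carrier := {ξ | ξ ∈ mixedPart G φ ζ ∧ ∀ X Y, G ζ X = 0 → G ζ Y = 0 →
    G ζ (ξ (φ X) (φ Y)) = ε * G ζ (ξ X Y) ∧ G ζ (ξ Y X) = δ * G ζ (ξ X Y)}
  zero_mem' := by simp
  add_mem' := by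
    rintro a b ⟨h1, h2⟩ ⟨k1, k2⟩
    exact ⟨add_mem h1 k1, fun X Y hX hY => by
      simp [h2 X Y hX hY, k2 X Y hX hY, mul_add]⟩
  smul_mem' := by
    rintro c a ⟨h1, h2⟩
    exact ⟨Submodule.smul_mem _ c h1, fun X Y hX hY => by
      simp [h2 X Y hX hY, mul_left_comm c]⟩

/-- `∇η` on `ζ^⊥` is Hermitian, skew-symmetric and orthogonal to `F`. -/
def C7 : Submodule ℝ (Tors n) where
  carrier := {ξ | ξ ∈ mixedSym G φ ζ 1 (-1) ∧ contract G (fun a b => G ζ (ξ a (φ b))) = 0}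
  zero_mem' := by simp [contract]
  add_mem' := by
    rintro a b ⟨h1, h3⟩ ⟨k1, k3⟩
    refine ⟨add_mem h1 k1, ?_⟩
    simp only [contract] at h3 k3
    simp only [contract, LinearMap.add_apply, map_add, smul_add, Finset.sum_add_distrib, h3, k3,
      add_zero]
  smul_mem' := by
    rintro c a ⟨h1, h3⟩
    refine ⟨Submodule.smul_mem _ c h1, ?_⟩
    simp only [contract] at h3
    simp only [contract, LinearMap.smul_apply, map_smul, smul_comm _ c, ← Finset.smul_sum, h3,
      smul_zero]

/-- `∇η` on `ζ^⊥` is Hermitian, symmetric and trace-free. -/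
def C8 : Submodule ℝ (Tors n) where
  carrier := {ξ | ξ ∈ mixedSym G φ ζ 1 1 ∧ contract G (fun a b => G ζ (ξ a b)) = 0}
  zero_mem' := by simp [contract]
  add_mem' := by
    rintro a b ⟨h1, h3⟩ ⟨k1, k3⟩
    refine ⟨add_mem h1 k1, ?_⟩
    simp only [contract] at h3 k3
    simp only [contract, LinearMap.add_apply, map_add, smul_add, Finset.sum_add_distrib, h3, k3,
      add_zero]
  smul_mem' := by
    rintro c a ⟨h1, h3⟩
    refine ⟨Submodule.smul_mem _ c h1, ?_⟩
    simp only [contract] at h3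
    simp only [contract, LinearMap.smul_apply, map_smul, smul_comm _ c, ← Finset.smul_sum, h3,
      smul_zero]

/-- `∇η` on `ζ^⊥` is anti-Hermitian and symmetric. -/
def C9 : Submodule ℝ (Tors n) := mixedSym G φ ζ (-1) 1

/-- `∇η` on `ζ^⊥` is anti-Hermitian and skew-symmetric. -/
def C10 : Submodule ℝ (Tors n) := mixedSym G φ ζ (-1) (-1)

/-- The module `η ⊗ 𝔲(n)^⊥_{|ζ^⊥}`. -/
def C11 : Submodule ℝ (Tors n) where
  carrier := {ξ | ξ ∈ verticalPart G φ ζ ∧ ξ ζ ζ = 0}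
  zero_mem' := by simp
  add_mem' := by
    rintro a b ⟨h1, h2⟩ ⟨k1, k2⟩
    exact ⟨add_mem h1 k1, by simp [h2, k2]⟩
  smul_mem' := by
    rintro c a ⟨h1, h2⟩
    exact ⟨Submodule.smul_mem _ c h1, by simp [h2]⟩

/-- The module `η ⊗ (η^⊥ ∧ η)`. -/
def C12 : Submodule ℝ (Tors n) where
  carrier := {ξ | ξ ∈ verticalPart G φ ζ ∧
    ∀ Y Z, G ζ Y = 0 → G ζ Z = 0 → G (ξ ζ Y) Z = 0}
  zero_mem' := by simp
  add_mem' := by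
    rintro a b ⟨h1, h2⟩ ⟨k1, k2⟩
    exact ⟨add_mem h1 k1, fun Y Z hY hZ => by simp [h2 Y Z hY hZ, k2 Y Z hY hZ]⟩
  smul_mem' := by
    rintro c a ⟨h1, h2⟩
    exact ⟨Submodule.smul_mem _ c h1, fun Y Z hY hZ => by simp [h2 Y Z hY hZ]⟩

/-- The modules `𝒞_1, …, 𝒞_12`. -/
def classModule : ℕ → Submodule ℝ (Tors n)
  | 1 => C1 G φ ζ
  | 2 => C2 G φ ζ
  | 3 => C3 G φ ζ
  | 4 => C4 G φ ζ
  | 5 => C5 G φ ζ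
  | 6 => C6 G φ ζ
  | 7 => C7 G φ ζ
  | 8 => C8 G φ ζ
  | 9 => C9 G φ ζ
  | 10 => C10 G φ ζ
  | 11 => C11 G φ ζ
  | 12 => C12 G φ ζ
  | _ => ⊥

end Modules

/-! ### Local tensor calculus -/

/-- The coordinate expressions of a metric, an endomorphism field and a vector field in a chart.
All tensors below are computed at a point `y` of the chart domain, on vectors of `ℝ^{2n+1}`. -/
structure LocalData (n : ℕ) where
  g : Model n → Form n
  φ : Model n → Model n →L[ℝ] Model n
  ζ : Model n → Model n

namespace LocalData

variable {n : ℕ} (D : LocalData n) (y : Model n)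

/-- `η = ζ^♭`. -/
def eta (X : Model n) : ℝ := D.g y (D.ζ y) X

/-- The fundamental two-form `F(X, Y) = ⟨X, φ Y⟩`. -/
def fundForm (X Y : Model n) : ℝ := D.g y X (D.φ y Y)

/-- Christoffel symbols of the first kind:
`⟨∇_X Y, Z⟩` for coordinate (constant) fields, by the Koszul formula. -/
def koszul (X Y Z : Model n) : ℝ :=
  (fderiv ℝ D.g y X Y Z + fderiv ℝ D.g y Y X Z - fderiv ℝ D.g y Z X Y) / 2

/-- The Christoffel symbols `Γ(X, Y)` of the Levi-Civita connection: for a vector field `V`,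
`∇_X V = D_X V + Γ(X, V)`. -/
def Γ : Tors n :=
  LinearMap.mk₂ ℝ (fun X Y => sharp (D.g y) fun Z => D.koszul y X Y Z)
    (by
      intro X X' Y
      simp only [sharp, contract, koszul, map_add, add_apply,
        ← Finset.sum_add_distrib, ← smul_add, ← add_smul]
      refine Finset.sum_congr rfl fun i _ => Finset.sum_congr rfl fun j _ => ?_
      congr 2; ring)
    (by
      intro c X Y
      simp only [sharp, contract, koszul, map_smul, smul_apply,
        Finset.smul_sum, smul_comm c, ← smul_assoc, smul_eq_mul]
      refine Finset.sum_congr rfl fun i _ => Finset.sum_congr rfl fun j _ => ?_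
      congr 1; ring)
    (by
      intro X Y Y'
      simp only [sharp, contract, koszul, map_add, add_apply,
        ← Finset.sum_add_distrib, ← smul_add, ← add_smul]
      refine Finset.sum_congr rfl fun i _ => Finset.sum_congr rfl fun j _ => ?_
      congr 2; ring)
    (by
      intro c X Y
      simp only [sharp, contract, koszul, map_smul, smul_apply,
        Finset.smul_sum, smul_comm c, ← smul_assoc, smul_eq_mul]
      refine Finset.sum_congr rfl fun i _ => Finset.sum_congr rfl fun j _ => ?_
      congr 1; ring)

/-- `(∇_X φ) Y`. -/
def nablaPhi (X Y : Model n) : Model n :=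
  fderiv ℝ D.φ y X Y + D.Γ y X (D.φ y Y) - D.φ y (D.Γ y X Y)

/-- `∇_X ζ`. -/
def nablaZeta (X : Model n) : Model n := fderiv ℝ D.ζ y X + D.Γ y X (D.ζ y)

/-- The intrinsic torsion
`ξ_X = - ½ φ ∘ ∇_X φ + ∇_X η ⊗ ζ - ½ η ⊗ ∇_X ζ`, where `∇_X η = (∇_X ζ)^♭`. -/
def ξ : Tors n :=
  LinearMap.mk₂ ℝ (fun X Y => -(1 / 2 : ℝ) • D.φ y (D.nablaPhi y X Y)
      + D.g y (D.nablaZeta y X) Y • D.ζ y - (1 / 2 : ℝ) • D.eta y Y • D.nablaZeta y X)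
    (by
      intro X X' Y
      simp only [nablaPhi, nablaZeta, eta, map_add, map_sub, add_apply,
        LinearMap.add_apply, smul_add, add_smul, smul_sub]
      abel)
    (by
      intro c X Y
      simp only [nablaPhi, nablaZeta, eta, map_add, map_sub, map_smul,
        add_apply, smul_apply, LinearMap.smul_apply,
        smul_add, add_smul, smul_sub, smul_eq_mul, mul_smul, smul_comm _ c])
    (by
      intro X Y Y'
      simp only [nablaPhi, nablaZeta, eta, map_add, map_sub, smul_add, add_smul, smul_sub]
      abel)
    (by
      intro c X Y
      simp only [nablaPhi, nablaZeta, eta, map_add, map_sub, map_smul,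
        smul_add, smul_sub, smul_eq_mul, mul_smul, smul_comm _ c])

/-- The curvature tensor `R_{X,Y} Z = ∇_{[X,Y]} Z - [∇_X, ∇_Y] Z`. -/
def R (X Y Z : Model n) : Model n :=
  -(fderiv ℝ (fun z => D.Γ z Y Z) y X - fderiv ℝ (fun z => D.Γ z X Z) y Y
    + D.Γ y X (D.Γ y Y Z) - D.Γ y Y (D.Γ y X Z))

/-- The Ricci tensor `Ric(X, Y) = ⟨R_{e_i,X} e_i, Y⟩`. -/
def ric (X Y : Model n) : ℝ :=
  contract (D.g y) fun a b => D.g y (D.R y a X b) Y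

/-- The `*`-Ricci tensor `Ric^*(X, Y) = ⟨R_{e_i,X} φ e_i, φ Y⟩`. -/
def ricStar (X Y : Model n) : ℝ :=
  contract (D.g y) fun a b => D.g y (D.R y a X (D.φ y b)) (D.φ y Y)

/-- The `*`-scalar curvature `s^* = Ric^*(e_i, e_i)`. -/
def sStar : ℝ := contract (D.g y) fun a b => D.ricStar y a b

/-- The differential `ds^*`. -/
def dsStar (X : Model n) : ℝ := fderiv ℝ D.sStar y X

/-- The coderivative `d^* α = - (∇_{e_i} α)(e_i)` of a field of one-forms. -/
def codiffOne (α : Model n → Model n → ℝ) : ℝ :=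
  -contract (D.g y) fun a b => fderiv ℝ (fun z => α z b) y a - α y (D.Γ y a b)

/-- The coderivative `d^* A (X) = - (∇_{e_i} A)(e_i, X)` of a field of `(0,2)`-tensors. -/
def codiffTwo (A : Model n → Model n → Model n → ℝ) (X : Model n) : ℝ :=
  -contract (D.g y) fun a b =>
    fderiv ℝ (fun z => A z b X) y a - A y (D.Γ y a b) X - A y b (D.Γ y a X)

/-- `d^* η`. -/
def dStarEta : ℝ := D.codiffOne y D.eta

/-- `d^* F`. -/
def dStarF (X : Model n) : ℝ := D.codiffTwo y D.fundForm X

/-- `d^* Ric^*`. -/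
def dStarRicStar (X : Model n) : ℝ := D.codiffTwo y D.ricStar X

/-- `d^* (Ric^*)^t`, where `(Ric^*)^t(X, Y) = Ric^*(Y, X)`. -/
def dStarRicStarT (X : Model n) : ℝ := D.codiffTwo y (fun z X Y => D.ricStar z Y X) X

/-- The metric dual `θ^♯` of the Lee form `θ`, `(n - 1) θ^♯ = - φ (d^*F)^♯ + ∇_ζ ζ`
(for `n = 1`, where the right-hand side vanishes, `θ = 0`). -/
def leeVec : Model n :=
  ((n : ℝ) - 1)⁻¹ • (-D.φ y (sharp (D.g y) (D.dStarF y)) + D.nablaZeta y (D.ζ y))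

/-- The Lee form `θ`. -/
def lee (X : Model n) : ℝ := D.g y (D.leeVec y) X

/-- `(∇_Z ξ)_X Y`. -/
def nablaXi (Z X Y : Model n) : Model n :=
  fderiv ℝ (fun z => D.ξ z X Y) y Z + D.Γ y Z (D.ξ y X Y) - D.ξ y (D.Γ y Z X) Y
    - D.ξ y X (D.Γ y Z Y)

/-- The coderivative `d^* ξ = - (∇_{e_i} ξ)_{e_i}` of the intrinsic torsion, an endomorphism. -/
def dStarXi (Y : Model n) : Model n :=
  -contract (D.g y) fun a b => D.nablaXi y a b Y

/-- `⟨Ric^*, ξ_X^♭⟩`, where `ξ_X^♭(Y, Z) = ⟨ξ_X Y, Z⟩`. -/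
def ricStarXi (X : Model n) : ℝ :=
  innerForm (D.g y) (D.ricStar y) fun Y Z => D.g y (D.ξ y X Y) Z

/-- `⟨R_{e_i,X} ζ, ξ_{e_i} ζ⟩`, summed over a whole orthonormal basis `e_1, …, e_{2n+1}`. -/
def curvXi (X : Model n) : ℝ :=
  contract (D.g y) fun a b => D.g y (D.R y a X (D.ζ y)) (D.ξ y b (D.ζ y))

/-- `∑_{i=1}^{2n} ⟨R_{e_i,X} ζ, ξ_{e_i} ζ⟩`, summed over an orthonormal basis `e_1, …, e_{2n}`
of `ζ^⊥`. -/
def curvXiHor (X : Model n) : ℝ :=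
  D.curvXi y X - D.g y (D.R y (D.ζ y) X (D.ζ y)) (D.ξ y (D.ζ y) (D.ζ y))

/-- `⟨R_{ζ,X}, ξ_ζ⟩`. -/
def curvZetaXi (X : Model n) : ℝ :=
  innerEnd (D.g y) (D.R y (D.ζ y) X) fun Y => D.ξ y (D.ζ y) Y

/-! ### The bundle `𝒮𝒪(M)/(U(n)×1)` and its Riemannian metric

The point `p · (U(n)×1)` of `𝒮𝒪(M)/(U(n)×1)` over `z`, where `p : ℝ^{2n+1} → T_z M` is an oriented
orthonormal frame, is identified with the pair `(p φ₀ p⁻¹, p ζ₀)` of an endomorphism and a vector of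
`T_z M`, where `(φ₀, ζ₀)` is the standard structure of `ℝ^{2n+1}`. The given structure `(φ, ζ)` is
the section `σ(z) = (φ_z, ζ_z)`, and the orientation is the one that it induces. -/

/-- `(A, v)` is a point of `𝒮𝒪(M)/(U(n)×1)` over `y`: it lies in the `SO(T_y M)`-orbit of
`(φ_y, ζ_y)`. -/
def IsFibrePoint (A : Model n →L[ℝ] Model n) (v : Model n) : Prop :=
  ∃ a : Model n →L[ℝ] Model n, (∀ X Y, D.g y (a X) (a Y) = D.g y X Y) ∧
    LinearMap.det (a : Model n →ₗ[ℝ] Model n) = 1 ∧ A.comp a = a.comp (D.φ y) ∧ v = a (D.ζ y)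

/-- A (local) smooth one-parameter variation `Φ(x, t) = (f(x, t), A(x, t), v(x, t))`, through maps
into `𝒮𝒪(M)/(U(n)×1)`, of the section `σ`; it is defined on the open set `Ω ⊆ ℝ^{2n+1} × ℝ` and
stays over the chart domain `U`. -/
structure IsVariation (U : Set (Model n)) (Ω : Set (Model n × ℝ)) (f : Model n × ℝ → Model n)
    (A : Model n × ℝ → Model n →L[ℝ] Model n) (v : Model n × ℝ → Model n) : Prop where
  isOpen : IsOpen Ω
  smooth_base : ContDiffOn ℝ ∞ f Ω
  smooth_end : ContDiffOn ℝ ∞ A Ω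
  smooth_vec : ContDiffOn ℝ ∞ v Ω
  mem_base : ∀ p ∈ Ω, f p ∈ U
  mem_fibre : ∀ p ∈ Ω, D.IsFibrePoint (f p) (A p) (v p)
  initial : ∀ x, (x, (0 : ℝ)) ∈ Ω → f (x, 0) = x ∧ A (x, 0) = D.φ x ∧ v (x, 0) = D.ζ x

section TargetMetric

variable (f : Model n × ℝ → Model n) (A : Model n × ℝ → Model n →L[ℝ] Model n)
  (v : Model n × ℝ → Model n) (p : Model n × ℝ)

/-- Covariant derivative of the endomorphism field `A` along `f` in the direction `w`,
applied to `Y`. -/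
def covEnd (w : Model n × ℝ) (Y : Model n) : Model n :=
  fderiv ℝ A p w Y + D.Γ (f p) (fderiv ℝ f p w) (A p Y) - A p (D.Γ (f p) (fderiv ℝ f p w) Y)

/-- Covariant derivative of the vector field `v` along `f` in the direction `w`. -/
def covVec (w : Model n × ℝ) : Model n :=
  fderiv ℝ v p w + D.Γ (f p) (fderiv ℝ f p w) (v p)

/-- The vertical component `ϕ(Φ_* w) ∈ 𝔪` of the velocity `Φ_* w`, for `Φ = (f, A, v)`. It is the
unique `a` in the complement `𝔪` of the stabiliser algebra of `(A, v)` such that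
`∇_w A = [a, A]` and `∇_w v = a v`, namely
`a = ½ A ∘ ∇_w A - (∇_w v)^♭ ⊗ v + ½ v^♭ ⊗ ∇_w v`. -/
def vertPart (w : Model n × ℝ) (Y : Model n) : Model n :=
  (1 / 2 : ℝ) • A p (D.covEnd f A p w Y) - D.g (f p) (D.covVec f v p w) Y • v p
    + (1 / 2 : ℝ) • D.g (f p) (v p) Y • D.covVec f v p w

/-- The Riemannian metric of `𝒮𝒪(M)/(U(n)×1)` on the velocities `Φ_* w`, `Φ_* w'`:
`⟨π_* Φ_* w, π_* Φ_* w'⟩ + ⟨ϕ(Φ_* w), ϕ(Φ_* w')⟩`. -/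
def targetMetric (w w' : Model n × ℝ) : ℝ :=
  D.g (f p) (fderiv ℝ f p w) (fderiv ℝ f p w') +
    innerEnd (D.g (f p)) (D.vertPart f A v p w) (D.vertPart f A v p w')

end TargetMetric

/-- The scalar product `⟨τ(σ), V⟩` of the tension field
`τ(σ) = ∑_i (∇^q_{σ_* e_i} σ_* e_i - σ_* (∇_{e_i} e_i))` with the variation field `V = Φ_* ∂_t`, at
`x`, for a variation `Φ` of `σ`. Here `∇^q` is the Levi-Civita connection of the metric `h` of
`𝒮𝒪(M)/(U(n)×1)`, so that, since coordinate fields commute, the Koszul formula gives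
`2 ⟨∇^q_{Φ_* X} Φ_* Y, Φ_* ∂_t⟩ = X h(Φ_* Y, Φ_* ∂_t) + Y h(Φ_* X, Φ_* ∂_t) - ∂_t h(Φ_* X, Φ_* Y)`
for constant vectors `X`, `Y`. -/
def tensionPairing (f : Model n × ℝ → Model n) (A : Model n × ℝ → Model n →L[ℝ] Model n)
    (v : Model n × ℝ → Model n) (x : Model n) : ℝ :=
  contract (D.g x) fun X Y =>
    (fderiv ℝ (fun p => D.targetMetric f A v p (Y, 0) (0, 1)) (x, 0) (X, 0)
      + fderiv ℝ (fun p => D.targetMetric f A v p (X, 0) (0, 1)) (x, 0) (Y, 0)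
      - fderiv ℝ (fun p => D.targetMetric f A v p (X, 0) (Y, 0)) (x, 0) (0, 1)) / 2
    - D.targetMetric f A v (x, 0) (D.Γ x X Y, 0) (0, 1)

/-- The section `σ` is a harmonic map on the chart domain `U`: its tension field vanishes, i.e. it
is orthogonal to every tangent vector of `𝒮𝒪(M)/(U(n)×1)` at the points of `σ`. (Every such vector
is the variation field of a variation.) -/
def IsHarmonicMapOn (U : Set (Model n)) : Prop :=
  ∀ Ω f A v, D.IsVariation U Ω f A v → ∀ x, (x, (0 : ℝ)) ∈ Ω → D.tensionPairing f A v x = 0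

end LocalData

/-! ### Almost contact metric manifolds -/

/-- An almost contact metric structure on the `(2n+1)`-dimensional manifold `M`. -/
structure AlmostContactMetricStructure (n : ℕ) (M : Type*) [TopologicalSpace M]
    [ChartedSpace (Model n) M] [IsManifold 𝓘(ℝ, Model n) ∞ M] where
  /-- the Riemannian metric -/
  g : Bundle.ContMDiffRiemannianMetric 𝓘(ℝ, Model n) ∞ (Model n)
    (fun x : M => TangentSpace 𝓘(ℝ, Model n) x)
  /-- the endomorphism field -/
  φ : ∀ x : M, TangentSpace 𝓘(ℝ, Model n) x →L[ℝ] TangentSpace 𝓘(ℝ, Model n) x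
  /-- the Reeb vector field -/
  ζ : ∀ x : M, TangentSpace 𝓘(ℝ, Model n) x
  smooth_φ : ContMDiff 𝓘(ℝ, Model n) (𝓘(ℝ, Model n).prod 𝓘(ℝ, Model n →L[ℝ] Model n)) ∞
    (fun x : M => Bundle.TotalSpace.mk' (Model n →L[ℝ] Model n)
      (E := fun x : M => TangentSpace 𝓘(ℝ, Model n) x →L[ℝ] TangentSpace 𝓘(ℝ, Model n) x) x (φ x))
  smooth_ζ : ContMDiff 𝓘(ℝ, Model n) (𝓘(ℝ, Model n).prod 𝓘(ℝ, Model n)) ∞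
    (fun x : M => Bundle.TotalSpace.mk' (Model n)
      (E := fun x : M => TangentSpace 𝓘(ℝ, Model n) x) x (ζ x))
  unit_ζ : ∀ x, g.inner x (ζ x) (ζ x) = 1
  φ_sq : ∀ x X, φ x (φ x X) = -X + g.inner x (ζ x) X • ζ x
  compat : ∀ x X Y, g.inner x (φ x X) (φ x Y) =
    g.inner x X Y - g.inner x (ζ x) X * g.inner x (ζ x) Y

namespace AlmostContactMetricStructure

variable {n : ℕ} {M : Type*} [TopologicalSpace M] [ChartedSpace (Model n) M]
  [IsManifold 𝓘(ℝ, Model n) ∞ M] (S : AlmostContactMetricStructure n M)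

/-- The coordinate expressions of `⟨·,·⟩`, `φ` and `ζ` in the chart `e`. -/
def inChart (e : OpenPartialHomeomorph M (Model n)) : LocalData n where
  g y :=
    let T : Model n →L[ℝ] TangentSpace 𝓘(ℝ, Model n) (e.symm y) :=
      mfderiv 𝓘(ℝ, Model n) 𝓘(ℝ, Model n) e.symm y
    (ContinuousLinearMap.precomp ℝ T).comp ((S.g.inner (e.symm y)).comp T)
  φ y :=
    let T : Model n →L[ℝ] TangentSpace 𝓘(ℝ, Model n) (e.symm y) :=
      mfderiv 𝓘(ℝ, Model n) 𝓘(ℝ, Model n) e.symm y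
    let T' : TangentSpace 𝓘(ℝ, Model n) (e.symm y) →L[ℝ] Model n :=
      mfderiv 𝓘(ℝ, Model n) 𝓘(ℝ, Model n) e (e.symm y)
    (T'.comp (S.φ (e.symm y))).comp T
  ζ y :=
    let T' : TangentSpace 𝓘(ℝ, Model n) (e.symm y) →L[ℝ] Model n :=
      mfderiv 𝓘(ℝ, Model n) 𝓘(ℝ, Model n) e (e.symm y)
    T' (S.ζ (e.symm y))

/-- The pointwise condition `P` holds at all points of the manifold, in all charts. (For a
condition on tensors it does not matter which chart around a given point is used.) -/
def Holds (P : LocalData n → Model n → Prop) : Prop :=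
  ∀ e ∈ atlas (Model n) M, ∀ y ∈ e.target, P (S.inChart e) y

/-- The structure is of type `⨁_{i ∈ I} 𝒞_i`. -/
def IsOfType (I : Finset ℕ) : Prop :=
  S.Holds fun D y => D.ξ y ∈ ⨆ i ∈ I, classModule (D.g y) (D.φ y) (D.ζ y) i

/-- The structure is harmonic: `d^* ξ = 0`. -/
def IsHarmonic : Prop := S.Holds fun D y => ∀ Y, D.dStarXi y Y = 0

/-- The structure `σ : M → 𝒮𝒪(M)/(U(n)×1)` is a harmonic map. -/
def IsHarmonicMap : Prop :=
  ∀ e ∈ atlas (Model n) M, (S.inChart e).IsHarmonicMapOn e.target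

/-- The `*`-Ricci tensor is symmetric. -/
def RicStarSymm : Prop := S.Holds fun D y => ∀ X Y, D.ricStar y X Y = D.ricStar y Y X

/-- The manifold is weakly-ac-Einstein: `Ric^* = (s^* / 2n) (⟨·,·⟩ - η ⊗ η)`. -/
def WeaklyAcEinstein : Prop := S.Holds fun D y => ∀ X Y,
  D.ricStar y X Y = D.sStar y / (2 * n) * (D.g y X Y - D.eta y X * D.eta y Y)

end AlmostContactMetricStructure

end AlmostContact

end

/-! The vertical component of the differential of `σ` is `-ξ`. For a variation of `σ` with base
velocity `V` and vertical velocity `-T`, the tension field pairs with the variation field to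
`-⟨d^*ξ, T⟩ + ∑ ⟨R_{e_i,V}, ξ_{e_i}⟩` (`tensionPairing_eq`). The point is that the minimal
connection `∇ + ξ` preserves the structure. Its curvature therefore lies in the stabiliser algebra
and is orthogonal to `𝔪`, where `ξ` takes its values. Hence derivatives of the vertical component
along the section and along the variation may be exchanged at the cost of the Levi-Civita curvature
and of a commutator, and the commutator disappears under the trace. Rotating the section over fixed
points and translating its base points shows that `σ` is a harmonic map exactly when `d^*ξ = 0` and
the pairing `∑ ⟨R_{e_i,X}, ξ_{e_i}⟩` vanishes for all `X` (`isHarmonicMapOn_iff`).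

The second Bianchi identity removes all derivatives of `R` from `d^*(Ric^*)^t + ½ ds^*`
(`dStarRicStarT_add`). What remains is algebraic in `R` and `ξ`. Apart from terms in `Ric^*`, it is
the contraction of `R` with `X ↦ [φ, ξ_{φX}]`. This operation multiplies the types by scalars `c`:
`2` on `𝒞_1, 𝒞_2`, `-2` on `𝒞_3, 𝒞_4`, `-1` on `𝒞_5, …, 𝒞_8`, `1` on `𝒞_9, 𝒞_10` and `0` on `𝒞_11,
𝒞_12`. By the first Bianchi identity a component with scalar `c` contributes `-c/2` times its own
pairing with `R`. Mixed and vertical pairings reduce to curvature terms at `ζ`, and the pairing of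
`𝒞_4` to the Lee form. So for each list of types the difference of the two sides of the stated
equation is `±∑ ⟨R_{e_i,X}, ξ_{e_i}⟩`.

Where symmetry of `Ric^*` appears, `ξ_ζ = 0` and `ξ_{φX} = J ξ_X`, where `J` is `εφ` on the
horizontal and `δφ` on the mixed component, with signs `ε`, `δ`. Writing `R` through the minimal
connection and tracing against `φ`, the skew part of `Ric^*` becomes, up to quadratic terms with
factor `ε + δ`, the twisted divergence `∑ (∇̃_{e_i}ξ)_{e_i} - ε ξ_{tr ξ}` (`twisted_skew`), where
`∇̃` is the minimal connection and `tr ξ = ∑ ξ_{e_i}e_i`. On the other hand `d^*ξ = -∑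
(∇̃_{e_i}ξ)_{e_i} - ξ_{tr ξ}`. For `ε = -1 = -δ` symmetry is harmonicity. For `ε = 1 = -δ` the two
differ by `ξ_{θ^♯}`.

For weakly-ac-Einstein structures the divergence of `Ric^*` is explicit, and evaluation at `ζ`
determines `ds^*(ζ)`. For `𝒞_1`, total skew-symmetry annihilates the pairing, and two independent
computations of the skew part of `Ric^*` force `d^*ξ = 0`. -/

noncomputable section

namespace AlmostContact

/-! ### Metric contractions and orthonormal bases -/

section Contraction

variable {n : ℕ} {W : Type*} [AddCommGroup W] [Module ℝ W]

/-- A map of two vector variables that is linear in each of them. -/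
structure IsBilin (B : Model n → Model n → W) : Prop where
  add_left : ∀ a a' b, B (a + a') b = B a b + B a' b
  smul_left : ∀ (c : ℝ) a b, B (c • a) b = c • B a b
  add_right : ∀ a b b', B a (b + b') = B a b + B a b'
  smul_right : ∀ (c : ℝ) a b, B a (c • b) = c • B a b

namespace IsBilin

variable {B : Model n → Model n → W}

/-- The bundled bilinear map. -/
def toLin (h : IsBilin B) : Model n →ₗ[ℝ] Model n →ₗ[ℝ] W :=
  LinearMap.mk₂ ℝ B h.add_left h.smul_left h.add_right h.smul_right

@[simp] theorem toLin_apply (h : IsBilin B) (a b : Model n) : h.toLin a b = B a b := rfl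

theorem sum_left (h : IsBilin B) {ι : Type*} (s : Finset ι) (f : ι → Model n) (b : Model n) :
    B (∑ i ∈ s, f i) b = ∑ i ∈ s, B (f i) b := by
  have := map_sum (h.toLin.flip b) f s
  simpa only [LinearMap.flip_apply, toLin_apply] using this

theorem sum_right (h : IsBilin B) {ι : Type*} (s : Finset ι) (f : ι → Model n) (a : Model n) :
    B a (∑ i ∈ s, f i) = ∑ i ∈ s, B a (f i) := by
  have := map_sum (h.toLin a) f s
  simpa only [toLin_apply] using this

theorem neg_right (h : IsBilin B) (a b : Model n) : B a (-b) = -B a b := by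
  simpa using h.smul_right (-1) a b

end IsBilin

/-- `e` is an orthonormal basis for the scalar product `G`. -/
def IsOrtho (G : Form n) (e : Fin (2 * n + 1) → Model n) : Prop :=
  ∀ i j, G (e i) (e j) = if i = j then 1 else 0

theorem eq_sum_stdVec (v : Model n) : v = ∑ i, v i • stdVec i := by
  ext j
  simp [stdVec, Pi.single_apply]

/-- Orthonormality is the matrix identity `P M Pᵀ = 1`, where the rows of `P` are the basis vectors
and `M` is the Gram matrix. Left and right inverses of square matrices agree, so `M⁻¹ = Pᵀ P`. -/
theorem isOrtho_gramInv {G : Form n} {e : Fin (2 * n + 1) → Model n} (he : IsOrtho G e)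
    (i j : Fin (2 * n + 1)) : gramInv G i j = ∑ k, e k i * e k j := by
  set P : Matrix (Fin (2 * n + 1)) (Fin (2 * n + 1)) ℝ := Matrix.of fun k i => e k i with hP
  set M : Matrix (Fin (2 * n + 1)) (Fin (2 * n + 1)) ℝ :=
    Matrix.of fun i j => G (stdVec i) (stdVec j) with hM
  have h1 : P * (M * P.transpose) = 1 := by
    ext k l
    have := he k l
    rw [eq_sum_stdVec (e k), eq_sum_stdVec (e l)] at this
    simp only [map_sum, map_smul, sum_apply, smul_apply, smul_eq_mul] at this
    rw [Matrix.one_apply, ← this]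
    simp only [Matrix.mul_apply, hP, hM, Matrix.of_apply, Matrix.transpose_apply]
    simp only [Finset.mul_sum]
    rw [Finset.sum_comm]
    refine Finset.sum_congr rfl fun i _ => Finset.sum_congr rfl fun j _ => ?_
    ring
  have h2 : M * (P.transpose * P) = 1 := by
    rw [← Matrix.mul_assoc]; exact mul_eq_one_comm.mp h1
  have h3 : gramInv G = P.transpose * P := Matrix.inv_eq_right_inv h2
  rw [h3]
  simp [Matrix.mul_apply, hP]

theorem contract_eq_sum {G : Form n} {e : Fin (2 * n + 1) → Model n} (he : IsOrtho G e)
    {B : Model n → Model n → W} (hB : IsBilin B) : contract G B = ∑ i, B (e i) (e i) := by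
  have : ∀ k, B (e k) (e k) = ∑ i, ∑ j, (e k i * e k j) • B (stdVec i) (stdVec j) := by
    intro k
    conv_lhs => rw [eq_sum_stdVec (e k)]
    rw [hB.sum_left]
    refine Finset.sum_congr rfl fun i _ => ?_
    rw [hB.sum_right]
    refine Finset.sum_congr rfl fun j _ => ?_
    rw [hB.smul_left, hB.smul_right, smul_smul]
  simp only [this, contract, isOrtho_gramInv he, Finset.sum_smul]
  refine (Finset.sum_congr rfl fun i _ => Finset.sum_comm).trans ?_
  rw [Finset.sum_comm]

end Contraction

/-- `(G, φ, ζ)` is an almost contact metric structure on the vector space `ℝ^{2n+1}`. -/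
structure IsACM {n : ℕ} (G : Form n) (φ : Model n →L[ℝ] Model n) (ζ : Model n) : Prop where
  symm : ∀ X Y, G X Y = G Y X
  pos : ∀ X, X ≠ 0 → 0 < G X X
  unit : G ζ ζ = 1
  sq : ∀ X, φ (φ X) = -X + G ζ X • ζ
  compat : ∀ X Y, G (φ X) (φ Y) = G X Y - G ζ X * G ζ Y

theorem exists_isOrtho {n : ℕ} {G : Form n} (symm : ∀ X Y, G X Y = G Y X)
    (pos : ∀ X, X ≠ 0 → 0 < G X X) : ∃ e, IsOrtho G e := by
  let B : LinearMap.BilinForm ℝ (Model n) :=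
    LinearMap.mk₂ ℝ (fun X Y => G X Y) (by simp) (by simp) (by simp) (by simp)
  have hB : LinearMap.IsSymm B := ⟨fun X Y => symm X Y⟩
  obtain ⟨v, hv⟩ := LinearMap.BilinForm.exists_orthogonal_basis (B := B) hB
  have hd : Module.finrank ℝ (Model n) = 2 * n + 1 := by simp
  let w := v.reindex (finCongr hd)
  have hw : ∀ i j, i ≠ j → G (w i) (w j) = 0 := by
    intro i j hij
    have := hv (i := (finCongr hd).symm i) (j := (finCongr hd).symm j) (by simpa using hij)
    simpa [w, B, Function.onFun] using this
  have hp : ∀ i, 0 < G (w i) (w i) := fun i => pos _ (w.ne_zero i)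
  refine ⟨fun i => (Real.sqrt (G (w i) (w i)))⁻¹ • w i, fun i j => ?_⟩
  simp only [map_smul, smul_apply, smul_eq_mul]
  split_ifs with h
  · subst h
    have h1 := Real.mul_self_sqrt (hp i).le
    have h2 := (Real.sqrt_pos.mpr (hp i)).ne'
    field_simp
    rw [sq, h1]
  · rw [hw i j h]; simp

/-! ### Expansion in an orthonormal basis. -/

section Ortho

variable {n : ℕ} {W : Type*} [AddCommGroup W] [Module ℝ W] {G : Form n}
  {e : Fin (2 * n + 1) → Model n}

theorem eq_zero_of_forall_inner (pos : ∀ X, X ≠ 0 → 0 < G X X) {v : Model n}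
    (h : ∀ Z, G v Z = 0) : v = 0 := by
  by_contra hv
  exact (pos v hv).ne' (h v)

theorem ext_inner (pos : ∀ X, X ≠ 0 → 0 < G X X) {v w : Model n}
    (h : ∀ Z, G v Z = G w Z) : v = w := by
  rw [← sub_eq_zero]
  refine eq_zero_of_forall_inner pos fun Z => ?_
  rw [map_sub, sub_apply, h, sub_self]

theorem IsOrtho.linearIndependent (he : IsOrtho G e) : LinearIndependent ℝ e := by
  rw [Fintype.linearIndependent_iff]
  intro g hg i
  have := congrArg (G (e i)) hg
  simpa [he i] using this

theorem IsOrtho.expand (he : IsOrtho G e) (v : Model n) : ∑ i, G (e i) v • e i = v := by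
  have hc : Fintype.card (Fin (2 * n + 1)) = Module.finrank ℝ (Model n) := by simp
  let b := basisOfLinearIndependentOfCardEqFinrank he.linearIndependent hc
  have hb : ∀ i, b i = e i := fun i => by simp [b]
  have h := b.sum_repr v
  simp only [hb] at h
  conv_rhs => rw [← h]
  refine Finset.sum_congr rfl fun i _ => ?_
  have := congrArg (G (e i)) h
  simp only [map_sum, map_smul, he i, smul_eq_mul, mul_ite, mul_one, mul_zero,
    Finset.sum_ite_eq, Finset.mem_univ, if_true] at this
  rw [this]

/-- Contracting a linear map against `G v`. -/
theorem IsOrtho.sum_smul (he : IsOrtho G e) (f : Model n → W) (hadd : ∀ a b, f (a + b) = f a + f b)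
    (hsmul : ∀ (c : ℝ) a, f (c • a) = c • f a) (v : Model n) : ∑ i, G (e i) v • f (e i) = f v := by
  let F : Model n →ₗ[ℝ] W := ⟨⟨f, hadd⟩, hsmul⟩
  have := congrArg F (he.expand v)
  rw [map_sum] at this
  exact (by simpa only [map_smul] using this : ∑ i, G (e i) v • F (e i) = F v)

end Ortho

section Contraction

variable {n : ℕ} {W : Type*} [AddCommGroup W] [Module ℝ W] {G : Form n}
  {e : Fin (2 * n + 1) → Model n}

theorem inner_sharp (symm : ∀ X Y, G X Y = G Y X) (pos : ∀ X, X ≠ 0 → 0 < G X X)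
    (α : Model n →ₗ[ℝ] ℝ) (Z : Model n) : G (sharp G fun a => α a) Z = α Z := by
  obtain ⟨e, he⟩ := exists_isOrtho symm pos
  have hB : IsBilin fun a b : Model n => α a • b :=
    ⟨by simp [add_smul], by simp [mul_smul], by simp, fun a c b => smul_comm _ _ _⟩
  rw [sharp, contract_eq_sum he hB]
  have := he.sum_smul (fun a => α a) (by simp) (by simp) Z
  simp only [map_sum, map_smul, sum_apply, smul_apply, smul_eq_mul] at this ⊢
  rw [← this]
  exact Finset.sum_congr rfl fun i _ => mul_comm _ _

theorem contract_congr {B B' : Model n → Model n → W} (h : ∀ a b, B a b = B' a b) :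
    contract G B = contract G B' := by
  simp only [contract, h]

/-- Written with sums so that `fderiv_contract` can differentiate it entry by entry. -/
theorem gramInv_mul_gram (symm : ∀ X Y, G X Y = G Y X) (pos : ∀ X, X ≠ 0 → 0 < G X X)
    (i j : Fin (2 * n + 1)) :
    ∑ k, gramInv G i k * G (stdVec k) (stdVec j) = if i = j then 1 else 0 := by
  obtain ⟨e, he⟩ := exists_isOrtho symm pos
  simp only [isOrtho_gramInv he, Finset.sum_mul]
  rw [Finset.sum_comm]
  have h1 : ∀ l, ∑ k, e l i * e l k * G (stdVec k) (stdVec j) = e l i * G (e l) (stdVec j) := by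
    intro l
    conv_rhs => rw [eq_sum_stdVec (e l)]
    simp only [map_sum, map_smul, sum_apply, smul_apply, smul_eq_mul, Finset.mul_sum]
    refine Finset.sum_congr rfl fun i _ => ?_
    rw [← eq_sum_stdVec]; ring
  simp only [h1]
  have h2 := he.sum_smul (fun v : Model n => v i) (by simp) (by simp) (stdVec j)
  simp only [smul_eq_mul] at h2
  rw [← (by simp [stdVec] :
    (stdVec j : Model n) i = if i = j then 1 else 0), ← h2]
  exact Finset.sum_congr rfl fun i _ => mul_comm _ _

theorem det_gram_ne_zero (symm : ∀ X Y, G X Y = G Y X) (pos : ∀ X, X ≠ 0 → 0 < G X X) :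
    (Matrix.of fun i j : Fin (2 * n + 1) => G (stdVec i) (stdVec j)).det ≠ 0 := by
  have h : gramInv G * (Matrix.of fun i j : Fin (2 * n + 1) => G (stdVec i) (stdVec j)) = 1 := by
    ext i j
    simpa [Matrix.mul_apply, Matrix.one_apply] using gramInv_mul_gram symm pos i j
  intro h0
  have := congrArg Matrix.det h
  rw [Matrix.det_mul, h0, mul_zero, Matrix.det_one] at this
  exact zero_ne_one this

end Contraction

/-! ### Smoothness and differentiation of metric contractions. -/

section Smooth

variable {n : ℕ} {P : Type*} [NormedAddCommGroup P] [NormedSpace ℝ P]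
  {W : Type*} [NormedAddCommGroup W] [NormedSpace ℝ W]

theorem contDiffAt_matrix_det {ι : Type*} [Fintype ι] [DecidableEq ι] {k : WithTop ℕ∞}
    {M : P → Matrix ι ι ℝ} {p : P} (h : ∀ i j, ContDiffAt ℝ k (fun z => M z i j) p) :
    ContDiffAt ℝ k (fun z => (M z).det) p := by
  simp only [Matrix.det_apply]
  refine ContDiffAt.sum fun σ _ => ?_
  have h1 : ContDiffAt ℝ k (fun z => ∏ i, M z (σ i) i) p := contDiffAt_prod fun i _ => h _ _
  simpa [Units.smul_def, zsmul_eq_mul] using (contDiffAt_const (c := ((σ.sign : ℤ) : ℝ))).mul h1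

/-- Cramer's rule: the entries are cofactors divided by a determinant that does not vanish. -/
theorem contDiffAt_gramInv {k : WithTop ℕ∞} {G : P → Form n} {p : P} (hG : ContDiffAt ℝ k G p)
    (symm : ∀ X Y, G p X Y = G p Y X) (pos : ∀ X, X ≠ 0 → 0 < G p X X) (i j : Fin (2 * n + 1)) :
    ContDiffAt ℝ k (fun z => gramInv (G z) i j) p := by
  have hM : ∀ a b : Fin (2 * n + 1), ContDiffAt ℝ k (fun z => G z (stdVec a) (stdVec b)) p :=
    fun a b => (hG.clm_apply contDiffAt_const).clm_apply contDiffAt_const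
  have hd := det_gram_ne_zero symm pos
  simp only [gramInv, Matrix.inv_def, Matrix.smul_apply, Ring.inverse_eq_inv', smul_eq_mul,
    Matrix.adjugate_apply]
  refine ContDiffAt.mul (ContDiffAt.inv (contDiffAt_matrix_det fun a b => ?_) hd)
    (contDiffAt_matrix_det fun a b => ?_)
  · simpa using hM a b
  · by_cases h : a = j
    · subst h; simpa using contDiffAt_const
    · simpa [Matrix.updateRow_ne h] using hM a b

theorem contDiffAt_contract {k : WithTop ℕ∞} {G : P → Form n} {p : P} (hG : ContDiffAt ℝ k G p)
    (symm : ∀ X Y, G p X Y = G p Y X) (pos : ∀ X, X ≠ 0 → 0 < G p X X)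
    {B : P → Model n → Model n → W} (hB : ∀ a b, ContDiffAt ℝ k (fun z => B z a b) p) :
    ContDiffAt ℝ k (fun z => contract (G z) (B z)) p := by
  unfold contract
  exact ContDiffAt.sum fun i _ => ContDiffAt.sum fun j _ =>
    (contDiffAt_gramInv hG symm pos i j).smul (hB _ _)

/-- Metric contraction commutes with covariant differentiation. -/
theorem fderiv_contract {G : P → Form n} {p : P} (hG : ContDiffAt ℝ 1 G p)
    (hs : ∀ᶠ z in nhds p, ∀ X Y, G z X Y = G z Y X)
    (hp : ∀ᶠ z in nhds p, ∀ X, X ≠ 0 → 0 < G z X X)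
    {w : P} {A : Model n →ₗ[ℝ] Model n}
    (hA : ∀ X Y, fderiv ℝ G p w X Y = G p (A X) Y + G p X (A Y))
    {B : P → Model n → Model n → W} (hB : ∀ a b, DifferentiableAt ℝ (fun z => B z a b) p)
    (hb : IsBilin (B p)) :
    fderiv ℝ (fun z => contract (G z) (B z)) p w =
      contract (G p) fun a b => fderiv ℝ (fun z => B z a b) p w - B p (A a) b - B p a (A b) := by
  have symm := hs.self_of_nhds
  have pos := hp.self_of_nhds
  obtain ⟨e, he⟩ := exists_isOrtho symm pos
  have hH : ∀ i j, DifferentiableAt ℝ (fun z => gramInv (G z) i j) p := fun i j =>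
    (contDiffAt_gramInv hG symm pos i j).differentiableAt one_ne_zero
  have hM : ∀ i j : Fin (2 * n + 1),
      HasFDerivAt (fun z => G z (stdVec i) (stdVec j))
        (((fderiv ℝ G p).flip (stdVec i)).flip (stdVec j)) p := by
    intro i j
    have h := (hG.differentiableAt one_ne_zero).hasFDerivAt
    have h1 := (h.clm_apply (hasFDerivAt_const (stdVec i) p)).clm_apply
      (hasFDerivAt_const (stdVec j) p)
    refine h1.congr_fderiv ?_
    ext v; simp
  set H : Matrix (Fin (2 * n + 1)) (Fin (2 * n + 1)) ℝ := gramInv (G p) with hHdef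
  set H' : Matrix (Fin (2 * n + 1)) (Fin (2 * n + 1)) ℝ :=
    Matrix.of fun i j => fderiv ℝ (fun z => gramInv (G z) i j) p w with hH'
  set M : Matrix (Fin (2 * n + 1)) (Fin (2 * n + 1)) ℝ :=
    Matrix.of fun i j => G p (stdVec i) (stdVec j) with hMdef
  set M' : Matrix (Fin (2 * n + 1)) (Fin (2 * n + 1)) ℝ :=
    Matrix.of fun i j => fderiv ℝ G p w (stdVec i) (stdVec j) with hM'
  set Q : Matrix (Fin (2 * n + 1)) (Fin (2 * n + 1)) ℝ := Matrix.of fun k i => e k i with hQ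
  have hHQ : H = Q.transpose * Q := by
    ext i j; simp [H, isOrtho_gramInv he, Matrix.mul_apply, hQ]
  have hHM : H * M = 1 := by
    ext i j
    simpa [Matrix.mul_apply, Matrix.one_apply, M, H] using gramInv_mul_gram symm pos i j
  -- The derivative of the identity `gramInv * gram = 1`, valid near `p`.
  have key : H' * M + H * M' = 0 := by
    ext i j
    have h1 : HasFDerivAt (fun z => ∑ k, gramInv (G z) i k * G z (stdVec k) (stdVec j))
        (∑ k, (gramInv (G p) i k • (((fderiv ℝ G p).flip (stdVec k)).flip (stdVec j)) +
          G p (stdVec k) (stdVec j) • fderiv ℝ (fun z => gramInv (G z) i k) p)) p :=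
      HasFDerivAt.fun_sum fun k _ => (hH i k).hasFDerivAt.mul (hM k j)
    have h2 : (fun z => ∑ k, gramInv (G z) i k * G z (stdVec k) (stdVec j)) =ᶠ[nhds p]
        fun _ => if i = j then 1 else 0 := by
      filter_upwards [hs, hp] with z hz hz' using gramInv_mul_gram hz hz' i j
    have h3 := h1.unique ((hasFDerivAt_const _ p).congr_of_eventuallyEq h2)
    have h4 := congrArg (fun l => l w) h3
    simp only [sum_apply, add_apply, smul_apply, ContinuousLinearMap.flip_apply, zero_apply,
      smul_eq_mul, Finset.sum_add_distrib] at h4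
    simp only [Matrix.add_apply, Matrix.mul_apply, Matrix.zero_apply, H', M, M', Matrix.of_apply]
    rw [← h4, add_comm]
    congr 1
    exact Finset.sum_congr rfl fun k _ => mul_comm _ _
  -- This is `H' = -H M' H` with `H = Qᵀ Q`, arranged so that `M'` enters only through its values on
  -- the orthonormal basis.
  have hH'eq : H' = -(Q.transpose * (Q * M' * Q.transpose) * Q) := by
    have h1 : H' * (M * H) = -(H * M' * H) := by
      rw [← Matrix.mul_assoc, eq_neg_of_add_eq_zero_left key, Matrix.neg_mul]
    rw [mul_eq_one_comm.mp hHM, Matrix.mul_one] at h1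
    rw [h1, hHQ]
    simp only [Matrix.mul_assoc]
  have hQM : ∀ r s, (Q * M' * Q.transpose) r s = fderiv ℝ G p w (e r) (e s) := by
    intro r s
    conv_rhs => rw [eq_sum_stdVec (e r), eq_sum_stdVec (e s)]
    simp only [map_sum, map_smul, sum_apply, smul_apply, smul_eq_mul, Matrix.mul_apply, Q, M',
      Matrix.of_apply, Matrix.transpose_apply, mul_comm]
  have hfd : fderiv ℝ (fun z => contract (G z) (B z)) p w =
      ∑ i, ∑ j, (H i j • fderiv ℝ (fun z => B z (stdVec i) (stdVec j)) p w +
        H' i j • B p (stdVec i) (stdVec j)) := by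
    have : HasFDerivAt (fun z => contract (G z) (B z))
        (∑ i, ∑ j, (gramInv (G p) i j • fderiv ℝ (fun z => B z (stdVec i) (stdVec j)) p +
          (fderiv ℝ (fun z => gramInv (G z) i j) p).smulRight (B p (stdVec i) (stdVec j)))) p :=
      HasFDerivAt.fun_sum fun i _ => HasFDerivAt.fun_sum fun j _ =>
        (hH i j).hasFDerivAt.smul (hB _ _).hasFDerivAt
    rw [this.fderiv]
    simp [sum_apply, hH', hHdef]
  have hBe : ∀ r s, B p (e r) (e s) = ∑ i, ∑ j, (e r i * e s j) • B p (stdVec i) (stdVec j) := by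
    intro r s
    conv_lhs => rw [eq_sum_stdVec (e r), eq_sum_stdVec (e s)]
    simp only [hb.sum_left, hb.sum_right, hb.smul_left, hb.smul_right, smul_smul]
  have hsum : ∑ i, ∑ j, H' i j • B p (stdVec i) (stdVec j) =
      -∑ r, ∑ s, fderiv ℝ G p w (e r) (e s) • B p (e r) (e s) := by
    simp only [hBe, Finset.smul_sum, smul_smul]
    rw [eq_neg_iff_add_eq_zero]
    have h1 : ∀ i j, H' i j = -∑ r, ∑ s, fderiv ℝ G p w (e r) (e s) * (e r i * e s j) := by
      intro i j
      rw [hH'eq, Matrix.neg_apply, Matrix.mul_apply]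
      simp only [Matrix.mul_apply (M := Q.transpose), hQM, Finset.sum_mul, Matrix.transpose_apply,
        Q, Matrix.of_apply]
      rw [Finset.sum_comm]
      congr 1
      refine Finset.sum_congr rfl fun r _ => Finset.sum_congr rfl fun s _ => ?_
      ring
    simp only [h1, neg_smul, Finset.sum_neg_distrib, Finset.sum_smul]
    rw [neg_add_eq_zero]
    calc _ = ∑ i, ∑ r, ∑ j, ∑ s, (fderiv ℝ G p w (e r) (e s) * (e r i * e s j)) •
          B p (stdVec i) (stdVec j) := Finset.sum_congr rfl fun i _ => Finset.sum_comm
      _ = ∑ r, ∑ i, ∑ j, ∑ s, (fderiv ℝ G p w (e r) (e s) * (e r i * e s j)) •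
          B p (stdVec i) (stdVec j) := Finset.sum_comm
      _ = ∑ r, ∑ i, ∑ s, ∑ j, (fderiv ℝ G p w (e r) (e s) * (e r i * e s j)) •
          B p (stdVec i) (stdVec j) :=
        Finset.sum_congr rfl fun r _ => Finset.sum_congr rfl fun i _ => Finset.sum_comm
      _ = _ := Finset.sum_congr rfl fun r _ => Finset.sum_comm
  have hb1 : IsBilin fun a b => B p (A a) b :=
    ⟨by simp [hb.add_left], by simp [hb.smul_left], fun _ => hb.add_right _,
      fun c a => hb.smul_right c _⟩
  have hb2 : IsBilin fun a b => B p a (A b) :=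
    ⟨fun a a' b => hb.add_left _ _ _, fun c a b => hb.smul_left _ _ _, by simp [hb.add_right],
      by simp [hb.smul_right]⟩
  have hsplit : (contract (G p) fun a b => fderiv ℝ (fun z => B z a b) p w - B p (A a) b -
      B p a (A b)) = (contract (G p) fun a b => fderiv ℝ (fun z => B z a b) p w) -
      (∑ r, B p (A (e r)) (e r)) - ∑ r, B p (e r) (A (e r)) := by
    rw [← contract_eq_sum he hb1, ← contract_eq_sum he hb2]
    simp only [contract, smul_sub, Finset.sum_sub_distrib]
  rw [hfd, hsplit]
  -- By `hA` the derivative of the metric splits into two terms, which place `A` in the second and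
  -- in the first argument of `B`.
  simp only [Finset.sum_add_distrib, hsum, hA, add_smul]
  have h1 : ∀ r, ∑ s, G p (A (e r)) (e s) • B p (e r) (e s) = B p (e r) (A (e r)) := by
    intro r
    rw [← he.sum_smul (fun x => B p (e r) x) (hb.add_right _) (fun c a => hb.smul_right c _ _)]
    exact Finset.sum_congr rfl fun s _ => by rw [symm]
  have h2 : ∑ r, ∑ s, G p (e r) (A (e s)) • B p (e r) (e s) = ∑ s, B p (A (e s)) (e s) := by
    rw [Finset.sum_comm]
    exact Finset.sum_congr rfl fun s _ =>
      he.sum_smul (fun x => B p x (e s)) (fun a b => hb.add_left a b _)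
        (fun c a => hb.smul_left c a _) _
  rw [h2]
  simp only [h1, contract, H]
  abel

end Smooth

/-! ### Almost contact metric linear algebra -/

section PointwiseAlgebra

variable {n : ℕ} {W : Type*} [AddCommGroup W] [Module ℝ W] {G : Form n}
  {φ : Model n →L[ℝ] Model n} {ζ : Model n} {e : Fin (2 * n + 1) → Model n}

namespace IsACM

/-- Compatibility gives `|φζ|² = 1 - 1`. -/
theorem phi_zeta (h : IsACM G φ ζ) : φ ζ = 0 := by
  by_contra hv
  have := h.pos _ hv
  rw [h.compat, h.unit] at this
  norm_num at this

theorem zeta_ne_zero (h : IsACM G φ ζ) : ζ ≠ 0 := by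
  intro h0
  have := h.unit
  rw [h0] at this
  simp at this

/-- Compute `φ³X` in two ways from the formula for `φ²`. -/
theorem eta_phi (h : IsACM G φ ζ) (X : Model n) : G ζ (φ X) = 0 := by
  have h1 := h.sq (φ X)
  rw [h.sq X, map_add, map_neg, map_smul, h.phi_zeta, smul_zero, add_zero] at h1
  have h2 : G ζ (φ X) • ζ = 0 := by simpa using h1
  exact (smul_eq_zero.mp h2).resolve_right h.zeta_ne_zero

theorem phi_eta (h : IsACM G φ ζ) (X : Model n) : G (φ X) ζ = 0 := by
  rw [h.symm, h.eta_phi]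

theorem skew (h : IsACM G φ ζ) (X Y : Model n) : G (φ X) Y = -G X (φ Y) := by
  have h1 := h.compat X (φ Y)
  rw [h.sq Y, map_add, map_neg, map_smul, h.phi_eta, h.eta_phi] at h1
  simp only [smul_zero, add_zero, mul_zero, sub_zero] at h1
  linarith

end IsACM

namespace IsOrtho

theorem sum_smul' (he : IsOrtho G e) (symm : ∀ X Y, G X Y = G Y X) (f : Model n → W)
    (hadd : ∀ a b, f (a + b) = f a + f b) (hsmul : ∀ (c : ℝ) a, f (c • a) = c • f a)
    (v : Model n) : ∑ i, G v (e i) • f (e i) = f v := by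
  rw [← he.sum_smul f hadd hsmul v]
  exact Finset.sum_congr rfl fun i _ => by rw [symm]

theorem sum_inner_self (he : IsOrtho G e) : ∑ i, G (e i) (e i) = 2 * n + 1 := by
  simp [he _ _]

/-- Skew-symmetric endomorphisms move across a metric contraction with a sign. -/
theorem sum_skew (he : IsOrtho G e) (symm : ∀ X Y, G X Y = G Y X) {S : Model n → Model n}
    (hS : ∀ X Y, G (S X) Y = -G X (S Y)) {B : Model n → Model n → W} (hB : IsBilin B) :
    ∑ i, B (S (e i)) (e i) = -∑ i, B (e i) (S (e i)) := by
  have h1 : ∀ i, B (S (e i)) (e i) = ∑ j, G (e j) (S (e i)) • B (e j) (e i) := fun i =>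
    (he.sum_smul (fun x => B x (e i)) (fun a b => hB.add_left a b _)
      (fun c a => hB.smul_left c a _) _).symm
  have h2 : ∀ i, B (e i) (S (e i)) = ∑ j, G (e j) (S (e i)) • B (e i) (e j) := fun i =>
    (he.sum_smul (fun x => B (e i) x) (hB.add_right _) (fun c a => hB.smul_right c _ _) _).symm
  simp only [h1, h2]
  rw [Finset.sum_comm, ← Finset.sum_neg_distrib]
  refine Finset.sum_congr rfl fun i _ => ?_
  rw [← Finset.sum_neg_distrib]
  refine Finset.sum_congr rfl fun j _ => ?_
  rw [← neg_smul, symm (e j), hS (e i) (e j)]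
  simp

theorem sum_phi (he : IsOrtho G e) (h : IsACM G φ ζ) {B : Model n → Model n → W}
    (hB : IsBilin B) : ∑ i, B (φ (e i)) (e i) = -∑ i, B (e i) (φ (e i)) :=
  he.sum_skew h.symm h.skew hB

theorem sum_zeta (he : IsOrtho G e) (h : IsACM G φ ζ) {B : Model n → Model n → W}
    (hB : IsBilin B) (x : Model n) : ∑ i, G ζ (e i) • B (e i) x = B ζ x :=
  he.sum_smul' h.symm (fun a => B a x) (fun a b => hB.add_left a b _)
    (fun c a => hB.smul_left c a _) _

theorem sum_phi_phi (he : IsOrtho G e) (h : IsACM G φ ζ) {B : Model n → Model n → W}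
    (hB : IsBilin B) : ∑ i, B (φ (e i)) (φ (e i)) = ∑ i, B (e i) (e i) - B ζ ζ := by
  have hB' : IsBilin fun a b => B a (φ b) :=
    ⟨fun a a' b => hB.add_left a a' _, fun c a b => hB.smul_left c a _,
      by simp [hB.add_right], by simp [hB.smul_right]⟩
  rw [he.sum_phi h hB']
  have : ∀ i, B (e i) (φ (φ (e i))) = -B (e i) (e i) + G ζ (e i) • B (e i) ζ := fun i => by
    rw [h.sq, hB.add_right, hB.neg_right, hB.smul_right]
  simp only [this, Finset.sum_add_distrib, he.sum_zeta h hB, Finset.sum_neg_distrib]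
  abel

end IsOrtho

/-! ### Curvature-like tensors -/

/-- Trilinear maps `(X, Y, Z) ↦ R_{X,Y} Z`. -/
abbrev Curv (n : ℕ) : Type := Model n →ₗ[ℝ] Model n →ₗ[ℝ] Model n →ₗ[ℝ] Model n

/-- `R` has the algebraic symmetries of a Riemannian curvature tensor. -/
structure IsCurv (G : Form n) (R : Curv n) : Prop where
  skew : ∀ X Y Z, R X Y Z = -R Y X Z
  inner_skew : ∀ X Y Z U, G (R X Y Z) U = -G (R X Y U) Z
  bianchi : ∀ X Y Z, R X Y Z + R Y Z X + R Z X Y = 0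

variable {R : Curv n}

namespace IsCurv

theorem inner_bianchi (hR : IsCurv G R) (X Y Z U : Model n) :
    G (R X Y Z) U + G (R Y Z X) U + G (R Z X Y) U = 0 := by
  have := congrArg (fun v => G v U) (hR.bianchi X Y Z)
  simpa only [map_add, add_apply, map_zero, zero_apply] using this

theorem inner_skew_left (hR : IsCurv G R) (X Y Z U : Model n) :
    G (R X Y Z) U = -G (R Y X Z) U := by
  rw [hR.skew X Y, map_neg, neg_apply]

/-- The classical argument: add the Bianchi identities for the four cyclic arrangements of the
arguments and cancel by skew-symmetry. -/
theorem pair (hR : IsCurv G R) (X Y Z U : Model n) : G (R X Y Z) U = G (R Z U X) Y := by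
  have a1 := hR.inner_bianchi X Y Z U
  have a2 := hR.inner_bianchi Y Z U X
  have a3 := hR.inner_bianchi Z U X Y
  have a4 := hR.inner_bianchi U X Y Z
  have s := hR.inner_skew
  have l := hR.inner_skew_left
  linarith [s X Y Z U, s Y Z X U, s Z X Y U, s Y Z U X, s Z U Y X, s U Y Z X, s Z U X Y, s U X Z Y,
    s X Z U Y, s U X Y Z, s X Y U Z, s Y U X Z, l X Z U Y, l Y U X Z, l Z X Y U, l U Y Z X,
    l Z X U Y, l U Y X Z]

end IsCurv

/-- Contraction of a curvature tensor with a field of skew endomorphisms, up to the first Bianchi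
identity. -/
theorem IsCurv.two_mul_sum_swap (hR : IsCurv G R) (symm : ∀ X Y, G X Y = G Y X)
    (he : IsOrtho G e) {S : Tors n}
    (hS : ∀ X Y Z, G (S X Y) Z = -G Y (S X Z)) (X : Model n) :
    2 * ∑ i, ∑ j, G (R (e i) X (S (e j) (e i))) (e j) =
      -∑ i, ∑ j, G (R (e i) X (e j)) (S (e i) (e j)) := by
  set r : Fin (2 * n + 1) → Fin (2 * n + 1) → Fin (2 * n + 1) → ℝ :=
    fun i j k => G (R (e i) X (e j)) (e k)
  set q : Fin (2 * n + 1) → Fin (2 * n + 1) → Fin (2 * n + 1) → ℝ :=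
    fun i j k => G (e k) (S (e i) (e j))
  have hr1 : ∀ i j k, r i j k = -r i k j := fun i j k => hR.inner_skew _ _ _ _
  -- By pair symmetry `r i j k = ⟨R_{e_j,e_k} e_i, X⟩`, so this cyclic sum is a first Bianchi sum.
  have hr2 : ∀ i j k, r i j k + r j k i + r k i j = 0 := by
    intro i j k
    simp only [r]
    linarith [hR.inner_bianchi (e i) (e j) (e k) X, hR.pair (e i) X (e j) (e k),
      hR.pair (e j) X (e k) (e i), hR.pair (e k) X (e i) (e j)]
  have hq : ∀ i j k, q i j k = -q i k j := by
    intro i j k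
    simp only [q]
    rw [symm, hS, symm (e j)]
  have h1 : ∀ i j, G (R (e i) X (S (e j) (e i))) (e j) = ∑ k, q j i k * r i k j := by
    intro i j
    have := he.sum_smul (fun x => G (R (e i) X x) (e j)) (by simp) (by simp) (S (e j) (e i))
    rw [← this]
    simp [q, r]
  have h2 : ∀ i j, G (R (e i) X (e j)) (S (e i) (e j)) = ∑ k, q i j k * r i j k := by
    intro i j
    have := he.sum_smul (fun x => G (R (e i) X (e j)) x) (by simp) (by simp) (S (e i) (e j))
    rw [← this]
    simp [q, r]
  simp only [h1, h2]
  have h3 : ∑ i, ∑ j, ∑ k, q j i k * r i k j = -∑ i, ∑ j, ∑ k, q i j k * r j i k := by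
    rw [Finset.sum_comm]
    simp only [← Finset.sum_neg_distrib]
    refine Finset.sum_congr rfl fun i _ => Finset.sum_congr rfl fun j _ =>
      Finset.sum_congr rfl fun k _ => ?_
    rw [hr1 j k i]; ring
  have h4 : ∑ i, ∑ j, ∑ k, q i j k * r k i j = -∑ i, ∑ j, ∑ k, q i j k * r j i k := by
    simp only [← Finset.sum_neg_distrib]
    refine Finset.sum_congr rfl fun i _ => ?_
    rw [Finset.sum_comm]
    refine Finset.sum_congr rfl fun j _ => Finset.sum_congr rfl fun k _ => ?_
    rw [hq i k j]; ring
  -- The Bianchi relation in the form `r j i k = r i j k + r k i j`. With `h4` it makes the left sum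
  -- half of the sum of `q i j k * r i j k`.
  have h5 : ∑ i, ∑ j, ∑ k, q i j k * r j i k =
      ∑ i, ∑ j, ∑ k, q i j k * r i j k + ∑ i, ∑ j, ∑ k, q i j k * r k i j := by
    simp only [← Finset.sum_add_distrib]
    refine Finset.sum_congr rfl fun i _ => Finset.sum_congr rfl fun j _ =>
      Finset.sum_congr rfl fun k _ => ?_
    rw [← mul_add]
    congr 1
    linarith [hr2 i j k, hr1 j i k]
  rw [h3]
  linarith

end PointwiseAlgebra

/-! ### The `*`-Ricci curvature and the divergence as algebra in `R` and `ξ`. -/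

section DivergenceAlgebra

variable {n : ℕ} {G : Form n} {φ : Model n →L[ℝ] Model n} {ζ : Model n}
  {e : Fin (2 * n + 1) → Model n} {R : Curv n}

/-- `[φ, ξ_X] Y`, which is `(∇_X φ) Y` for the intrinsic torsion `ξ`. -/
def commPhi (φ : Model n →L[ℝ] Model n) (ξ : Tors n) (X Y : Model n) : Model n :=
  φ (ξ X Y) - ξ X (φ Y)

/-- The curvature endomorphism `∑ R_{e_i, φ e_i}`. -/
def curvPhi (R : Curv n) (φ : Model n →L[ℝ] Model n) (e : Fin (2 * n + 1) → Model n) :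
    Model n →ₗ[ℝ] Model n := ∑ i, R (e i) (φ (e i))

theorem curvPhi_apply (X : Model n) : curvPhi R φ e X = ∑ i, R (e i) (φ (e i)) X := by
  simp [curvPhi]

theorem curvPhi_skew (hR : IsCurv G R) (symm : ∀ X Y, G X Y = G Y X) (X Y : Model n) :
    G (curvPhi R φ e X) Y = -G X (curvPhi R φ e Y) := by
  rw [symm X]
  simp only [curvPhi_apply, map_sum, sum_apply, ← Finset.sum_neg_distrib]
  exact Finset.sum_congr rfl fun i _ => hR.inner_skew _ _ _ _

/-- The `*`-Ricci tensor in terms of `∑ R_{e_i, φ e_i}`. -/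
theorem sum_curv_phi (h : IsACM G φ ζ) (he : IsOrtho G e) (hR : IsCurv G R) (X U : Model n) :
    ∑ i, G (R (e i) X (φ (e i))) U = 1 / 2 * G (curvPhi R φ e X) U := by
  have h1 : ∑ i, G (R X (φ (e i)) (e i)) U = ∑ i, G (R (e i) X (φ (e i))) U := by
    rw [he.sum_phi h (B := fun a b => G (R X a b) U) ⟨by simp, by simp, by simp, by simp⟩,
      ← Finset.sum_neg_distrib]
    exact Finset.sum_congr rfl fun i _ => by rw [hR.inner_skew_left, neg_neg]
  have h2 : ∑ i, G (R (φ (e i)) (e i) X) U = -G (curvPhi R φ e X) U := by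
    rw [he.sum_phi h (B := fun a b => G (R a b X) U) ⟨by simp, by simp, by simp, by simp⟩]
    simp [curvPhi_apply]
  have h3 : ∑ i, (G (R (e i) X (φ (e i))) U + G (R X (φ (e i)) (e i)) U +
      G (R (φ (e i)) (e i) X) U) = 0 :=
    -- In the Bianchi sum at `e_i, X, φ e_i`, two terms agree after `φ` is moved across the trace,
    -- and the third is `-curvPhi`.
    Finset.sum_eq_zero fun i _ => hR.inner_bianchi _ _ _ _
  rw [Finset.sum_add_distrib, Finset.sum_add_distrib, h1, h2] at h3
  linarith

/-- `∑ ⟨R_{e_i, X}, ξ_{e_i}⟩` -/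
def curvTors (G : Form n) (R : Curv n) (e : Fin (2 * n + 1) → Model n) (ξ : Tors n)
    (X : Model n) : ℝ := ∑ i, ∑ j, G (R (e i) X (e j)) (ξ (e i) (e j))

theorem curvTors_add (ξ ξ' : Tors n) (X : Model n) :
    curvTors G R e (ξ + ξ') X = curvTors G R e ξ X + curvTors G R e ξ' X := by
  simp [curvTors, Finset.sum_add_distrib]

/-- The algebraic part of `d^*(Ric^*)^t + ½ ds^*`. -/
theorem sum_div_eq (h : IsACM G φ ζ) (he : IsOrtho G e) (hR : IsCurv G R) {ξ : Tors n}
    (hξ : ∀ X Y Z, G (ξ X Y) Z = -G Y (ξ X Z)) (X : Model n) :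
    (∑ a, ∑ i, (G (R (e i) (e a) (commPhi φ ξ X (e i))) (φ (e a))
      - G (R (e i) X (commPhi φ ξ (e a) (e i))) (φ (e a))
      - G (R (e i) X (φ (e i))) (commPhi φ ξ (e a) (e a)))) =
    (∑ i, G (curvPhi R φ e (e i)) (φ (ξ X (e i))))
      + 1 / 2 * G (curvPhi R φ e X) (φ (φ (∑ a, commPhi φ ξ (e a) (e a))))
      - G ζ (∑ a, commPhi φ ξ (e a) (e a)) * (1 / 2 * G (curvPhi R φ e ζ) (φ (φ X)))
      + ∑ i, ∑ a, G (R (e i) X (commPhi φ ξ (φ (e a)) (e i))) (e a) := by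
  have hP := curvPhi_skew (φ := φ) (e := e) hR h.symm
  set P := curvPhi R φ e with hPdef
  simp only [Finset.sum_sub_distrib]
  -- Summation over `a` produces `½ P`. Since `P`, `φ` and `ξ_X` are skew, both halves of the
  -- commutator then contribute equally.
  have h1 : ∑ a, ∑ i, G (R (e i) (e a) (commPhi φ ξ X (e i))) (φ (e a)) =
      ∑ i, G (P (e i)) (φ (ξ X (e i))) := by
    rw [Finset.sum_comm]
    have h11 : ∀ i, ∑ a, G (R (e i) (e a) (commPhi φ ξ X (e i))) (φ (e a)) =
        1 / 2 * G (P (e i)) (commPhi φ ξ X (e i)) := by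
      intro i
      rw [← sum_curv_phi h he hR]
      exact Finset.sum_congr rfl fun a _ => by rw [hR.inner_skew, hR.inner_skew_left, neg_neg]
    simp only [h11]
    simp only [commPhi, map_sub]
    rw [← Finset.mul_sum, Finset.sum_sub_distrib]
    have h12 : ∑ i, G (P (e i)) (ξ X (φ (e i))) = -∑ i, G (P (e i)) (φ (ξ X (e i))) := by
      have e1 := he.sum_phi h (B := fun a b => G (P a) (ξ X b)) ⟨by simp, by simp, by simp, by simp⟩
      have e2 := he.sum_skew h.symm (hξ X) (B := fun a b => G (P (φ a)) b)
        ⟨by simp, by simp, by simp, by simp⟩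
      have e3 : ∀ i, G (P (φ (ξ X (e i)))) (e i) = -G (P (e i)) (φ (ξ X (e i))) := fun i => by
        rw [hP, h.symm]
      simp only [e3, Finset.sum_neg_distrib] at e2
      linarith
    rw [h12]; ring
  have h2 : ∑ a, ∑ i, G (R (e i) X (φ (e i))) (commPhi φ ξ (e a) (e a)) =
      1 / 2 * G (P X) (∑ a, commPhi φ ξ (e a) (e a)) := by
    rw [map_sum, Finset.mul_sum]
    exact Finset.sum_congr rfl fun a _ => sum_curv_phi h he hR _ _
  -- Moving `φ` from `e_a` to the direction of `ξ` yields the operator `X ↦ [φ, ξ_{φX}]`, which is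
  -- scalar on each type.
  have h3 : ∑ a, ∑ i, G (R (e i) X (commPhi φ ξ (e a) (e i))) (φ (e a)) =
      -∑ i, ∑ a, G (R (e i) X (commPhi φ ξ (φ (e a)) (e i))) (e a) := by
    rw [Finset.sum_comm, ← Finset.sum_neg_distrib]
    refine Finset.sum_congr rfl fun i _ => ?_
    have := he.sum_phi h (B := fun a b => G (R (e i) X (commPhi φ ξ a (e i))) b)
      ⟨by simp [commPhi, sub_add_sub_comm], by simp [commPhi, mul_sub], by simp, by simp⟩
    rw [this, neg_neg]
  rw [h1, h2, h3]
  set w := ∑ a, commPhi φ ξ (e a) (e a)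
  have h4 : G (P ζ) ζ = 0 := by linarith [hP ζ ζ, h.symm (P ζ) ζ]
  have h5 : G (P X) ζ = -G (P ζ) X := by rw [hP, h.symm]
  -- Expanding both `φ²`, the `ζ`-components cancel because `⟨Pζ, ζ⟩ = 0` and `⟨PX, ζ⟩ = -⟨Pζ, X⟩`.
  rw [h.sq w, h.sq X]
  simp only [map_add, map_neg, map_smul, smul_eq_mul, h4, h5]
  ring

end DivergenceAlgebra

/-! ### Coarse decomposition of the space of intrinsic torsions -/

section Eigen

variable {n : ℕ} {G : Form n} {φ : Model n →L[ℝ] Model n} {ζ : Model n}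
  {e : Fin (2 * n + 1) → Model n} {R : Curv n}

/-- The eigenspaces of `ξ ↦ (X ↦ [φ, ξ_{φ X}])`. -/
def eigPart (φ : Model n →L[ℝ] Model n) (c : ℝ) : Submodule ℝ (Tors n) where
  carrier := {ξ | ∀ X Y, commPhi φ ξ (φ X) Y = c • ξ X Y}
  zero_mem' := by simp [commPhi]
  add_mem' := by
    intro a b ha hb X Y
    have := congrArg₂ (· + ·) (ha X Y) (hb X Y)
    simp only [commPhi, LinearMap.add_apply, map_add, smul_add] at this ⊢
    rw [← this]; abel
  smul_mem' := by
    intro s a ha X Y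
    have := congrArg (s • ·) (ha X Y)
    simp only [commPhi, LinearMap.smul_apply, map_smul, smul_sub] at this ⊢
    rw [this, smul_comm]

/-- On an eigenspace the commutator is `c ξ_{e_a}`, and the factor `-½` comes from the first Bianchi
identity in `two_mul_sum_swap`. This makes every type contribute a fixed multiple of its pairing
with the curvature. -/
theorem sum_curv_commPhi_of_mem_eigPart (hR : IsCurv G R) (symm : ∀ X Y, G X Y = G Y X)
    (he : IsOrtho G e) {ξ : Tors n} (hξ : ∀ X Y Z, G (ξ X Y) Z = -G Y (ξ X Z)) {c : ℝ}
    (hc : ξ ∈ eigPart φ c) (X : Model n) :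
    ∑ i, ∑ a, G (R (e i) X (commPhi φ ξ (φ (e a)) (e i))) (e a) =
      -(c / 2) * curvTors G R e ξ X := by
  have h1 := hR.two_mul_sum_swap symm he hξ X
  have h2 : ∀ i a, G (R (e i) X (commPhi φ ξ (φ (e a)) (e i))) (e a) =
      c * G (R (e i) X (ξ (e a) (e i))) (e a) := fun i a => by rw [hc]; simp
  simp only [h2, ← Finset.mul_sum]
  rw [curvTors]
  linear_combination (c / 2) * h1

/-- The terms at `ζ` in the defining relation of the torsion space vanish, which leaves
anticommutation with `φ`. -/
theorem horizontal_comm (h : IsACM G φ ζ) {ξ : Tors n} (hξ : ξ ∈ horizontalPart G φ ζ)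
    (X Y : Model n) : ξ X (φ Y) = -φ (ξ X Y) := by
  obtain ⟨⟨h1, h2⟩, h3, h4⟩ := hξ
  have h5 := h2 X Y
  rw [h.symm ζ (ξ X (φ Y)), h1, h4] at h5
  simp only [map_zero, neg_zero, smul_zero, zero_smul, add_zero] at h5
  exact eq_neg_of_add_eq_zero_right h5

theorem horizontal_eta (h : IsACM G φ ζ) {ξ : Tors n} (hξ : ξ ∈ horizontalPart G φ ζ)
    (X Y : Model n) : G ζ (ξ X Y) = 0 := by
  rw [h.symm, hξ.1.1, hξ.2.2, map_zero, neg_zero]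

theorem horizontal_phi_phi (h : IsACM G φ ζ) {ξ : Tors n} (hξ : ξ ∈ horizontalPart G φ ζ)
    (X Y : Model n) : φ (φ (ξ X Y)) = -ξ X Y := by
  rw [h.sq, horizontal_eta h hξ, zero_smul, add_zero]

/-- By anticommutation `[φ, ξ_{φX}]Y = -2 ξ_{φX}φY`. -/
theorem horizontal_mem_eigPart (h : IsACM G φ ζ) {ξ : Tors n} (hξ : ξ ∈ horizontalPart G φ ζ)
    {c : ℝ} (hc : ∀ X Y, ξ (φ X) (φ Y) = c • ξ X Y) : ξ ∈ eigPart φ (-2 * c) := by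
  intro X Y
  have h1 := horizontal_comm h hξ (φ X) Y
  rw [commPhi, ← neg_eq_iff_eq_neg.mpr h1, hc, ← neg_smul, ← sub_smul]
  congr 1; ring

/-- The modules `𝒞_1 ⊕ 𝒞_2`. -/
def nearlyPart (G : Form n) (φ : Model n →L[ℝ] Model n) (ζ : Model n) : Submodule ℝ (Tors n) :=
  horizontalPart G φ ζ ⊓ eigPart φ 2

/-- The modules `𝒞_5 ⊕ ⋯ ⊕ 𝒞_8` (for `c = -1`) and `𝒞_9 ⊕ 𝒞_10` (for `c = 1`). -/
def mixedEig (G : Form n) (φ : Model n →L[ℝ] Model n) (ζ : Model n) (c : ℝ) :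
    Submodule ℝ (Tors n) := mixedPart G φ ζ ⊓ eigPart φ c

/-- Anticommutation and `ξ_X Y = -ξ_Y X` move both `φ` outside, where `φ² = -1`; the outcome is
`ξ_{φX}φY = -ξ_X Y`. -/
theorem C1_le (h : IsACM G φ ζ) : C1 G φ ζ ≤ nearlyPart G φ ζ := by
  rintro ξ ⟨h1, h2⟩
  refine ⟨h1, ?_⟩
  have := horizontal_mem_eigPart h h1 (c := -1) fun X Y => by
    rw [horizontal_comm h h1, h2, map_neg, neg_neg, horizontal_comm h h1, map_neg,
      horizontal_phi_phi h h1, h2 X Y]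
    simp
  simpa using this

theorem C2_le (h : IsACM G φ ζ) : C2 G φ ζ ≤ nearlyPart G φ ζ := by
  rintro ξ ⟨h1, h2⟩
  refine ⟨h1, ?_⟩
  have hc := horizontal_comm h h1
  have hpp := horizontal_phi_phi h h1
  have hsw : ∀ X Y Z, G (ξ X (φ Y)) (φ Z) = -G (ξ X Y) Z := by
    intro X Y Z
    rw [hc, map_neg, neg_apply, h.compat, horizontal_eta h h1, zero_mul, sub_zero]
  have hz : ∀ X Y Z, G (ξ X Y) (φ (φ Z)) = -G (ξ X Y) Z := by
    intro X Y Z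
    rw [← neg_eq_iff_eq_neg.mpr (h.skew _ _), ← neg_eq_iff_eq_neg.mpr (h.skew _ _), hpp]
    simp
  have hmv : ∀ X Y Z, G (ξ X (φ Y)) (φ Z) = G (ξ X Y) (φ (φ Z)) := fun X Y Z => by
    rw [hsw, hz]
  have key : ∀ X Y Z, G (ξ (φ X) (φ Y)) (φ Z) = -G (ξ X Y) (φ Z) := by
    intro X Y Z
    -- The cyclic identity at `(X, Y, Z)` and with `φ` applied to each pair of arguments. These four
    -- relations determine the required term.
    have a0 := h2 X Y Z
    have a1 := h2 (φ X) (φ Y) Z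
    have a2 := h2 (φ Y) (φ Z) X
    have a3 := h2 (φ Z) (φ X) Y
    rw [hsw Z X (φ Y), ← hmv] at a1
    rw [hsw X Y (φ Z), ← hmv] at a2
    rw [hsw Y Z (φ X), ← hmv] at a3
    linarith
  have := horizontal_mem_eigPart h h1 (c := -1) fun X Y => by
    rw [neg_one_smul]
    refine ext_inner h.pos fun Z => ?_
    have h5 := key X Y (φ Z)
    rw [hz, hz] at h5
    simp only [map_neg, neg_apply]
    linarith
  simpa using this

theorem C3_le (h : IsACM G φ ζ) : C3 G φ ζ ≤ horizontalPart G φ ζ ⊓ eigPart φ (-2) := by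
  rintro ξ ⟨h1, h2, -⟩
  refine ⟨h1, ?_⟩
  simpa using horizontal_mem_eigPart h h1 (c := 1) fun X Y => by rw [h2, one_smul]

/-- Replacing `X, Y` by `φX, φY` fixes the first and third terms of the defining formula and
exchanges the second and fourth. -/
theorem C4_le (h : IsACM G φ ζ) : C4 G φ ζ ≤ horizontalPart G φ ζ ⊓ eigPart φ (-2) := by
  rintro ξ ⟨h1, θ, h2, h3⟩
  have h4 : ξ ∈ horizontalPart G φ ζ := by
    refine ⟨h1, LinearMap.ext fun Y => ?_, fun X => ?_⟩
    · have := h3 ζ Y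
      simpa [h.unit, h.phi_zeta] using this
    · have := h3 X ζ
      simpa [h.symm _ ζ, h.unit, h.eta_phi, h2] using this
  refine ⟨h4, ?_⟩
  have := horizontal_mem_eigPart h h4 (c := 1) fun X Y => by
    have e1 := h3 (φ X) (φ Y)
    have e2 := h3 X Y
    have e3 : G (φ X) (φ Y) = G (X - G ζ X • ζ) Y := by
      rw [h.compat]; simp
    have e4 : φ (φ X) = -(X - G ζ X • ζ) := by rw [h.sq]; abel
    have e5 : G (φ (φ X)) (φ Y) = G (φ X) Y := by rw [h.compat, h.eta_phi]; simp
    have e6 : G θ (φ Y) = -G (φ θ) Y := by rw [h.skew, neg_neg]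
    have e7 : G (φ θ) (φ Y) = G θ Y := by rw [h.compat, h2]; simp
    rw [h.eta_phi, zero_smul, sub_zero, e3, e5, e6, e7, e4] at e1
    have h5 : (4 : ℝ) • ξ (φ X) (φ Y) = (4 : ℝ) • ξ X Y := by
      rw [e1, e2, neg_smul, smul_neg]; abel
    rw [one_smul]
    exact smul_right_injective _ (by norm_num : (4 : ℝ) ≠ 0) h5
  simpa using this

/-- The shape of an element of `η^⊥ ⊗ (η^⊥ ∧ η)`. -/
theorem mixed_apply (h : IsACM G φ ζ) {ξ : Tors n} (hξ : ξ ∈ mixedPart G φ ζ) (X Y : Model n) :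
    ξ X Y = G ζ Y • ξ X ζ - G (ξ X ζ) Y • ζ := by
  obtain ⟨⟨h1, -⟩, -, h3⟩ := hξ
  have hzz : G (ξ X ζ) ζ = 0 := by linarith [h1 X ζ ζ, h.symm (ξ X ζ) ζ]
  refine ext_inner h.pos fun Z => ?_
  -- The hypothesis concerns horizontal vectors only, so it is applied to the projections of `Y` and
  -- `Z`.
  have h4 := h3 X (Y - G ζ Y • ζ) (Z - G ζ Z • ζ) (by simp [h.unit]) (by simp [h.unit])
  simp only [map_sub, map_smul, sub_apply, smul_apply, smul_eq_mul] at h4 ⊢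
  have h5 : G (ξ X Y) ζ = -G (ξ X ζ) Y := by rw [h1, h.symm]
  rw [hzz, h5] at h4
  linarith

/-- A mixed torsion is determined by `X ↦ ξ_X ζ`, for which the eigenvalue equation is `φ ξ_{φX}ζ =
c ξ_X ζ`. Thus Hermitian forms have `c = -1` and anti-Hermitian forms `c = 1`. -/
theorem mixed_mem_eigPart (h : IsACM G φ ζ) {ξ : Tors n} (hξ : ξ ∈ mixedPart G φ ζ) {c : ℝ}
    (hc : ∀ X Y, G ζ X = 0 → G ζ Y = 0 → G ζ (ξ (φ X) (φ Y)) = -c * G ζ (ξ X Y)) :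
    ξ ∈ mixedEig G φ ζ c := by
  refine ⟨hξ, fun X Y => ?_⟩
  have hm := mixed_apply h hξ
  obtain ⟨⟨h1, -⟩, h2, h3⟩ := hξ
  have hzz : ∀ X, G (ξ X ζ) ζ = 0 := fun X => by linarith [h1 X ζ ζ, h.symm (ξ X ζ) ζ]
  have hη : ∀ X Y, G ζ (ξ X Y) = -G (ξ X ζ) Y := fun X Y => by rw [h.symm, h1, h.symm]
  have key : φ (ξ (φ X) ζ) = c • ξ X ζ := by
    refine ext_inner h.pos fun Z => ?_
    have h4 := hc (X - G ζ X • ζ) (Z - G ζ Z • ζ) (by simp [h.unit]) (by simp [h.unit])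
    simp only [hη, map_sub, map_smul, h.phi_zeta, h2, smul_zero, sub_zero, hzz, neg_zero] at h4
    rw [h.skew]
    simp only [map_smul, smul_apply, smul_eq_mul]
    linarith
  rw [commPhi, hm (φ X) Y, hm (φ X) (φ Y), hm X Y, h.eta_phi, ← neg_eq_iff_eq_neg.mpr (h.skew _ _),
    map_sub, map_smul, map_smul, key, h.phi_zeta]
  simp only [map_smul, smul_apply, smul_eq_mul, smul_sub, smul_smul, mul_comm]
  module

theorem C5_le (h : IsACM G φ ζ) : C5 G φ ζ ≤ mixedEig G φ ζ (-1) := by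
  rintro ξ ⟨h1, a, h2⟩
  refine mixed_mem_eigPart h h1 fun X Y hX hY => ?_
  rw [h2 _ _ (h.eta_phi _) (h.eta_phi _), h2 _ _ hX hY, h.compat, hX]
  ring

theorem C6_le (h : IsACM G φ ζ) : C6 G φ ζ ≤ mixedEig G φ ζ (-1) := by
  rintro ξ ⟨h1, a, h2⟩
  refine mixed_mem_eigPart h h1 fun X Y hX hY => ?_
  rw [h2 _ _ (h.eta_phi _) (h.eta_phi _), h2 _ _ hX hY, h.compat, hX]
  ring

theorem mixedSym_le (h : IsACM G φ ζ) (ε δ : ℝ) :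
    mixedSym G φ ζ ε δ ≤ mixedEig G φ ζ (-ε) := by
  rintro ξ ⟨h1, h2⟩
  exact mixed_mem_eigPart h h1 fun X Y hX hY => by rw [(h2 X Y hX hY).1, neg_neg]

end Eigen

/-! ### Curvature pairings, codifferential and Lee vector of each component. -/

section TypeAlgebra

variable {n : ℕ} {G : Form n} {φ : Model n →L[ℝ] Model n} {ζ : Model n}
  {e : Fin (2 * n + 1) → Model n} {R : Curv n}

theorem vertical_mem_eigPart (h : IsACM G φ ζ) {ξ : Tors n} (hξ : ξ ∈ verticalPart G φ ζ) :
    ξ ∈ eigPart φ 0 := by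
  intro X Y
  simp [commPhi, hξ.2 (φ X), h.eta_phi]

/-- `∑_{i ≤ 2n+1} ⟨R_{e_i, X} ζ, ξ_{e_i} ζ⟩` -/
def curvReeb (G : Form n) (R : Curv n) (e : Fin (2 * n + 1) → Model n) (ζ : Model n)
    (ξ : Tors n) (X : Model n) : ℝ := ∑ i, G (R (e i) X ζ) (ξ (e i) ζ)

theorem curvReeb_add (ξ ξ' : Tors n) (X : Model n) :
    curvReeb G R e ζ (ξ + ξ') X = curvReeb G R e ζ ξ X + curvReeb G R e ζ ξ' X := by
  simp [curvReeb, Finset.sum_add_distrib]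

theorem curvReeb_horizontal {ξ : Tors n} (hξ : ξ ∈ horizontalPart G φ ζ) (X : Model n) :
    curvReeb G R e ζ ξ X = 0 := by
  simp [curvReeb, hξ.2.2]

/-- A mixed `ξ_X` is the wedge product of `ζ` and `ξ_X ζ`. Both halves of the wedge pair equally
with the skew endomorphism `R_{e_i,X}`. -/
theorem curvTors_mixed (h : IsACM G φ ζ) (he : IsOrtho G e) (hR : IsCurv G R) {ξ : Tors n}
    (hξ : ξ ∈ mixedPart G φ ζ) (X : Model n) :
    curvTors G R e ξ X = 2 * curvReeb G R e ζ ξ X := by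
  rw [curvTors, curvReeb, Finset.mul_sum]
  refine Finset.sum_congr rfl fun i _ => ?_
  have h1 := he.sum_smul' h.symm (fun x => G (R (e i) X x) (ξ (e i) ζ)) (by simp) (by simp) ζ
  have h2 := he.sum_smul' h.symm (fun x => G (R (e i) X x) ζ) (by simp) (by simp) (ξ (e i) ζ)
  rw [hR.inner_skew (e i) X (ξ (e i) ζ) ζ] at h2
  have h3 : ∑ j, G (R (e i) X (e j)) (ξ (e i) (e j)) =
      ∑ j, G ζ (e j) • G (R (e i) X (e j)) (ξ (e i) ζ)
        - ∑ j, G (ξ (e i) ζ) (e j) • G (R (e i) X (e j)) ζ := by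
    rw [← Finset.sum_sub_distrib]
    refine Finset.sum_congr rfl fun j _ => ?_
    rw [mixed_apply h hξ (e i) (e j)]
    simp
  rw [h3, h1, h2]; ring

theorem curvReeb_vertical (h : IsACM G φ ζ) (he : IsOrtho G e) {ξ : Tors n}
    (hξ : ξ ∈ verticalPart G φ ζ) (X : Model n) :
    curvReeb G R e ζ ξ X = G (R ζ X ζ) (ξ ζ ζ) := by
  have h1 := he.sum_smul' h.symm (fun x => G (R x X ζ) (ξ ζ ζ)) (by simp) (by simp) ζ
  rw [curvReeb, ← h1]
  refine Finset.sum_congr rfl fun j _ => ?_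
  rw [hξ.2]; simp

theorem curvTors_vertical (h : IsACM G φ ζ) (he : IsOrtho G e) {ξ : Tors n}
    (hξ : ξ ∈ verticalPart G φ ζ) (X : Model n) :
    curvTors G R e ξ X = ∑ j, G (R ζ X (e j)) (ξ ζ (e j)) := by
  have h1 := he.sum_smul' h.symm (fun x => ∑ j, G (R x X (e j)) (ξ ζ (e j)))
    (by simp [Finset.sum_add_distrib]) (by simp [Finset.mul_sum]) ζ
  rw [curvTors, ← h1]
  refine Finset.sum_congr rfl fun i _ => ?_
  rw [Finset.smul_sum]
  refine Finset.sum_congr rfl fun j _ => ?_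
  rw [hξ.2 (e i)]; simp

/-- Contraction of a bilinear-in-`j` expression with an element of `𝒞_4`. -/
theorem sum_inner_C4 (h : IsACM G φ ζ) (he : IsOrtho G e) {ξ : Tors n} {θ : Model n}
    (hξ : ∀ X Y, (4 : ℝ) • ξ X Y = G (X - G ζ X • ζ) Y • θ - G θ Y • (X - G ζ X • ζ)
      - G (φ X) Y • φ θ + G (φ θ) Y • φ X) {S : Model n →ₗ[ℝ] Model n}
    (hS : ∀ X Y, G (S X) Y = -G (S Y) X) (X : Model n) :
    4 * ∑ j, G (S (e j)) (ξ X (e j)) =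
      2 * (G (S (X - G ζ X • ζ)) θ - G (S (φ X)) (φ θ)) := by
  have key : ∀ u p : Model n, ∑ j, G u (e j) * G (S (e j)) p = G (S u) p := fun u p => by
    simpa using he.sum_smul' h.symm (fun x => G (S x) p) (by simp) (by simp) u
  have h1 : ∀ j, 4 * G (S (e j)) (ξ X (e j)) =
      G (X - G ζ X • ζ) (e j) * G (S (e j)) θ - G θ (e j) * G (S (e j)) (X - G ζ X • ζ)
      - G (φ X) (e j) * G (S (e j)) (φ θ) + G (φ θ) (e j) * G (S (e j)) (φ X) := by
    intro j
    have := congrArg (G (S (e j))) (hξ X (e j))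
    rw [map_smul, map_add, map_sub, map_sub] at this
    simpa only [map_smul, smul_eq_mul] using this
  rw [Finset.mul_sum]
  simp only [h1, Finset.sum_add_distrib, Finset.sum_sub_distrib, key]
  rw [hS θ, hS (φ θ)]
  ring

/-- The rank-one terms of the `𝒞_4` formula turn the pairing into traces of `R`, of Ricci and
`*`-Ricci type. The term at `ζ` comes from the projection `X_⊥`. -/
theorem curvTors_C4 (h : IsACM G φ ζ) (he : IsOrtho G e) (hR : IsCurv G R) {ξ : Tors n}
    {θ : Model n}
    (hξ : ∀ X Y, (4 : ℝ) • ξ X Y = G (X - G ζ X • ζ) Y • θ - G θ Y • (X - G ζ X • ζ)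
      - G (φ X) Y • φ θ + G (φ θ) Y • φ X) (X : Model n) :
    2 * curvTors G R e ξ X = ∑ i, G (R (e i) X (e i)) θ
      - ∑ i, G (R (e i) X (φ (e i))) (φ θ) - G (R ζ X ζ) θ := by
  have h1 : ∀ i, 2 * ∑ j, G (R (e i) X (e j)) (ξ (e i) (e j)) =
      G (R (e i) X (e i)) θ - G ζ (e i) • G (R (e i) X ζ) θ - G (R (e i) X (φ (e i))) (φ θ) := by
    intro i
    have := sum_inner_C4 h he hξ (S := R (e i) X) (hR.inner_skew _ _) (e i)
    rw [map_sub, map_smul, map_sub, map_smul] at this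
    simp only [sub_apply, smul_apply] at this
    linarith
  rw [curvTors, Finset.mul_sum]
  simp only [h1, Finset.sum_sub_distrib]
  rw [he.sum_zeta h (B := fun a b => G (R a X b) θ) ⟨by simp, by simp, by simp, by simp⟩]
  ring

/-- Four times the trace has coefficient `(2n + 1) - 1 - 1 - 1`: the subtracted units come from the
`ζ`-direction, from `θ^♭ ⊗ X_⊥` and from `φ²θ = -θ`. -/
theorem trace_C4 (h : IsACM G φ ζ) (he : IsOrtho G e) {ξ : Tors n} {θ : Model n}
    (hθ : G ζ θ = 0)
    (hξ : ∀ X Y, (4 : ℝ) • ξ X Y = G (X - G ζ X • ζ) Y • θ - G θ Y • (X - G ζ X • ζ)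
      - G (φ X) Y • φ θ + G (φ θ) Y • φ X) :
    (2 : ℝ) • ∑ i, ξ (e i) (e i) = ((n : ℝ) - 1) • θ := by
  have h1 : ∀ i, (4 : ℝ) • ξ (e i) (e i) = G (e i) (e i) • θ - G ζ (e i) • G ζ (e i) • θ
      - G θ (e i) • e i + G θ (e i) • G ζ (e i) • ζ + G (φ θ) (e i) • φ (e i) := by
    intro i
    have h2 : G (φ (e i)) (e i) = 0 := by
      linarith [h.skew (e i) (e i), h.symm (φ (e i)) (e i)]
    rw [hξ, h2]
    simp only [map_sub, map_smul, sub_apply, smul_apply, smul_sub, sub_smul, zero_smul, sub_zero,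
      smul_eq_mul, mul_smul]
    abel
  have h3 : (4 : ℝ) • ∑ i, ξ (e i) (e i) = (2 * ((n : ℝ) - 1)) • θ := by
    rw [Finset.smul_sum]
    simp only [h1, Finset.sum_add_distrib, Finset.sum_sub_distrib]
    rw [← Finset.sum_smul, he.sum_inner_self,
      he.sum_smul' h.symm (fun x => G ζ x • θ) (by simp [add_smul]) (by simp [mul_smul]),
      he.sum_smul' h.symm (fun x => x) (by simp) (by simp),
      he.sum_smul' h.symm (fun x => G ζ x • ζ) (by simp [add_smul]) (by simp [mul_smul]),
      he.sum_smul' h.symm (fun x => φ x) (by simp) (by simp), h.unit, hθ, h.sq, hθ]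
    module
  have h4 : (2 : ℝ) • ((2 : ℝ) • ∑ i, ξ (e i) (e i)) = (2 : ℝ) • (((n : ℝ) - 1) • θ) := by
    rw [smul_smul, smul_smul, ← h3]; norm_num
  exact smul_right_injective _ (by norm_num : (2 : ℝ) ≠ 0) h4

/-- The formula gives `|ξ|² = ⟨tr ξ, θ⟩`, which is `½(n - 1)|θ|²`. For `n = 1` the module is
therefore zero, as the convention `θ = 0` requires. -/
theorem C4_eq_zero (h : IsACM G φ ζ) (he : IsOrtho G e) (hn : (n : ℝ) - 1 = 0) {ξ : Tors n}
    (hC : ξ ∈ C4 G φ ζ) (i j : Fin (2 * n + 1)) : ξ (e i) (e j) = 0 := by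
  have hH := (C4_le h hC).1
  obtain ⟨⟨hs, -⟩, θ, hθ, hξ⟩ := hC
  have h1 : ∀ i, 2 * ∑ j, G (ξ (e i) (e j)) (ξ (e i) (e j)) = 2 * G (ξ (e i) (e i)) θ := by
    intro i
    have h2 := sum_inner_C4 h he hξ (S := ξ (e i)) (fun X Y => by rw [hs, h.symm]) (e i)
    rw [map_sub, map_smul, hH.2.2, smul_zero, sub_zero, horizontal_comm h hH, map_neg, neg_apply,
      h.compat, hθ, mul_zero, sub_zero] at h2
    linarith
  have h3 : ∑ i, ∑ j, G (ξ (e i) (e j)) (ξ (e i) (e j)) = 0 := by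
    have h4 := congrArg (fun v => G v θ) (trace_C4 h he hθ hξ)
    simp only [hn, zero_smul, map_zero, zero_apply, map_smul, map_sum, smul_apply, sum_apply,
      smul_eq_mul] at h4
    have h5 : 2 * ∑ i, ∑ j, G (ξ (e i) (e j)) (ξ (e i) (e j)) = 0 := by
      rw [Finset.mul_sum, ← h4, Finset.mul_sum]
      exact Finset.sum_congr rfl fun i _ => h1 i
    linarith
  have hnn : ∀ v, 0 ≤ G v v := fun v => by
    by_cases hv : v = 0
    · simp [hv]
    · exact (h.pos v hv).le
  have h4 := (Finset.sum_eq_zero_iff_of_nonneg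
    fun i _ => Finset.sum_nonneg fun j _ => hnn _).mp h3 i (Finset.mem_univ _)
  have h5 := (Finset.sum_eq_zero_iff_of_nonneg fun j _ => hnn _).mp h4 j (Finset.mem_univ _)
  by_contra hv
  exact (h.pos _ hv).ne' h5

/-- `(d^*F)^♯` in terms of the intrinsic torsion. -/
def codiffVec (φ : Model n →L[ℝ] Model n) (e : Fin (2 * n + 1) → Model n) (ξ : Tors n) : Model n :=
  ∑ a, commPhi φ ξ (e a) (e a)

theorem codiffVec_add (ξ ξ' : Tors n) :
    codiffVec φ e (ξ + ξ') = codiffVec φ e ξ + codiffVec φ e ξ' := by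
  simp only [codiffVec, commPhi, LinearMap.add_apply, map_add, ← Finset.sum_add_distrib]
  exact Finset.sum_congr rfl fun _ _ => by abel

theorem codiffVec_eq (h : IsACM G φ ζ) (he : IsOrtho G e) {ξ : Tors n}
    (hξ : ξ ∈ torsionSpace G φ ζ) : codiffVec φ e ξ = (2 : ℝ) • φ (∑ i, ξ (e i) (e i))
      - φ (ξ ζ ζ) - (∑ i, G ζ (ξ (e i) (φ (e i)))) • ζ := by
  have h1 : ∀ i, commPhi φ ξ (e i) (e i) = (2 : ℝ) • φ (ξ (e i) (e i))
      - G ζ (e i) • φ (ξ (e i) ζ) - G ζ (ξ (e i) (φ (e i))) • ζ := by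
    intro i
    have := hξ.2 (e i) (e i)
    rw [commPhi]
    rw [← sub_eq_zero] at this ⊢
    rw [← neg_eq_zero, ← this]
    module
  simp only [codiffVec, h1, Finset.sum_sub_distrib]
  rw [he.sum_zeta h (B := fun a b => φ (ξ a b)) ⟨by simp, by simp, by simp, by simp⟩,
    ← Finset.smul_sum, map_sum, Finset.sum_smul]

theorem inner_zeta_torsion (h : IsACM G φ ζ) {ξ : Tors n} (hξ : ξ ∈ torsionSpace G φ ζ)
    (X : Model n) : G ζ (ξ X ζ) = 0 := by
  linarith [hξ.1 X ζ ζ, h.symm (ξ X ζ) ζ]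

theorem eta_codiffVec (h : IsACM G φ ζ) (he : IsOrtho G e) {ξ : Tors n}
    (hξ : ξ ∈ torsionSpace G φ ζ) :
    G ζ (codiffVec φ e ξ) = ∑ i, G (ξ (e i) ζ) (φ (e i)) := by
  rw [codiffVec_eq h he hξ]
  simp only [map_sub, map_smul, h.eta_phi, h.unit, smul_eq_mul, mul_zero, mul_one, zero_sub,
    sub_zero, ← Finset.sum_neg_distrib]
  exact Finset.sum_congr rfl fun i _ => by rw [hξ.1]

/-- `-φ (d^*F)^♯ + ∇_ζ ζ` in terms of the intrinsic torsion. -/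
def leeRaw (φ : Model n →L[ℝ] Model n) (ζ : Model n) (e : Fin (2 * n + 1) → Model n)
    (ξ : Tors n) : Model n := -φ (codiffVec φ e ξ) - ξ ζ ζ

theorem leeRaw_add (ξ ξ' : Tors n) :
    leeRaw φ ζ e (ξ + ξ') = leeRaw φ ζ e ξ + leeRaw φ ζ e ξ' := by
  simp only [leeRaw, codiffVec_add, map_add, LinearMap.add_apply]
  abel

theorem leeRaw_eq (h : IsACM G φ ζ) (he : IsOrtho G e) {ξ : Tors n}
    (hξ : ξ ∈ torsionSpace G φ ζ) : leeRaw φ ζ e ξ =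
      -((2 : ℝ) • φ (φ (∑ i, ξ (e i) (e i)))) - (2 : ℝ) • ξ ζ ζ := by
  rw [leeRaw, codiffVec_eq h he hξ]
  simp only [map_sub, map_smul, h.phi_zeta, smul_zero, sub_zero, h.sq (ξ ζ ζ),
    inner_zeta_torsion h hξ, zero_smul, add_zero]
  module

/-- Moving `φ` across the trace of `[φ, ξ_{φ e_i}] e_i` shows that `2 tr ξ = -2 tr ξ`. -/
theorem trace_nearly (h : IsACM G φ ζ) (he : IsOrtho G e) {ξ : Tors n}
    (hξ : ξ ∈ nearlyPart G φ ζ) : ∑ i, ξ (e i) (e i) = 0 := by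
  obtain ⟨h1, h2⟩ := hξ
  have h3 : ∑ i, commPhi φ ξ (φ (e i)) (e i) = (2 : ℝ) • ∑ i, ξ (e i) (e i) := by
    rw [Finset.smul_sum]
    exact Finset.sum_congr rfl fun i _ => h2 _ _
  have h4 := he.sum_phi h (B := fun a b => commPhi φ ξ a b)
    ⟨by simp [commPhi, sub_add_sub_comm], by simp [commPhi, smul_sub],
      by simp [commPhi, sub_add_sub_comm], by simp [commPhi, smul_sub]⟩
  have h5 : ∀ i, commPhi φ ξ (e i) (φ (e i)) = (2 : ℝ) • ξ (e i) (e i) := by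
    intro i
    rw [commPhi, horizontal_comm h h1 _ (φ (e i)), horizontal_comm h h1 _ (e i)]
    simp only [map_neg, horizontal_phi_phi h h1]
    module
  simp only [h5, ← Finset.smul_sum] at h4
  rw [h3] at h4
  have h6 : (4 : ℝ) • ∑ i, ξ (e i) (e i) = 0 := by
    have : (4 : ℝ) = 2 + 2 := by norm_num
    rw [this, add_smul]
    nth_rw 1 [h4]
    abel
  exact (smul_eq_zero.mp h6).resolve_left (by norm_num)

theorem phi_trace_mixed (h : IsACM G φ ζ) (he : IsOrtho G e) {ξ : Tors n}
    (hξ : ξ ∈ mixedPart G φ ζ) : φ (∑ i, ξ (e i) (e i)) = 0 := by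
  have h1 : ∀ i, φ (ξ (e i) (e i)) = G ζ (e i) • φ (ξ (e i) ζ) := fun i => by
    rw [mixed_apply h hξ (e i) (e i)]
    simp [h.phi_zeta]
  rw [map_sum]
  simp only [h1]
  rw [he.sum_zeta h (B := fun a b => φ (ξ a b)) ⟨by simp, by simp, by simp, by simp⟩, hξ.2.1]
  simp

/-- The sum is the contraction of `∇η` with `F`. Being anti-Hermitian makes it invariant when `φ`
changes argument, whereas skewness of `φ` reverses its sign. -/
theorem eta_codiffVec_anti (h : IsACM G φ ζ) (he : IsOrtho G e) {ξ : Tors n}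
    (hξ : ξ ∈ mixedEig G φ ζ 1) : G ζ (codiffVec φ e ξ) = 0 := by
  rw [eta_codiffVec h he hξ.1.1]
  have h1 : ∀ X, φ (ξ (φ X) ζ) = ξ X ζ := fun X => by
    simpa [commPhi, h.phi_zeta] using hξ.2 X ζ
  have h2 : ∀ i, G (ξ (e i) ζ) (φ (e i)) = G (ξ (φ (e i)) ζ) (e i) := fun i => by
    rw [← h1, h.compat, inner_zeta_torsion h hξ.1.1, zero_mul, sub_zero]
  have h3 := he.sum_phi h (B := fun a b => G (ξ a ζ) b) ⟨by simp, by simp, by simp, by simp⟩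
  have h4 : ∑ i, G (ξ (e i) ζ) (φ (e i)) = ∑ i, G (ξ (φ (e i)) ζ) (e i) :=
    Finset.sum_congr rfl fun i _ => h2 i
  linarith

theorem eta_codiffVec_horizontal (h : IsACM G φ ζ) (he : IsOrtho G e) {ξ : Tors n}
    (hξ : ξ ∈ horizontalPart G φ ζ) : G ζ (codiffVec φ e ξ) = 0 := by
  rw [eta_codiffVec h he hξ.1]
  simp [hξ.2.2]

theorem eta_codiffVec_vertical (h : IsACM G φ ζ) (he : IsOrtho G e) {ξ : Tors n}
    (hξ : ξ ∈ verticalPart G φ ζ) : G ζ (codiffVec φ e ξ) = 0 := by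
  rw [eta_codiffVec h he hξ.1]
  have : ∀ i, G (ξ (e i) ζ) (φ (e i)) = G ζ (e i) • G (ξ ζ ζ) (φ (e i)) := fun i => by
    rw [hξ.2]; simp
  simp only [this]
  rw [he.sum_smul' h.symm (fun x => G (ξ ζ ζ) (φ x)) (by simp) (by simp), h.phi_zeta, map_zero]

theorem leeRaw_C4 (h : IsACM G φ ζ) (he : IsOrtho G e) {ξ : Tors n} {θ : Model n}
    (hξT : ξ ∈ horizontalPart G φ ζ) (hθ : G ζ θ = 0)
    (hξ : ∀ X Y, (4 : ℝ) • ξ X Y = G (X - G ζ X • ζ) Y • θ - G θ Y • (X - G ζ X • ζ)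
      - G (φ X) Y • φ θ + G (φ θ) Y • φ X) : leeRaw φ ζ e ξ = ((n : ℝ) - 1) • θ := by
  rw [leeRaw_eq h he hξT.1, hξT.2.2, smul_zero, sub_zero, ← map_smul, ← map_smul,
    trace_C4 h he hθ hξ, map_smul, map_smul, h.sq, hθ]
  simp

theorem leeRaw_eq_zero (h : IsACM G φ ζ) (he : IsOrtho G e) {ξ : Tors n}
    (hξ : ξ ∈ torsionSpace G φ ζ) (hz : ξ ζ ζ = 0) (ht : φ (∑ i, ξ (e i) (e i)) = 0) :
    leeRaw φ ζ e ξ = 0 := by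
  rw [leeRaw_eq h he hξ, hz, ht]; simp

theorem trace_vertical (h : IsACM G φ ζ) (he : IsOrtho G e) {ξ : Tors n}
    (hξ : ξ ∈ verticalPart G φ ζ) : ∑ i, ξ (e i) (e i) = ξ ζ ζ := by
  have h1 : ∀ i, ξ (e i) (e i) = G ζ (e i) • ξ ζ (e i) := fun i => hξ.2 _ _
  simp only [h1]
  exact he.sum_smul' h.symm (fun x => ξ ζ x) (by simp) (by simp) ζ

/-- The trace of a vertical torsion is `ξ_ζ ζ`, and the summand `-ξ ζ ζ` of `leeRaw` cancels its
contribution. Hence the Lee vector sees only the `𝒞_4` component. -/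
theorem leeRaw_vertical (h : IsACM G φ ζ) (he : IsOrtho G e) {ξ : Tors n}
    (hξ : ξ ∈ verticalPart G φ ζ) : leeRaw φ ζ e ξ = 0 := by
  rw [leeRaw_eq h he hξ.1, trace_vertical h he hξ, h.sq, inner_zeta_torsion h hξ.1]
  simp

/-- The consequences of the decomposition of the intrinsic torsion into its components. -/
theorem sum_div_of_decomposition (h : IsACM G φ ζ) (he : IsOrtho G e) (hR : IsCurv G R)
    {a b c m k v ξ : Tors n} (ha : a ∈ nearlyPart G φ ζ) (hb : b ∈ C3 G φ ζ) (hc : c ∈ C4 G φ ζ)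
    (hm : m ∈ mixedEig G φ ζ (-1)) (hk : k ∈ mixedEig G φ ζ 1) (hv : v ∈ verticalPart G φ ζ)
    (hξ : ξ = a + b + c + m + k + v) (X : Model n) :
    (∑ i, ∑ j, G (R (e j) X (commPhi φ ξ (φ (e i)) (e j))) (e i) =
      -curvTors G R e a X + curvTors G R e b X + curvTors G R e c X + curvReeb G R e ζ m X
        - curvReeb G R e ζ k X) ∧
    curvTors G R e ξ X = curvTors G R e a X + curvTors G R e b X + curvTors G R e c X
      + 2 * curvReeb G R e ζ m X + 2 * curvReeb G R e ζ k X
      + ∑ j, G (R ζ X (e j)) (ξ ζ (e j)) ∧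
    curvReeb G R e ζ ξ X = curvReeb G R e ζ m X + curvReeb G R e ζ k X
      + G (R ζ X ζ) (ξ ζ ζ) ∧
    G ζ (codiffVec φ e ξ) = G ζ (codiffVec φ e m) ∧
    ((n : ℝ) - 1) • (((n : ℝ) - 1)⁻¹ • leeRaw φ ζ e ξ) = leeRaw φ ζ e ξ ∧
    2 * curvTors G R e c X = ∑ i, G (R (e i) X (e i)) (((n : ℝ) - 1)⁻¹ • leeRaw φ ζ e ξ)
      - ∑ i, G (R (e i) X (φ (e i))) (φ (((n : ℝ) - 1)⁻¹ • leeRaw φ ζ e ξ))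
      - G (R ζ X ζ) (((n : ℝ) - 1)⁻¹ • leeRaw φ ζ e ξ) ∧
    ((n : ℝ) - 1) • (((n : ℝ) - 1)⁻¹ • leeRaw φ ζ e ξ) = (2 : ℝ) • ∑ i, c (e i) (e i) := by
  have hb' := C3_le h hb
  have hc' := C4_le h hc
  have hz : ξ ζ = v ζ := by
    rw [hξ]
    simp [ha.1.2.1, hb'.1.2.1, hc'.1.2.1, hm.1.2.1, hk.1.2.1]
  obtain ⟨θ, hθ, hcθ⟩ := hc.2
  have hraw : leeRaw φ ζ e ξ = ((n : ℝ) - 1) • θ := by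
    rw [hξ]
    simp only [leeRaw_add]
    rw [leeRaw_C4 h he hc'.1 hθ hcθ, leeRaw_vertical h he hv,
      leeRaw_eq_zero h he ha.1.1 (by rw [ha.1.2.1]; rfl) (by rw [trace_nearly h he ha, map_zero]),
      leeRaw_eq_zero h he hb'.1.1 (by rw [hb'.1.2.1]; rfl) (by
        have h3 := hb.2.2
        rw [contract_eq_sum he ⟨by simp, by simp, by simp, by simp⟩] at h3
        rw [h3, map_zero]),
      leeRaw_eq_zero h he hm.1.1 (by rw [hm.1.2.1]; rfl) (phi_trace_mixed h he hm.1),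
      leeRaw_eq_zero h he hk.1.1 (by rw [hk.1.2.1]; rfl) (phi_trace_mixed h he hk.1)]
    simp
  -- For `n = 1` the inverse is the default value `0`, but `leeRaw` is then zero as well.
  have hscal : ((n : ℝ) - 1) • (((n : ℝ) - 1)⁻¹ • leeRaw φ ζ e ξ) = leeRaw φ ζ e ξ := by
    by_cases h0 : (n : ℝ) - 1 = 0
    · rw [hraw, h0]; simp
    · rw [smul_smul, mul_inv_cancel₀ h0, one_smul]
  refine ⟨?_, ?_, ?_, ?_, hscal, ?_, ?_⟩
  · rw [Finset.sum_comm]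
    have hadd : ∀ x y : Tors n,
        (∑ i, ∑ j, G (R (e i) X (commPhi φ (x + y) (φ (e j)) (e i))) (e j)) =
        (∑ i, ∑ j, G (R (e i) X (commPhi φ x (φ (e j)) (e i))) (e j)) +
        ∑ i, ∑ j, G (R (e i) X (commPhi φ y (φ (e j)) (e i))) (e j) := by
      intro x y
      simp only [← Finset.sum_add_distrib]
      refine Finset.sum_congr rfl fun i _ => Finset.sum_congr rfl fun j _ => ?_
      simp only [commPhi, LinearMap.add_apply, map_add, map_sub, sub_apply, add_apply]
      ring
    rw [hξ]
    simp only [hadd]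
    -- The eigenvalues `2, -2, -2, -1, 1, 0` give the factors `-1, 1, 1, ½, -½, 0`. The halves are
    -- absorbed by `curvTors_mixed`.
    rw [sum_curv_commPhi_of_mem_eigPart hR h.symm he ha.1.1.1 ha.2,
      sum_curv_commPhi_of_mem_eigPart hR h.symm he hb'.1.1.1 hb'.2,
      sum_curv_commPhi_of_mem_eigPart hR h.symm he hc'.1.1.1 hc'.2,
      sum_curv_commPhi_of_mem_eigPart hR h.symm he hm.1.1.1 hm.2,
      sum_curv_commPhi_of_mem_eigPart hR h.symm he hk.1.1.1 hk.2,
      sum_curv_commPhi_of_mem_eigPart hR h.symm he hv.1.1 (vertical_mem_eigPart h hv),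
      curvTors_mixed h he hR hm.1, curvTors_mixed h he hR hk.1]
    ring
  · rw [hz, ← curvTors_vertical h he hv, hξ]
    simp only [curvTors_add]
    rw [curvTors_mixed h he hR hm.1, curvTors_mixed h he hR hk.1]
  · rw [hz, ← curvReeb_vertical h he hv, hξ]
    simp only [curvReeb_add, curvReeb_horizontal ha.1, curvReeb_horizontal hb'.1,
      curvReeb_horizontal hc'.1]
    ring
  · rw [hξ]
    simp only [codiffVec_add, map_add, eta_codiffVec_horizontal h he ha.1,
      eta_codiffVec_horizontal h he hb'.1, eta_codiffVec_horizontal h he hc'.1,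
      eta_codiffVec_anti h he hk, eta_codiffVec_vertical h he hv]
    ring
  -- For `n = 1` both sides vanish, the left one by `C4_eq_zero`.
  · by_cases h0 : (n : ℝ) - 1 = 0
    · rw [h0]
      simp [curvTors, C4_eq_zero h he h0 hc]
    · rw [hraw, smul_smul, inv_mul_cancel₀ h0, one_smul, curvTors_C4 h he hR hcθ]
  · rw [hscal, hraw, trace_C4 h he hθ hcθ]

end TypeAlgebra

/-! ### Linear connections on trivial vector bundles -/

section Connection

variable {P V : Type*} [NormedAddCommGroup P] [NormedSpace ℝ P] [NormedAddCommGroup V]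
  [NormedSpace ℝ V]

/-- The curvature of the connection `D + κ` on a trivial bundle over `P` with fibre `V`. -/
def connCurv (κ : P → P →L[ℝ] V →L[ℝ] V) (p w w' : P) : V →L[ℝ] V :=
  fderiv ℝ κ p w w' - fderiv ℝ κ p w' w + κ p w * κ p w' - κ p w' * κ p w

theorem fderiv_fderiv_comm {W : Type*} [NormedAddCommGroup W] [NormedSpace ℝ W] {f : P → W}
    {p : P} (hf : ContDiffAt ℝ 2 f p) (w w' : P) :
    fderiv ℝ (fun q => fderiv ℝ f q w') p w = fderiv ℝ (fun q => fderiv ℝ f q w) p w' := by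
  have h1 : DifferentiableAt ℝ (fderiv ℝ f) p :=
    (hf.fderiv_right (m := 1) (by norm_num)).differentiableAt one_ne_zero
  have h2 : ∀ u v, fderiv ℝ (fun q => fderiv ℝ f q u) p v = fderiv ℝ (fderiv ℝ f) p v u := by
    intro u v
    rw [fderiv_clm_apply h1 (differentiableAt_const u)]
    simp
  rw [h2, h2]
  exact (hf.isSymmSndFDerivAt (by simp)).eq w w'

theorem fderiv_apply_const {W : Type*} [NormedAddCommGroup W] [NormedSpace ℝ W]
    {f : P → V →L[ℝ] W} {p : P} (hf : DifferentiableAt ℝ f p) (v : V) (w : P) :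
    fderiv ℝ (fun q => f q v) p w = fderiv ℝ f p w v := by
  rw [fderiv_clm_apply hf (differentiableAt_const v)]
  simp

theorem fderiv_mul_apply {f g : P → V →L[ℝ] V} {p : P} (hf : DifferentiableAt ℝ f p)
    (hg : DifferentiableAt ℝ g p) (w : P) :
    fderiv ℝ (fun q => f q * g q) p w = fderiv ℝ f p w * g p + f p * fderiv ℝ g p w := by
  have := (hf.hasFDerivAt.clm_comp hg.hasFDerivAt).fderiv
  have h2 : (fun q => f q * g q) = fun q => (f q).comp (g q) := rfl
  rw [h2, this]
  ext x
  simp [add_comm]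

theorem differentiableAt_mul {f g : P → V →L[ℝ] V} {p : P} (hf : DifferentiableAt ℝ f p)
    (hg : DifferentiableAt ℝ g p) : DifferentiableAt ℝ (fun q => f q * g q) p :=
  hf.clm_comp hg

theorem clm_mul_apply (f g : V →L[ℝ] V) (x : V) : (f * g) x = f (g x) := rfl

variable {κ τ : P → P →L[ℝ] V →L[ℝ] V} {p : P}

theorem connCurv_swap (w w' : P) : connCurv κ p w w' = -connCurv κ p w' w := by
  simp only [connCurv]; abel

/-- Differentiate `∇v = 0` once more and use the symmetry of second derivatives. The versions for
endomorphisms and for forms follow the same pattern. -/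
theorem connCurv_parallel_vec (hκ : DifferentiableAt ℝ κ p) {v : P → V} (hv : ContDiffAt ℝ 2 v p)
    (h : ∀ᶠ q in nhds p, ∀ w, fderiv ℝ v q w = -κ q w (v q)) (w w' : P) :
    connCurv κ p w w' (v p) = 0 := by
  have hp := h.self_of_nhds
  have h1 : ∀ u u', fderiv ℝ (fun q => fderiv ℝ v q u') p u =
      -(fderiv ℝ κ p u u' (v p)) + κ p u' (κ p u (v p)) := by
    intro u u'
    have h2 : (fun q => fderiv ℝ v q u') =ᶠ[nhds p] fun q => -κ q u' (v q) := by
      filter_upwards [h] with q hq using hq u'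
    have h3 : DifferentiableAt ℝ (fun q => κ q u') p := hκ.clm_apply (differentiableAt_const _)
    rw [h2.fderiv_eq, fderiv_fun_neg,
      fderiv_clm_apply h3 (hv.differentiableAt two_ne_zero)]
    simp only [neg_apply, add_apply, ContinuousLinearMap.comp_apply,
      ContinuousLinearMap.flip_apply, hp, map_neg, fderiv_apply_const hκ]
    abel
  have h2 := fderiv_fderiv_comm hv w w'
  rw [h1, h1] at h2
  simp only [connCurv, add_apply, sub_apply, clm_mul_apply]
  rw [← sub_eq_zero] at h2
  rw [← neg_eq_zero, ← h2]
  abel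

theorem connCurv_parallel_end (hκ : DifferentiableAt ℝ κ p) {A : P → V →L[ℝ] V}
    (hA : ContDiffAt ℝ 2 A p)
    (h : ∀ᶠ q in nhds p, ∀ w, fderiv ℝ A q w = A q * κ q w - κ q w * A q) (w w' : P) :
    connCurv κ p w w' * A p = A p * connCurv κ p w w' := by
  have hp := h.self_of_nhds
  have h1 : ∀ u u', fderiv ℝ (fun q => fderiv ℝ A q u') p u =
      (A p * κ p u - κ p u * A p) * κ p u' + A p * fderiv ℝ κ p u u'
      - (fderiv ℝ κ p u u' * A p + κ p u' * (A p * κ p u - κ p u * A p)) := by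
    intro u u'
    have h2 : (fun q => fderiv ℝ A q u') =ᶠ[nhds p] fun q => A q * κ q u' - κ q u' * A q := by
      filter_upwards [h] with q hq using hq u'
    have h3 : DifferentiableAt ℝ (fun q => κ q u') p := hκ.clm_apply (differentiableAt_const _)
    have h4 := hA.differentiableAt two_ne_zero
    rw [h2.fderiv_eq, fderiv_fun_sub (differentiableAt_mul h4 h3) (differentiableAt_mul h3 h4),
      sub_apply,
      fderiv_mul_apply h4 h3, fderiv_mul_apply h3 h4, hp, fderiv_apply_const hκ]
  have h2 := fderiv_fderiv_comm hA w w'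
  rw [h1, h1] at h2
  rw [← sub_eq_zero] at h2 ⊢
  rw [← neg_eq_zero, ← h2]
  simp only [connCurv]
  noncomm_ring

theorem connCurv_parallel_form (hκ : DifferentiableAt ℝ κ p) {G : P → V →L[ℝ] V →L[ℝ] ℝ}
    (hG : ContDiffAt ℝ 2 G p)
    (h : ∀ᶠ q in nhds p, ∀ w x y, fderiv ℝ G q w x y = G q (κ q w x) y + G q x (κ q w y))
    (w w' : P) (x y : V) :
    G p (connCurv κ p w w' x) y = -G p x (connCurv κ p w w' y) := by
  have hp := h.self_of_nhds
  have hGd := hG.differentiableAt two_ne_zero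
  have hf : ContDiffAt ℝ 2 (fun q => G q x y) p :=
    (hG.clm_apply contDiffAt_const).clm_apply contDiffAt_const
  have hfd : ∀ᶠ q in nhds p, ∀ w, fderiv ℝ (fun q => G q x y) q w =
      G q (κ q w x) y + G q x (κ q w y) := by
    have h5 : ∀ᶠ q in nhds p, DifferentiableAt ℝ G q :=
      (hG.eventually (by simp)).mono fun q hq => hq.differentiableAt two_ne_zero
    filter_upwards [h, h5] with q hq hq5 u
    rw [← hq, fderiv_apply_const (hq5.clm_apply (differentiableAt_const _)),
      fderiv_apply_const hq5]
  have h1 : ∀ u u', fderiv ℝ (fun q => fderiv ℝ (fun q => G q x y) q u') p u =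
      G p (κ p u (κ p u' x)) y + G p (κ p u' x) (κ p u y) + G p (fderiv ℝ κ p u u' x) y +
      (G p (κ p u x) (κ p u' y) + G p x (κ p u (κ p u' y)) + G p x (fderiv ℝ κ p u u' y)) := by
    intro u u'
    have h2 : (fun q => fderiv ℝ (fun q => G q x y) q u') =ᶠ[nhds p]
        fun q => G q (κ q u' x) y + G q x (κ q u' y) := by
      filter_upwards [hfd] with q hq using hq u'
    have h3 : ∀ z, DifferentiableAt ℝ (fun q => κ q u' z) p := fun z =>
      (hκ.clm_apply (differentiableAt_const _)).clm_apply (differentiableAt_const _)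
    have h4 : ∀ z, fderiv ℝ (fun q => κ q u' z) p u = fderiv ℝ κ p u u' z := fun z => by
      rw [fderiv_apply_const (hκ.clm_apply (differentiableAt_const _)), fderiv_apply_const hκ]
    have h5 : DifferentiableAt ℝ (fun q => G q (κ q u' x)) p := hGd.clm_apply (h3 x)
    have h6 : DifferentiableAt ℝ (fun q => G q x) p := hGd.clm_apply (differentiableAt_const _)
    rw [h2.fderiv_eq, fderiv_fun_add (h5.clm_apply (differentiableAt_const _))
      (h6.clm_apply (h3 y)), add_apply, fderiv_apply_const h5, fderiv_clm_apply hGd (h3 x),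
      fderiv_clm_apply h6 (h3 y)]
    simp only [add_apply, ContinuousLinearMap.comp_apply, ContinuousLinearMap.flip_apply, h4,
      fderiv_apply_const hGd, hp]
    ring
  have h2 := fderiv_fderiv_comm hf w w'
  rw [h1, h1] at h2
  simp only [connCurv, add_apply, sub_apply, clm_mul_apply, map_add, map_sub]
  linarith

/-- Cartan's formula: the curvature changes by the exterior covariant derivative of `τ` and by `[τ,
τ]`. For the torsion as `τ` it compares the minimal connection with the given one. -/
theorem connCurv_add (hκ : DifferentiableAt ℝ κ p) (hτ : DifferentiableAt ℝ τ p) (w w' : P) :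
    connCurv (fun q => κ q + τ q) p w w' = connCurv κ p w w'
      + (fderiv ℝ τ p w w' + (κ p w * τ p w' - τ p w' * κ p w))
      - (fderiv ℝ τ p w' w + (κ p w' * τ p w - τ p w * κ p w'))
      + (τ p w * τ p w' - τ p w' * τ p w) := by
  simp only [connCurv]
  have h1 : ∀ u u', fderiv ℝ (fun q => κ q + τ q) p u u' =
      fderiv ℝ κ p u u' + fderiv ℝ τ p u u' := by
    intro u u'
    have h2 : ∀ {θ : P → P →L[ℝ] V →L[ℝ] V}, DifferentiableAt ℝ θ p →
        DifferentiableAt ℝ (fun q => θ q u') p := fun h =>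
      h.clm_apply (differentiableAt_const _)
    have h3 : DifferentiableAt ℝ (fun q => κ q + τ q) p := by
      have h4 := DifferentiableAt.fun_add (𝕜 := ℝ) (E := P)
        (F := P →L[ℝ] V →L[ℝ] V) (f := κ) (g := τ) (x := p) hκ hτ
      exact h4
    rw [← fderiv_apply_const h3, ← fderiv_apply_const hκ, ← fderiv_apply_const hτ]
    simp only [add_apply]
    rw [fderiv_fun_add (h2 hκ) (h2 hτ), add_apply]
  simp only [h1]
  simp only [add_apply, mul_add, add_mul]
  abel

/-- The second Bianchi identity on constant fields. It needs only the symmetry of the second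
derivatives of `κ`, and no connection on the base. -/
theorem connCurv_bianchi (hκ : ContDiffAt ℝ 2 κ p) (u v w : P) :
    (fderiv ℝ (fun q => connCurv κ q v w) p u + (κ p u * connCurv κ p v w -
      connCurv κ p v w * κ p u)) +
    (fderiv ℝ (fun q => connCurv κ q w u) p v + (κ p v * connCurv κ p w u -
      connCurv κ p w u * κ p v)) +
    (fderiv ℝ (fun q => connCurv κ q u v) p w + (κ p w * connCurv κ p u v -
      connCurv κ p u v * κ p w)) = 0 := by
  have hd := hκ.differentiableAt two_ne_zero
  have h1 : DifferentiableAt ℝ (fderiv ℝ κ) p :=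
    (hκ.fderiv_right (m := 1) (by norm_num)).differentiableAt one_ne_zero
  have h2 : ∀ a b, DifferentiableAt ℝ (fun q => fderiv ℝ κ q a b) p := fun a b =>
    (h1.clm_apply (differentiableAt_const _)).clm_apply (differentiableAt_const _)
  have h3 : ∀ a, DifferentiableAt ℝ (fun q => κ q a) p := fun a =>
    hd.clm_apply (differentiableAt_const _)
  have h4 : ∀ a b c, fderiv ℝ (fun q => fderiv ℝ κ q a b) p c =
      fderiv ℝ (fun q => fderiv ℝ κ q a) p c b := fun a b c =>
    fderiv_apply_const (h1.clm_apply (differentiableAt_const _)) _ _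
  have h5 : ∀ a b c, fderiv ℝ (fun q => connCurv κ q a b) p c =
      fderiv ℝ (fun q => fderiv ℝ κ q a) p c b - fderiv ℝ (fun q => fderiv ℝ κ q b) p c a
      + (fderiv ℝ κ p c a * κ p b + κ p a * fderiv ℝ κ p c b)
      - (fderiv ℝ κ p c b * κ p a + κ p b * fderiv ℝ κ p c a) := by
    intro a b c
    simp only [connCurv]
    rw [fderiv_fun_sub (((h2 a b).fun_sub (h2 b a)).fun_add (differentiableAt_mul (h3 a) (h3 b)))
      (differentiableAt_mul (h3 b) (h3 a)),
      fderiv_fun_add ((h2 a b).fun_sub (h2 b a)) (differentiableAt_mul (h3 a) (h3 b)),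
      fderiv_fun_sub (h2 a b) (h2 b a)]
    simp only [add_apply, sub_apply]
    rw [fderiv_mul_apply (h3 a) (h3 b), fderiv_mul_apply (h3 b) (h3 a), h4, h4,
      fderiv_apply_const hd, fderiv_apply_const hd]
  simp only [h5]
  rw [fderiv_fderiv_comm hκ v u, fderiv_fderiv_comm hκ w v, fderiv_fderiv_comm hκ w u]
  simp only [connCurv]
  noncomm_ring

/-- The curvature of a pulled-back connection. -/
theorem connCurv_pullback {E : Type*} [NormedAddCommGroup E] [NormedSpace ℝ E]
    {θ : E → E →L[ℝ] V →L[ℝ] V} {f : P → E} (hf : ContDiffAt ℝ 2 f p)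
    (hθ : DifferentiableAt ℝ θ (f p)) (w w' : P) :
    connCurv (fun q => (θ (f q)).comp (fderiv ℝ f q)) p w w' =
      connCurv θ (f p) (fderiv ℝ f p w) (fderiv ℝ f p w') := by
  have hfd := hf.differentiableAt two_ne_zero
  have h1 : DifferentiableAt ℝ (fderiv ℝ f) p :=
    (hf.fderiv_right (m := 1) (by norm_num)).differentiableAt one_ne_zero
  have h2 : DifferentiableAt ℝ (fun q => θ (f q)) p :=
    DifferentiableAt.comp (G := E →L[ℝ] V →L[ℝ] V) p hθ hfd
  have h3 : ∀ u u', fderiv ℝ (fun q => (θ (f q)).comp (fderiv ℝ f q)) p u u' =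
      fderiv ℝ θ (f p) (fderiv ℝ f p u) (fderiv ℝ f p u') +
        θ (f p) (fderiv ℝ (fun q => fderiv ℝ f q u') p u) := by
    intro u u'
    have h4 : fderiv ℝ (fun q => θ (f q)) p = (fderiv ℝ θ (f p)).comp (fderiv ℝ f p) :=
      (HasFDerivAt.comp (G := E →L[ℝ] V →L[ℝ] V) p hθ.hasFDerivAt hfd.hasFDerivAt).fderiv
    rw [(h2.hasFDerivAt.clm_comp h1.hasFDerivAt).fderiv, h4, fderiv_apply_const h1]
    simp [add_comm]
  simp only [connCurv, h3, ContinuousLinearMap.comp_apply]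
  rw [fderiv_fderiv_comm hf w w']
  abel

end Connection

/-! ### First derivatives of an almost contact metric structure -/

/-- The identities satisfied by the covariant derivatives `N` and `u` of the endomorphism `A` and
the vector `v` of an almost contact metric structure. -/
structure IsACMDeriv {n : ℕ} (G : Form n) (A : Model n →L[ℝ] Model n) (v : Model n)
    (N : Model n →L[ℝ] Model n) (u : Model n) : Prop where
  unit : G u v = 0
  sq : ∀ X, N (A X) + A (N X) = G u X • v + G v X • u
  skew : ∀ X Y, G (N X) Y = -G X (N Y)
  vec : N v + A u = 0

/-- The component in the complement `𝔪` of the stabiliser algebra of `(A, v)`. -/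
def vertEnd {n : ℕ} (G : Form n) (A : Model n →L[ℝ] Model n) (v : Model n)
    (N : Model n →L[ℝ] Model n) (u Y : Model n) : Model n :=
  (1 / 2 : ℝ) • A (N Y) - G u Y • v + (1 / 2 : ℝ) • G v Y • u

/-- The complement `𝔪` of the stabiliser algebra of `(A, v)` in `𝔰𝔬(2n+1)`. -/
structure IsComplEnd {n : ℕ} (G : Form n) (A : Model n →L[ℝ] Model n) (v : Model n)
    (a : Model n → Model n) : Prop where
  skew : ∀ X Y, G (a X) Y = -G X (a Y)
  comm : ∀ Y, A (a Y) + a (A Y) = G v Y • A (a v) + G v (a (A Y)) • v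

section Vert

variable {n : ℕ} {G : Form n} {A : Model n →L[ℝ] Model n} {v : Model n}
  {N : Model n →L[ℝ] Model n} {u : Model n}

theorem IsACMDeriv.inner_vec (h : IsACM G A v) (d : IsACMDeriv G A v N u) (X : Model n) :
    G v (N X) = -G u (A X) := by
  have h1 := d.skew v X
  rw [eq_neg_of_add_eq_zero_left d.vec, map_neg, neg_apply, h.skew] at h1
  linarith

theorem IsACMDeriv.vertEnd_vec (h : IsACM G A v) (d : IsACMDeriv G A v N u) :
    vertEnd G A v N u v = u := by
  have h1 : G v u = 0 := by rw [h.symm, d.unit]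
  simp only [vertEnd, eq_neg_of_add_eq_zero_left d.vec, map_neg, h.sq, d.unit, h.unit, h1]
  module

theorem IsACMDeriv.phi_vertEnd (h : IsACM G A v) (d : IsACMDeriv G A v N u) (X : Model n) :
    A (vertEnd G A v N u X) =
      -(1 / 2 : ℝ) • N X - (1 / 2 : ℝ) • G u (A X) • v + (1 / 2 : ℝ) • G v X • A u := by
  simp only [vertEnd, map_add, map_sub, map_smul, h.sq, h.phi_zeta, d.inner_vec h]
  module

theorem IsACMDeriv.vertEnd_phi (h : IsACM G A v) (d : IsACMDeriv G A v N u) (X : Model n) :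
    vertEnd G A v N u (A X) =
      (1 / 2 : ℝ) • N X - (1 / 2 : ℝ) • G u (A X) • v + (1 / 2 : ℝ) • G v X • A u := by
  have h1 : A (N (A X)) = N X + G u (A X) • v + G v X • A u := by
    rw [eq_sub_of_add_eq (d.sq X), map_sub, map_add, map_smul, map_smul, h.sq, h.phi_zeta,
      d.inner_vec h]
    module
  simp only [vertEnd, h1, h.eta_phi]
  module

/-- Together with `vertEnd_vec` and `isComplEnd` this identifies `vertEnd` as the element of `𝔪`
that induces the derivatives `N` and `u` of the structure. -/
theorem IsACMDeriv.vertEnd_comm (h : IsACM G A v) (d : IsACMDeriv G A v N u) (X : Model n) :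
    vertEnd G A v N u (A X) - A (vertEnd G A v N u X) = N X := by
  rw [d.vertEnd_phi h, d.phi_vertEnd h]
  module

theorem IsACMDeriv.vertEnd_skew (h : IsACM G A v) (d : IsACMDeriv G A v N u) (X Y : Model n) :
    G (vertEnd G A v N u X) Y = -G X (vertEnd G A v N u Y) := by
  have h1 : G (A (N X)) Y + G (N (A X)) Y = G u X * G v Y + G v X * G u Y := by
    have := congrArg (fun x => G x Y) (d.sq X)
    simp only [map_add, map_smul, add_apply, smul_apply, smul_eq_mul] at this
    linarith
  have h2 : G X (A (N Y)) = G (N (A X)) Y := by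
    rw [d.skew, h.skew]; ring
  simp only [vertEnd, map_add, map_sub, map_smul, add_apply, sub_apply, smul_apply, smul_eq_mul,
    h2, h.symm X v, h.symm X u]
  linarith

theorem IsACMDeriv.isComplEnd (h : IsACM G A v) (d : IsACMDeriv G A v N u) :
    IsComplEnd G A v (vertEnd G A v N u) := by
  refine ⟨d.vertEnd_skew h, fun Y => ?_⟩
  have h1 : G v u = 0 := by rw [h.symm, d.unit]
  rw [d.vertEnd_vec h, d.vertEnd_phi h, d.phi_vertEnd h]
  simp only [map_add, map_sub, map_smul, smul_eq_mul, h.eta_phi, h.unit, d.inner_vec h]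
  module

/-- Endomorphisms in the stabiliser algebra are orthogonal to its complement. -/
theorem IsComplEnd.sum_inner_eq_zero {e : Fin (2 * n + 1) → Model n} (h : IsACM G A v)
    (he : IsOrtho G e) {a : Model n →ₗ[ℝ] Model n} (ha : IsComplEnd G A v a)
    {E : Model n →ₗ[ℝ] Model n} (hE : ∀ X Y, G (E X) Y = -G X (E Y))
    (hEA : ∀ X, E (A X) = A (E X)) (hEv : E v = 0) : ∑ i, G (E (e i)) (a (e i)) = 0 := by
  have hEη : ∀ X, G v (E X) = 0 := fun X => by
    have := hE v X
    rw [hEv] at this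
    simpa using this.symm
  have hb : IsBilin fun x y => G (E x) (a y) :=
    ⟨by simp, by simp, by simp, by simp⟩
  -- The sum over `A e_i` equals the sum over `e_i`, because `E v = 0`. As `E` commutes and `a`
  -- anticommutes with `A` up to terms at `v`, it also equals its negative.
  have h1 := he.sum_phi_phi h hb
  simp only [hEv, map_zero, zero_apply, sub_zero] at h1
  have h2 : ∀ x, G (E (A x)) (a (A x)) = -G (E x) (a x) + G v x * G (E x) (a v) := by
    intro x
    have h3 : a (A x) = G v x • A (a v) + G v (a (A x)) • v - A (a x) :=
      eq_sub_of_add_eq' (ha.comm x)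
    have h4 : G v (a v) = 0 := by
      have := ha.skew v v; rw [h.symm (a v)] at this; linarith
    have h5 : G (E (A x)) v = 0 := by rw [h.symm, hEη]
    rw [h3, hEA, map_sub, map_add, map_smul, map_smul, h.compat, h.compat, ← hEA, h5, hEη]
    simp
    ring
  simp only [h2, Finset.sum_add_distrib, Finset.sum_neg_distrib] at h1
  have h6 := he.sum_smul (fun x => G (E x) (a v)) (by simp) (by simp) v
  simp only [smul_eq_mul, hEv, map_zero, zero_apply] at h6
  have h7 : ∑ i, G v (e i) * G (E (e i)) (a v) = 0 := by
    rw [← h6]; exact Finset.sum_congr rfl fun i _ => by rw [h.symm v]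
  rw [h7] at h1
  linarith

/-- An element of the complement is determined by its action on the structure. -/
theorem IsComplEnd.vertEnd_eq (h : IsACM G A v) {a : Model n →ₗ[ℝ] Model n}
    (ha : IsComplEnd G A v a) {N : Model n →L[ℝ] Model n} (hN : ∀ X, N X = a (A X) - A (a X))
    (Y : Model n) : vertEnd G A v N (a v) Y = a Y := by
  have h4 : G v (a v) = 0 := by
    have := ha.skew v v; rw [h.symm (a v)] at this; linarith
  have h1 : A (a (A Y)) = a Y - G v (a Y) • v - G v Y • a v := by
    rw [eq_sub_of_add_eq' (ha.comm Y)]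
    simp only [map_sub, map_add, map_smul, h.sq, h.phi_zeta, h4]
    module
  have h2 : G (a v) Y = -G v (a Y) := ha.skew v Y
  simp only [vertEnd, hN, map_sub, h1, h2, h.sq]
  module

end Vert

/-! ### Metric connections and almost contact metric structures along a map -/

/-- A bilinear map on finite-dimensional spaces as a continuous one. -/
def toCLM₂ {P V W : Type*} [NormedAddCommGroup P] [NormedSpace ℝ P] [FiniteDimensional ℝ P]
    [NormedAddCommGroup V] [NormedSpace ℝ V] [FiniteDimensional ℝ V] [NormedAddCommGroup W]
    [NormedSpace ℝ W] (B : P →ₗ[ℝ] V →ₗ[ℝ] W) : P →L[ℝ] V →L[ℝ] W :=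
  LinearMap.toContinuousLinearMap (LinearMap.toContinuousLinearMap.toLinearMap ∘ₗ B)

@[simp] theorem toCLM₂_apply {P V W : Type*} [NormedAddCommGroup P] [NormedSpace ℝ P]
    [FiniteDimensional ℝ P] [NormedAddCommGroup V] [NormedSpace ℝ V] [FiniteDimensional ℝ V]
    [NormedAddCommGroup W] [NormedSpace ℝ W] (B : P →ₗ[ℝ] V →ₗ[ℝ] W) (w : P) (x : V) :
    toCLM₂ B w x = B w x := rfl

theorem two_le_infty : (2 : WithTop ℕ∞) ≤ ∞ := WithTop.coe_le_coe.mpr le_top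

theorem one_le_infty : (1 : WithTop ℕ∞) ≤ ∞ := WithTop.coe_le_coe.mpr le_top

theorem contDiffOn_clm₂ {P V W X : Type*} [NormedAddCommGroup P] [NormedSpace ℝ P]
    [FiniteDimensional ℝ P] [NormedAddCommGroup V] [NormedSpace ℝ V] [FiniteDimensional ℝ V]
    [NormedAddCommGroup W] [NormedSpace ℝ W] [NormedAddCommGroup X] [NormedSpace ℝ X]
    {k : WithTop ℕ∞} {s : Set X} {B : X → P →L[ℝ] V →L[ℝ] W}
    (h : ∀ w x, ContDiffOn ℝ k (fun z => B z w x) s) : ContDiffOn ℝ k B s :=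
  contDiffOn_clm_apply.mpr fun w => contDiffOn_clm_apply.mpr fun x => h w x

section Connection

variable {n : ℕ} {P : Type*} [NormedAddCommGroup P] [NormedSpace ℝ P]
  (κ : P → P →L[ℝ] Model n →L[ℝ] Model n) (G : P → Form n) (A : P → Model n →L[ℝ] Model n)
  (v : P → Model n)

/-- The covariant derivative of the endomorphism field `A`. -/
def covE (p w : P) : Model n →L[ℝ] Model n := fderiv ℝ A p w + κ p w * A p - A p * κ p w

/-- The covariant derivative of the vector field `v`. -/
def covV (p w : P) : Model n := fderiv ℝ v p w + κ p w (v p)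

/-- A metric connection on the trivial bundle over `Ω` with fibre `ℝ^{2n+1}`, and an almost contact
metric structure on this bundle. -/
structure IsMetricConn (Ω : Set P) : Prop where
  isOpen : IsOpen Ω
  smooth_conn : ContDiffOn ℝ ∞ κ Ω
  smooth_metric : ContDiffOn ℝ ∞ G Ω
  smooth_end : ContDiffOn ℝ ∞ A Ω
  smooth_vec : ContDiffOn ℝ ∞ v Ω
  isACM : ∀ p ∈ Ω, IsACM (G p) (A p) (v p)
  metric : ∀ p ∈ Ω, ∀ w X Y, fderiv ℝ G p w X Y = G p (κ p w X) Y + G p X (κ p w Y)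

/-- The intrinsic torsion of the almost contact metric structure `(G, A, v)` with respect to the
connection `κ`. -/
def torsLin (p : P) : P →ₗ[ℝ] Model n →ₗ[ℝ] Model n :=
  LinearMap.mk₂ ℝ (fun w Y => -vertEnd (G p) (A p) (v p) (covE κ A p w) (covV κ v p w) Y)
    (by
      intro w w' Y
      simp only [vertEnd, covE, covV, map_add, add_apply, sub_apply, clm_mul_apply, map_sub]
      module)
    (by
      intro c w Y
      simp only [vertEnd, covE, covV, map_smul, smul_apply, add_apply, sub_apply, clm_mul_apply,
        map_add, map_sub, smul_eq_mul]
      module)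
    (by
      intro w Y Y'
      simp only [vertEnd, map_add]
      module)
    (by
      intro c w Y
      simp only [vertEnd, map_smul, smul_eq_mul]
      module)

/-- The bundled form of `torsLin`. -/
def tors [FiniteDimensional ℝ P] (p : P) : P →L[ℝ] Model n →L[ℝ] Model n :=
  toCLM₂ (torsLin κ G A v p)

variable {κ G A v} {Ω : Set P}

namespace IsMetricConn

/-- These are the covariant derivatives of `|v|² = 1`, of the formula for `A²`, of the skewness of
`A` and of `A v = 0`. -/
theorem deriv (h : IsMetricConn κ G A v Ω) {p : P} (hp : p ∈ Ω) (w : P) :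
    IsACMDeriv (G p) (A p) (v p) (covE κ A p w) (covV κ v p w) := by
  have hΩ := h.isOpen.mem_nhds hp
  have hG : DifferentiableAt ℝ G p :=
    (h.smooth_metric.contDiffAt hΩ).differentiableAt (by simp)
  have hA : DifferentiableAt ℝ A p := (h.smooth_end.contDiffAt hΩ).differentiableAt (by simp)
  have hv : DifferentiableAt ℝ v p := (h.smooth_vec.contDiffAt hΩ).differentiableAt (by simp)
  have hm := h.metric p hp w
  have acm := h.isACM p hp
  have dG : ∀ {V W : P → Model n}, DifferentiableAt ℝ V p → DifferentiableAt ℝ W p →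
      fderiv ℝ (fun q => G q (V q) (W q)) p w =
        G p (fderiv ℝ V p w + κ p w (V p)) (W p) + G p (V p) (fderiv ℝ W p w + κ p w (W p)) := by
    intro V W hV hW
    rw [fderiv_clm_apply (hG.clm_apply hV) hW]
    simp only [add_apply, ContinuousLinearMap.comp_apply, ContinuousLinearMap.flip_apply,
      fderiv_clm_apply hG hV, hm, map_add]
    ring
  have dA : ∀ {V : P → Model n}, DifferentiableAt ℝ V p →
      fderiv ℝ (fun q => A q (V q)) p w = fderiv ℝ A p w (V p) + A p (fderiv ℝ V p w) := by
    intro V hV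
    rw [fderiv_clm_apply hA hV]
    simp [add_comm]
  have hc : ∀ X : Model n, DifferentiableAt ℝ (fun _ : P => X) p := fun X =>
    differentiableAt_const X
  have hAc : ∀ X : Model n, DifferentiableAt ℝ (fun q => A q X) p := fun X =>
    hA.clm_apply (hc X)
  refine ⟨?_, fun X => ?_, fun X Y => ?_, ?_⟩
  · have h1 : (fun q => G q (v q) (v q)) =ᶠ[nhds p] fun _ => (1 : ℝ) := by
      filter_upwards [hΩ] with q hq using (h.isACM q hq).unit
    have h2 := dG hv hv
    rw [h1.fderiv_eq, acm.symm (v p)] at h2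
    simp only [fderiv_fun_const, Pi.zero_apply, zero_apply] at h2
    simp only [covV]
    linarith
  · have h1 : (fun q => A q (A q X)) =ᶠ[nhds p] fun q => -X + G q (v q) X • v q := by
      filter_upwards [hΩ] with q hq using (h.isACM q hq).sq X
    have h2 := dA (hAc X)
    have h3 : DifferentiableAt ℝ (fun q => G q (v q) X) p := (hG.clm_apply hv).clm_apply (hc X)
    rw [h1.fderiv_eq, fderiv_fun_add (hc _) (h3.fun_smul hv), fderiv_fun_smul h3 hv,
      dA (hc X)] at h2
    simp only [add_apply, smul_apply, ContinuousLinearMap.smulRight_apply, dG hv (hc X),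
      fderiv_fun_const, Pi.zero_apply, zero_apply, map_zero, add_zero, zero_add] at h2
    simp only [covE, covV, add_apply, sub_apply, clm_mul_apply, map_add, map_sub, smul_add,
      add_smul] at h2 ⊢
    have h4 := acm.sq (κ p w X)
    have h5 := congrArg (κ p w) (acm.sq X)
    rw [map_add, map_neg, map_smul] at h5
    rw [h4, h5]
    linear_combination (norm := module) -h2
  · have h1 : (fun q => G q (A q X) Y) =ᶠ[nhds p] fun q => -G q X (A q Y) := by
      filter_upwards [hΩ] with q hq using (h.isACM q hq).skew X Y
    have h2 := dG (hAc X) (hc Y)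
    rw [h1.fderiv_eq, fderiv_fun_neg, neg_apply, dG (hc X) (hAc Y), dA (hc X), dA (hc Y)] at h2
    simp only [fderiv_fun_const, Pi.zero_apply, zero_apply, map_zero, add_zero, zero_add] at h2
    have h3 := acm.skew (κ p w X) Y
    have h4 := acm.skew X (κ p w Y)
    simp only [covE, add_apply, sub_apply, clm_mul_apply, map_add, map_sub] at h2 ⊢
    linarith
  · have h1 : (fun q => A q (v q)) =ᶠ[nhds p] fun _ => 0 := by
      filter_upwards [hΩ] with q hq using (h.isACM q hq).phi_zeta
    have h2 := dA hv
    rw [h1.fderiv_eq] at h2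
    simp only [fderiv_fun_const, Pi.zero_apply, zero_apply] at h2
    simp only [covE, covV, add_apply, sub_apply, clm_mul_apply, map_add, acm.phi_zeta, map_zero]
    linear_combination (norm := module) -h2

theorem torsLin_isComplEnd (h : IsMetricConn κ G A v Ω) {p : P} (hp : p ∈ Ω) (w : P) :
    IsComplEnd (G p) (A p) (v p) (torsLin κ G A v p w) := by
  have := (h.deriv hp w).isComplEnd (h.isACM p hp)
  refine ⟨fun X Y => ?_, fun Y => ?_⟩
  · simp only [torsLin, LinearMap.mk₂_apply, map_neg, neg_apply, this.skew X Y]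
  · have h1 := congrArg Neg.neg (this.comm Y)
    simp only [torsLin, LinearMap.mk₂_apply, map_neg, smul_neg, neg_smul]
    rw [← neg_add, h1, neg_add]

theorem torsLin_vec (h : IsMetricConn κ G A v Ω) {p : P} (hp : p ∈ Ω) (w : P) :
    torsLin κ G A v p w (v p) = -covV κ v p w := by
  simp only [torsLin, LinearMap.mk₂_apply, (h.deriv hp w).vertEnd_vec (h.isACM p hp)]

theorem covE_apply (h : IsMetricConn κ G A v Ω) {p : P} (hp : p ∈ Ω) (w : P) (Y : Model n) :
    covE κ A p w Y = A p (torsLin κ G A v p w Y) - torsLin κ G A v p w (A p Y) := by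
  rw [← (h.deriv hp w).vertEnd_comm (h.isACM p hp)]
  simp only [torsLin, LinearMap.mk₂_apply, map_neg]
  abel

variable [FiniteDimensional ℝ P]

theorem smooth_tors (h : IsMetricConn κ G A v Ω) : ContDiffOn ℝ ∞ (tors κ G A v) Ω := by
  refine contDiffOn_clm₂ fun w Y => ?_
  have h1 : ContDiffOn ℝ ∞ (fun q => fderiv ℝ A q w) Ω :=
    (h.smooth_end.fderiv_of_isOpen h.isOpen (by simp)).clm_apply contDiffOn_const
  have h2 : ContDiffOn ℝ ∞ (fun q => fderiv ℝ v q w) Ω :=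
    (h.smooth_vec.fderiv_of_isOpen h.isOpen (by simp)).clm_apply contDiffOn_const
  have h3 : ContDiffOn ℝ ∞ (fun q => κ q w) Ω := h.smooth_conn.clm_apply contDiffOn_const
  have h4 : ContDiffOn ℝ ∞ (fun q => covV κ v q w) Ω := by
    have := h3.clm_apply h.smooth_vec
    simp only [covV]
    exact ContDiffOn.add h2 this
  have h5 : ContDiffOn ℝ ∞ (fun q => covE κ A q w Y) Ω := by
    have h6 : ContDiffOn ℝ ∞ (fun q => fderiv ℝ A q w Y) Ω := h1.clm_apply contDiffOn_const
    have h7 : ContDiffOn ℝ ∞ (fun q => κ q w (A q Y)) Ω :=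
      h3.clm_apply (h.smooth_end.clm_apply contDiffOn_const)
    have h8 : ContDiffOn ℝ ∞ (fun q => A q (κ q w Y)) Ω :=
      h.smooth_end.clm_apply (h3.clm_apply contDiffOn_const)
    simp only [covE, add_apply, sub_apply, clm_mul_apply]
    exact ContDiffOn.sub (ContDiffOn.add h6 h7) h8
  have h6 : ContDiffOn ℝ ∞ (fun q => (1 / 2 : ℝ) • A q (covE κ A q w Y)) Ω :=
    (h.smooth_end.clm_apply h5).const_smul _
  have h7 : ContDiffOn ℝ ∞ (fun q => G q (covV κ v q w) Y) Ω :=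
    (h.smooth_metric.clm_apply h4).clm_apply contDiffOn_const
  have h8 : ContDiffOn ℝ ∞ (fun q => G q (v q) Y) Ω :=
    (h.smooth_metric.clm_apply h.smooth_vec).clm_apply contDiffOn_const
  have h9 : ContDiffOn ℝ ∞ (fun q => (1 / 2 : ℝ) • G q (v q) Y • covV κ v q w) Ω :=
    (h8.fun_smul h4).const_smul _
  simp only [tors, toCLM₂_apply, torsLin, LinearMap.mk₂_apply, vertEnd]
  exact ContDiffOn.neg (ContDiffOn.add (ContDiffOn.sub h6 (h7.fun_smul h.smooth_vec)) h9)

/-- The minimal connection preserves the structure. -/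
theorem fderiv_end (h : IsMetricConn κ G A v Ω) {p : P} (hp : p ∈ Ω) (w : P) :
    fderiv ℝ A p w = A p * (κ p w + tors κ G A v p w) - (κ p w + tors κ G A v p w) * A p := by
  ext1 Y
  have h1 := h.covE_apply hp w Y
  simp only [covE, add_apply, sub_apply, clm_mul_apply] at h1
  simp only [mul_add, add_mul, add_apply, sub_apply, clm_mul_apply, tors, toCLM₂_apply]
  linear_combination (norm := module) h1

theorem fderiv_vec (h : IsMetricConn κ G A v Ω) {p : P} (hp : p ∈ Ω) (w : P) :
    fderiv ℝ v p w = -(κ p w + tors κ G A v p w) (v p) := by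
  have h1 := h.torsLin_vec hp w
  simp only [covV] at h1
  simp only [add_apply, tors, toCLM₂_apply, h1]
  abel

theorem fderiv_metric (h : IsMetricConn κ G A v Ω) {p : P} (hp : p ∈ Ω) (w : P) (X Y : Model n) :
    fderiv ℝ G p w X Y = G p ((κ p w + tors κ G A v p w) X) Y
      + G p X ((κ p w + tors κ G A v p w) Y) := by
  have := (h.torsLin_isComplEnd hp w).skew X Y
  simp only [h.metric p hp, add_apply, map_add, tors, toCLM₂_apply, this]
  ring

/-- The minimal connection. -/
theorem smooth_minimal (h : IsMetricConn κ G A v Ω) :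
    ContDiffOn ℝ ∞ (fun q => κ q + tors κ G A v q) Ω := by
  refine contDiffOn_clm₂ fun w Y => ?_
  have h1 : ContDiffOn ℝ ∞ (fun q => κ q w Y) Ω :=
    (h.smooth_conn.clm_apply contDiffOn_const).clm_apply contDiffOn_const
  have h2 : ContDiffOn ℝ ∞ (fun q => tors κ G A v q w Y) Ω :=
    (h.smooth_tors.clm_apply contDiffOn_const).clm_apply contDiffOn_const
  exact ContDiffOn.add h1 h2

/-- The minimal connection makes `G`, `A` and `v` parallel, so its curvature lies in the stabiliser
algebra, which is orthogonal to `𝔪`. -/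
theorem sum_curv_minimal (h : IsMetricConn κ G A v Ω) {p : P} (hp : p ∈ Ω)
    {e : Fin (2 * n + 1) → Model n} (he : IsOrtho (G p) e) {a : Model n →ₗ[ℝ] Model n}
    (ha : IsComplEnd (G p) (A p) (v p) a) (w w' : P) :
    ∑ i, G p (connCurv (fun q => κ q + tors κ G A v q) p w w' (e i)) (a (e i)) = 0 := by
  have hΩ := h.isOpen.mem_nhds hp
  have h1 := (h.smooth_minimal.contDiffAt hΩ).differentiableAt (by simp)
  have h2 := connCurv_parallel_vec h1 ((h.smooth_vec.contDiffAt hΩ).of_le two_le_infty)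
    (by filter_upwards [hΩ] with q hq u using h.fderiv_vec hq u) w w'
  have h3 := connCurv_parallel_end h1 ((h.smooth_end.contDiffAt hΩ).of_le two_le_infty)
    (by filter_upwards [hΩ] with q hq u using h.fderiv_end hq u) w w'
  have h4 := connCurv_parallel_form h1 ((h.smooth_metric.contDiffAt hΩ).of_le two_le_infty)
    (by filter_upwards [hΩ] with q hq u using h.fderiv_metric hq u) w w'
  exact ha.sum_inner_eq_zero (h.isACM p hp) he
    (E := (connCurv (fun q => κ q + tors κ G A v q) p w w' : Model n →ₗ[ℝ] Model n)) h4
    (fun X => congrArg (fun f => f X) h3) h2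

end IsMetricConn

end Connection

/-! ### The Levi-Civita connection in a chart -/

namespace LocalData

variable {n : ℕ} (D : LocalData n) {U : Set (Model n)}

/-- `D` is a smooth almost contact metric structure on the open set `U`. -/
structure IsGood (U : Set (Model n)) : Prop where
  isOpen : IsOpen U
  smooth_g : ContDiffOn ℝ ∞ D.g U
  smooth_φ : ContDiffOn ℝ ∞ D.φ U
  smooth_ζ : ContDiffOn ℝ ∞ D.ζ U
  isACM : ∀ y ∈ U, IsACM (D.g y) (D.φ y) (D.ζ y)

/-- The Levi-Civita connection form. -/
def conn (y : Model n) : Model n →L[ℝ] Model n →L[ℝ] Model n := toCLM₂ (D.Γ y)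

/-- The curvature tensor as a trilinear map. -/
def curv (y : Model n) : Curv n :=
  LinearMap.mk₂ ℝ (fun X Y => ((-connCurv D.conn y X Y : Model n →L[ℝ] Model n) :
      Model n →ₗ[ℝ] Model n))
    (by intro X X' Y; ext1 Z; simp [connCurv]; abel)
    (by intro c X Y; ext1 Z; simp [connCurv, smul_sub, smul_add])
    (by intro X Y Y'; ext1 Z; simp [connCurv]; abel)
    (by intro c X Y; ext1 Z; simp [connCurv, smul_sub, smul_add])

variable {D}

namespace IsGood

variable (h : D.IsGood U) {y : Model n} (hy : y ∈ U)

include h hy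

theorem nhds_mem : U ∈ nhds y := h.isOpen.mem_nhds hy

theorem contDiffAt_g : ContDiffAt ℝ ∞ D.g y := h.smooth_g.contDiffAt (h.nhds_mem hy)

theorem inner_Γ (X Y Z : Model n) : D.g y (D.Γ y X Y) Z = D.koszul y X Y Z := by
  let α : Model n →ₗ[ℝ] ℝ :=
    { toFun := fun Z => D.koszul y X Y Z
      map_add' := fun Z Z' => by simp only [koszul, map_add, add_apply]; ring
      map_smul' := fun c Z => by
        simp only [koszul, map_smul, smul_apply, smul_eq_mul, RingHom.id_apply]; ring }
  exact inner_sharp (h.isACM y hy).symm (h.isACM y hy).pos α Z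

theorem fderiv_g_symm (Z X Y : Model n) : fderiv ℝ D.g y Z X Y = fderiv ℝ D.g y Z Y X := by
  have hd := (h.contDiffAt_g hy).differentiableAt (by simp)
  have h1 : ∀ X Y, fderiv ℝ (fun z => D.g z X Y) y Z = fderiv ℝ D.g y Z X Y := fun X Y => by
    rw [fderiv_apply_const (hd.clm_apply (differentiableAt_const _)), fderiv_apply_const hd]
  rw [← h1, ← h1]
  have h2 : (fun z => D.g z X Y) =ᶠ[nhds y] fun z => D.g z Y X := by
    filter_upwards [h.nhds_mem hy] with z hz using (h.isACM z hz).symm X Y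
  rw [h2.fderiv_eq]

theorem Γ_symm (X Y : Model n) : D.Γ y X Y = D.Γ y Y X := by
  refine ext_inner (h.isACM y hy).pos fun Z => ?_
  rw [h.inner_Γ hy, h.inner_Γ hy]
  simp only [koszul, h.fderiv_g_symm hy Z X Y]
  ring

theorem fderiv_g (Z X Y : Model n) :
    fderiv ℝ D.g y Z X Y = D.g y (D.Γ y Z X) Y + D.g y X (D.Γ y Z Y) := by
  rw [(h.isACM y hy).symm X, h.inner_Γ hy, h.inner_Γ hy]
  simp only [koszul, h.fderiv_g_symm hy Z Y X]
  ring

omit hy in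
theorem smooth_conn : ContDiffOn ℝ ∞ D.conn U := by
  refine contDiffOn_clm₂ fun X Y => ?_
  have hg := h.smooth_g.fderiv_of_isOpen (m := ∞) h.isOpen (by simp)
  have h1 : ∀ X Y Z : Model n, ContDiffOn ℝ ∞ (fun z => fderiv ℝ D.g z X Y Z) U := fun X Y Z =>
    ((hg.clm_apply contDiffOn_const).clm_apply contDiffOn_const).clm_apply contDiffOn_const
  have h2 : ∀ a b : Model n, ContDiffOn ℝ ∞ (fun z => D.koszul z X Y a • b) U := fun a b => by
    refine ContDiffOn.fun_smul ?_ contDiffOn_const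
    simp only [koszul]
    exact ((((h1 _ _ _).add (h1 _ _ _)).sub (h1 _ _ _)).div_const 2)
  intro y hy
  exact (contDiffAt_contract (h.contDiffAt_g hy) (h.isACM y hy).symm (h.isACM y hy).pos
    fun a b => (h2 a b).contDiffAt (h.nhds_mem hy)).contDiffWithinAt

omit hy in
theorem isMetricConn : IsMetricConn D.conn D.g D.φ D.ζ U :=
  ⟨h.isOpen, h.smooth_conn, h.smooth_g, h.smooth_φ, h.smooth_ζ, h.isACM,
    fun _ hy => h.fderiv_g hy⟩

theorem differentiableAt_conn : DifferentiableAt ℝ D.conn y :=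
  (h.smooth_conn.contDiffAt (h.nhds_mem hy)).differentiableAt (by simp)

theorem fderiv_Γ (X Y Z : Model n) :
    fderiv ℝ (fun z => D.Γ z Y Z) y X = fderiv ℝ D.conn y X Y Z := by
  have hd := h.differentiableAt_conn hy
  rw [← fderiv_apply_const hd, ← fderiv_apply_const (hd.clm_apply (differentiableAt_const _))]
  rfl

theorem R_eq (X Y Z : Model n) : D.R y X Y Z = D.curv y X Y Z := by
  simp only [R, h.fderiv_Γ hy]
  rfl

theorem isCurv : IsCurv (D.g y) (D.curv y) := by
  have hd := h.differentiableAt_conn hy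
  have hU := h.nhds_mem hy
  refine ⟨fun X Y Z => ?_, fun X Y Z V => ?_, fun X Y Z => ?_⟩
  · have := congrArg (fun f => f Z) (connCurv_swap (κ := D.conn) (p := y) X Y)
    simp only [curv, LinearMap.mk₂_apply]
    simpa using congrArg Neg.neg this
  · have := connCurv_parallel_form hd ((h.contDiffAt_g hy).of_le two_le_infty)
      (by filter_upwards [hU] with q hq u using h.fderiv_g hq u) X Y Z V
    simp only [curv, LinearMap.mk₂_apply, ContinuousLinearMap.coe_coe, neg_apply, map_neg, this]
    rw [(h.isACM y hy).symm]
  · have hs : ∀ X Y Z, fderiv ℝ D.conn y X Y Z = fderiv ℝ D.conn y X Z Y := fun X Y Z => by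
      rw [← h.fderiv_Γ hy, ← h.fderiv_Γ hy]
      have h2 : (fun z => D.Γ z Y Z) =ᶠ[nhds y] fun z => D.Γ z Z Y := by
        filter_upwards [hU] with z hz using h.Γ_symm hz Y Z
      rw [h2.fderiv_eq]
    have hc : ∀ X Y, D.conn y X Y = D.conn y Y X := h.Γ_symm hy
    simp only [curv, LinearMap.mk₂_apply, ContinuousLinearMap.coe_coe, neg_apply, connCurv,
      add_apply, sub_apply, clm_mul_apply]
    rw [hs Y Z X, hs Z X Y, hs X Z Y, hc Y Z, hc Z X, hc Y X]
    abel

/-! #### The intrinsic torsion -/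

omit h hy in
omit h hy in
omit h hy in
theorem torsLin_conn : torsLin D.conn D.g D.φ D.ζ y = D.ξ y := by
  ext1 X; ext1 Y
  simp only [torsLin, ξ, LinearMap.mk₂_apply, vertEnd]
  change -((1 / 2 : ℝ) • D.φ y (D.nablaPhi y X Y) - D.g y (D.nablaZeta y X) Y • D.ζ y +
    (1 / 2 : ℝ) • D.eta y Y • D.nablaZeta y X) = _
  module

theorem ξ_isComplEnd (X : Model n) : IsComplEnd (D.g y) (D.φ y) (D.ζ y) (D.ξ y X) := by
  rw [← torsLin_conn]
  exact h.isMetricConn.torsLin_isComplEnd hy X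

theorem ξ_mem : D.ξ y ∈ torsionSpace (D.g y) (D.φ y) (D.ζ y) :=
  ⟨fun X => (h.ξ_isComplEnd hy X).skew, fun X => (h.ξ_isComplEnd hy X).comm⟩

theorem nablaZeta_eq (X : Model n) : D.nablaZeta y X = -D.ξ y X (D.ζ y) := by
  have := h.isMetricConn.torsLin_vec hy X
  rw [torsLin_conn] at this
  rw [this, neg_neg]; rfl

theorem nablaPhi_eq (X Y : Model n) : D.nablaPhi y X Y = commPhi (D.φ y) (D.ξ y) X Y := by
  have := h.isMetricConn.covE_apply hy X Y
  rw [torsLin_conn] at this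
  exact this

/-- The bundled intrinsic torsion. -/
def _root_.AlmostContact.LocalData.torsion (D : LocalData n) (y : Model n) :
    Model n →L[ℝ] Model n →L[ℝ] Model n := toCLM₂ (D.ξ y)

omit h hy in
theorem tors_conn : tors D.conn D.g D.φ D.ζ y = D.torsion y := by
  rw [tors, torsLin_conn, torsion]

omit hy in
theorem smooth_torsion : ContDiffOn ℝ ∞ D.torsion U := by
  have := h.isMetricConn.smooth_tors
  rwa [show tors D.conn D.g D.φ D.ζ = D.torsion from funext fun y => tors_conn] at this

theorem differentiableAt_torsion : DifferentiableAt ℝ D.torsion y :=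
  (h.smooth_torsion.contDiffAt (h.nhds_mem hy)).differentiableAt (by simp)

theorem differentiableAt_φ : DifferentiableAt ℝ D.φ y :=
  (h.smooth_φ.contDiffAt (h.nhds_mem hy)).differentiableAt (by simp)

theorem differentiableAt_ζ : DifferentiableAt ℝ D.ζ y :=
  (h.smooth_ζ.contDiffAt (h.nhds_mem hy)).differentiableAt (by simp)

theorem differentiableAt_g : DifferentiableAt ℝ D.g y :=
  (h.contDiffAt_g hy).differentiableAt (by simp)

end IsGood

end LocalData

/-! ### Orthonormal-frame formulas, coderivatives and the derivative of the curvature. -/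

namespace LocalData

variable {n : ℕ} {D : LocalData n} {U : Set (Model n)} {y : Model n}
  {e : Fin (2 * n + 1) → Model n}

/-- The `*`-Ricci tensor as a bilinear form, built from the trilinear curvature. -/
def ricStarForm (D : LocalData n) (y : Model n) : Form n :=
  toCLM₂ (LinearMap.mk₂ ℝ (fun X Y => contract (D.g y) fun a b =>
      D.g y (D.curv y a X (D.φ y b)) (D.φ y Y))
    (by intro X X' Y; simp [contract, mul_add, Finset.sum_add_distrib])
    (by intro c X Y; simp [contract, Finset.mul_sum, mul_left_comm c])
    (by intro X Y Y'; simp [contract, mul_add, Finset.sum_add_distrib])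
    (by intro c X Y; simp [contract, Finset.mul_sum, mul_left_comm c]))

/-- The covariant derivative `(∇_Z α)(X, Y)` of a field of bilinear forms. -/
def covForm (D : LocalData n) (α : Model n → Form n) (y Z X Y : Model n) : ℝ :=
  fderiv ℝ α y Z X Y - α y (D.Γ y Z X) Y - α y X (D.Γ y Z Y)

/-- The covariant derivative `(∇_Z R)(X, Y)` of the curvature tensor. -/
def covCurv (D : LocalData n) (y Z X Y : Model n) : Model n →L[ℝ] Model n :=
  -(fderiv ℝ (fun z => connCurv D.conn z X Y) y Z
    + (D.conn y Z * connCurv D.conn y X Y - connCurv D.conn y X Y * D.conn y Z)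
    - connCurv D.conn y (D.Γ y Z X) Y - connCurv D.conn y X (D.Γ y Z Y))

namespace IsGood

variable (h : D.IsGood U) (hy : y ∈ U)

include h hy

theorem exists_isOrtho : ∃ e, IsOrtho (D.g y) e :=
  AlmostContact.exists_isOrtho (h.isACM y hy).symm (h.isACM y hy).pos

theorem fderiv_inner {V W : Model n → Model n} (hV : DifferentiableAt ℝ V y)
    (hW : DifferentiableAt ℝ W y) (Z : Model n) :
    fderiv ℝ (fun q => D.g q (V q) (W q)) y Z =
      D.g y (fderiv ℝ V y Z + D.Γ y Z (V y)) (W y)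
        + D.g y (V y) (fderiv ℝ W y Z + D.Γ y Z (W y)) := by
  have hG := h.differentiableAt_g hy
  rw [fderiv_clm_apply (hG.clm_apply hV) hW]
  simp only [add_apply, ContinuousLinearMap.comp_apply, ContinuousLinearMap.flip_apply,
    fderiv_clm_apply hG hV, h.fderiv_g hy, map_add]
  ring

theorem fderiv_φ_apply (Z X : Model n) : fderiv ℝ (fun q => D.φ q X) y Z =
    commPhi (D.φ y) (D.ξ y) Z X - D.Γ y Z (D.φ y X) + D.φ y (D.Γ y Z X) := by
  rw [fderiv_apply_const (h.differentiableAt_φ hy), ← h.nablaPhi_eq hy, nablaPhi]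
  abel

theorem differentiableAt_φ_apply (X : Model n) : DifferentiableAt ℝ (fun q => D.φ q X) y :=
  (h.differentiableAt_φ hy).clm_apply (differentiableAt_const _)

theorem ric_eq (he : IsOrtho (D.g y) e) (X Y : Model n) :
    D.ric y X Y = ∑ i, D.g y (D.curv y (e i) X (e i)) Y := by
  simp only [ric, h.R_eq hy]
  exact contract_eq_sum he ⟨by simp, by simp, by simp, by simp⟩

theorem ricStar_eq_form (X Y : Model n) : D.ricStar y X Y = D.ricStarForm y X Y := by
  simp only [ricStar, h.R_eq hy]
  rfl

omit h hy in
theorem ricStarForm_eq (he : IsOrtho (D.g y) e) (X Y : Model n) :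
    D.ricStarForm y X Y = ∑ i, D.g y (D.curv y (e i) X (D.φ y (e i))) (D.φ y Y) := by
  simp only [ricStarForm, toCLM₂_apply, LinearMap.mk₂_apply]
  exact contract_eq_sum he ⟨by simp, by simp, by simp, by simp⟩

theorem ricStar_eq (he : IsOrtho (D.g y) e) (X Y : Model n) :
    D.ricStar y X Y = ∑ i, D.g y (D.curv y (e i) X (D.φ y (e i))) (D.φ y Y) := by
  rw [h.ricStar_eq_form hy, ricStarForm_eq he]

/-- In this form the skew part of `Ric^*` is measured by the commutator of `∑ R_{e_i, φ e_i}` with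
`φ`. -/
theorem ricStar_eq_curvPhi (he : IsOrtho (D.g y) e) (X Y : Model n) :
    D.ricStar y X Y = 1 / 2 * D.g y (curvPhi (D.curv y) (D.φ y) e X) (D.φ y Y) := by
  rw [h.ricStar_eq hy he, sum_curv_phi (h.isACM y hy) he (h.isCurv hy)]

theorem ricStarXi_eq (he : IsOrtho (D.g y) e) (X : Model n) :
    D.ricStarXi y X = ∑ i, D.ricStar y (e i) (D.ξ y X (e i)) := by
  have h1 : ∀ a a', (contract (D.g y) fun b b' => D.ricStarForm y a b *
      D.g y (D.ξ y X a') b') = D.ricStarForm y a (D.ξ y X a') := by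
    intro a a'
    rw [contract_eq_sum he ⟨by simp [add_mul], by simp [mul_assoc], by simp [mul_add],
      by simp [mul_left_comm]⟩]
    have := he.sum_smul' (h.isACM y hy).symm (fun b => D.ricStarForm y a b) (by simp) (by simp)
      (D.ξ y X a')
    rw [← this]
    exact Finset.sum_congr rfl fun i _ => mul_comm _ _
  simp only [ricStarXi, innerForm, h.ricStar_eq_form hy, h1]
  exact contract_eq_sum he ⟨by simp, by simp, by simp, by simp⟩

theorem curvXi_eq (he : IsOrtho (D.g y) e) (X : Model n) :
    D.curvXi y X = curvReeb (D.g y) (D.curv y) e (D.ζ y) (D.ξ y) X := by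
  simp only [curvXi, h.R_eq hy]
  exact contract_eq_sum he ⟨by simp, by simp, by simp, by simp⟩

theorem curvZetaXi_eq (he : IsOrtho (D.g y) e) (X : Model n) :
    D.curvZetaXi y X = ∑ j, D.g y (D.curv y (D.ζ y) X (e j)) (D.ξ y (D.ζ y) (e j)) := by
  simp only [curvZetaXi, innerEnd, h.R_eq hy]
  exact contract_eq_sum he ⟨by simp, by simp, by simp, by simp⟩

/-! #### Coderivatives -/

omit hy in
theorem codiffTwo_eq {A : Model n → Model n → Model n → ℝ} {α : Model n → Form n}
    (hy : y ∈ U) (hA : ∀ z ∈ U, ∀ X Y, A z X Y = α z X Y) (hα : DifferentiableAt ℝ α y)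
    (he : IsOrtho (D.g y) e) (X : Model n) :
    D.codiffTwo y A X = -∑ i, D.covForm α y (e i) (e i) X := by
  have h1 : ∀ X Y Z, fderiv ℝ (fun z => A z X Y) y Z = fderiv ℝ α y Z X Y := by
    intro X Y Z
    have h2 : (fun z => A z X Y) =ᶠ[nhds y] fun z => α z X Y := by
      filter_upwards [h.nhds_mem hy] with z hz using hA z hz X Y
    rw [h2.fderiv_eq, fderiv_apply_const (hα.clm_apply (differentiableAt_const _)),
      fderiv_apply_const hα]
  simp only [codiffTwo, h1, hA y hy]
  rw [contract_eq_sum he]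
  · rfl
  · refine ⟨fun a a' b => ?_, fun c a b => ?_, fun a b b' => ?_, fun c a b => ?_⟩ <;>
      simp <;> ring

theorem dStarF_eq (he : IsOrtho (D.g y) e) (X : Model n) :
    D.dStarF y X = D.g y (codiffVec (D.φ y) e (D.ξ y)) X := by
  have acm := h.isACM y hy
  have h1 : ∀ Z X Y, fderiv ℝ (fun z => D.fundForm z X Y) y Z - D.fundForm y (D.Γ y Z X) Y
      - D.fundForm y X (D.Γ y Z Y) = D.g y X (commPhi (D.φ y) (D.ξ y) Z Y) := by
    intro Z X Y
    simp only [fundForm]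
    rw [h.fderiv_inner hy (differentiableAt_const _) (h.differentiableAt_φ_apply hy _),
      h.fderiv_φ_apply hy]
    simp
    ring
  simp only [dStarF, codiffTwo, h1]
  rw [contract_eq_sum he ⟨by simp [commPhi]; intros; ring, by simp [commPhi, mul_sub],
    by simp, by simp⟩]
  simp only [codiffVec, map_sum, sum_apply, ← Finset.sum_neg_distrib]
  refine Finset.sum_congr rfl fun i _ => ?_
  have h2 := (h.ξ_mem hy).1 (e i)
  simp only [commPhi, map_sub, sub_apply]
  rw [acm.skew (D.ξ y (e i) (e i)), h2 (D.φ y (e i)), acm.skew, h2 (e i)]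
  ring

theorem sharp_dStarF (he : IsOrtho (D.g y) e) :
    sharp (D.g y) (D.dStarF y) = codiffVec (D.φ y) e (D.ξ y) := by
  have acm := h.isACM y hy
  refine ext_inner acm.pos fun Z => ?_
  have := inner_sharp acm.symm acm.pos (D.g y (codiffVec (D.φ y) e (D.ξ y)) : Model n →ₗ[ℝ] ℝ) Z
  simp only [ContinuousLinearMap.coe_coe] at this
  rw [← this, show D.dStarF y = fun X => D.g y (codiffVec (D.φ y) e (D.ξ y)) X from
    funext (h.dStarF_eq hy he)]

theorem leeVec_eq (he : IsOrtho (D.g y) e) :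
    D.leeVec y = ((n : ℝ) - 1)⁻¹ • leeRaw (D.φ y) (D.ζ y) e (D.ξ y) := by
  rw [leeVec, h.sharp_dStarF hy he, h.nablaZeta_eq hy, leeRaw, ← sub_eq_add_neg]

/-! #### The second Bianchi identity -/

omit h hy in
theorem connCurv_add_left (a a' X : Model n) :
    connCurv D.conn y (a + a') X = connCurv D.conn y a X + connCurv D.conn y a' X := by
  ext1 Z
  simp only [connCurv, map_add, add_apply, sub_apply, clm_mul_apply]
  abel

omit h hy in
theorem connCurv_smul_left (c : ℝ) (a X : Model n) :
    connCurv D.conn y (c • a) X = c • connCurv D.conn y a X := by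
  ext1 Z
  simp only [connCurv, map_smul, add_apply, sub_apply, clm_mul_apply, smul_apply]
  module

omit hy in
theorem smooth_connCurv (a X : Model n) : ContDiffOn ℝ ∞ (fun z => connCurv D.conn z a X) U := by
  have h0 := h.smooth_conn.fderiv_of_isOpen (m := ∞) h.isOpen (by simp)
  have h1 : ∀ X Y, ContDiffOn ℝ ∞ (fun z => fderiv ℝ D.conn z X Y) U := fun X Y =>
    (h0.clm_apply contDiffOn_const).clm_apply contDiffOn_const
  have h2 : ∀ X, ContDiffOn ℝ ∞ (fun z => D.conn z X) U := fun X =>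
    h.smooth_conn.clm_apply contDiffOn_const
  simp only [connCurv]
  exact (((h1 a X).sub (h1 X a)).add ((h2 a).clm_comp (h2 X))).sub ((h2 X).clm_comp (h2 a))

theorem differentiableAt_connCurv (a X : Model n) :
    DifferentiableAt ℝ (fun z => connCurv D.conn z a X) y :=
  ((h.smooth_connCurv a X).contDiffAt (h.nhds_mem hy)).differentiableAt (by simp)

/-- The Christoffel terms that turn `connCurv_bianchi` into a tensor identity cancel in pairs, by
symmetry of `Γ` and skewness of the curvature. -/
theorem covCurv_bianchi (X Y Z : Model n) :
    D.covCurv y X Y Z + D.covCurv y Y Z X + D.covCurv y Z X Y = 0 := by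
  have h1 := connCurv_bianchi ((h.smooth_conn.contDiffAt (h.nhds_mem hy)).of_le two_le_infty) X Y Z
  have s := h.Γ_symm hy
  have k := fun X Y => connCurv_swap (κ := D.conn) (p := y) X Y
  simp only [covCurv]
  rw [s Y X, s Z X, s Z Y, k Z (D.Γ y X Y), k X (D.Γ y Y Z), k (D.Γ y X Z) Y]
  linear_combination (norm := abel) -h1

theorem covCurv_add_left (X Y Y' Z : Model n) :
    D.covCurv y X (Y + Y') Z = D.covCurv y X Y Z + D.covCurv y X Y' Z := by
  simp only [covCurv, connCurv_add_left, map_add]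
  rw [fderiv_fun_add (h.differentiableAt_connCurv hy Y Z) (h.differentiableAt_connCurv hy Y' Z)]
  simp only [add_apply, mul_add, add_mul]
  abel

theorem covCurv_smul_left (c : ℝ) (X Y Z : Model n) :
    D.covCurv y X (c • Y) Z = c • D.covCurv y X Y Z := by
  ext1 V
  simp only [covCurv, connCurv_smul_left, map_smul]
  rw [fderiv_fun_const_smul (h.differentiableAt_connCurv hy Y Z)]
  simp only [neg_apply, add_apply, sub_apply, smul_apply, clm_mul_apply, map_smul]
  module

omit h hy in
theorem covCurv_skew_left (X Y Z : Model n) : D.covCurv y X Y Z = -D.covCurv y X Z Y := by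
  have h1 : (fun z => connCurv D.conn z Y Z) = fun z => -connCurv D.conn z Z Y :=
    funext fun z => connCurv_swap _ _
  have k := fun X Y => connCurv_swap (κ := D.conn) (p := y) X Y
  simp only [covCurv, h1, fderiv_fun_neg, neg_apply]
  rw [k Y Z, k Y (D.Γ y X Z), k (D.Γ y X Y) Z]
  ext1 V
  simp only [neg_apply, add_apply, sub_apply, clm_mul_apply, map_neg]
  abel

theorem inner_connCurv (a b V W : Model n) : D.g y (connCurv D.conn y a b V) W =
    -D.g y V (connCurv D.conn y a b W) := by
  refine connCurv_parallel_form (h.differentiableAt_conn hy)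
    ((h.contDiffAt_g hy).of_le two_le_infty) ?_ a b V W
  filter_upwards [h.nhds_mem hy] with q hq u using h.fderiv_g hq u

theorem covCurv_skew (X Y Z V W : Model n) :
    D.g y (D.covCurv y X Y Z V) W = -D.g y V (D.covCurv y X Y Z W) := by
  have hd := h.differentiableAt_connCurv hy Y Z
  have h1 : (fun z => D.g z (connCurv D.conn z Y Z V) W) =ᶠ[nhds y]
      fun z => -D.g z V (connCurv D.conn z Y Z W) := by
    filter_upwards [h.nhds_mem hy] with z hz using h.inner_connCurv hz Y Z V W
  have hc : ∀ V, DifferentiableAt ℝ (fun z => connCurv D.conn z Y Z V) y := fun V =>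
    hd.clm_apply (differentiableAt_const V)
  have h2 := congrArg (fun f : Model n →L[ℝ] ℝ => f X) h1.fderiv_eq
  simp only [fderiv_fun_neg, neg_apply] at h2
  rw [h.fderiv_inner hy (hc V) (differentiableAt_const W),
    h.fderiv_inner hy (differentiableAt_const V) (hc W), fderiv_apply_const hd,
    fderiv_apply_const hd] at h2
  have i1 := h.inner_connCurv hy Y Z (D.Γ y X V) W
  have i2 := h.inner_connCurv hy Y Z V (D.Γ y X W)
  have i3 := h.inner_connCurv hy (D.Γ y X Y) Z V W
  have i4 := h.inner_connCurv hy Y (D.Γ y X Z) V W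
  have hcn : ∀ V, D.conn y X V = D.Γ y X V := fun _ => rfl
  simp only [covCurv, neg_apply, add_apply, sub_apply, clm_mul_apply, map_neg, map_add, map_sub,
    fderiv_fun_const, Pi.zero_apply, zero_apply, zero_add, hcn] at h2 ⊢
  linarith

end IsGood

end LocalData

/-! ### The divergence of the `*`-Ricci tensor. -/

namespace LocalData

variable {n : ℕ} {D : LocalData n} {U : Set (Model n)} {y : Model n}
  {e : Fin (2 * n + 1) → Model n}

namespace IsGood

variable (h : D.IsGood U) (hy : y ∈ U)

include h hy

omit hy in
theorem smooth_curv_inner (a X b Y : Model n) : ContDiffOn ℝ ∞ (fun z =>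
    D.g z (D.curv z a X (D.φ z b)) (D.φ z Y)) U := by
  have h1 : ∀ b : Model n, ContDiffOn ℝ ∞ (fun z => D.φ z b) U := fun b =>
    h.smooth_φ.clm_apply contDiffOn_const
  have h2 : ContDiffOn ℝ ∞ (fun z => -connCurv D.conn z a X (D.φ z b)) U :=
    ((h.smooth_connCurv a X).clm_apply (h1 b)).neg
  exact (h.smooth_g.clm_apply h2).clm_apply (h1 Y)

omit hy in
theorem smooth_ricStarForm : ContDiffOn ℝ ∞ D.ricStarForm U := by
  refine contDiffOn_clm₂ fun X Y => ?_
  intro y hy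
  exact (contDiffAt_contract (h.contDiffAt_g hy) (h.isACM y hy).symm (h.isACM y hy).pos
    fun a b => (h.smooth_curv_inner a X b Y).contDiffAt (h.nhds_mem hy)).contDiffWithinAt

theorem differentiableAt_ricStarForm : DifferentiableAt ℝ D.ricStarForm y :=
  (h.smooth_ricStarForm.contDiffAt (h.nhds_mem hy)).differentiableAt (by simp)

theorem fderiv_contract {B : Model n → Model n → Model n → ℝ}
    (hB : ∀ a b, DifferentiableAt ℝ (fun z => B z a b) y) (hb : IsBilin (B y)) (Z : Model n) :
    fderiv ℝ (fun z => contract (D.g z) (B z)) y Z = contract (D.g y) fun a b =>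
      fderiv ℝ (fun z => B z a b) y Z - B y (D.Γ y Z a) b - B y a (D.Γ y Z b) := by
  refine AlmostContact.fderiv_contract ((h.contDiffAt_g hy).of_le one_le_infty) ?_ ?_
    (h.fderiv_g hy Z) hB hb
  · filter_upwards [h.nhds_mem hy] with z hz using (h.isACM z hz).symm
  · filter_upwards [h.nhds_mem hy] with z hz using (h.isACM z hz).pos

set_option maxHeartbeats 400000 in
theorem fderiv_curv_inner (a X b Y Z : Model n) :
    fderiv ℝ (fun z => D.g z (D.curv z a X (D.φ z b)) (D.φ z Y)) y Z =
      D.g y (D.covCurv y Z a X (D.φ y b)) (D.φ y Y)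
      + D.g y (D.curv y a X (commPhi (D.φ y) (D.ξ y) Z b)) (D.φ y Y)
      + D.g y (D.curv y a X (D.φ y b)) (commPhi (D.φ y) (D.ξ y) Z Y)
      + D.g y (D.curv y (D.Γ y Z a) X (D.φ y b)) (D.φ y Y)
      + D.g y (D.curv y a (D.Γ y Z X) (D.φ y b)) (D.φ y Y)
      + D.g y (D.curv y a X (D.φ y (D.Γ y Z b))) (D.φ y Y)
      + D.g y (D.curv y a X (D.φ y b)) (D.φ y (D.Γ y Z Y)) := by
  have hd := h.differentiableAt_connCurv hy a X
  have hφ := h.differentiableAt_φ_apply hy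
  have h1 : DifferentiableAt ℝ (fun z => -connCurv D.conn z a X (D.φ z b)) y :=
    (hd.clm_apply (hφ b)).fun_neg
  have h2 : fderiv ℝ (fun z => -connCurv D.conn z a X (D.φ z b)) y Z =
      -(fderiv ℝ (fun z => connCurv D.conn z a X) y Z (D.φ y b) +
        connCurv D.conn y a X (fderiv ℝ (fun z => D.φ z b) y Z)) := by
    rw [fderiv_fun_neg, fderiv_clm_apply hd (hφ b)]
    simp [add_comm]
  change fderiv ℝ (fun z => D.g z (-connCurv D.conn z a X (D.φ z b)) (D.φ z Y)) y Z = _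
  rw [h.fderiv_inner hy h1 (hφ Y), h2, h.fderiv_φ_apply hy, h.fderiv_φ_apply hy]
  have hcn : ∀ V, D.conn y Z V = D.Γ y Z V := fun _ => rfl
  simp only [covCurv, curv, LinearMap.mk₂_apply, ContinuousLinearMap.coe_coe, neg_apply, add_apply,
    sub_apply, clm_mul_apply, map_neg, map_add, map_sub, hcn]
  ring

/-- The covariant derivative of the `*`-Ricci tensor. -/
theorem covForm_ricStar (he : IsOrtho (D.g y) e) (Z X Y : Model n) :
    D.covForm D.ricStarForm y Z X Y = ∑ i,
      (D.g y (D.covCurv y Z (e i) X (D.φ y (e i))) (D.φ y Y)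
      + D.g y (D.curv y (e i) X (commPhi (D.φ y) (D.ξ y) Z (e i))) (D.φ y Y)
      + D.g y (D.curv y (e i) X (D.φ y (e i))) (commPhi (D.φ y) (D.ξ y) Z Y)) := by
  have hd := h.differentiableAt_ricStarForm hy
  have h1 : fderiv ℝ D.ricStarForm y Z X Y = fderiv ℝ (fun z => contract (D.g z) fun a b =>
      D.g z (D.curv z a X (D.φ z b)) (D.φ z Y)) y Z := by
    rw [← fderiv_apply_const hd, ← fderiv_apply_const (hd.clm_apply (differentiableAt_const _))]
    rfl
  rw [covForm, h1, h.fderiv_contract hy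
    (fun a b => ((h.smooth_curv_inner a X b Y).contDiffAt (h.nhds_mem hy)).differentiableAt
      (by simp)) ⟨by simp, by simp, by simp, by simp⟩]
  simp only [h.fderiv_curv_inner hy]
  have h2 : IsBilin fun a b => D.g y (D.covCurv y Z a X (D.φ y b)) (D.φ y Y) := by
    exact ⟨by simp [h.covCurv_add_left hy], by simp [h.covCurv_smul_left hy], by simp, by simp⟩
  have h3 : IsBilin fun a b => D.g y (D.curv y a X (commPhi (D.φ y) (D.ξ y) Z b)) (D.φ y Y) :=
    ⟨by simp, by simp, by simp [commPhi]; intros; ring, by simp [commPhi, mul_sub]⟩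
  have h4 : IsBilin fun a b => D.g y (D.curv y a X (D.φ y b)) (commPhi (D.φ y) (D.ξ y) Z Y) :=
    ⟨by simp, by simp, by simp, by simp⟩
  have h5 : IsBilin fun a b => D.g y (D.curv y a (D.Γ y Z X) (D.φ y b)) (D.φ y Y) :=
    ⟨by simp, by simp, by simp, by simp⟩
  have h6 : IsBilin fun a b => D.g y (D.curv y a X (D.φ y b)) (D.φ y (D.Γ y Z Y)) :=
    ⟨by simp, by simp, by simp, by simp⟩
  rw [ricStarForm_eq he, ricStarForm_eq he, Finset.sum_add_distrib, Finset.sum_add_distrib,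
    ← contract_eq_sum he h2, ← contract_eq_sum he h3, ← contract_eq_sum he h4,
    ← contract_eq_sum he h5, ← contract_eq_sum he h6]
  simp only [contract, ← Finset.sum_add_distrib, ← Finset.sum_sub_distrib, ← smul_add, ← smul_sub]
  refine Finset.sum_congr rfl fun i _ => Finset.sum_congr rfl fun j _ => ?_
  congr 1
  ring

theorem dStarRicStar_eq (he : IsOrtho (D.g y) e) (X : Model n) :
    D.dStarRicStar y X = -∑ a, D.covForm D.ricStarForm y (e a) (e a) X :=
  h.codiffTwo_eq hy (fun _ hz => h.ricStar_eq_form hz) (h.differentiableAt_ricStarForm hy) he X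

theorem dStarRicStarT_eq (he : IsOrtho (D.g y) e) (X : Model n) :
    D.dStarRicStarT y X = -∑ a, D.covForm D.ricStarForm y (e a) X (e a) := by
  have hd := h.differentiableAt_ricStarForm hy
  obtain ⟨α, hα⟩ : ∃ α : Model n → Form n, ∀ z X Y, α z X Y = D.ricStarForm z Y X :=
    ⟨fun z => (D.ricStarForm z).flip, fun _ _ _ => rfl⟩
  have hs : ContDiffOn ℝ ∞ α U := by
    refine contDiffOn_clm₂ fun X Y => ?_
    simp only [hα]
    exact (h.smooth_ricStarForm.clm_apply contDiffOn_const).clm_apply contDiffOn_const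
  have hd' : DifferentiableAt ℝ α y := (hs.contDiffAt (h.nhds_mem hy)).differentiableAt (by simp)
  have hf : ∀ X Y Z, fderiv ℝ α y Z X Y = fderiv ℝ D.ricStarForm y Z Y X := by
    intro X Y Z
    have h1 := fderiv_apply_const (hd.clm_apply (differentiableAt_const Y)) X Z
    have h2 := fderiv_apply_const (hd'.clm_apply (differentiableAt_const X)) Y Z
    rw [← fderiv_apply_const hd', ← fderiv_apply_const hd, ← h1, ← h2]
    simp only [hα]
  have hA : ∀ z ∈ U, ∀ X Y, (fun z X Y => D.ricStar z Y X) z X Y = α z X Y := fun z hz X Y => by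
    rw [hα, ← h.ricStar_eq_form hz]
  have h1 := h.codiffTwo_eq hy hA hd' he X
  have h2 : ∀ a, D.covForm α y a a X = D.covForm D.ricStarForm y a X a := fun a => by
    rw [covForm, covForm, hf, hα, hα]
    ring
  simp only [h2] at h1
  exact h1

theorem dsStar_eq (he : IsOrtho (D.g y) e) (X : Model n) :
    D.dsStar y X = ∑ a, D.covForm D.ricStarForm y X (e a) (e a) := by
  have hd := h.differentiableAt_ricStarForm hy
  have h3 : D.sStar =ᶠ[nhds y] fun z => contract (D.g z) fun a b => D.ricStarForm z a b := by
    filter_upwards [h.nhds_mem hy] with z hz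
    simp only [sStar, h.ricStar_eq_form hz]
  have hd1 : ∀ a : Model n, DifferentiableAt ℝ (fun z => D.ricStarForm z a) y := fun a =>
    hd.clm_apply (differentiableAt_const a)
  rw [dsStar, h3.fderiv_eq, h.fderiv_contract hy
    (fun a b => (hd1 a).clm_apply (differentiableAt_const b))
    ⟨by simp, by simp, by simp, by simp⟩]
  have h4 : ∀ a b : Model n, fderiv ℝ (fun z => D.ricStarForm z a b) y X =
      fderiv ℝ D.ricStarForm y X a b := fun a b => by
    rw [fderiv_apply_const (hd1 a), fderiv_apply_const hd]
  simp only [h4]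
  rw [contract_eq_sum he]
  · rfl
  · refine ⟨fun a a' b => ?_, fun c a b => ?_, fun a b b' => ?_, fun c a b => ?_⟩ <;>
      simp <;> ring

/-- The divergence of the transpose of the `*`-Ricci tensor. -/
theorem dStarRicStarT_add (he : IsOrtho (D.g y) e) (X : Model n) :
    D.dStarRicStarT y X + 1 / 2 * D.dsStar y X = ∑ a, ∑ i,
      (D.g y (D.curv y (e i) (e a) (commPhi (D.φ y) (D.ξ y) X (e i))) (D.φ y (e a))
      - D.g y (D.curv y (e i) X (commPhi (D.φ y) (D.ξ y) (e a) (e i))) (D.φ y (e a))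
      - D.g y (D.curv y (e i) X (D.φ y (e i))) (commPhi (D.φ y) (D.ξ y) (e a) (e a))) := by
  have hR := h.isCurv hy
  have acm := h.isACM y hy
  -- The second Bianchi identity at `X, e_i, e_a`, contracted with `φ` twice: the other two terms
  -- agree after renaming indices. Hence `½ ds^*` cancels the derivative of `R` in the divergence.
  have h3 : ∑ a, ∑ i, D.g y (D.covCurv y X (e i) (e a) (D.φ y (e i))) (D.φ y (e a)) =
      2 * ∑ a, ∑ i, D.g y (D.covCurv y (e a) (e i) X (D.φ y (e i))) (D.φ y (e a)) := by
    have h4 : ∀ a i, D.g y (D.covCurv y X (e i) (e a) (D.φ y (e i))) (D.φ y (e a)) =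
        D.g y (D.covCurv y (e a) (e i) X (D.φ y (e i))) (D.φ y (e a))
        + D.g y (D.covCurv y (e i) (e a) X (D.φ y (e a))) (D.φ y (e i)) := by
      intro a i
      have h5 := h.covCurv_bianchi hy X (e i) (e a)
      rw [covCurv_skew_left (e a)] at h5
      have h6 := congrArg
        (fun f : Model n →L[ℝ] Model n => D.g y (f (D.φ y (e i))) (D.φ y (e a))) h5
      simp only [add_apply, neg_apply, map_add, map_neg, zero_apply, map_zero] at h6
      have h7 := h.covCurv_skew hy (e i) (e a) X (D.φ y (e a)) (D.φ y (e i))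
      rw [acm.symm (D.φ y (e a))] at h7
      linarith
    simp only [h4, Finset.sum_add_distrib]
    linarith [Finset.sum_comm (s := Finset.univ) (t := Finset.univ)
      (f := fun a i => D.g y (D.covCurv y (e i) (e a) X (D.φ y (e a))) (D.φ y (e i)))]
  -- The derivatives of the two factors `φ` in `ds^*` contribute equally, so the factor `½`
  -- disappears.
  have h4 : ∑ a, ∑ i, D.g y (D.curv y (e i) (e a) (D.φ y (e i)))
      (commPhi (D.φ y) (D.ξ y) X (e a)) = ∑ a, ∑ i, D.g y (D.curv y (e i) (e a)
      (commPhi (D.φ y) (D.ξ y) X (e i))) (D.φ y (e a)) := by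
    rw [Finset.sum_comm]
    refine Finset.sum_congr rfl fun a _ => Finset.sum_congr rfl fun i _ => ?_
    rw [hR.inner_skew_left, hR.inner_skew]
    ring
  rw [h.dStarRicStarT_eq hy he, h.dsStar_eq hy he]
  simp only [h.covForm_ricStar hy he, Finset.sum_add_distrib, Finset.sum_sub_distrib, h3, h4]
  ring

end IsGood

end LocalData

/-! ### Variations of the section and the first variation formula -/

section Connection

variable {n : ℕ} {P : Type*} [NormedAddCommGroup P] [NormedSpace ℝ P]
  {κ : P → P →L[ℝ] Model n →L[ℝ] Model n} {G : P → Form n} {A : P → Model n →L[ℝ] Model n}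
  {v : P → Model n} {Ω : Set P} {p : P} {e : Fin (2 * n + 1) → Model n}

/-- The scalar product of endomorphisms in an orthonormal basis. -/
def innerSum (G : Form n) (e : Fin (2 * n + 1) → Model n) (S S' : Model n →L[ℝ] Model n) : ℝ :=
  ∑ i, G (S (e i)) (S' (e i))

/-- Invariance of the trace form: `⟨S, [S, T]⟩ = 0` for skew endomorphisms. -/
theorem innerSum_commutator {G : Form n} (symm : ∀ X Y, G X Y = G Y X) (he : IsOrtho G e)
    {S T : Model n →L[ℝ] Model n} (hS : ∀ X Y, G (S X) Y = -G X (S Y))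
    (hT : ∀ X Y, G (T X) Y = -G X (T Y)) : innerSum G e S (S * T - T * S) = 0 := by
  have h1 := he.sum_skew symm hT (B := fun x y => G x (S (S y)))
    ⟨by simp, by simp, by simp, by simp⟩
  have h2 := he.sum_skew symm hS (B := fun x y => G x (T (S y)))
    ⟨by simp, by simp, by simp, by simp⟩
  have h3 : ∀ i, G (e i) (S (S (T (e i)))) = G (T (e i)) (S (S (e i))) := fun i => by
    have := hS (T (e i)) (S (e i))
    have h4 := hS (e i) (S (T (e i)))
    rw [symm (S (T (e i)))] at this
    linarith
  have h4 : ∀ i, G (e i) (T (S (S (e i)))) = -G (T (e i)) (S (S (e i))) := fun i => by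
    rw [hT, neg_neg]
  have h5 : ∀ i, G (S (e i)) (S (T (e i))) = -G (T (e i)) (S (S (e i))) := fun i => by
    rw [symm, hS]
  simp only [h3] at h1
  simp only [h4, Finset.sum_neg_distrib] at h2
  simp only [innerSum, sub_apply, clm_mul_apply, map_sub, Finset.sum_sub_distrib, h5,
    Finset.sum_neg_distrib, h2]
  linarith

namespace IsMetricConn

variable (h : IsMetricConn κ G A v Ω) (hp : p ∈ Ω)

include h hp

theorem differentiableAt_metric : DifferentiableAt ℝ G p :=
  (h.smooth_metric.contDiffAt (h.isOpen.mem_nhds hp)).differentiableAt (by simp)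

theorem fderiv_inner {V W : P → Model n} (hV : DifferentiableAt ℝ V p)
    (hW : DifferentiableAt ℝ W p) (w : P) :
    fderiv ℝ (fun q => G q (V q) (W q)) p w =
      G p (covV κ V p w) (W p) + G p (V p) (covV κ W p w) := by
  have hG := h.differentiableAt_metric hp
  rw [fderiv_clm_apply (hG.clm_apply hV) hW]
  simp only [add_apply, ContinuousLinearMap.comp_apply, ContinuousLinearMap.flip_apply,
    fderiv_clm_apply hG hV, h.metric p hp, map_add, covV]
  ring

theorem differentiableAt_inner {V W : P → Model n} (hV : DifferentiableAt ℝ V p)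
    (hW : DifferentiableAt ℝ W p) : DifferentiableAt ℝ (fun q => G q (V q) (W q)) p :=
  ((h.differentiableAt_metric hp).clm_apply hV).clm_apply hW

theorem differentiableAt_innerEnd {S S' : P → Model n →L[ℝ] Model n}
    (hS : ContDiffAt ℝ 1 S p) (hS' : ContDiffAt ℝ 1 S' p) :
    DifferentiableAt ℝ (fun q => innerEnd (G q) (S q) (S' q)) p := by
  have hG := (h.smooth_metric.contDiffAt (h.isOpen.mem_nhds hp)).of_le one_le_infty
  exact (contDiffAt_contract hG (h.isACM p hp).symm (h.isACM p hp).pos fun a b =>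
    (hG.clm_apply (hS.clm_apply contDiffAt_const)).clm_apply
      (hS'.clm_apply contDiffAt_const)).differentiableAt one_ne_zero

theorem fderiv_innerEnd (he : IsOrtho (G p) e) {S S' : P → Model n →L[ℝ] Model n}
    (hS : DifferentiableAt ℝ S p) (hS' : DifferentiableAt ℝ S' p) (w : P) :
    fderiv ℝ (fun q => innerEnd (G q) (S q) (S' q)) p w =
      innerSum (G p) e (covE κ S p w) (S' p) + innerSum (G p) e (S p) (covE κ S' p w) := by
  have hΩ := h.isOpen.mem_nhds hp
  have hSa : ∀ a, DifferentiableAt ℝ (fun q => S q a) p := fun a =>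
    hS.clm_apply (differentiableAt_const a)
  have hSa' : ∀ a, DifferentiableAt ℝ (fun q => S' q a) p := fun a =>
    hS'.clm_apply (differentiableAt_const a)
  have h1 := AlmostContact.fderiv_contract (G := G) (p := p) (w := w)
    (A := (κ p w : Model n →ₗ[ℝ] Model n)) (B := fun q a b => G q (S q a) (S' q b))
    ((h.smooth_metric.contDiffAt hΩ).of_le one_le_infty)
    (by filter_upwards [hΩ] with q hq using (h.isACM q hq).symm)
    (by filter_upwards [hΩ] with q hq using (h.isACM q hq).pos) (h.metric p hp w)
    (fun a b => h.differentiableAt_inner hp (hSa a) (hSa' b))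
    ⟨by simp, by simp, by simp, by simp⟩
  have h2 : ∀ a b, fderiv ℝ (fun q => G q (S q a) (S' q b)) p w - G p (S p (κ p w a)) (S' p b)
      - G p (S p a) (S' p (κ p w b)) =
      G p (covE κ S p w a) (S' p b) + G p (S p a) (covE κ S' p w b) := by
    intro a b
    rw [h.fderiv_inner hp (hSa a) (hSa' b)]
    simp only [covV, covE, fderiv_apply_const hS, fderiv_apply_const hS', add_apply, sub_apply,
      clm_mul_apply, map_add, map_sub]
    ring
  refine h1.trans ?_
  simp only [ContinuousLinearMap.coe_coe, h2]
  rw [contract_eq_sum he ⟨by simp; intros; ring, by simp [mul_add], by simp; intros; ring,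
    by simp [mul_add]⟩, Finset.sum_add_distrib]
  rfl

end IsMetricConn

end Connection

/-! ### Almost contact metric structures along a variation. -/

namespace LocalData

variable {n : ℕ} {D : LocalData n} {U : Set (Model n)} {Ω : Set (Model n × ℝ)}
  {f : Model n × ℝ → Model n} {A : Model n × ℝ → Model n →L[ℝ] Model n}
  {v : Model n × ℝ → Model n}

/-- The isometry `a` transports the structure. It is injective, hence surjective, so every vector
may be written as `a X`. -/
theorem IsFibrePoint.isACM {y : Model n} {B : Model n →L[ℝ] Model n} {u : Model n}
    (acm : IsACM (D.g y) (D.φ y) (D.ζ y)) (hf : D.IsFibrePoint y B u) : IsACM (D.g y) B u := by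
  obtain ⟨a, ha, -, hB, rfl⟩ := hf
  have hinj : Function.Injective a := by
    rw [injective_iff_map_eq_zero]
    intro x hx
    by_contra hx0
    have := acm.pos x hx0
    rw [← ha, hx] at this
    simp at this
  have hsurj : Function.Surjective a :=
    (LinearMap.injective_iff_surjective (f := (a : Model n →ₗ[ℝ] Model n))).mp hinj
  have hB' : ∀ X, B (a X) = a (D.φ y X) := fun X => congrArg (fun f => f X) hB
  refine ⟨acm.symm, acm.pos, by rw [ha, acm.unit], fun X => ?_, fun X Y => ?_⟩
  · obtain ⟨X, rfl⟩ := hsurj X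
    rw [hB', hB', acm.sq, ha]
    simp
  · obtain ⟨X, rfl⟩ := hsurj X
    obtain ⟨Y, rfl⟩ := hsurj Y
    rw [hB', hB', ha, ha, ha, ha, acm.compat]

/-- The connection pulled back along `f`. -/
def pullConn (D : LocalData n) (f : Model n × ℝ → Model n) (p : Model n × ℝ) :
    Model n × ℝ →L[ℝ] Model n →L[ℝ] Model n := (D.conn (f p)).comp (fderiv ℝ f p)

namespace IsVariation

variable (hv : D.IsVariation U Ω f A v) (h : D.IsGood U)

include hv h

/-- A variation becomes an almost contact metric structure on a trivial bundle over `Ω` with the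
pulled-back Levi-Civita connection. All results on `IsMetricConn` thus apply in the direction of the
variation parameter as well. -/
theorem isMetricConn : IsMetricConn (D.pullConn f) (fun p => D.g (f p)) A v Ω := by
  refine ⟨hv.isOpen, ?_, h.smooth_g.comp hv.smooth_base hv.mem_base, hv.smooth_end,
    hv.smooth_vec, fun p hp => (hv.mem_fibre p hp).isACM (h.isACM _ (hv.mem_base p hp)), ?_⟩
  · have h1 : ContDiffOn ℝ ∞ (fun p => D.conn (f p)) Ω :=
      h.smooth_conn.comp hv.smooth_base hv.mem_base
    exact h1.clm_comp (hv.smooth_base.fderiv_of_isOpen hv.isOpen (by simp))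
  · intro p hp w X Y
    have h1 := (hv.smooth_base.contDiffAt (hv.isOpen.mem_nhds hp)).differentiableAt
      (by simp : (∞ : WithTop ℕ∞) ≠ 0)
    have h2 := h.differentiableAt_g (hv.mem_base p hp)
    have h3 : fderiv ℝ (fun p => D.g (f p)) p = (fderiv ℝ D.g (f p)).comp (fderiv ℝ f p) :=
      (HasFDerivAt.comp (G := Form n) p h2.hasFDerivAt h1.hasFDerivAt).fderiv
    rw [h3, ContinuousLinearMap.comp_apply, h.fderiv_g (hv.mem_base p hp)]
    rfl

end IsVariation

end LocalData

theorem fderiv_comp_prodMk {n : ℕ} {W : Type*} [NormedAddCommGroup W] [NormedSpace ℝ W]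
    {F : Model n × ℝ → W} {x : Model n} (hF : DifferentiableAt ℝ F (x, (0 : ℝ))) (X : Model n) :
    fderiv ℝ (fun z => F (z, (0 : ℝ))) x X = fderiv ℝ F (x, 0) (X, 0) := by
  have h0 : HasFDerivAt (fun z : Model n => (z, (0 : ℝ))) (ContinuousLinearMap.inl ℝ _ _) x :=
    hasFDerivAt_prodMk_left x (0 : ℝ)
  have h1 := HasFDerivAt.comp x hF.hasFDerivAt h0
  rw [show (fun z => F (z, (0 : ℝ))) = F ∘ fun z => (z, 0) from rfl, h1.fderiv]
  simp

namespace LocalData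

variable {n : ℕ} {D : LocalData n} {U : Set (Model n)} {Ω : Set (Model n × ℝ)}
  {f : Model n × ℝ → Model n} {A : Model n × ℝ → Model n →L[ℝ] Model n}
  {v : Model n × ℝ → Model n} {e : Fin (2 * n + 1) → Model n}

/-- The vertical component of the velocity, up to sign, as a continuous bilinear map. -/
def varTors (D : LocalData n) (f : Model n × ℝ → Model n)
    (A : Model n × ℝ → Model n →L[ℝ] Model n) (v : Model n × ℝ → Model n) :
    Model n × ℝ → Model n × ℝ →L[ℝ] Model n →L[ℝ] Model n :=
  tors (D.pullConn f) (fun p => D.g (f p)) A v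

theorem vertPart_eq (p w : Model n × ℝ) (Y : Model n) :
    D.vertPart f A v p w Y = -D.varTors f A v p w Y := by
  simp only [varTors, tors, toCLM₂_apply, torsLin, LinearMap.mk₂_apply, neg_neg]
  rfl

theorem targetMetric_eq (p w w' : Model n × ℝ) : D.targetMetric f A v p w w' =
    D.g (f p) (fderiv ℝ f p w) (fderiv ℝ f p w') +
      innerEnd (D.g (f p)) (D.varTors f A v p w) (D.varTors f A v p w') := by
  simp only [targetMetric, innerEnd, vertPart_eq, map_neg, neg_apply, neg_neg]

namespace IsVariation

variable (hv : D.IsVariation U Ω f A v) (h : D.IsGood U)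

include hv

theorem contDiffAt_base {p : Model n × ℝ} (hp : p ∈ Ω) : ContDiffAt ℝ ∞ f p :=
  hv.smooth_base.contDiffAt (hv.isOpen.mem_nhds hp)

theorem differentiableAt_fderiv {p : Model n × ℝ} (hp : p ∈ Ω) :
    DifferentiableAt ℝ (fderiv ℝ f) p :=
  (((hv.contDiffAt_base hp).of_le two_le_infty).fderiv_right (m := 1)
    (by norm_num)).differentiableAt one_ne_zero

theorem differentiableAt_velocity {p : Model n × ℝ} (hp : p ∈ Ω) (w : Model n × ℝ) :
    DifferentiableAt ℝ (fun q => fderiv ℝ f q w) p :=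
  (hv.differentiableAt_fderiv hp).clm_apply (differentiableAt_const _)

variable {x : Model n} (hx : (x, (0 : ℝ)) ∈ Ω)

include hx

theorem eventually_mem : ∀ᶠ z in nhds x, (z, (0 : ℝ)) ∈ Ω :=
  (Continuous.prodMk_left (0 : ℝ)).continuousAt.eventually_mem (hv.isOpen.mem_nhds hx)

theorem fderiv_base (X : Model n) : fderiv ℝ f (x, 0) (X, 0) = X := by
  rw [← fderiv_comp_prodMk ((hv.contDiffAt_base hx).differentiableAt (by simp))]
  have h1 : (fun z => f (z, 0)) =ᶠ[nhds x] fun z => z := by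
    filter_upwards [hv.eventually_mem hx] with z hz using (hv.initial z hz).1
  rw [h1.fderiv_eq]
  simp

theorem fderiv_end (X : Model n) : fderiv ℝ A (x, 0) (X, 0) = fderiv ℝ D.φ x X := by
  have hA := (hv.smooth_end.contDiffAt (hv.isOpen.mem_nhds hx)).differentiableAt
    (by simp : (∞ : WithTop ℕ∞) ≠ 0)
  rw [← fderiv_comp_prodMk hA]
  have h1 : (fun z => A (z, 0)) =ᶠ[nhds x] D.φ := by
    filter_upwards [hv.eventually_mem hx] with z hz using (hv.initial z hz).2.1
  rw [h1.fderiv_eq]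

theorem fderiv_vec (X : Model n) : fderiv ℝ v (x, 0) (X, 0) = fderiv ℝ D.ζ x X := by
  have hA := (hv.smooth_vec.contDiffAt (hv.isOpen.mem_nhds hx)).differentiableAt
    (by simp : (∞ : WithTop ℕ∞) ≠ 0)
  rw [← fderiv_comp_prodMk hA]
  have h1 : (fun z => v (z, 0)) =ᶠ[nhds x] D.ζ := by
    filter_upwards [hv.eventually_mem hx] with z hz using (hv.initial z hz).2.2
  rw [h1.fderiv_eq]

theorem pullConn_initial (X : Model n) : D.pullConn f (x, 0) (X, 0) = D.conn x X := by
  rw [pullConn, ContinuousLinearMap.comp_apply, hv.fderiv_base hx, (hv.initial x hx).1]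

theorem varTors_initial (X : Model n) : D.varTors f A v (x, 0) (X, 0) = D.torsion x X := by
  ext1 Y
  rw [← IsGood.tors_conn]
  simp only [varTors, tors, toCLM₂_apply, torsLin, LinearMap.mk₂_apply, covE, covV,
    hv.pullConn_initial hx, hv.fderiv_end hx, hv.fderiv_vec hx, (hv.initial x hx).1,
    (hv.initial x hx).2.1, (hv.initial x hx).2.2]

theorem cov_base (X Y : Model n) :
    covV (D.pullConn f) (fun q => fderiv ℝ f q (Y, 0)) (x, 0) (X, 0) = D.Γ x X Y := by
  rw [covV, hv.pullConn_initial hx, hv.fderiv_base hx,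
    ← fderiv_comp_prodMk (hv.differentiableAt_velocity hx _)]
  have h1 : (fun z => fderiv ℝ f (z, 0) (Y, 0)) =ᶠ[nhds x] fun _ => Y := by
    filter_upwards [hv.eventually_mem hx] with z hz using hv.fderiv_base hz Y
  rw [h1.fderiv_eq]
  simp [conn]

include h

omit hx in
theorem smooth_varTors (w : Model n × ℝ) : ContDiffOn ℝ ∞ (fun q => D.varTors f A v q w) Ω :=
  (hv.isMetricConn h).smooth_tors.clm_apply contDiffOn_const

omit hx in
theorem differentiableAt_varTors {p : Model n × ℝ} (hp : p ∈ Ω) (w : Model n × ℝ) :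
    DifferentiableAt ℝ (fun q => D.varTors f A v q w) p :=
  ((hv.smooth_varTors h w).contDiffAt (hv.isOpen.mem_nhds hp)).differentiableAt (by simp)

/-- `covE` differentiates only the endomorphism, while `nablaXi` also corrects the direction slot.
The extra term cancels against the `∇_X Y` term of the tension field. -/
theorem cov_varTors (X Y Z : Model n) :
    covE (D.pullConn f) (fun q => D.varTors f A v q (Y, 0)) (x, 0) (X, 0) Z =
      D.nablaXi x X Y Z + D.ξ x (D.Γ x X Y) Z := by
  have hU : x ∈ U := by
    have := hv.mem_base _ hx
    rwa [(hv.initial x hx).1] at this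
  have hd := h.differentiableAt_torsion hU
  have h1 : (fun z => D.varTors f A v (z, 0) (Y, 0)) =ᶠ[nhds x] fun z => D.torsion z Y := by
    filter_upwards [hv.eventually_mem hx] with z hz using hv.varTors_initial hz Y
  have h2 : fderiv ℝ (fun z => D.ξ z Y Z) x X = fderiv ℝ (fun z => D.torsion z Y) x X Z := by
    rw [← fderiv_apply_const (hd.clm_apply (differentiableAt_const _))]
    rfl
  rw [covE, hv.pullConn_initial hx, hv.varTors_initial hx,
    ← fderiv_comp_prodMk (hv.differentiableAt_varTors h hx _), h1.fderiv_eq]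
  simp only [nablaXi, h2, add_apply, sub_apply, clm_mul_apply]
  change _ + D.Γ x X (D.ξ x Y Z) - D.ξ x Y (D.Γ x X Z) = _
  abel

-- Second derivatives of `f` are symmetric and `Γ` is torsion-free.
omit hx in
theorem cov_base_symm {p : Model n × ℝ} (hp : p ∈ Ω) (w w' : Model n × ℝ) :
    covV (D.pullConn f) (fun q => fderiv ℝ f q w') p w =
      covV (D.pullConn f) (fun q => fderiv ℝ f q w) p w' := by
  simp only [covV]
  rw [fderiv_fderiv_comm ((hv.contDiffAt_base hp).of_le two_le_infty) w w']
  congr 1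
  exact h.Γ_symm (hv.mem_base p hp) _ _

-- The curvature of the minimal connection in the directions `w, w'` is orthogonal to `μ`. Expanding
-- it by `connCurv_add` compares the two mixed derivatives of the vertical component.
omit hx in
theorem innerSum_cov_varTors {p : Model n × ℝ} (hp : p ∈ Ω) (he : IsOrtho (D.g (f p)) e)
    {μ : Model n →L[ℝ] Model n} (hμ : IsComplEnd (D.g (f p)) (A p) (v p) μ)
    (w w' : Model n × ℝ) :
    innerSum (D.g (f p)) e μ (covE (D.pullConn f) (fun q => D.varTors f A v q w') p w) =
      innerSum (D.g (f p)) e μ (covE (D.pullConn f) (fun q => D.varTors f A v q w) p w')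
      - innerSum (D.g (f p)) e μ (connCurv D.conn (f p) (fderiv ℝ f p w) (fderiv ℝ f p w'))
      - innerSum (D.g (f p)) e μ (D.varTors f A v p w * D.varTors f A v p w'
        - D.varTors f A v p w' * D.varTors f A v p w) := by
  have hM := hv.isMetricConn h
  have hΩ := hv.isOpen.mem_nhds hp
  have hκ := (hM.smooth_conn.contDiffAt hΩ).differentiableAt (by simp : (∞ : WithTop ℕ∞) ≠ 0)
  have hτ := (hM.smooth_tors.contDiffAt hΩ).differentiableAt (by simp : (∞ : WithTop ℕ∞) ≠ 0)
  have h1 := hM.sum_curv_minimal hp he (a := (μ : Model n →ₗ[ℝ] Model n)) hμ w w'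
  have h2 := connCurv_add hκ hτ w w'
  have h3 : connCurv (D.pullConn f) p w w' =
      connCurv D.conn (f p) (fderiv ℝ f p w) (fderiv ℝ f p w') :=
    connCurv_pullback ((hv.contDiffAt_base hp).of_le two_le_infty)
      (h.differentiableAt_conn (hv.mem_base p hp)) w w'
  have h4 : ∀ u u', fderiv ℝ (fun q => D.varTors f A v q u') p u =
      fderiv ℝ (D.varTors f A v) p u u' := fun u u' => fderiv_apply_const hτ _ _
  have symm := (h.isACM _ (hv.mem_base p hp)).symm
  simp only [h2, h3, ContinuousLinearMap.coe_coe] at h1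
  simp only [innerSum, covE, h4, ← Finset.sum_sub_distrib]
  rw [← sub_eq_zero, ← Finset.sum_sub_distrib, ← h1]
  refine Finset.sum_congr rfl fun i _ => ?_
  rw [symm _ (μ (e i))]
  simp only [varTors, add_apply, sub_apply, map_add, map_sub]
  ring

end IsVariation

end LocalData

/-! ### The tension field paired with a variation field. -/

namespace LocalData

variable {n : ℕ} {D : LocalData n} {U : Set (Model n)} {Ω : Set (Model n × ℝ)}
  {f : Model n × ℝ → Model n} {A : Model n × ℝ → Model n →L[ℝ] Model n}
  {v : Model n × ℝ → Model n} {e : Fin (2 * n + 1) → Model n}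

theorem innerSum_add_right {G : Form n} (S T T' : Model n →L[ℝ] Model n) :
    innerSum G e S (T + T') = innerSum G e S T + innerSum G e S T' := by
  simp [innerSum, Finset.sum_add_distrib]

theorem innerSum_comm {G : Form n} (symm : ∀ X Y, G X Y = G Y X) (S T : Model n →L[ℝ] Model n) :
    innerSum G e S T = innerSum G e T S :=
  Finset.sum_congr rfl fun _ _ => symm _ _

namespace IsGood

variable (h : D.IsGood U) {y : Model n} (hy : y ∈ U)

include h hy

theorem isBilin_nablaXi (Y : Model n) : IsBilin fun a b => D.nablaXi y a b Y := by
  have hd := h.differentiableAt_torsion hy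
  have h1 : ∀ X Y Z, fderiv ℝ (fun z => D.ξ z X Y) y Z = fderiv ℝ D.torsion y Z X Y := by
    intro X Y Z
    rw [← fderiv_apply_const hd, ← fderiv_apply_const (hd.clm_apply (differentiableAt_const _))]
    rfl
  simp only [nablaXi, h1]
  refine ⟨fun a a' b => ?_, fun c a b => ?_, fun a b b' => ?_, fun c a b => ?_⟩ <;>
    simp only [map_add, map_smul, add_apply, smul_apply, LinearMap.add_apply, LinearMap.smul_apply]
    <;> module

theorem dStarXi_eq (he : IsOrtho (D.g y) e) (Y : Model n) :
    D.dStarXi y Y = -∑ i, D.nablaXi y (e i) (e i) Y := by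
  rw [dStarXi, contract_eq_sum he (h.isBilin_nablaXi hy Y)]

end IsGood

namespace IsVariation

variable (hv : D.IsVariation U Ω f A v) (h : D.IsGood U) {x : Model n} (hx : (x, (0 : ℝ)) ∈ Ω)

include hv hx

theorem mem_of_mem : x ∈ U := by
  have := hv.mem_base _ hx
  rwa [(hv.initial x hx).1] at this

include h

theorem fderiv_targetMetric (he : IsOrtho (D.g x) e) (u w w' : Model n × ℝ) :
    fderiv ℝ (fun p => D.targetMetric f A v p w w') (x, 0) u =
      D.g x (covV (D.pullConn f) (fun q => fderiv ℝ f q w) (x, 0) u) (fderiv ℝ f (x, 0) w')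
      + D.g x (fderiv ℝ f (x, 0) w) (covV (D.pullConn f) (fun q => fderiv ℝ f q w') (x, 0) u)
      + innerSum (D.g x) e (covE (D.pullConn f) (fun q => D.varTors f A v q w) (x, 0) u)
          (D.varTors f A v (x, 0) w')
      + innerSum (D.g x) e (D.varTors f A v (x, 0) w)
          (covE (D.pullConn f) (fun q => D.varTors f A v q w') (x, 0) u) := by
  have hM := hv.isMetricConn h
  have hb := hv.differentiableAt_velocity hx
  have ht := fun w => ((hv.smooth_varTors h w).contDiffAt (hv.isOpen.mem_nhds hx)).of_le
    one_le_infty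
  have hf := (hv.initial x hx).1
  have he' : IsOrtho (D.g (f (x, 0))) e := by rwa [hf]
  simp only [targetMetric_eq]
  rw [fderiv_fun_add (hM.differentiableAt_inner hx (hb w) (hb w'))
    (hM.differentiableAt_innerEnd hx (ht w) (ht w')), add_apply,
    hM.fderiv_inner hx (hb w) (hb w'),
    hM.fderiv_innerEnd hx he' ((ht w).differentiableAt one_ne_zero)
      ((ht w').differentiableAt one_ne_zero), hf]
  ring

/-- The first variation formula. -/
theorem tensionPairing_eq (he : IsOrtho (D.g x) e) : D.tensionPairing f A v x =
    -∑ j, D.g x (D.dStarXi x (e j)) (D.varTors f A v (x, 0) (0, 1) (e j))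
      + curvTors (D.g x) (D.curv x) e (D.ξ x) (fderiv ℝ f (x, 0) (0, 1)) := by
  have hU := hv.mem_of_mem hx
  have hM := hv.isMetricConn h
  have symm := (h.isACM x hU).symm
  obtain ⟨hf, hA, hvv⟩ := hv.initial x hx
  have he' : IsOrtho (D.g (f (x, 0))) e := by rwa [hf]
  set V := fderiv ℝ f (x, 0) (0, 1) with hV
  set T := D.varTors f A v (x, 0) (0, 1) with hT
  have hTskew : ∀ X Y, D.g x (T X) Y = -D.g x X (T Y) := by
    have := (hM.torsLin_isComplEnd hx (0, 1)).skew
    rwa [hf] at this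
  have hξ : ∀ X, IsComplEnd (D.g (f (x, 0))) (A (x, 0)) (v (x, 0)) (D.torsion x X) := by
    rw [hf, hA, hvv]
    exact h.ξ_isComplEnd hU
  -- The error made when the derivatives along `X` and along the variation parameter are exchanged.
  let C : Model n → Model n → ℝ := fun X Y => innerSum (D.g x) e (D.torsion x Y)
    (connCurv D.conn x X V + (D.torsion x X * T - T * D.torsion x X))
  have h1 : ∀ X Y, innerSum (D.g x) e (D.torsion x Y)
      (covE (D.pullConn f) (fun q => D.varTors f A v q (0, 1)) (x, 0) (X, 0)) =
      innerSum (D.g x) e (D.torsion x Y)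
      (covE (D.pullConn f) (fun q => D.varTors f A v q (X, 0)) (x, 0) (0, 1)) - C X Y := by
    intro X Y
    have h2 := hv.innerSum_cov_varTors h hx he' (hξ Y) (X, 0) (0, 1)
    rw [hf, hv.fderiv_base hx, hv.varTors_initial hx] at h2
    rw [h2]
    simp only [C, innerSum_add_right]
    ring
  let N : Model n → Model n → ℝ := fun X Y => ∑ j, D.g x (D.nablaXi x X Y (e j)) (T (e j))
  have h3 : ∀ X Y, innerSum (D.g x) e
      (covE (D.pullConn f) (fun q => D.varTors f A v q (Y, 0)) (x, 0) (X, 0)) T =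
      N X Y + innerSum (D.g x) e (D.torsion x (D.Γ x X Y)) T := by
    intro X Y
    simp only [innerSum, hv.cov_varTors h hx, N, map_add, add_apply, Finset.sum_add_distrib]
    rfl
  -- In the Koszul expression the base terms and the terms in `Γ` cancel because the pulled-back
  -- connection is torsion-free. Only derivatives of the torsion and the error `C` survive.
  have h4 : ∀ X Y,
      (fderiv ℝ (fun p => D.targetMetric f A v p (Y, 0) (0, 1)) (x, 0) (X, 0)
      + fderiv ℝ (fun p => D.targetMetric f A v p (X, 0) (0, 1)) (x, 0) (Y, 0)
      - fderiv ℝ (fun p => D.targetMetric f A v p (X, 0) (Y, 0)) (x, 0) (0, 1)) / 2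
      - D.targetMetric f A v (x, 0) (D.Γ x X Y, 0) (0, 1) =
      1 / 2 * (N X Y + N Y X - C X Y - C Y X) := by
    intro X Y
    have h5 : innerEnd (D.g x) (D.torsion x (D.Γ x X Y)) T =
        innerSum (D.g x) e (D.torsion x (D.Γ x X Y)) T :=
      contract_eq_sum he ⟨by simp, by simp, by simp, by simp⟩
    rw [hv.fderiv_targetMetric h hx he, hv.fderiv_targetMetric h hx he,
      hv.fderiv_targetMetric h hx he, targetMetric_eq, hf]
    simp only [hv.fderiv_base hx, hv.varTors_initial hx, hv.cov_base hx, ← hT, ← hV, h1, h3, h5]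
    rw [hv.cov_base_symm h hx (X, 0) (0, 1), hv.cov_base_symm h hx (Y, 0) (0, 1),
      h.Γ_symm hU Y X, innerSum_comm symm (covE _ _ _ _) (D.torsion x Y),
      symm (covV _ _ _ _) Y]
    ring
  have hN : IsBilin N := by
    have hb := fun Z => h.isBilin_nablaXi hU Z
    refine ⟨fun a a' b => ?_, fun c a b => ?_, fun a b b' => ?_, fun c a b => ?_⟩
    · simp only [N, (hb _).add_left, map_add, add_apply, Finset.sum_add_distrib]
    · simp only [N, (hb _).smul_left, map_smul, smul_apply, Finset.smul_sum]
    · simp only [N, (hb _).add_right, map_add, add_apply, Finset.sum_add_distrib]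
    · simp only [N, (hb _).smul_right, map_smul, smul_apply, Finset.smul_sum]
  have hC : IsBilin C := by
    refine ⟨fun a a' b => ?_, fun c a b => ?_, fun a b b' => ?_, fun c a b => ?_⟩
    · simp only [C, innerSum, IsGood.connCurv_add_left, map_add, add_apply, sub_apply,
        clm_mul_apply, map_sub, ← Finset.sum_add_distrib]
      exact Finset.sum_congr rfl fun i _ => by ring
    · simp only [C, innerSum, IsGood.connCurv_smul_left, map_smul, map_add, add_apply, sub_apply,
        smul_apply, clm_mul_apply, map_sub, smul_eq_mul]
      rw [Finset.mul_sum]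
      exact Finset.sum_congr rfl fun i _ => by ring
    · simp only [C, innerSum, map_add, add_apply, Finset.sum_add_distrib]
      ring
    · simp only [C, innerSum, map_smul, smul_apply, smul_eq_mul,
        ← Finset.mul_sum]
  have hB : IsBilin fun X Y => 1 / 2 * (N X Y + N Y X - C X Y - C Y X) := by
    refine ⟨fun a a' b => ?_, fun c a b => ?_, fun a b b' => ?_, fun c a b => ?_⟩
    · rw [hN.add_left, hN.add_right, hC.add_left, hC.add_right]; ring
    · rw [hN.smul_left, hN.smul_right, hC.smul_left, hC.smul_right]; simp only [smul_eq_mul]; ring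
    · rw [hN.add_left, hN.add_right, hC.add_left, hC.add_right]; ring
    · rw [hN.smul_left, hN.smul_right, hC.smul_left, hC.smul_right]; simp only [smul_eq_mul]; ring
  -- On the diagonal the commutator is paired with one of its own factors and vanishes.
  have h6 : ∀ i, C (e i) (e i) = innerSum (D.g x) e (D.torsion x (e i))
      (connCurv D.conn x (e i) V) := by
    intro i
    simp only [C, innerSum_add_right]
    rw [innerSum_commutator symm he (h.ξ_isComplEnd hU (e i)).skew hTskew, add_zero]
  rw [tensionPairing, contract_congr h4, contract_eq_sum he hB]
  have h7 : ∀ i, 1 / 2 * (N (e i) (e i) + N (e i) (e i) - C (e i) (e i) - C (e i) (e i)) =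
      N (e i) (e i) - C (e i) (e i) := fun i => by ring
  rw [Finset.sum_congr rfl fun i _ => h7 i]
  simp only [Finset.sum_sub_distrib, h6, N, innerSum, curvTors]
  rw [sub_eq_add_neg]
  congr 1
  · rw [Finset.sum_comm, ← Finset.sum_neg_distrib]
    refine Finset.sum_congr rfl fun j _ => ?_
    rw [h.dStarXi_eq hU he]
    simp
  · simp only [← Finset.sum_neg_distrib]
    refine Finset.sum_congr rfl fun i _ => Finset.sum_congr rfl fun j _ => ?_
    rw [symm]
    simp only [curv, LinearMap.mk₂_apply, ContinuousLinearMap.coe_coe, neg_apply, map_neg]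
    rfl

end IsVariation

end LocalData

/-! ### The minimal connection in a chart -/

/-- The complement of the stabiliser algebra as a subspace. -/
def complEnd {n : ℕ} (G : Form n) (A : Model n →L[ℝ] Model n) (v : Model n) :
    Submodule ℝ (Model n →ₗ[ℝ] Model n) where
  carrier := {a | IsComplEnd G A v a}
  zero_mem' := ⟨by simp, by simp⟩
  add_mem' := by
    rintro a b ⟨h1, h2⟩ ⟨k1, k2⟩
    refine ⟨fun X Y => ?_, fun Y => ?_⟩
    · simp only [LinearMap.add_apply, map_add, add_apply, h1, k1]; ring
    · simp only [LinearMap.add_apply, map_add]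
      linear_combination (norm := module) h2 Y + k2 Y
  smul_mem' := by
    rintro c a ⟨h1, h2⟩
    refine ⟨fun X Y => ?_, fun Y => ?_⟩
    · simp only [LinearMap.smul_apply, map_smul, smul_apply, h1, smul_neg]
    · simp only [LinearMap.smul_apply, map_smul, smul_eq_mul]
      linear_combination (norm := module) c • h2 Y

namespace LocalData

variable {n : ℕ}

/-- `W'` is the covariant derivative at `y`, in the direction `Z`, of the vector field `W` for the
minimal connection `∇ + ξ`. -/
structure HasCov (D : LocalData n) (y Z : Model n) (W : Model n → Model n) (W' : Model n) :
    Prop where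
  diff : DifferentiableAt ℝ W y
  eq : fderiv ℝ W y Z + D.Γ y Z (W y) + D.ξ y Z (W y) = W'

/-- The covariant derivative of the intrinsic torsion for the minimal connection. -/
def covXi (D : LocalData n) (y Z : Model n) : Tors n :=
  LinearMap.mk₂ ℝ (fun X Y => fderiv ℝ D.torsion y Z X Y + D.Γ y Z (D.ξ y X Y)
      - D.ξ y (D.Γ y Z X) Y - D.ξ y X (D.Γ y Z Y) + D.ξ y Z (D.ξ y X Y) - D.ξ y (D.ξ y Z X) Y
      - D.ξ y X (D.ξ y Z Y))
    (by intros; simp only [map_add, add_apply, LinearMap.add_apply]; abel)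
    (by intros; simp only [map_smul, smul_apply, LinearMap.smul_apply]; module)
    (by intros; simp only [map_add]; abel)
    (by intros; simp only [map_smul]; module)

variable {D : LocalData n} {U : Set (Model n)} {y Z : Model n} {V W V' W' : Model n → Model n}
  {a b : Model n} {e : Fin (2 * n + 1) → Model n}

namespace HasCov

theorem add (hV : D.HasCov y Z V a) (hW : D.HasCov y Z W b) :
    D.HasCov y Z (fun z => V z + W z) (a + b) := by
  refine ⟨hV.diff.fun_add hW.diff, ?_⟩
  rw [fderiv_fun_add hV.diff hW.diff, ← hV.eq, ← hW.eq]
  simp only [add_apply, map_add]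
  abel

theorem neg (hV : D.HasCov y Z V a) : D.HasCov y Z (fun z => -V z) (-a) := by
  refine ⟨hV.diff.fun_neg, ?_⟩
  rw [fderiv_fun_neg, ← hV.eq]
  simp only [neg_apply, map_neg]
  abel

theorem sub (hV : D.HasCov y Z V a) (hW : D.HasCov y Z W b) :
    D.HasCov y Z (fun z => V z - W z) (a - b) := by
  simpa only [sub_eq_add_neg] using hV.add hW.neg

theorem smul {c : Model n → ℝ} (hc : DifferentiableAt ℝ c y) (hV : D.HasCov y Z V a) :
    D.HasCov y Z (fun z => c z • V z) (fderiv ℝ c y Z • V y + c y • a) := by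
  refine ⟨hc.fun_smul hV.diff, ?_⟩
  rw [fderiv_fun_smul hc hV.diff, ← hV.eq]
  simp only [add_apply, smul_apply, ContinuousLinearMap.smulRight_apply, map_smul, smul_add]
  abel

theorem const_smul (c : ℝ) (hV : D.HasCov y Z V a) : D.HasCov y Z (fun z => c • V z) (c • a) := by
  simpa using hV.smul (differentiableAt_const c)

theorem congr (hV : D.HasCov y Z V a) (hW : D.HasCov y Z W b) (hVW : V =ᶠ[nhds y] W) : a = b := by
  rw [← hV.eq, ← hW.eq, hVW.fderiv_eq, hVW.self_of_nhds]

end HasCov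

/-- An affine field with prescribed value and vanishing covariant derivative at `y`. Evaluated on
such fields, identities between tensors differentiate to identities between their covariant
derivatives. -/
theorem exists_hasCov (D : LocalData n) (y X : Model n) :
    ∃ V : Model n → Model n, V y = X ∧ ∀ Z, D.HasCov y Z V 0 := by
  let L : Model n →L[ℝ] Model n := LinearMap.toContinuousLinearMap
    ((D.Γ y).flip X + (D.ξ y).flip X)
  have hL : HasFDerivAt (fun z => X - (L z - L y)) (-L) y :=
    ((L.hasFDerivAt (x := y)).sub_const (L y)).const_sub X
  refine ⟨fun z => X - (L z - L y), by simp, fun Z => ⟨hL.differentiableAt, ?_⟩⟩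
  rw [hL.fderiv]
  simp [L]

namespace IsGood

variable (h : D.IsGood U) (hy : y ∈ U)

include h hy

theorem hasCov_φ (hV : D.HasCov y Z V a) : D.HasCov y Z (fun z => D.φ z (V z)) (D.φ y a) := by
  have hφ := h.differentiableAt_φ hy
  refine ⟨hφ.clm_apply hV.diff, ?_⟩
  have h1 := h.isMetricConn.fderiv_end hy Z
  rw [tors_conn] at h1
  rw [fderiv_clm_apply hφ hV.diff, ← hV.eq]
  simp only [add_apply, ContinuousLinearMap.comp_apply, ContinuousLinearMap.flip_apply, h1,
    sub_apply, clm_mul_apply, map_add, conn, torsion, toCLM₂_apply]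
  abel

theorem hasCov_ζ : D.HasCov y Z D.ζ 0 := by
  refine ⟨h.differentiableAt_ζ hy, ?_⟩
  have h1 := h.isMetricConn.fderiv_vec hy Z
  rw [tors_conn] at h1
  rw [h1]
  simp only [conn, torsion, toCLM₂_apply, add_apply]
  abel

theorem differentiableAt_inner (hV : D.HasCov y Z V a) (hW : D.HasCov y Z W b) :
    DifferentiableAt ℝ (fun z => D.g z (V z) (W z)) y :=
  ((h.differentiableAt_g hy).clm_apply hV.diff).clm_apply hW.diff

theorem fderiv_inner_cov (hV : D.HasCov y Z V a) (hW : D.HasCov y Z W b) :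
    fderiv ℝ (fun z => D.g z (V z) (W z)) y Z = D.g y a (W y) + D.g y (V y) b := by
  have h1 := (h.ξ_mem hy).1 Z (V y) (W y)
  rw [h.fderiv_inner hy hV.diff hW.diff, ← hV.eq, ← hW.eq]
  simp only [map_add, add_apply, h1]
  ring

theorem hasCov_ξ (hV : D.HasCov y Z V a) (hW : D.HasCov y Z W b) :
    D.HasCov y Z (fun z => D.ξ z (V z) (W z))
      (D.covXi y Z (V y) (W y) + D.ξ y a (W y) + D.ξ y (V y) b) := by
  have hd := h.differentiableAt_torsion hy
  have hd1 := hd.clm_apply hV.diff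
  refine ⟨hd1.clm_apply hW.diff, ?_⟩
  have h1 : fderiv ℝ (fun z => D.ξ z (V z) (W z)) y Z = fderiv ℝ D.torsion y Z (V y) (W y)
      + D.ξ y (fderiv ℝ V y Z) (W y) + D.ξ y (V y) (fderiv ℝ W y Z) := by
    change fderiv ℝ (fun z => D.torsion z (V z) (W z)) y Z = _
    rw [fderiv_clm_apply hd1 hW.diff]
    simp only [add_apply, ContinuousLinearMap.comp_apply, ContinuousLinearMap.flip_apply,
      fderiv_clm_apply hd hV.diff]
    simp only [torsion, toCLM₂_apply]
    abel
  rw [h1, ← hV.eq, ← hW.eq]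
  simp only [covXi, LinearMap.mk₂_apply, map_add, LinearMap.add_apply]
  abel

/-- Covariant derivatives of the intrinsic torsion satisfy the equations of `ξ`. -/
theorem covXi_mem (Z : Model n) : D.covXi y Z ∈ torsionSpace (D.g y) (D.φ y) (D.ζ y) := by
  have hU := h.nhds_mem hy
  constructor
  · intro X Y T
    obtain ⟨V, rfl, hV⟩ := D.exists_hasCov y X
    obtain ⟨W, rfl, hW⟩ := D.exists_hasCov y Y
    obtain ⟨Q, rfl, hQ⟩ := D.exists_hasCov y T
    have h1 : (fun z => D.g z (D.ξ z (V z) (W z)) (Q z)) =ᶠ[nhds y]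
        fun z => -D.g z (W z) (D.ξ z (V z) (Q z)) := by
      filter_upwards [hU] with z hz using (h.ξ_mem hz).1 _ _ _
    have h2 := congrArg (fun l : Model n →L[ℝ] ℝ => l Z) h1.fderiv_eq
    simp only [fderiv_fun_neg, neg_apply] at h2
    rw [h.fderiv_inner_cov hy (h.hasCov_ξ hy (hV Z) (hW Z)) (hQ Z),
      h.fderiv_inner_cov hy (hW Z) (h.hasCov_ξ hy (hV Z) (hQ Z))] at h2
    simpa using h2
  · intro X Y
    obtain ⟨V, rfl, hV⟩ := D.exists_hasCov y X
    obtain ⟨W, rfl, hW⟩ := D.exists_hasCov y Y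
    have hζ := h.hasCov_ζ hy (Z := Z)
    have hξ := h.hasCov_ξ hy (hV Z) (hW Z)
    have hξζ := h.hasCov_ξ hy (hV Z) hζ
    have hξφ := h.hasCov_ξ hy (hV Z) (h.hasCov_φ hy (hW Z))
    have h1 := ((h.hasCov_φ hy hξ).add hξφ).congr
      (((h.hasCov_φ hy hξζ).smul (h.differentiableAt_inner hy hζ (hW Z))).add
        (hζ.smul (h.differentiableAt_inner hy hζ hξφ)))
      (by filter_upwards [hU] with z hz using (h.ξ_mem hz).2 _ _)
    rw [h.fderiv_inner_cov hy hζ (hW Z), h.fderiv_inner_cov hy hζ hξφ] at h1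
    simpa using h1

theorem nablaXi_eq (Z X Y : Model n) : D.nablaXi y Z X Y = D.covXi y Z X Y
    - D.ξ y Z (D.ξ y X Y) + D.ξ y (D.ξ y Z X) Y + D.ξ y X (D.ξ y Z Y) := by
  have hd := h.differentiableAt_torsion hy
  have h1 : ∀ X Y Z, fderiv ℝ (fun z => D.ξ z X Y) y Z = fderiv ℝ D.torsion y Z X Y := by
    intro X Y Z
    rw [← fderiv_apply_const hd, ← fderiv_apply_const (hd.clm_apply (differentiableAt_const _))]
    rfl
  simp only [nablaXi, h1, covXi, LinearMap.mk₂_apply]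
  abel

/-- The coderivative of `ξ` in terms of the minimal connection. -/
theorem dStarXi_eq_cov (he : IsOrtho (D.g y) e) (Y : Model n) : D.dStarXi y Y =
    -∑ i, D.covXi y (e i) (e i) Y - D.ξ y (∑ i, D.ξ y (e i) (e i)) Y := by
  rw [h.dStarXi_eq hy he]
  -- On the diagonal the two terms `ξ_{e_i} ξ_{e_i} Y` cancel, which leaves the single correction
  -- `ξ_{tr ξ}`.
  simp only [h.nablaXi_eq hy, Finset.sum_add_distrib, Finset.sum_sub_distrib, map_sum,
    LinearMap.sum_apply]
  abel

/-- The minimal connection preserves `𝔪`, and the correction is a value of `ξ`, so `d^*ξ` lies in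
`𝔪`. It is therefore an admissible direction in which to rotate the section. -/
theorem exists_dStarXi : ∃ σ : Model n →L[ℝ] Model n, (∀ Y, σ Y = D.dStarXi y Y) ∧
    IsComplEnd (D.g y) (D.φ y) (D.ζ y) σ := by
  obtain ⟨e, he⟩ := h.exists_isOrtho hy
  have hm : ∀ {S : Tors n}, S ∈ torsionSpace (D.g y) (D.φ y) (D.ζ y) → ∀ X,
      S X ∈ complEnd (D.g y) (D.φ y) (D.ζ y) := fun hS X => ⟨hS.1 X, hS.2 X⟩
  let σ : Model n →ₗ[ℝ] Model n :=
    -∑ i, D.covXi y (e i) (e i) - D.ξ y (∑ i, D.ξ y (e i) (e i))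
  have hσ : ∀ Y, σ Y = D.dStarXi y Y := fun Y => by
    rw [h.dStarXi_eq_cov hy he]
    simp only [σ, LinearMap.sub_apply, LinearMap.neg_apply, LinearMap.sum_apply]
  exact ⟨LinearMap.toContinuousLinearMap σ, hσ,
    sub_mem (neg_mem (sum_mem fun i _ => hm (h.covXi_mem hy (e i)) (e i))) (hm (h.ξ_mem hy) _)⟩

end IsGood

end LocalData

/-! ### Cayley transforms -/

section Cayley

variable {n : ℕ} {G : Form n} {B : Model n →L[ℝ] Model n}

/-- A fixed vector `x` of a skew `B` satisfies `|x|² = ⟨Bx, x⟩ = 0`. Hence the Cayley transform, a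
rational path of rotations, is defined for every skew field. -/
theorem isUnit_one_sub_of_skew (pos : ∀ X, X ≠ 0 → 0 < G X X) (symm : ∀ X Y, G X Y = G Y X)
    (hB : ∀ X Y, G (B X) Y = -G X (B Y)) : IsUnit (1 - B) := by
  have hinj : Function.Injective ((1 - B : Model n →L[ℝ] Model n) : Model n →ₗ[ℝ] Model n) := by
    rw [← LinearMap.ker_eq_bot, LinearMap.ker_eq_bot']
    intro x hx
    by_contra hx0
    have h1 : x - B x = 0 := hx
    have h2 := hB x x
    rw [symm (B x), ← sub_eq_zero.mp h1] at h2
    linarith [pos x hx0]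
  let L := (LinearEquiv.ofInjectiveEndo _ hinj).toContinuousLinearEquiv
  have hL : (L : Model n →L[ℝ] Model n) = 1 - B := by
    ext1 x; rfl
  rw [← hL]
  exact ⟨L.toUnit, rfl⟩

/-- The Cayley transform `(1 - B)⁻¹ (1 + B)`. -/
def cayley (B : Model n →L[ℝ] Model n) : Model n →L[ℝ] Model n := Ring.inverse (1 - B) * (1 + B)

theorem sub_mul_cayley (hu : IsUnit (1 - B)) : (1 - B) * cayley B = 1 + B := by
  rw [cayley, ← mul_assoc, Ring.mul_inverse_cancel _ hu, one_mul]

theorem cayley_mul_sub (hu : IsUnit (1 - B)) : cayley B * (1 - B) = 1 + B := by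
  have hc : (1 + B) * (1 - B) = (1 - B) * (1 + B) := by
    simp only [add_mul, mul_sub, sub_mul, mul_add, one_mul, mul_one]; abel
  rw [cayley, mul_assoc, hc, ← mul_assoc, Ring.inverse_mul_cancel _ hu, one_mul]

theorem cayley_neg_mul (hu : IsUnit (1 - B)) (hu' : IsUnit (1 + B)) :
    cayley (-B) * cayley B = 1 := by
  have h1 : cayley (-B) = Ring.inverse (1 + B) * (1 - B) := by
    rw [cayley, sub_neg_eq_add, ← sub_eq_add_neg]
  rw [h1, mul_assoc, sub_mul_cayley hu, Ring.inverse_mul_cancel _ hu']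

theorem cayley_isometry (hu : IsUnit (1 - B)) (hB : ∀ X Y, G (B X) Y = -G X (B Y))
    (X Y : Model n) : G (cayley B X) (cayley B Y) = G X Y := by
  have h1 : ∀ X, ∃ X', X = X' - B X' ∧ cayley B X = X' + B X' := by
    intro X
    refine ⟨Ring.inverse (1 - B) X, ?_, ?_⟩
    · have := congrArg (fun f : Model n →L[ℝ] Model n => f X) (Ring.mul_inverse_cancel _ hu)
      simpa [clm_mul_apply] using this.symm
    · have := congrArg (fun f : Model n →L[ℝ] Model n => f (Ring.inverse (1 - B) X))
        (cayley_mul_sub hu)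
      have h2 := congrArg (fun f : Model n →L[ℝ] Model n => f X) (Ring.mul_inverse_cancel _ hu)
      simp only [clm_mul_apply, add_apply, one_apply_eq_self] at this h2
      rw [h2] at this
      exact this
  obtain ⟨X', hX, hX2⟩ := h1 X
  obtain ⟨Y', hY, hY2⟩ := h1 Y
  rw [hX2, hY2, hX, hY]
  simp only [map_add, map_sub, add_apply, sub_apply, hB]
  ring

/-- The endomorphisms `1 + B` and `1 - B` are adjoint to each other. -/
theorem det_one_add_eq {e : Fin (2 * n + 1) → Model n} (he : IsOrtho G e)
    (symm : ∀ X Y, G X Y = G Y X) (hB : ∀ X Y, G (B X) Y = -G X (B Y)) :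
    LinearMap.det ((1 + B : Model n →L[ℝ] Model n) : Model n →ₗ[ℝ] Model n) =
      LinearMap.det ((1 - B : Model n →L[ℝ] Model n) : Model n →ₗ[ℝ] Model n) := by
  have hc : Fintype.card (Fin (2 * n + 1)) = Module.finrank ℝ (Model n) := by simp
  let b := basisOfLinearIndependentOfCardEqFinrank he.linearIndependent hc
  have hb : ∀ i, b i = e i := fun i => by simp [b]
  have hr : ∀ v i, b.repr v i = G (e i) v := by
    intro v i
    have h := b.sum_repr v
    simp only [hb] at h
    conv_rhs => rw [← h]
    simp [he i]
  rw [← LinearMap.det_toMatrix b, ← LinearMap.det_toMatrix b, ← Matrix.det_transpose]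
  congr 1
  ext i j
  simp only [Matrix.transpose_apply, LinearMap.toMatrix_apply, hr, hb]
  have h1 := hB (e j) (e i)
  have h2 := symm (e j) (e i)
  have h3 := symm (B (e j)) (e i)
  simp
  linarith

theorem det_cayley {e : Fin (2 * n + 1) → Model n} (he : IsOrtho G e)
    (symm : ∀ X Y, G X Y = G Y X) (hB : ∀ X Y, G (B X) Y = -G X (B Y)) (hu : IsUnit (1 - B)) :
    LinearMap.det (cayley B : Model n →ₗ[ℝ] Model n) = 1 := by
  have h1 := congrArg (fun f : Model n →L[ℝ] Model n => LinearMap.det (f : Model n →ₗ[ℝ] Model n))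
    (sub_mul_cayley hu)
  have h2 : LinearMap.det ((1 - B : Model n →L[ℝ] Model n) : Model n →ₗ[ℝ] Model n) ≠ 0 := by
    obtain ⟨u, hu⟩ := hu
    have h3 : ((u : Model n →L[ℝ] Model n) : Model n →ₗ[ℝ] Model n) *
        ((u⁻¹ : (Model n →L[ℝ] Model n)ˣ) : Model n →L[ℝ] Model n) = 1 := by
      ext1 x
      exact congrArg (fun f : Model n →L[ℝ] Model n => f x) u.mul_inv
    have h4 := congrArg LinearMap.det h3
    rw [map_mul, map_one, hu] at h4
    exact left_ne_zero_of_mul_eq_one h4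
  have h3 : LinearMap.det (((1 - B) * cayley B : Model n →L[ℝ] Model n) : Model n →ₗ[ℝ] Model n) =
      LinearMap.det ((1 - B : Model n →L[ℝ] Model n) : Model n →ₗ[ℝ] Model n) *
      LinearMap.det (cayley B : Model n →ₗ[ℝ] Model n) := by
    rw [← map_mul]
    rfl
  simp only [h3, det_one_add_eq he symm hB] at h1
  exact mul_left_cancel₀ h2 (h1.trans (mul_one _).symm)

end Cayley

/-! ### Harmonic maps in a chart -/

theorem contDiffOn_cayley {P : Type*} [NormedAddCommGroup P] [NormedSpace ℝ P] {Ω : Set P}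
    {B : P → Model n →L[ℝ] Model n} (hB : ContDiffOn ℝ ∞ B Ω)
    (hu : ∀ p ∈ Ω, IsUnit (1 - B p)) : ContDiffOn ℝ ∞ (fun p => cayley (B p)) Ω := by
  intro p hp
  have h1 : ContDiffWithinAt ℝ ∞ (fun p => 1 - B p) Ω p := contDiffWithinAt_const.sub (hB p hp)
  have h2 : ContDiffAt ℝ ∞ Ring.inverse (1 - B p) := by
    obtain ⟨u, hu⟩ := hu p hp
    rw [← hu]
    exact contDiffAt_ringInverse ℝ u
  have h3 : ContDiffWithinAt ℝ ∞ (fun p => Ring.inverse (1 - B p)) Ω p :=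
    ContDiffAt.comp_contDiffWithinAt (g := Ring.inverse) (f := fun p => 1 - B p) p h2 h1
  exact h3.mul (contDiffWithinAt_const.add (hB p hp))

namespace LocalData

variable {n : ℕ} {D : LocalData n} {U : Set (Model n)} {y : Model n}
  {e : Fin (2 * n + 1) → Model n}

namespace IsGood

variable (h : D.IsGood U)

include h

/-- The variation of the section obtained by translating the base point. -/
theorem isVariation_translate (w : Model n) : D.IsVariation U
    {p | p.1 ∈ U ∧ p.1 + p.2 • w ∈ U} (fun p => p.1 + p.2 • w)
    (fun p => D.φ (p.1 + p.2 • w)) (fun p => D.ζ (p.1 + p.2 • w)) := by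
  have hf : ContDiff ℝ ∞ (fun p : Model n × ℝ => p.1 + p.2 • w) :=
    contDiff_fst.add (contDiff_snd.smul contDiff_const)
  have hm : Set.MapsTo (fun p : Model n × ℝ => p.1 + p.2 • w)
      {p | p.1 ∈ U ∧ p.1 + p.2 • w ∈ U} U := fun p hp => hp.2
  refine ⟨(h.isOpen.preimage continuous_fst).inter (h.isOpen.preimage hf.continuous),
    hf.contDiffOn, h.smooth_φ.comp hf.contDiffOn hm, h.smooth_ζ.comp hf.contDiffOn hm, hm,
    fun p _ => ⟨1, fun _ _ => rfl, ?_, rfl, rfl⟩, fun x _ => by simp⟩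
  exact LinearMap.det_id

/-- A skew-symmetric field of endomorphisms that extends a given one. -/
theorem exists_skew_extension (hy : y ∈ U) {σ : Model n →L[ℝ] Model n}
    (hσ : ∀ X Y, D.g y (σ X) Y = -D.g y X (σ Y)) :
    ∃ s : Model n → Model n →L[ℝ] Model n, s y = σ ∧ ContDiffOn ℝ ∞ s U ∧
      ∀ z ∈ U, ∀ X Y, D.g z (s z X) Y = -D.g z X (s z Y) := by
  let s : Model n → Model n →L[ℝ] Model n := fun z => LinearMap.toContinuousLinearMap
    { toFun := fun Y => sharp (D.g z) fun a => D.g y (σ Y) a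
      map_add' := fun Y Y' => by
        simp [sharp, contract, add_smul, Finset.sum_add_distrib]
      map_smul' := fun c Y => by
        simp [sharp, contract, mul_smul, Finset.smul_sum, smul_comm c] }
  have hs : ∀ z ∈ U, ∀ X Y, D.g z (s z X) Y = D.g y (σ X) Y := fun z hz X Y =>
    inner_sharp (h.isACM z hz).symm (h.isACM z hz).pos (D.g y (σ X) : Model n →ₗ[ℝ] ℝ) Y
  refine ⟨s, ?_, ?_, ?_⟩
  · ext1 X
    exact ext_inner (h.isACM y hy).pos (hs y hy X)
  · refine contDiffOn_clm_apply.mpr fun Y z hz => ?_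
    exact (contDiffAt_contract (h.contDiffAt_g hz) (h.isACM z hz).symm (h.isACM z hz).pos
      (B := fun _ a b => D.g y (σ Y) a • b) fun a b => contDiffAt_const).contDiffWithinAt
  · intro z hz X Y
    rw [hs z hz, (h.isACM z hz).symm X, hs z hz, hσ, (h.isACM y hy).symm X]

/-- The variation of the section obtained by rotating it by Cayley transforms. -/
theorem isVariation_rotate {s : Model n → Model n →L[ℝ] Model n} (hs : ContDiffOn ℝ ∞ s U)
    (hskew : ∀ z ∈ U, ∀ X Y, D.g z (s z X) Y = -D.g z X (s z Y)) : D.IsVariation U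
    {p | p.1 ∈ U} (fun p => p.1)
    (fun p => cayley ((p.2 / 2) • s p.1) * D.φ p.1 * cayley (-((p.2 / 2) • s p.1)))
    (fun p => cayley ((p.2 / 2) • s p.1) (D.ζ p.1)) := by
  have hfst : ContDiffOn ℝ ∞ (fun p : Model n × ℝ => p.1) {p | p.1 ∈ U} := contDiff_fst.contDiffOn
  have hm : Set.MapsTo (fun p : Model n × ℝ => p.1) {p | p.1 ∈ U} U := fun p hp => hp
  have hB : ContDiffOn ℝ ∞ (fun p : Model n × ℝ => (p.2 / 2) • s p.1) {p | p.1 ∈ U} :=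
    (contDiff_snd.div_const 2).contDiffOn.fun_smul (hs.comp hfst hm)
  have hBs : ∀ p : Model n × ℝ, p.1 ∈ U → ∀ X Y, D.g p.1 (((p.2 / 2) • s p.1) X) Y =
      -D.g p.1 X (((p.2 / 2) • s p.1) Y) := by
    intro p hp X Y
    simp [hskew p.1 hp]
  have hBs' : ∀ p : Model n × ℝ, p.1 ∈ U → ∀ X Y, D.g p.1 ((-((p.2 / 2) • s p.1)) X) Y =
      -D.g p.1 X ((-((p.2 / 2) • s p.1)) Y) := by
    intro p hp X Y
    simp [hskew p.1 hp]
  have hu : ∀ p : Model n × ℝ, p.1 ∈ U → IsUnit (1 - (p.2 / 2) • s p.1) := fun p hp =>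
    isUnit_one_sub_of_skew (h.isACM _ hp).pos (h.isACM _ hp).symm (hBs p hp)
  have hu' : ∀ p : Model n × ℝ, p.1 ∈ U → IsUnit (1 - -((p.2 / 2) • s p.1)) := fun p hp =>
    isUnit_one_sub_of_skew (h.isACM _ hp).pos (h.isACM _ hp).symm (hBs' p hp)
  have hc1 := contDiffOn_cayley hB hu
  have hc2 := contDiffOn_cayley hB.neg hu'
  refine ⟨h.isOpen.preimage continuous_fst, hfst, (hc1.mul (h.smooth_φ.comp hfst hm)).mul hc2,
    hc1.clm_apply (h.smooth_ζ.comp hfst hm), hm, fun p hp => ?_, fun x _ => ?_⟩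
  · obtain ⟨e, he⟩ := h.exists_isOrtho (y := p.1) hp
    refine ⟨cayley ((p.2 / 2) • s p.1), cayley_isometry (hu p hp) (hBs p hp),
      det_cayley he (h.isACM _ hp).symm (hBs p hp) (hu p hp), ?_, rfl⟩
    have h1 := cayley_neg_mul (hu p hp) (by simpa using hu' p hp)
    change cayley ((p.2 / 2) • s p.1) * D.φ p.1 * cayley (-((p.2 / 2) • s p.1)) *
      cayley ((p.2 / 2) • s p.1) = cayley ((p.2 / 2) • s p.1) * D.φ p.1
    rw [mul_assoc, h1, mul_one]
  · have h1 : ((0 : ℝ) / 2) • s x = 0 := by rw [zero_div]; exact zero_smul ℝ (s x)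
    simp only [h1, cayley, neg_zero, sub_zero, add_zero, Ring.inverse_one, mul_one, one_mul]
    exact ⟨trivial, trivial, rfl⟩

-- The rotation changes `φ` and `ζ` at the rates `[s, φ]` and `s ζ`. Since `s y` lies in `𝔪`, it is
-- itself the vertical velocity, and the sign is that of `varTors`.
set_option maxHeartbeats 400000 in
theorem varTors_rotate (hy : y ∈ U) {s : Model n → Model n →L[ℝ] Model n}
    (hs : ContDiffOn ℝ ∞ s U)
    (hskew : ∀ z ∈ U, ∀ X Y, D.g z (s z X) Y = -D.g z X (s z Y))
    (hσ : IsComplEnd (D.g y) (D.φ y) (D.ζ y) (s y)) (Y : Model n) :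
    D.varTors (fun p => p.1)
      (fun p => cayley ((p.2 / 2) • s p.1) * D.φ p.1 * cayley (-((p.2 / 2) • s p.1)))
      (fun p => cayley ((p.2 / 2) • s p.1) (D.ζ p.1)) (y, 0) (0, 1) Y = -s y Y := by
  have hv := h.isVariation_rotate hs hskew
  have hΩ : {p : Model n × ℝ | p.1 ∈ U} ∈ nhds (y, (0 : ℝ)) := hv.isOpen.mem_nhds hy
  obtain ⟨-, hA0, hv0⟩ := hv.initial y hy
  have hfst : DifferentiableAt ℝ (fun p : Model n × ℝ => p.1) (y, 0) := differentiableAt_fst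
  have hfst' : fderiv ℝ (fun p : Model n × ℝ => p.1) (y, 0) (0, 1) = 0 := by
    rw [hasFDerivAt_fst.fderiv]; rfl
  have hsd : DifferentiableAt ℝ s y :=
    (hs.contDiffAt (h.nhds_mem hy)).differentiableAt (by simp)
  have pull : ∀ {W : Type} [NormedAddCommGroup W] [NormedSpace ℝ W] {F : Model n → W},
      DifferentiableAt ℝ F y → DifferentiableAt ℝ (fun p : Model n × ℝ => F p.1) (y, 0) ∧
      fderiv ℝ (fun p : Model n × ℝ => F p.1) (y, 0) (0, 1) = 0 := by
    intro W _ _ F hF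
    have h1 : HasFDerivAt (fun p : Model n × ℝ => F p.1) ((fderiv ℝ F y).comp
        (ContinuousLinearMap.fst ℝ (Model n) ℝ)) (y, 0) :=
      HasFDerivAt.comp (g := F) (f := Prod.fst) (y, (0 : ℝ)) hF.hasFDerivAt hasFDerivAt_fst
    exact ⟨h1.differentiableAt, by rw [h1.fderiv]; simp⟩
  obtain ⟨hs1, hs2⟩ := pull hsd
  obtain ⟨hφ1, hφ2⟩ := pull (h.differentiableAt_φ hy)
  obtain ⟨hζ1, hζ2⟩ := pull (h.differentiableAt_ζ hy)
  set B : Model n × ℝ → Model n →L[ℝ] Model n := fun p => (p.2 / 2) • s p.1 with hBdef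
  have hsnd : HasFDerivAt (fun p : Model n × ℝ => p.2 / 2)
      ((2 : ℝ)⁻¹ • ContinuousLinearMap.snd ℝ (Model n) ℝ) (y, 0) := by
    simpa [div_eq_inv_mul] using (hasFDerivAt_snd (𝕜 := ℝ) (p := (y, (0 : ℝ)))).const_mul (2 : ℝ)⁻¹
  have hB0 : B (y, 0) = 0 := by
    rw [hBdef]; simp only [zero_div]; exact zero_smul ℝ (s y)
  have hB : DifferentiableAt ℝ B (y, 0) := hsnd.differentiableAt.fun_smul hs1
  have hB' : fderiv ℝ B (y, 0) (0, 1) = (1 / 2 : ℝ) • s y := by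
    rw [hBdef, fderiv_fun_smul hsnd.differentiableAt hs1, hsnd.fderiv]
    simp
  have hu : ∀ p : Model n × ℝ, p.1 ∈ U → IsUnit (1 - B p) := fun p hp =>
    isUnit_one_sub_of_skew (h.isACM _ hp).pos (h.isACM _ hp).symm fun X Y => by
      simp [hBdef, hskew p.1 hp]
  have hu' : ∀ p : Model n × ℝ, p.1 ∈ U → IsUnit (1 + B p) := fun p hp => by
    have := isUnit_one_sub_of_skew (B := -B p) (h.isACM _ hp).pos (h.isACM _ hp).symm fun X Y => by
      simp [hBdef, hskew p.1 hp]
    rwa [sub_neg_eq_add] at this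
  have hBsm : ContDiffOn ℝ ∞ B {p | p.1 ∈ U} :=
    (contDiff_snd.div_const 2).contDiffOn.fun_smul
      (hs.comp contDiff_fst.contDiffOn fun p hp => hp)
  have ha : DifferentiableAt ℝ (fun p => cayley (B p)) (y, 0) :=
    ((contDiffOn_cayley hBsm hu).contDiffAt hΩ).differentiableAt (by simp)
  have ha0 : cayley (B (y, 0)) = 1 := by
    simp only [hB0, cayley, sub_zero, add_zero, Ring.inverse_one, mul_one]
  -- At `B = 0` the derivative of the Cayley transform is `2 dB`; the factor `½` in the rotation
  -- compensates it.
  have ha' : fderiv ℝ (fun p => cayley (B p)) (y, 0) (0, 1) = s y := by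
    have h1 : (fun p => (1 - B p) * cayley (B p)) =ᶠ[nhds (y, 0)] fun p => 1 + B p := by
      filter_upwards [hΩ] with p hp using sub_mul_cayley (hu p hp)
    have h2 := congrArg (fun l : Model n × ℝ →L[ℝ] Model n →L[ℝ] Model n => l (0, 1)) h1.fderiv_eq
    beta_reduce at h2
    rw [fderiv_mul_apply ((differentiableAt_const _).fun_sub hB) ha, ha0, hB0,
      fderiv_const_sub, fderiv_const_add, neg_apply, hB', mul_one, sub_zero, one_mul] at h2
    rw [← sub_eq_zero] at h2 ⊢
    rw [← h2]
    module
  have hA : DifferentiableAt ℝ (fun p => cayley (B p) * D.φ p.1 * cayley (-B p)) (y, 0) :=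
    (hv.smooth_end.contDiffAt hΩ).differentiableAt (by simp)
  have hA' : fderiv ℝ (fun p => cayley (B p) * D.φ p.1 * cayley (-B p)) (y, 0) (0, 1) =
      s y * D.φ y - D.φ y * s y := by
    -- Multiplication by `cayley (B p)` avoids differentiating the inverse factor.
    have h1 : (fun p => cayley (B p) * D.φ p.1 * cayley (-B p) * cayley (B p)) =ᶠ[nhds (y, 0)]
        fun p => cayley (B p) * D.φ p.1 := by
      filter_upwards [hΩ] with p hp
      rw [mul_assoc, cayley_neg_mul (hu p hp) (hu' p hp), mul_one]
    have h2 := congrArg (fun l : Model n × ℝ →L[ℝ] Model n →L[ℝ] Model n => l (0, 1)) h1.fderiv_eq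
    beta_reduce at h2
    have ha1 : cayley (-B (y, 0)) = 1 := by
      rw [hB0, neg_zero, ← hB0, ha0]
    rw [fderiv_mul_apply hA ha, fderiv_mul_apply ha hφ1, ha', hφ2, ha0, ha1, mul_one, mul_zero,
      add_zero, one_mul, mul_one] at h2
    exact eq_sub_of_add_eq h2
  have hv' : fderiv ℝ (fun p => cayley (B p) (D.ζ p.1)) (y, 0) (0, 1) = s y (D.ζ y) := by
    rw [fderiv_clm_apply ha hζ1]
    simp [ha', hζ2]
  have hA2 : fderiv ℝ (fun p : Model n × ℝ => cayley ((p.2 / 2) • s p.1) * D.φ p.1 *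
      cayley (-((p.2 / 2) • s p.1))) (y, 0) (0, 1) = s y * D.φ y - D.φ y * s y := hA'
  have hv2 : fderiv ℝ (fun p : Model n × ℝ => cayley ((p.2 / 2) • s p.1) (D.ζ p.1)) (y, 0) (0, 1) =
      s y (D.ζ y) := hv'
  have hκ : D.pullConn (fun p => p.1) (y, 0) (0, 1) = 0 := by
    rw [pullConn, ContinuousLinearMap.comp_apply, hfst', map_zero]
  have h3 := hσ.vertEnd_eq (a := (s y : Model n →ₗ[ℝ] Model n)) (h.isACM y hy)
    (N := s y * D.φ y - D.φ y * s y) (fun X => rfl) Y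
  simp only [varTors, tors, toCLM₂_apply, torsLin, LinearMap.mk₂_apply, covE, covV, hκ, hA2, hv2,
    zero_mul, mul_zero, zero_apply, add_zero, sub_zero]
  rw [hA0, hv0]
  exact congrArg Neg.neg h3

/-- The structure is a harmonic map if and only if the horizontal and the vertical component of
the tension field vanish. -/
theorem isHarmonicMapOn_iff : D.IsHarmonicMapOn U ↔ ∀ y ∈ U, (∀ Y, D.dStarXi y Y = 0) ∧
    ∀ e, IsOrtho (D.g y) e → ∀ X, curvTors (D.g y) (D.curv y) e (D.ξ y) X = 0 := by
  constructor
  · intro H y hy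
    have h1 : ∀ Y, D.dStarXi y Y = 0 := by
      -- Rotating by `d^*ξ` keeps base points fixed, so the tension pairing is `|d^*ξ|²`.
      obtain ⟨σ, hσ, hc⟩ := h.exists_dStarXi hy
      obtain ⟨s, hs0, hs, hskew⟩ := h.exists_skew_extension hy hc.skew
      obtain ⟨e, he⟩ := h.exists_isOrtho hy
      have hv := h.isVariation_rotate hs hskew
      have h2 := H _ _ _ _ hv y hy
      have h3 : fderiv ℝ (fun p : Model n × ℝ => p.1) (y, 0) (0, 1) = 0 := by
        rw [hasFDerivAt_fst.fderiv]; rfl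
      rw [hv.tensionPairing_eq h hy he, h3] at h2
      simp only [h.varTors_rotate hy hs hskew (by rwa [hs0]), hs0, ← hσ, curvTors, map_zero,
        LinearMap.zero_apply, zero_apply, Finset.sum_const_zero, add_zero, map_neg,
        Finset.sum_neg_distrib, neg_neg] at h2
      have h4 : ∀ X, 0 ≤ D.g y X X := fun X => by
        by_cases hX : X = 0
        · simp [hX]
        · exact ((h.isACM y hy).pos X hX).le
      have h5 := (Finset.sum_eq_zero_iff_of_nonneg fun j _ => h4 (σ (e j))).mp h2
      intro Y
      rw [← hσ, ← he.expand Y, map_sum]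
      refine Finset.sum_eq_zero fun j _ => ?_
      have h6 : σ (e j) = 0 := by
        by_contra hX
        exact ((h.isACM y hy).pos _ hX).ne' (h5 j (Finset.mem_univ j))
      rw [map_smul, h6, smul_zero]
    refine ⟨h1, fun e he X => ?_⟩
    -- Once `d^*ξ = 0`, the vertical velocity of a translation is irrelevant and only the curvature
    -- term remains.
    have hv := h.isVariation_translate X
    have hy' : (y, (0 : ℝ)) ∈ {p : Model n × ℝ | p.1 ∈ U ∧ p.1 + p.2 • X ∈ U} :=
      ⟨hy, by simpa using hy⟩
    have h2 := H _ _ _ _ hv y hy'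
    have h3 : fderiv ℝ (fun p : Model n × ℝ => p.1 + p.2 • X) (y, 0) (0, 1) = X := by
      have : HasFDerivAt (fun p : Model n × ℝ => p.1 + p.2 • X)
          (ContinuousLinearMap.fst ℝ (Model n) ℝ +
            (ContinuousLinearMap.snd ℝ (Model n) ℝ).smulRight X) (y, 0) :=
        hasFDerivAt_fst.add ((ContinuousLinearMap.snd ℝ (Model n) ℝ).smulRight X).hasFDerivAt
      rw [this.fderiv]
      simp
    rw [hv.tensionPairing_eq h hy' he, h3] at h2
    simpa [h1] using h2
  · intro H Ω f A v hv x hx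
    have hU := hv.mem_of_mem hx
    obtain ⟨e, he⟩ := h.exists_isOrtho hU
    rw [hv.tensionPairing_eq h hx he, (H x hU).2 e he]
    simp [(H x hU).1]

end IsGood

end LocalData

/-! ### The skew-symmetric part of the `*`-Ricci tensor -/

section TwistAlgebra

variable {n : ℕ} {G : Form n} {φ : Model n →L[ℝ] Model n} {ζ : Model n}
  {e : Fin (2 * n + 1) → Model n} {R : Curv n}

/-- The endomorphism `a ↦ J a` of the complement of the stabiliser algebra that is `ε φ` on the
horizontal component and `δ φ` on the mixed component. -/
def twist (G : Form n) (φ : Model n →L[ℝ] Model n) (ζ : Model n) (ε δ : ℝ)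
    (a : Model n →ₗ[ℝ] Model n) : Model n →ₗ[ℝ] Model n where
  toFun Y := ε • (φ (a Y) - G ζ Y • φ (a ζ)) + δ • (G ζ Y • φ (a ζ) - G (φ (a ζ)) Y • ζ)
  map_add' X Y := by simp only [map_add]; module
  map_smul' c Y := by simp only [map_smul, smul_eq_mul, RingHom.id_apply]; module

theorem twist_apply (ε δ : ℝ) (a : Model n →ₗ[ℝ] Model n) (Y : Model n) :
    twist G φ ζ ε δ a Y = ε • (φ (a Y) - G ζ Y • φ (a ζ))
      + δ • (G ζ Y • φ (a ζ) - G (φ (a ζ)) Y • ζ) := rfl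

/-- The horizontal component of an endomorphism in the complement of the stabiliser algebra. -/
def horEnd (G : Form n) (ζ : Model n) (a : Model n →ₗ[ℝ] Model n) (Y : Model n) : Model n :=
  a Y - G ζ Y • a ζ + G (a ζ) Y • ζ

namespace IsComplEnd

variable {a : Model n →ₗ[ℝ] Model n}

theorem inner_vec (h : IsACM G φ ζ) (ha : IsComplEnd G φ ζ a) : G ζ (a ζ) = 0 := by
  have := ha.skew ζ ζ
  rw [h.symm] at this
  linarith

theorem inner_apply (ha : IsComplEnd G φ ζ a) (Y : Model n) : G ζ (a Y) = -G (a ζ) Y := by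
  rw [ha.skew, neg_neg]

theorem horEnd_phi (h : IsACM G φ ζ) (ha : IsComplEnd G φ ζ a) (Y : Model n) :
    horEnd G ζ a (φ Y) = -φ (horEnd G ζ a Y) := by
  have h1 := ha.comm Y
  rw [ha.inner_apply] at h1
  simp only [horEnd, h.eta_phi, map_add, map_sub, map_smul, h.phi_zeta]
  linear_combination (norm := module) h1

theorem inner_horEnd (h : IsACM G φ ζ) (ha : IsComplEnd G φ ζ a) (Y : Model n) :
    G ζ (horEnd G ζ a Y) = 0 := by
  simp only [horEnd, map_add, map_sub, map_smul, ha.inner_apply Y, ha.inner_vec h, h.unit,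
    smul_eq_mul]
  ring

theorem phi_phi_horEnd (h : IsACM G φ ζ) (ha : IsComplEnd G φ ζ a) (Y : Model n) :
    φ (φ (horEnd G ζ a Y)) = -horEnd G ζ a Y := by
  rw [h.sq, ha.inner_horEnd h, zero_smul, add_zero]

theorem horEnd_skew (h : IsACM G φ ζ) (ha : IsComplEnd G φ ζ a) (Y W : Model n) :
    G (horEnd G ζ a Y) W = -G Y (horEnd G ζ a W) := by
  simp only [horEnd, map_add, map_sub, map_smul, add_apply, sub_apply, smul_apply, smul_eq_mul,
    ha.skew Y W, h.symm Y ζ, h.symm Y (a ζ)]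
  ring

/-- `[J s, φ]` in terms of the components of `s`. -/
theorem twist_comm (h : IsACM G φ ζ) (ha : IsComplEnd G φ ζ a) (ε δ : ℝ) (Y : Model n) :
    twist G φ ζ ε δ a (φ Y) - φ (twist G φ ζ ε δ a Y) =
      (2 * ε) • horEnd G ζ a Y + δ • (G ζ Y • a ζ - G (a ζ) Y • ζ) := by
  have h1 := congrArg φ (ha.horEnd_phi h Y)
  rw [map_neg, ha.phi_phi_horEnd h, neg_neg] at h1
  have h2 := ha.phi_phi_horEnd h Y
  have h3 := h.sq (a ζ)
  rw [ha.inner_vec h] at h3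
  have h4 : G (φ (a ζ)) (φ Y) = G (a ζ) Y := by
    rw [h.compat, ha.inner_vec h, zero_mul, sub_zero]
  simp only [horEnd, h.eta_phi, map_add, map_sub, map_smul, h.phi_zeta, smul_zero, add_zero]
    at h1 h2
  simp only [twist_apply, h.eta_phi, map_add, map_sub, map_smul, h.phi_zeta, h4, horEnd]
  linear_combination (norm := module) ε • h1 - ε • h2 - (δ * G ζ Y) • h3

/-- `[[a, J a], φ]` in terms of the components of `a`. -/
theorem comm_twist_comm (h : IsACM G φ ζ) (ha : IsComplEnd G φ ζ a) (ε δ : ℝ) (Y : Model n) :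
    (a (twist G φ ζ ε δ a (φ Y)) - twist G φ ζ ε δ a (a (φ Y)))
      - φ (a (twist G φ ζ ε δ a Y) - twist G φ ζ ε δ a (a Y)) =
    (δ + ε) • (G (horEnd G ζ a (a ζ)) Y • ζ - G ζ Y • horEnd G ζ a (a ζ)) := by
  obtain ⟨A, hA⟩ : ∃ A : Model n →ₗ[ℝ] Model n, ∀ Y, horEnd G ζ a Y = A Y :=
    ⟨⟨⟨horEnd G ζ a, fun X Y => by simp only [horEnd, map_add]; module⟩, fun c Y => by
      simp only [horEnd, map_smul, smul_eq_mul, RingHom.id_apply]; module⟩, fun _ => rfl⟩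
  have h1 : ∀ Y, A (φ Y) = -φ (A Y) := fun Y => by rw [← hA, ← hA, ha.horEnd_phi h]
  have h2 : ∀ Y, G ζ (A Y) = 0 := fun Y => by rw [← hA, ha.inner_horEnd h]
  have h3 : ∀ Y, φ (φ (A Y)) = -A Y := fun Y => by rw [← hA, ha.phi_phi_horEnd h]
  have h4 : ∀ Y W, G (A Y) W = -G Y (A W) := fun Y W => by
    rw [← hA, ← hA, ha.horEnd_skew h]
  have h5 : A ζ = 0 := ext_inner h.pos fun Z => by
    rw [h4, h2, map_zero, zero_apply, neg_zero]
  have h6 := ha.inner_vec h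
  rw [hA]
  have h7 : ∀ Y, a Y = A Y + G ζ Y • a ζ - G (a ζ) Y • ζ := fun Y => by
    rw [← hA, horEnd]; abel
  generalize a ζ = x at h6 h7 ⊢
  have h8 : φ (φ x) = -x := by rw [h.sq, h6, zero_smul, add_zero]
  have h9 : ∀ Y, twist G φ ζ ε δ a Y = ε • φ (A Y) + δ • (G ζ Y • φ x + G x (φ Y) • ζ) :=
    fun Y => by
      have h10 : a ζ = x := by rw [h7, h5, h.unit, h.symm, h6]; module
      rw [twist_apply, h10, h7 Y, h.skew]
      simp only [map_add, map_sub, map_smul, h.phi_zeta]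
      module
  have h11 : ∀ Y, G x (φ (φ Y)) = -G x Y := fun Y => by
    rw [h.sq, map_add, map_neg, map_smul, h.symm x ζ, h6, smul_zero, add_zero]
  have h12 : G x ζ = 0 := by rw [h.symm, h6]
  have h13 : G x (φ x) = 0 := by
    have := h.skew x x
    rw [h.symm] at this
    linarith
  have h14 : ∀ Y, G x (A Y) = -G (A x) Y := fun Y => by rw [h4, neg_neg]
  simp only [h9, h7, map_add, map_sub, map_smul, map_neg, h1, h2, h3, h5, h6, h8, h11, h12, h13,
    h14, h.phi_zeta, h.eta_phi, h.unit, smul_eq_mul, map_zero]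
  module

end IsComplEnd

/-- `J` as a linear map. -/
def twistHom (G : Form n) (φ : Model n →L[ℝ] Model n) (ζ : Model n) (ε δ : ℝ) :
    (Model n →ₗ[ℝ] Model n) →ₗ[ℝ] Model n →ₗ[ℝ] Model n where
  toFun := twist G φ ζ ε δ
  map_add' a b := by
    ext1 Y
    simp only [twist_apply, LinearMap.add_apply, map_add, add_apply]
    module
  map_smul' c a := by
    ext1 Y
    simp only [twist_apply, LinearMap.smul_apply, map_smul, smul_apply, smul_eq_mul,
      RingHom.id_apply]
    module

/-- The curvature `R` splits into the part of the covariant derivative `T` of the torsion `ξ`, a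
quadratic part, and a part `E` with values in the stabiliser algebra. -/
structure CurvSplit (G : Form n) (φ : Model n →L[ℝ] Model n) (ζ : Model n) (R : Curv n)
    (ξ : Tors n) (T : Model n → Tors n) (E : Model n → Model n → Model n →ₗ[ℝ] Model n) :
    Prop where
  split : ∀ X Y Z, R X Y Z = T X Y Z - T Y X Z - (ξ X (ξ Y Z) - ξ Y (ξ X Z))
    + ξ (ξ X Y - ξ Y X) Z - E X Y Z
  bilin : ∀ Y, IsBilin fun a b => T a b Y
  comm : ∀ X Y Z, E X Y (φ Z) = φ (E X Y Z)
  vec : ∀ X Y, E X Y ζ = 0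
  skew : ∀ X Y Z W, G (E X Y Z) W = -G Z (E X Y W)

variable {ξ : Tors n} {T : Model n → Tors n} {E : Model n → Model n → Model n →ₗ[ℝ] Model n}
  {ε δ : ℝ}

/-- Trace the defining relation of the torsion space. The term `η(e_i) φ ξ_{e_i}ζ` sums to `φ ξ_ζ ζ
= 0`. -/
theorem trace_phi_of_torsion (h : IsACM G φ ζ) (he : IsOrtho G e) (hξ : ξ ∈ torsionSpace G φ ζ)
    (hζ : ξ ζ = 0) : ∃ c : ℝ, ∑ i, ξ (e i) (φ (e i)) = -φ (∑ i, ξ (e i) (e i)) + c • ζ := by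
  refine ⟨∑ i, G ζ (ξ (e i) (φ (e i))), ?_⟩
  have h1 : ∑ i, G ζ (e i) • φ (ξ (e i) ζ) = 0 := by
    have := he.sum_zeta h (B := fun a b => φ (ξ a b))
      ⟨by simp, by simp, by simp, by simp⟩ ζ
    simpa [hζ] using this
  have h2 : ∑ i, (φ (ξ (e i) (e i)) + ξ (e i) (φ (e i))) = _ :=
    Finset.sum_congr rfl fun i _ => hξ.2 (e i) (e i)
  rw [Finset.sum_add_distrib, Finset.sum_add_distrib, h1, zero_add, ← Finset.sum_smul] at h2
  rw [map_sum, ← h2]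
  abel

/-- The trace of the torsion is a multiple of `ζ` in the nearly Kähler-like case. -/
theorem phi_trace_of_twist (h : IsACM G φ ζ) (he : IsOrtho G e) (hξ : ξ ∈ torsionSpace G φ ζ)
    (hζ : ξ ζ = 0) (hJ : ∀ X, ξ (φ X) = twist G φ ζ ε δ (ξ X)) :
    φ (∑ i, ξ (e i) (e i)) = ε • φ (∑ i, ξ (e i) (e i)) := by
  obtain ⟨c, hc⟩ := trace_phi_of_torsion h he hξ hζ
  have h1 := he.sum_phi_phi h (B := fun a b => ξ a b) ⟨by simp, by simp, by simp, by simp⟩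
  rw [hζ, LinearMap.zero_apply, sub_zero] at h1
  have h2 : φ (∑ i, ξ (φ (e i)) (φ (e i))) = ε • φ (φ (∑ i, ξ (e i) (φ (e i)))) := by
    simp only [map_sum, Finset.smul_sum, hJ, twist_apply, map_add, map_smul, map_sub, h.eta_phi,
      h.phi_zeta]
    refine Finset.sum_congr rfl fun i _ => ?_
    module
  have h3 : φ (φ (φ (∑ i, ξ (e i) (e i)))) = -φ (∑ i, ξ (e i) (e i)) := by
    rw [h.sq, h.eta_phi, zero_smul, add_zero]
  rw [h1] at h2
  refine h2.trans ?_
  rw [hc, map_add, map_smul, h.phi_zeta, smul_zero, add_zero, map_neg, map_neg, h3, neg_neg]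

/-- For `ε = 1` this is the preceding trace relation. For `ε = -1` both sides vanish, because `φ(tr
ξ) = -φ(tr ξ)`. -/
theorem torsion_trace_phi (h : IsACM G φ ζ) (he : IsOrtho G e) (hξ : ξ ∈ torsionSpace G φ ζ)
    (hζ : ξ ζ = 0) (hJ : ∀ X, ξ (φ X) = twist G φ ζ ε δ (ξ X)) (hε : ε = 1 ∨ ε = -1) :
    ξ (∑ i, ξ (e i) (φ (e i))) = -(ε • ξ (φ (∑ i, ξ (e i) (e i)))) := by
  obtain ⟨c, hc⟩ := trace_phi_of_torsion h he hξ hζ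
  have h1 := phi_trace_of_twist h he hξ hζ hJ
  rw [hc, map_add, map_smul, hζ, map_neg, smul_zero, add_zero]
  rcases hε with rfl | rfl
  · rw [one_smul]
  · have h2 : φ (∑ i, ξ (e i) (e i)) = 0 := by
      rw [neg_one_smul, eq_neg_iff_add_eq_zero, ← two_smul ℝ] at h1
      exact (smul_eq_zero.mp h1).resolve_left two_ne_zero
    simp only [h2, map_zero, smul_zero]

/-- The derivative part of `R` traced against `φ` is twice `∑ T_{e_i}(φ e_i)`, and `hJT` rewrites it
as `2J` of the divergence. The term `ξ_{[ξ,·]}` adds the correction by the trace. -/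
theorem CurvSplit.curvPhi_eq (hs : CurvSplit G φ ζ R ξ T E) (h : IsACM G φ ζ) (he : IsOrtho G e)
    (hξ : ξ ∈ torsionSpace G φ ζ) (hζ : ξ ζ = 0) (hJ : ∀ X, ξ (φ X) = twist G φ ζ ε δ (ξ X))
    (hJT : ∀ Z X, T Z (φ X) = twist G φ ζ ε δ (T Z X)) (hε : ε = 1 ∨ ε = -1) (Z : Model n) :
    curvPhi R φ e Z =
      (2 : ℝ) • twist G φ ζ ε δ (∑ i, T (e i) (e i) - ε • ξ (∑ i, ξ (e i) (e i))) Z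
      - ∑ i, (ξ (e i) (twist G φ ζ ε δ (ξ (e i)) Z) - twist G φ ζ ε δ (ξ (e i)) (ξ (e i) Z))
      - ∑ i, E (e i) (φ (e i)) Z := by
  have h1 := he.sum_phi h (hs.bilin Z)
  have h2 : ∑ i, T (e i) (φ (e i)) Z = twist G φ ζ ε δ (∑ i, T (e i) (e i)) Z := by
    change _ = twistHom G φ ζ ε δ (∑ i, T (e i) (e i)) Z
    rw [map_sum, LinearMap.sum_apply]
    exact Finset.sum_congr rfl fun i _ => by rw [hJT]; rfl
  have h3 : ∑ i, ξ (φ (e i)) (e i) = -∑ i, ξ (e i) (φ (e i)) :=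
    he.sum_phi h (B := fun a b => ξ a b) ⟨by simp, by simp, by simp, by simp⟩
  have h4 : twist G φ ζ ε δ (∑ i, T (e i) (e i) - ε • ξ (∑ i, ξ (e i) (e i))) =
      twist G φ ζ ε δ (∑ i, T (e i) (e i)) - ε • ξ (φ (∑ i, ξ (e i) (e i))) := by
    rw [hJ]
    change twistHom G φ ζ ε δ _ = _
    rw [map_sub, map_smul]
    rfl
  have h5 : ∑ i, ξ (ξ (e i) (φ (e i)) - ξ (φ (e i)) (e i)) Z =
      -((2 * ε) • ξ (φ (∑ i, ξ (e i) (e i))) Z) := by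
    rw [← LinearMap.sum_apply, ← map_sum, Finset.sum_sub_distrib, h3, sub_neg_eq_add, map_add,
      torsion_trace_phi h he hξ hζ hJ hε]
    simp only [LinearMap.add_apply, LinearMap.neg_apply, LinearMap.smul_apply]
    module
  have h6 : curvPhi R φ e Z = ∑ i, T (e i) (φ (e i)) Z - ∑ i, T (φ (e i)) (e i) Z
      - ∑ i, (ξ (e i) (ξ (φ (e i)) Z) - ξ (φ (e i)) (ξ (e i) Z))
      + ∑ i, ξ (ξ (e i) (φ (e i)) - ξ (φ (e i)) (e i)) Z - ∑ i, E (e i) (φ (e i)) Z := by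
    rw [curvPhi_apply, ← Finset.sum_sub_distrib, ← Finset.sum_sub_distrib,
      ← Finset.sum_add_distrib, ← Finset.sum_sub_distrib]
    exact Finset.sum_congr rfl fun i _ => hs.split _ _ _
  rw [h6, h1, h2, h4, h5, LinearMap.sub_apply, LinearMap.smul_apply]
  simp only [← hJ]
  module

/-- The commutator of `∑ R_{e_i, φ e_i}` and `φ`. -/
theorem CurvSplit.curvPhi_comm (hs : CurvSplit G φ ζ R ξ T E) (h : IsACM G φ ζ) (he : IsOrtho G e)
    (hξ : ξ ∈ torsionSpace G φ ζ) (hζ : ξ ζ = 0) (hJ : ∀ X, ξ (φ X) = twist G φ ζ ε δ (ξ X))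
    (hT : ∀ Z, T Z ∈ torsionSpace G φ ζ)
    (hJT : ∀ Z X, T Z (φ X) = twist G φ ζ ε δ (T Z X)) (hε : ε = 1 ∨ ε = -1)
    {s : Model n →ₗ[ℝ] Model n}
    (hst : s = ∑ i, T (e i) (e i) - ε • ξ (∑ i, ξ (e i) (e i))) (Y : Model n) :
    IsComplEnd G φ ζ s ∧ curvPhi R φ e (φ Y) - φ (curvPhi R φ e Y) =
      (4 * ε) • horEnd G ζ s Y + (2 * δ) • (G ζ Y • s ζ - G (s ζ) Y • ζ)
      - (δ + ε) • (G (∑ i, horEnd G ζ (ξ (e i)) (ξ (e i) ζ)) Y • ζ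
        - G ζ Y • ∑ i, horEnd G ζ (ξ (e i)) (ξ (e i) ζ)) := by
  have hm : ∀ {S : Tors n}, S ∈ torsionSpace G φ ζ → ∀ X, S X ∈ complEnd G φ ζ :=
    fun hS X => ⟨hS.1 X, hS.2 X⟩
  have hsc : IsComplEnd G φ ζ s := by
    have : s ∈ complEnd G φ ζ := by
      rw [hst]
      exact sub_mem (sum_mem fun i _ => hm (hT _) _) (Submodule.smul_mem _ _ (hm hξ _))
    exact this
  refine ⟨hsc, ?_⟩
  have h1 := hsc.twist_comm h ε δ Y
  have h2 : ∑ i, _ = ∑ i, _ :=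
    Finset.sum_congr rfl fun i _ => IsComplEnd.comm_twist_comm h (hm hξ (e i)) ε δ Y
  have h3 : ∑ i, (G (horEnd G ζ (ξ (e i)) (ξ (e i) ζ)) Y • ζ
      - G ζ Y • horEnd G ζ (ξ (e i)) (ξ (e i) ζ)) =
      G (∑ i, horEnd G ζ (ξ (e i)) (ξ (e i) ζ)) Y • ζ
        - G ζ Y • ∑ i, horEnd G ζ (ξ (e i)) (ξ (e i) ζ) := by
    rw [Finset.sum_sub_distrib, Finset.smul_sum, map_sum, sum_apply, Finset.sum_smul]
  have h4 : ∀ f g : Fin (2 * n + 1) → Model n, ∑ i, (f i - φ (g i)) = ∑ i, f i - φ (∑ i, g i) :=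
    fun f g => by rw [Finset.sum_sub_distrib, map_sum]
  rw [h4, ← Finset.smul_sum, h3] at h2
  -- The stabiliser part commutes with `φ` and disappears. The quadratic commutators contribute only
  -- with the factor `δ + ε`.
  rw [hs.curvPhi_eq h he hξ hζ hJ hJT hε, hs.curvPhi_eq h he hξ hζ hJ hJT hε, ← hst]
  simp only [hs.comm, map_sub, map_smul, ← map_sum]
  linear_combination (norm := module) (2 : ℝ) • h1 - h2

end TwistAlgebra

/-! ### Symmetry of the `*`-Ricci tensor and harmonicity -/

namespace LocalData

variable {n : ℕ} {D : LocalData n} {U : Set (Model n)} {y : Model n}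
  {e : Fin (2 * n + 1) → Model n} {ε δ : ℝ}

/-- The intrinsic torsion satisfies `ξ_ζ = 0` and `ξ_{φ X} = J ξ_X` on `U`. -/
structure IsTwisted (D : LocalData n) (U : Set (Model n)) (ε δ : ℝ) : Prop where
  zeta : ∀ z ∈ U, D.ξ z (D.ζ z) = 0
  phi : ∀ z ∈ U, ∀ X, D.ξ z (D.φ z X) = twist (D.g z) (D.φ z) (D.ζ z) ε δ (D.ξ z X)

namespace IsGood

variable (h : D.IsGood U) (hy : y ∈ U)

include h hy

theorem exists_curvSplit :
    ∃ E, CurvSplit (D.g y) (D.φ y) (D.ζ y) (D.curv y) (D.ξ y) (D.covXi y) E := by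
  have hm := h.isMetricConn
  have hU := h.nhds_mem hy
  have h1 := (hm.smooth_minimal.contDiffAt hU).differentiableAt (by simp)
  have h2 := connCurv_parallel_vec h1 ((h.smooth_ζ.contDiffAt hU).of_le two_le_infty)
    (by filter_upwards [hU] with q hq u using hm.fderiv_vec hq u)
  have h3 := connCurv_parallel_end h1 ((h.smooth_φ.contDiffAt hU).of_le two_le_infty)
    (by filter_upwards [hU] with q hq u using hm.fderiv_end hq u)
  have h4 := connCurv_parallel_form h1 ((h.contDiffAt_g hy).of_le two_le_infty)
    (by filter_upwards [hU] with q hq u using hm.fderiv_metric hq u)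
  have h5 := connCurv_add (h.differentiableAt_conn hy) (h.differentiableAt_torsion hy)
  have h6 : (fun q => D.conn q + tors D.conn D.g D.φ D.ζ q) = fun q => D.conn q + D.torsion q :=
    funext fun q => by rw [tors_conn]
  rw [h6] at h2 h3 h4
  refine ⟨fun X Y => (connCurv (fun q => D.conn q + D.torsion q) y X Y :
    Model n →L[ℝ] Model n), fun X Y Z => ?_, fun Y => ?_, fun X Y Z => ?_, h2, h4⟩
  · have hΓ := h.Γ_symm hy X Y
    have h7 : D.curv y X Y Z = -connCurv D.conn y X Y Z := rfl
    have h8 : ∀ X Y, D.conn y X Y = D.Γ y X Y := fun _ _ => rfl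
    have h9 : ∀ X Y, D.torsion y X Y = D.ξ y X Y := fun _ _ => rfl
    rw [h7]
    simp only [ContinuousLinearMap.coe_coe, h5, covXi, LinearMap.mk₂_apply, add_apply, sub_apply,
      clm_mul_apply, hΓ, map_sub, LinearMap.sub_apply, h8, h9]
    abel
  · refine ⟨fun a a' b => ?_, fun c a b => ?_, fun a b b' => ?_, fun c a b => ?_⟩
    · simp only [covXi, LinearMap.mk₂_apply, map_add, add_apply, LinearMap.add_apply]
      abel
    · simp only [covXi, LinearMap.mk₂_apply, map_smul, smul_apply, LinearMap.smul_apply]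
      module
    · rw [map_add, LinearMap.add_apply]
    · rw [map_smul, LinearMap.smul_apply]
  · exact congrArg (fun f => f Z) (h3 X Y)

/-- `J` is built from `g`, `φ` and `ζ`, which are parallel for the minimal connection, so the
derivative of `ξ` inherits the relation. -/
theorem covXi_twist (ht : D.IsTwisted U ε δ) (Z X : Model n) :
    D.covXi y Z (D.φ y X) = twist (D.g y) (D.φ y) (D.ζ y) ε δ (D.covXi y Z X) := by
  have hU := h.nhds_mem hy
  ext1 Y
  obtain ⟨V, rfl, hV⟩ := D.exists_hasCov y X
  obtain ⟨W, rfl, hW⟩ := D.exists_hasCov y Y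
  have hζ := h.hasCov_ζ hy (Z := Z)
  have c1 := h.hasCov_ξ hy (h.hasCov_φ hy (hV Z)) (hW Z)
  have c2 := h.hasCov_φ hy (h.hasCov_ξ hy (hV Z) (hW Z))
  have c3 := h.hasCov_φ hy (h.hasCov_ξ hy (hV Z) hζ)
  have d1 := h.differentiableAt_inner hy hζ (hW Z)
  have c4 := hζ.smul (h.differentiableAt_inner hy c3 (hW Z))
  have h1 := c1.congr (((c2.sub (c3.smul d1)).const_smul ε).add
    (((c3.smul d1).sub c4).const_smul δ))
    (by filter_upwards [hU] with z hz using congrArg (fun f => f (W z)) (ht.phi z hz (V z)))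
  rw [h.fderiv_inner_cov hy hζ (hW Z), h.fderiv_inner_cov hy c3 (hW Z)] at h1
  rw [twist_apply]
  simpa using h1

/-- With `P = ∑ R_{e_i, φ e_i}` one has `2(Ric^*(Y,W) - Ric^*(W,Y)) = ⟨[P, φ]Y, W⟩`, and
`CurvSplit.curvPhi_comm` evaluates the commutator. The vector `p` collects the quadratic terms. -/
theorem twisted_skew (ht : D.IsTwisted U ε δ) (hε : ε = 1 ∨ ε = -1) (he : IsOrtho (D.g y) e)
    {s : Model n →ₗ[ℝ] Model n}
    (hs : s = ∑ i, D.covXi y (e i) (e i) - ε • D.ξ y (∑ i, D.ξ y (e i) (e i))) :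
    IsComplEnd (D.g y) (D.φ y) (D.ζ y) s ∧ ∃ p, ∀ Y W,
      2 * (D.ricStar y Y W - D.ricStar y W Y) = D.g y ((4 * ε) • horEnd (D.g y) (D.ζ y) s Y
        + (2 * δ) • (D.g y (D.ζ y) Y • s (D.ζ y) - D.g y (s (D.ζ y)) Y • D.ζ y)
        - (δ + ε) • (D.g y p Y • D.ζ y - D.g y (D.ζ y) Y • p)) W := by
  have acm := h.isACM y hy
  obtain ⟨E, hE⟩ := h.exists_curvSplit hy
  have h1 := hE.curvPhi_comm acm he (h.ξ_mem hy) (ht.zeta y hy) (ht.phi y hy) (h.covXi_mem hy)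
    (h.covXi_twist hy ht) hε hs
  refine ⟨(h1 0).1, ∑ i, horEnd (D.g y) (D.ζ y) (D.ξ y (e i)) (D.ξ y (e i) (D.ζ y)),
    fun Y W => ?_⟩
  rw [← (h1 Y).2, h.ricStar_eq_curvPhi hy he, h.ricStar_eq_curvPhi hy he]
  have h2 := curvPhi_skew (e := e) (φ := D.φ y) (h.isCurv hy) acm.symm W (D.φ y Y)
  have h3 := acm.skew (curvPhi (D.curv y) (D.φ y) e Y) W
  have h4 := acm.symm W (curvPhi (D.curv y) (D.φ y) e (D.φ y Y))
  rw [map_sub, sub_apply]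
  linarith

/-- If `ε + δ = 0`, then the `*`-Ricci tensor is symmetric if and only if the twisted divergence of
the intrinsic torsion vanishes. -/
theorem ricStar_symm_iff (ht : D.IsTwisted U ε (-ε)) (hε : ε = 1 ∨ ε = -1)
    (he : IsOrtho (D.g y) e) : (∀ X Y, D.ricStar y X Y = D.ricStar y Y X) ↔
      ∀ Y, ∑ i, D.covXi y (e i) (e i) Y = ε • D.ξ y (∑ i, D.ξ y (e i) (e i)) Y := by
  have acm := h.isACM y hy
  obtain ⟨s, hs⟩ : ∃ s, s = ∑ i, D.covXi y (e i) (e i) - ε • D.ξ y (∑ i, D.ξ y (e i) (e i)) :=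
    ⟨_, rfl⟩
  obtain ⟨hc, p, hp⟩ := h.twisted_skew hy ht hε he hs
  have hε0 : ε ≠ 0 := by rcases hε with rfl | rfl <;> norm_num
  have h1 : ∀ Y, s Y = ∑ i, D.covXi y (e i) (e i) Y - ε • D.ξ y (∑ i, D.ξ y (e i) (e i)) Y :=
    fun Y => by rw [hs]; simp only [LinearMap.sub_apply, LinearMap.sum_apply, LinearMap.smul_apply]
  simp only [neg_add_cancel, zero_smul, sub_zero] at hp
  constructor
  · intro H
    have h2 : ∀ Y, (4 * ε) • horEnd (D.g y) (D.ζ y) s Y + (2 * -ε) • (D.g y (D.ζ y) Y • s (D.ζ y)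
        - D.g y (s (D.ζ y)) Y • D.ζ y) = 0 := fun Y => by
      refine eq_zero_of_forall_inner acm.pos fun W => ?_
      rw [← hp, H Y W, sub_self, mul_zero]
    -- The horizontal component vanishes at `ζ`, so `Y = ζ` isolates `s ζ`.
    have h3 : s (D.ζ y) = 0 := by
      have h4 := h2 (D.ζ y)
      have h5 := hc.inner_vec acm
      simp only [horEnd, acm.unit, acm.symm (s (D.ζ y)) (D.ζ y), h5] at h4
      have h6 : (2 * -ε) • s (D.ζ y) = 0 := by rw [← h4]; module
      exact (smul_eq_zero.mp h6).resolve_left (by simpa using hε0)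
    intro Y
    have h4 := h2 Y
    simp only [horEnd, h3, smul_zero, map_zero, zero_apply, zero_smul, sub_zero, add_zero] at h4
    rw [← sub_eq_zero, ← h1]
    exact (smul_eq_zero.mp h4).resolve_left (by simpa using hε0)
  · intro H X Y
    have h2 : ∀ Y, s Y = 0 := fun Y => by rw [h1, H, sub_self]
    have h3 := hp X Y
    simp only [horEnd, h2, smul_zero, map_zero, zero_apply, zero_smul, sub_zero, add_zero] at h3
    linarith

theorem ricStar_zeta (X : Model n) : D.ricStar y X (D.ζ y) = 0 := by
  obtain ⟨e, he⟩ := h.exists_isOrtho hy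
  rw [h.ricStar_eq hy he]
  simp [(h.isACM y hy).phi_zeta]

/-- If the structure is harmonic and `ε = -1 = δ`, the `*`-Ricci tensor is symmetric on the contact
distribution. -/
theorem ricStarXi_of_harmonic (ht : D.IsTwisted U (-1) (-1)) (hd : ∀ Y, D.dStarXi y Y = 0)
    (X : Model n) : D.ricStarXi y X = D.ricStar y (D.ζ y) (D.ξ y X (D.ζ y)) := by
  have acm := h.isACM y hy
  obtain ⟨e, he⟩ := h.exists_isOrtho hy
  obtain ⟨hc, p, hp⟩ := h.twisted_skew hy ht (Or.inr rfl) he rfl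
  have h1 : ∀ Y, (∑ i, D.covXi y (e i) (e i) -
      (-1 : ℝ) • D.ξ y (∑ i, D.ξ y (e i) (e i))) Y = 0 := fun Y => by
    have h2 := hd Y
    rw [h.dStarXi_eq_cov hy he] at h2
    simp only [LinearMap.sub_apply, LinearMap.sum_apply, LinearMap.smul_apply]
    linear_combination (norm := module) -h2
  -- Harmonicity removes the divergence, so the skew part of `Ric^*` is the wedge of `η` with the
  -- dual of `p`. The value at `ζ` then eliminates `p`.
  have h2 : ∀ Y W, D.ricStar y Y W - D.ricStar y W Y =
      D.g y p Y * D.g y (D.ζ y) W - D.g y (D.ζ y) Y * D.g y p W := fun Y W => by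
    have := hp Y W
    simp only [horEnd, h1, smul_zero, map_zero, zero_apply, zero_smul, sub_zero, add_zero,
      zero_sub, map_neg, neg_apply, map_smul, smul_apply, map_sub, sub_apply, smul_eq_mul] at this
    linarith
  have hξ := (h.ξ_mem hy).1 X
  have hb : IsBilin fun a b => D.ricStarForm y a b := ⟨by simp, by simp, by simp, by simp⟩
  have h3 := he.sum_skew acm.symm hξ hb
  have h4 : ∑ i, (D.ricStar y (e i) (D.ξ y X (e i)) - D.ricStar y (D.ξ y X (e i)) (e i)) =
      -2 * D.g y p (D.ξ y X (D.ζ y)) := by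
    simp only [h2, hξ _ (D.ζ y), fun v => acm.symm (D.ζ y) (D.ξ y X v)]
    rw [Finset.sum_sub_distrib]
    have i1 := he.sum_smul' acm.symm (fun v => D.g y v (D.ξ y X (D.ζ y))) (by simp) (by simp) p
    have i2 := he.sum_smul' acm.symm (fun v => D.g y p (D.ξ y X v)) (by simp) (by simp) (D.ζ y)
    simp only [smul_eq_mul] at i1 i2
    simp only [mul_neg, Finset.sum_neg_distrib, i1, i2]
    ring
  have h5 := h2 (D.ζ y) (D.ξ y X (D.ζ y))
  rw [h.ricStar_zeta hy, acm.unit, inner_zeta_torsion acm (h.ξ_mem hy)] at h5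
  rw [h.ricStarXi_eq hy he]
  rw [Finset.sum_sub_distrib] at h4
  simp only [h.ricStar_eq_form hy] at h3 h4 h5 ⊢
  linarith

end IsGood

end LocalData

/-! ### Consequences of the type -/

section TypeDecomposition

variable {n : ℕ} {G : Form n} {φ : Model n →L[ℝ] Model n} {ζ : Model n}
  {e : Fin (2 * n + 1) → Model n} {I : Finset ℕ}

open Classical in
/-- The decomposition of a torsion tensor of type `⨁_{i ∈ I} 𝒞_i` into six components. -/
theorem exists_decomposition (h : IsACM G φ ζ) {ξ : Tors n}
    (hξ : ξ ∈ ⨆ i ∈ I, classModule G φ ζ i) : ∃ a b c m k v : Tors n,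
      a ∈ nearlyPart G φ ζ ∧ b ∈ C3 G φ ζ ∧ c ∈ C4 G φ ζ ∧ m ∈ mixedEig G φ ζ (-1) ∧
      k ∈ mixedEig G φ ζ 1 ∧ v ∈ verticalPart G φ ζ ∧ ξ = a + b + c + m + k + v ∧
      (1 ∉ I → 2 ∉ I → a = 0) ∧ (3 ∉ I → b = 0) ∧ (4 ∉ I → c = 0) ∧
      (5 ∉ I → 6 ∉ I → 7 ∉ I → 8 ∉ I → m = 0) ∧ (9 ∉ I → 10 ∉ I → k = 0) ∧
      (11 ∉ I → 12 ∉ I → v = 0) := by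
  -- `Q p W` is `W` or `0` according to `p`. One inclusion then treats all index sets, and absent
  -- types force their component to vanish.
  obtain ⟨Q, hQ⟩ : ∃ Q : Prop → Submodule ℝ (Tors n) → Submodule ℝ (Tors n),
      Q = fun p W => if p then W else ⊥ := ⟨_, rfl⟩
  have hQ1 : ∀ {p : Prop} {W : Submodule ℝ (Tors n)}, p → W ≤ Q p W := fun hp => by
    rw [hQ]; simp [hp]
  have hQ2 : ∀ {p : Prop} {W : Submodule ℝ (Tors n)} {x : Tors n}, x ∈ Q p W → x ∈ W := by
    intro p W x hx
    rw [hQ] at hx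
    by_cases hp : p
    · simpa [hp] using hx
    · simp only [hp, if_false, Submodule.mem_bot] at hx
      exact hx ▸ W.zero_mem
  have hQ3 : ∀ {p : Prop} {W : Submodule ℝ (Tors n)} {x : Tors n}, x ∈ Q p W → ¬p → x = 0 := by
    intro p W x hx hp
    simpa [hQ, hp] using hx
  have key : (⨆ i ∈ I, classModule G φ ζ i) ≤ Q (1 ∈ I ∨ 2 ∈ I) (nearlyPart G φ ζ) ⊔
      Q (3 ∈ I) (C3 G φ ζ) ⊔ Q (4 ∈ I) (C4 G φ ζ) ⊔
      Q (5 ∈ I ∨ 6 ∈ I ∨ 7 ∈ I ∨ 8 ∈ I) (mixedEig G φ ζ (-1)) ⊔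
      Q (9 ∈ I ∨ 10 ∈ I) (mixedEig G φ ζ 1) ⊔ Q (11 ∈ I ∨ 12 ∈ I) (verticalPart G φ ζ) := by
    have l1 : ∀ {A B : Submodule ℝ (Tors n)} {C}, A ≤ B → A ≤ B ⊔ C :=
      fun hh => hh.trans le_sup_left
    have l2 : ∀ {A B : Submodule ℝ (Tors n)} {C}, A ≤ C → A ≤ B ⊔ C :=
      fun hh => hh.trans le_sup_right
    refine iSup₂_le fun i hi => ?_
    match i, hi with
    | 0, _ => exact bot_le
    | 1, hi => exact l1 (l1 (l1 (l1 (l1 ((C1_le h).trans (hQ1 (Or.inl hi)))))))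
    | 2, hi => exact l1 (l1 (l1 (l1 (l1 ((C2_le h).trans (hQ1 (Or.inr hi)))))))
    | 3, hi => exact l1 (l1 (l1 (l1 (l2 (hQ1 hi)))))
    | 4, hi => exact l1 (l1 (l1 (l2 (hQ1 hi))))
    | 5, hi => exact l1 (l1 (l2 ((C5_le h).trans (hQ1 (Or.inl hi)))))
    | 6, hi => exact l1 (l1 (l2 ((C6_le h).trans (hQ1 (Or.inr (Or.inl hi))))))
    | 7, hi => exact l1 (l1 (l2 ((show C7 G φ ζ ≤ _ from fun x hx =>
        mixedSym_le h 1 (-1) hx.1).trans (hQ1 (Or.inr (Or.inr (Or.inl hi)))))))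
    | 8, hi => exact l1 (l1 (l2 ((show C8 G φ ζ ≤ _ from fun x hx =>
        mixedSym_le h 1 1 hx.1).trans (hQ1 (Or.inr (Or.inr (Or.inr hi)))))))
    | 9, hi => exact l1 (l2 ((show C9 G φ ζ ≤ _ from fun x hx => by
        simpa using mixedSym_le h (-1) 1 hx).trans (hQ1 (Or.inl hi))))
    | 10, hi => exact l1 (l2 ((show C10 G φ ζ ≤ _ from fun x hx => by
        simpa using mixedSym_le h (-1) (-1) hx).trans (hQ1 (Or.inr hi))))
    | 11, hi => exact l2 ((show C11 G φ ζ ≤ _ from fun x hx => hx.1).trans (hQ1 (Or.inl hi)))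
    | 12, hi => exact l2 ((show C12 G φ ζ ≤ _ from fun x hx => hx.1).trans (hQ1 (Or.inr hi)))
    | _ + 13, _ => exact bot_le
  obtain ⟨w5, hw5, v, hv, rfl⟩ := Submodule.mem_sup.mp (key hξ)
  obtain ⟨w4, hw4, k, hk, rfl⟩ := Submodule.mem_sup.mp hw5
  obtain ⟨w3, hw3, m, hm, rfl⟩ := Submodule.mem_sup.mp hw4
  obtain ⟨w2, hw2, c, hc, rfl⟩ := Submodule.mem_sup.mp hw3
  obtain ⟨a, ha, b, hb, rfl⟩ := Submodule.mem_sup.mp hw2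
  exact ⟨a, b, c, m, k, v, hQ2 ha, hQ2 hb, hQ2 hc, hQ2 hm, hQ2 hk, hQ2 hv, rfl,
    fun h1 h2 => hQ3 ha (by tauto), fun h1 => hQ3 hb h1, fun h1 => hQ3 hc h1,
    fun h1 h2 h3 h4 => hQ3 hm (by tauto), fun h1 h2 => hQ3 hk (by tauto),
    fun h1 h2 => hQ3 hv (by tauto)⟩

/-- The torsion tensors with `ξ_ζ = 0` and `ξ_{φ X} = J ξ_X`. -/
def twistPart (G : Form n) (φ : Model n →L[ℝ] Model n) (ζ : Model n) (ε δ : ℝ) :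
    Submodule ℝ (Tors n) where
  carrier := {ξ | ξ ζ = 0 ∧ ∀ X, ξ (φ X) = twistHom G φ ζ ε δ (ξ X)}
  zero_mem' := by simp
  add_mem' := by
    rintro a b ⟨h1, h2⟩ ⟨k1, k2⟩
    exact ⟨by simp [h1, k1], fun X => by simp [h2, k2]⟩
  smul_mem' := by
    rintro c a ⟨h1, h2⟩
    exact ⟨by simp [h1], fun X => by simp [h2]⟩

/-- Applying `φ` to the eigenvalue equation gives `ξ_{φX} = -(c/2) φ ξ_X`. The sign `δ` is free
because `ξ_X ζ = 0`. -/
theorem horizontal_le_twistPart (h : IsACM G φ ζ) (δ c : ℝ) :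
    horizontalPart G φ ζ ⊓ eigPart φ c ≤ twistPart G φ ζ (-c / 2) δ := by
  rintro ξ ⟨h1, h2⟩
  refine ⟨h1.2.1, fun X => ?_⟩
  ext1 Y
  have h3 := congrArg φ (h2 X Y)
  rw [commPhi, horizontal_comm h h1, sub_neg_eq_add, map_add, horizontal_phi_phi h h1,
    map_smul] at h3
  change _ = twist G φ ζ (-c / 2) δ (ξ X) Y
  rw [twist_apply, h1.2.2 X, map_zero, map_zero, zero_apply]
  linear_combination (norm := module) (-1 / 2 : ℝ) • h3

/-- Applying `φ` to the eigenvalue equation at `ζ` gives `ξ_{φX}ζ = -c φ ξ_X ζ`. The sign `ε` is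
free because there is no horizontal component. -/
theorem mixedEig_le_twistPart (h : IsACM G φ ζ) (ε c : ℝ) :
    mixedEig G φ ζ c ≤ twistPart G φ ζ ε (-c) := by
  rintro ξ ⟨h1, h2⟩
  refine ⟨h1.2.1, fun X => ?_⟩
  ext1 Y
  have h3 := congrArg φ (h2 X ζ)
  rw [commPhi, h.phi_zeta, map_zero, sub_zero, map_smul, h.sq, inner_zeta_torsion h h1.1,
    zero_smul, add_zero] at h3
  have h4 : ξ (φ X) ζ = -(c • φ (ξ X ζ)) := by rw [← h3, neg_neg]
  have h5 : φ (ξ X Y) = G ζ Y • φ (ξ X ζ) := by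
    rw [mixed_apply h h1, map_sub, map_smul, map_smul, h.phi_zeta, smul_zero, sub_zero]
  change _ = twist G φ ζ ε (-c) (ξ X) Y
  rw [twist_apply, h5, mixed_apply h h1 (φ X) Y, h4]
  simp only [map_neg, map_smul, neg_apply, smul_apply, smul_eq_mul]
  module

end TypeDecomposition

/-! ### The divergence formula in terms of the components of the torsion. -/

namespace LocalData

variable {n : ℕ} {D : LocalData n} {U : Set (Model n)} {y : Model n}
  {e : Fin (2 * n + 1) → Model n} {I : Finset ℕ}

/-- The structure is of type `⨁_{i ∈ I} 𝒞_i` on `U`. -/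
def HasType (D : LocalData n) (U : Set (Model n)) (I : Finset ℕ) : Prop :=
  ∀ y ∈ U, D.ξ y ∈ ⨆ i ∈ I, classModule (D.g y) (D.φ y) (D.ζ y) i

namespace IsGood

variable (h : D.IsGood U) (hy : y ∈ U)

include h hy

/-- `d^*(Ric^*)^t + ½ ds^*` in terms of the components of the intrinsic torsion. -/
theorem dStarRicStarT_eq_of_decomposition (he : IsOrtho (D.g y) e) (X : Model n)
    {a b c m k v : Tors n} (ha : a ∈ nearlyPart (D.g y) (D.φ y) (D.ζ y))
    (hb : b ∈ C3 (D.g y) (D.φ y) (D.ζ y)) (hc : c ∈ C4 (D.g y) (D.φ y) (D.ζ y))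
    (hm : m ∈ mixedEig (D.g y) (D.φ y) (D.ζ y) (-1)) (hk : k ∈ mixedEig (D.g y) (D.φ y) (D.ζ y) 1)
    (hv : v ∈ verticalPart (D.g y) (D.φ y) (D.ζ y)) (hξ : D.ξ y = a + b + c + m + k + v) :
    D.dStarRicStarT y X + 1 / 2 * D.dsStar y X =
      2 * D.ricStarXi y X - ((n : ℝ) - 1) * D.ricStar y X (D.leeVec y)
      - D.ricStar y X (D.ξ y (D.ζ y) (D.ζ y))
      - D.dStarF y (D.ζ y) * D.ricStar y (D.ζ y) (D.φ y X)
      + (-curvTors (D.g y) (D.curv y) e a X + curvTors (D.g y) (D.curv y) e b X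
        + curvTors (D.g y) (D.curv y) e c X + curvReeb (D.g y) (D.curv y) e (D.ζ y) m X
        - curvReeb (D.g y) (D.curv y) e (D.ζ y) k X) ∧
    curvTors (D.g y) (D.curv y) e (D.ξ y) X = curvTors (D.g y) (D.curv y) e a X
      + curvTors (D.g y) (D.curv y) e b X + curvTors (D.g y) (D.curv y) e c X
      + 2 * curvReeb (D.g y) (D.curv y) e (D.ζ y) m X
      + 2 * curvReeb (D.g y) (D.curv y) e (D.ζ y) k X + D.curvZetaXi y X ∧
    D.curvXiHor y X = curvReeb (D.g y) (D.curv y) e (D.ζ y) m X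
      + curvReeb (D.g y) (D.curv y) e (D.ζ y) k X ∧
    2 * curvTors (D.g y) (D.curv y) e c X = D.ric y X (D.leeVec y) - D.ricStar y X (D.leeVec y)
      - D.g y (D.R y (D.ζ y) X (D.ζ y)) (D.leeVec y) ∧
    (m = 0 → D.dStarF y (D.ζ y) = 0) ∧
    ((n : ℝ) - 1) • D.leeVec y = leeRaw (D.φ y) (D.ζ y) e (D.ξ y) ∧
    (c = 0 → D.leeVec y = 0) := by
  have acm := h.isACM y hy
  have hR := h.isCurv hy
  have hmem := h.ξ_mem hy
  obtain ⟨h1, h2, h3, h4, h5, h6, h7⟩ :=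
    sum_div_of_decomposition acm he hR ha hb hc hm hk hv hξ X
  rw [← h.leeVec_eq hy he] at h5 h6 h7
  have hdF : D.dStarF y (D.ζ y) = D.g y (D.ζ y) (codiffVec (D.φ y) e (D.ξ y)) := by
    rw [h.dStarF_eq hy he, acm.symm]
  refine ⟨?_, ?_, ?_, ?_, ?_, h5, ?_⟩
  · have i1 := h.dStarRicStarT_add hy he X
    rw [Finset.sum_comm] at h1
    rw [sum_div_eq acm he hR hmem.1 X, h1] at i1
    have i2 : ∑ i, D.g y (curvPhi (D.curv y) (D.φ y) e (e i)) (D.φ y (D.ξ y X (e i))) =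
        2 * D.ricStarXi y X := by
      rw [h.ricStarXi_eq hy he, Finset.mul_sum]
      refine Finset.sum_congr rfl fun i _ => ?_
      rw [h.ricStar_eq_curvPhi hy he]
      ring
    -- The definition of the Lee form splits this term into the contributions of `θ^♯` and of `ξ_ζ
    -- ζ`.
    have i3 : D.φ y (codiffVec (D.φ y) e (D.ξ y)) =
        -(((n : ℝ) - 1) • D.leeVec y) - D.ξ y (D.ζ y) (D.ζ y) := by
      rw [h5, leeRaw]; abel
    change _ = _ + 1 / 2 * D.g y (curvPhi (D.curv y) (D.φ y) e X)
      (D.φ y (D.φ y (codiffVec (D.φ y) e (D.ξ y))))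
      - D.g y (D.ζ y) (codiffVec (D.φ y) e (D.ξ y)) * (1 / 2 *
        D.g y (curvPhi (D.curv y) (D.φ y) e (D.ζ y)) (D.φ y (D.φ y X))) + _ at i1
    rw [← h.ricStar_eq_curvPhi hy he, ← h.ricStar_eq_curvPhi hy he, i2, i3] at i1
    rw [i1, hdF]
    simp only [h.ricStar_eq_form hy, map_sub, map_neg, map_smul, smul_eq_mul]
    ring
  · rw [h2, h.curvZetaXi_eq hy he]
  · rw [curvXiHor, h.curvXi_eq hy he, h3, h.R_eq hy]
    ring
  · rw [h6, h.ric_eq hy he, h.ricStar_eq hy he, h.R_eq hy]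
  · intro hm0
    rw [hdF, h4, hm0]
    simp [codiffVec, commPhi]
  · intro hc0
    rw [hc0] at h7
    simp only [LinearMap.zero_apply, Finset.sum_const_zero, smul_zero] at h7
    rw [h.leeVec_eq hy he, ← h5, h7, smul_zero]

end IsGood

end LocalData

/-! ### The harmonic map equation for each list of types. -/

namespace LocalData

variable {n : ℕ} {D : LocalData n} {U : Set (Model n)} {y : Model n}
  {e : Fin (2 * n + 1) → Model n}

namespace IsGood

variable (h : D.IsGood U)

include h

/-- It suffices that the two sides of an equation differ by a nonzero multiple of the horizontal
tension. The comparison may assume harmonicity, since this is part of both conditions. -/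
theorem isHarmonicMapOn_iff_of {A B : Model n → Model n → ℝ} {s : ℝ} (hs : s ≠ 0)
    (H : ∀ y ∈ U, (∀ Y, D.dStarXi y Y = 0) → ∀ e, IsOrtho (D.g y) e → ∀ X,
      A y X - B y X = s * curvTors (D.g y) (D.curv y) e (D.ξ y) X) :
    D.IsHarmonicMapOn U ↔ (∀ y ∈ U, ∀ Y, D.dStarXi y Y = 0) ∧ ∀ y ∈ U, ∀ X, A y X = B y X := by
  rw [h.isHarmonicMapOn_iff]
  constructor
  · intro h1
    refine ⟨fun y hy => (h1 y hy).1, fun y hy X => ?_⟩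
    obtain ⟨e, he⟩ := h.exists_isOrtho hy
    have h2 := H y hy (h1 y hy).1 e he X
    rw [(h1 y hy).2 e he X, mul_zero] at h2
    linarith
  · rintro ⟨h1, h2⟩ y hy
    refine ⟨h1 y hy, fun e he X => ?_⟩
    have h3 := H y hy (h1 y hy) e he X
    rw [h2 y hy X, sub_self] at h3
    exact (mul_eq_zero.mp h3.symm).resolve_left hs

/-- Adding the pairing to the divergence formula cancels `𝒞_1 ⊕ 𝒞_2` and doubles `𝒞_4`, which
becomes the Lee terms. The Hermitian mixed part has coefficient `1 + 2 = 3`; an anti-Hermitian one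
would have `-1 + 2 = 1`. -/
theorem isHarmonicMapOn_iff_quasi_hermitian_vertical
    (hT : D.HasType U {1, 2, 4, 5, 6, 7, 8, 11, 12}) :
    D.IsHarmonicMapOn U ↔ (∀ y ∈ U, ∀ Y, D.dStarXi y Y = 0) ∧ ∀ y ∈ U, ∀ X,
      D.dStarRicStarT y X + 1 / 2 * D.dsStar y X =
        D.ric y X (D.leeVec y) - n * D.ricStar y X (D.leeVec y) + 2 * D.ricStarXi y X
        - D.dStarF y (D.ζ y) * D.ricStar y (D.ζ y) (D.φ y X)
        - D.ricStar y X (D.ξ y (D.ζ y) (D.ζ y))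
        - D.g y (D.R y (D.ζ y) X (D.ζ y)) (D.leeVec y)
        + 3 * D.curvXiHor y X + D.curvZetaXi y X := by
  refine h.isHarmonicMapOn_iff_of (s := -1) (by norm_num) fun y hy _ e he X => ?_
  obtain ⟨a, b, c, m, k, v, ha, hb, hc, hm, hk, hv, hξ, -, hb0, -, -, hk0, -⟩ :=
    exists_decomposition (h.isACM y hy) (hT y hy)
  obtain ⟨h1, h2, h3, h4, -⟩ :=
    h.dStarRicStarT_eq_of_decomposition hy he X ha hb hc hm hk hv hξ
  have b0 : curvTors (D.g y) (D.curv y) e b X = 0 := by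
    simp [hb0 (by decide), curvTors]
  have k0 : curvReeb (D.g y) (D.curv y) e (D.ζ y) k X = 0 := by
    simp [hk0 (by decide) (by decide), curvReeb]
  rw [h1, h2, h3]
  linear_combination h4 + 2 * b0 - 2 * k0

theorem isHarmonicMapOn_iff_quasi_antihermitian_vertical
    (hT : D.HasType U {1, 2, 4, 9, 10, 11, 12}) :
    D.IsHarmonicMapOn U ↔ (∀ y ∈ U, ∀ Y, D.dStarXi y Y = 0) ∧ ∀ y ∈ U, ∀ X,
      D.dStarRicStarT y X + 1 / 2 * D.dsStar y X =
        D.ric y X (D.leeVec y) - n * D.ricStar y X (D.leeVec y) + 2 * D.ricStarXi y X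
        - D.ricStar y X (D.ξ y (D.ζ y) (D.ζ y))
        - D.g y (D.R y (D.ζ y) X (D.ζ y)) (D.leeVec y)
        + D.curvXiHor y X + D.curvZetaXi y X := by
  refine h.isHarmonicMapOn_iff_of (s := -1) (by norm_num) fun y hy _ e he X => ?_
  obtain ⟨a, b, c, m, k, v, ha, hb, hc, hm, hk, hv, hξ, -, hb0, -, hm0, -⟩ :=
    exists_decomposition (h.isACM y hy) (hT y hy)
  obtain ⟨h1, h2, h3, h4, h5, -⟩ :=
    h.dStarRicStarT_eq_of_decomposition hy he X ha hb hc hm hk hv hξ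
  have b0 : curvTors (D.g y) (D.curv y) e b X = 0 := by
    simp [hb0 (by decide), curvTors]
  have m0 := hm0 (by decide) (by decide) (by decide) (by decide)
  have m1 : curvReeb (D.g y) (D.curv y) e (D.ζ y) m X = 0 := by
    simp [m0, curvReeb]
  rw [h1, h2, h3, h5 m0]
  linear_combination h4 + 2 * b0 + 2 * m1

/-- Here the pairing is subtracted, so `𝒞_3 ⊕ 𝒞_4` cancels without use of the Lee form. The mixed
coefficients become `1 - 2 = -1` and, in the anti-Hermitian case, `-1 - 2 = -3`. -/
theorem isHarmonicMapOn_iff_integrable_hermitian_vertical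
    (hT : D.HasType U {3, 4, 5, 6, 7, 8, 11, 12}) :
    D.IsHarmonicMapOn U ↔ (∀ y ∈ U, ∀ Y, D.dStarXi y Y = 0) ∧ ∀ y ∈ U, ∀ X,
      D.dStarRicStarT y X + 1 / 2 * D.dsStar y X =
        -((n : ℝ) - 1) * D.ricStar y X (D.leeVec y) + 2 * D.ricStarXi y X
        - D.dStarF y (D.ζ y) * D.ricStar y (D.ζ y) (D.φ y X)
        - D.ricStar y X (D.ξ y (D.ζ y) (D.ζ y))
        - D.curvXiHor y X - D.curvZetaXi y X := by
  refine h.isHarmonicMapOn_iff_of (s := 1) (by norm_num) fun y hy _ e he X => ?_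
  obtain ⟨a, b, c, m, k, v, ha, hb, hc, hm, hk, hv, hξ, ha0, -, -, -, hk0, -⟩ :=
    exists_decomposition (h.isACM y hy) (hT y hy)
  obtain ⟨h1, h2, h3, -⟩ :=
    h.dStarRicStarT_eq_of_decomposition hy he X ha hb hc hm hk hv hξ
  have a0 : curvTors (D.g y) (D.curv y) e a X = 0 := by
    simp [ha0 (by decide) (by decide), curvTors]
  have k0 : curvReeb (D.g y) (D.curv y) e (D.ζ y) k X = 0 := by
    simp [hk0 (by decide) (by decide), curvReeb]
  rw [h1, h2, h3]
  linear_combination -2 * a0 - 2 * k0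

theorem isHarmonicMapOn_iff_integrable_antihermitian_vertical
    (hT : D.HasType U {3, 4, 9, 10, 11, 12}) :
    D.IsHarmonicMapOn U ↔ (∀ y ∈ U, ∀ Y, D.dStarXi y Y = 0) ∧ ∀ y ∈ U, ∀ X,
      D.dStarRicStarT y X + 1 / 2 * D.dsStar y X =
        -((n : ℝ) - 1) * D.ricStar y X (D.leeVec y) + 2 * D.ricStarXi y X
        - D.ricStar y X (D.ξ y (D.ζ y) (D.ζ y))
        - 3 * D.curvXiHor y X - D.curvZetaXi y X := by
  refine h.isHarmonicMapOn_iff_of (s := 1) (by norm_num) fun y hy _ e he X => ?_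
  obtain ⟨a, b, c, m, k, v, ha, hb, hc, hm, hk, hv, hξ, ha0, -, -, hm0, -, -⟩ :=
    exists_decomposition (h.isACM y hy) (hT y hy)
  obtain ⟨h1, h2, h3, -, h5, -⟩ :=
    h.dStarRicStarT_eq_of_decomposition hy he X ha hb hc hm hk hv hξ
  have a0 : curvTors (D.g y) (D.curv y) e a X = 0 := by
    simp [ha0 (by decide) (by decide), curvTors]
  have m0 := hm0 (by decide) (by decide) (by decide) (by decide)
  have m1 : curvReeb (D.g y) (D.curv y) e (D.ζ y) m X = 0 := by
    simp [m0, curvReeb]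
  rw [h1, h2, h3, h5 m0]
  linear_combination -2 * a0 + 2 * m1

/-! #### Types with `ξ_ζ = 0` -/

theorem isTwisted_of_quasi_hermitian (hT : D.HasType U {1, 2, 5, 6, 7, 8}) :
    D.IsTwisted U (-1) 1 := by
  have key : ∀ z ∈ U, D.ξ z ∈ twistPart (D.g z) (D.φ z) (D.ζ z) (-1) 1 := fun z hz => by
    have acm := h.isACM z hz
    obtain ⟨a, b, c, m, k, v, ha, -, -, hm, -, -, hξ, -, hb0, hc0, -, hk0, hv0⟩ :=
      exists_decomposition acm (hT z hz)
    rw [hξ, hb0 (by decide), hc0 (by decide), hk0 (by decide) (by decide),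
      hv0 (by decide) (by decide)]
    simp only [add_zero]
    exact add_mem (by simpa using horizontal_le_twistPart acm 1 2 ha)
      (by simpa using mixedEig_le_twistPart acm (-1) (-1) hm)
  exact ⟨fun z hz => (key z hz).1, fun z hz => (key z hz).2⟩

theorem isTwisted_of_quasi_antihermitian
    (hT : D.HasType U {1, 2, 9, 10}) : D.IsTwisted U (-1) (-1) := by
  have key : ∀ z ∈ U, D.ξ z ∈ twistPart (D.g z) (D.φ z) (D.ζ z) (-1) (-1) := fun z hz => by
    have acm := h.isACM z hz
    obtain ⟨a, b, c, m, k, v, ha, -, -, -, hk, -, hξ, -, hb0, hc0, hm0, -, hv0⟩ :=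
      exists_decomposition acm (hT z hz)
    rw [hξ, hb0 (by decide), hc0 (by decide), hm0 (by decide) (by decide) (by decide) (by decide),
      hv0 (by decide) (by decide)]
    simp only [add_zero]
    exact add_mem (by simpa using horizontal_le_twistPart acm (-1) 2 ha)
      (mixedEig_le_twistPart acm (-1) 1 hk)
  exact ⟨fun z hz => (key z hz).1, fun z hz => (key z hz).2⟩

theorem isTwisted_of_integrable_antihermitian
    (hT : D.HasType U {3, 4, 9, 10}) : D.IsTwisted U 1 (-1) := by
  have key : ∀ z ∈ U, D.ξ z ∈ twistPart (D.g z) (D.φ z) (D.ζ z) 1 (-1) := fun z hz => by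
    have acm := h.isACM z hz
    obtain ⟨a, b, c, m, k, v, -, hb, hc, -, hk, -, hξ, ha0, -, -, hm0, -, hv0⟩ :=
      exists_decomposition acm (hT z hz)
    rw [hξ, ha0 (by decide) (by decide), hm0 (by decide) (by decide) (by decide) (by decide),
      hv0 (by decide) (by decide)]
    simp only [add_zero, zero_add]
    exact add_mem (add_mem (by simpa using horizontal_le_twistPart acm (-1) (-2) (C3_le acm hb))
      (by simpa using horizontal_le_twistPart acm (-1) (-2) (C4_le acm hc)))
      (mixedEig_le_twistPart acm 1 1 hk)
  exact ⟨fun z hz => (key z hz).1, fun z hz => (key z hz).2⟩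

omit h in
theorem hasType_mono {I J : Finset ℕ} (hIJ : I ⊆ J) (hT : D.HasType U I) : D.HasType U J :=
  fun y hy => SetLike.le_def.mp (biSup_mono fun _ hi => hIJ hi) (hT y hy)

theorem curvXiHor_of_zeta (hy : y ∈ U) (hζ : D.ξ y (D.ζ y) = 0) (X : Model n) :
    D.curvXiHor y X = D.curvXi y X ∧ D.curvZetaXi y X = 0 := by
  obtain ⟨e, he⟩ := h.exists_isOrtho hy
  rw [h.curvZetaXi_eq hy he, curvXiHor, hζ]
  simp

/-- The `*`-Ricci form of a structure with symmetric `*`-Ricci tensor. -/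
theorem dStarRicStarT_of_symm (hs : ∀ y ∈ U, ∀ X Y, D.ricStar y X Y = D.ricStar y Y X)
    (hy : y ∈ U) (X : Model n) : D.dStarRicStarT y X = D.dStarRicStar y X := by
  obtain ⟨e, he⟩ := h.exists_isOrtho hy
  rw [h.dStarRicStar_eq hy he]
  exact h.codiffTwo_eq hy (fun z hz X Y => by rw [hs z hz, h.ricStar_eq_form hz])
    (h.differentiableAt_ricStarForm hy) he X

/-- A symmetric form is orthogonal to the skew endomorphism `ξ_X`. -/
theorem ricStarXi_of_symm (hs : ∀ X Y, D.ricStar y X Y = D.ricStar y Y X) (hy : y ∈ U)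
    (X : Model n) : D.ricStarXi y X = 0 := by
  obtain ⟨e, he⟩ := h.exists_isOrtho hy
  have hb : IsBilin fun a b => D.ricStarForm y a b := ⟨by simp, by simp, by simp, by simp⟩
  have h1 := he.sum_skew (h.isACM y hy).symm ((h.ξ_mem hy).1 X) hb
  rw [h.ricStarXi_eq hy he]
  simp only [h.ricStar_eq_form hy] at hs ⊢
  simp only [fun i => hs (D.ξ y X (e i)) (e i)] at h1
  linarith

end IsGood

end LocalData

namespace LocalData

variable {n : ℕ} {D : LocalData n} {U : Set (Model n)} {y : Model n}
  {e : Fin (2 * n + 1) → Model n}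

namespace IsGood

variable (h : D.IsGood U) (hy : y ∈ U)

include h hy

/-! #### Weakly-ac-Einstein structures -/

theorem fderiv_eta (X Z : Model n) : fderiv ℝ (fun z => D.eta z X) y Z =
    -D.g y (D.ξ y Z (D.ζ y)) X + D.g y (D.ζ y) (D.Γ y Z X) := by
  simp only [eta]
  rw [h.fderiv_inner hy (h.differentiableAt_ζ hy) (differentiableAt_const X)]
  have h1 := h.nablaZeta_eq hy Z
  rw [nablaZeta] at h1
  rw [h1]
  simp

theorem differentiableAt_eta (X : Model n) : DifferentiableAt ℝ (fun z => D.eta z X) y :=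
  ((h.differentiableAt_g hy).clm_apply (h.differentiableAt_ζ hy)).clm_apply
    (differentiableAt_const X)

theorem dStarEta_eq (he : IsOrtho (D.g y) e) :
    D.dStarEta y = ∑ i, D.g y (D.ξ y (e i) (D.ζ y)) (e i) := by
  have h1 : ∀ a b, fderiv ℝ (fun z => D.eta z b) y a - D.eta y (D.Γ y a b) =
      -D.g y (D.ξ y a (D.ζ y)) b := fun a b => by
    rw [h.fderiv_eta hy, eta]; ring
  simp only [dStarEta, codiffOne, h1]
  rw [contract_eq_sum he ⟨by simp; intros; ring, by simp, by simp; intros; ring, by simp⟩]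
  simp

/-- For `δ = -1` the form `∇η` is anti-Hermitian on `ζ^⊥`, and such forms have zero trace. -/
theorem dStarEta_of_twisted {ε : ℝ} (ht : D.IsTwisted U ε (-1)) : D.dStarEta y = 0 := by
  have acm := h.isACM y hy
  obtain ⟨e, he⟩ := h.exists_isOrtho hy
  have h1 := he.sum_phi_phi acm (B := fun a b => D.g y (D.ξ y a (D.ζ y)) b)
    ⟨by simp, by simp, by simp, by simp⟩
  have h2 : ∀ X, D.g y (D.ξ y (D.φ y X) (D.ζ y)) (D.φ y X) = -D.g y (D.ξ y X (D.ζ y)) X := by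
    intro X
    have h3 := inner_zeta_torsion acm (h.ξ_mem hy) X
    rw [ht.phi y hy, twist_apply, acm.unit, acm.phi_eta]
    simp [acm.compat, h3]
  simp only [h2, ht.zeta y hy, LinearMap.zero_apply, map_zero, zero_apply, sub_zero,
    Finset.sum_neg_distrib] at h1
  rw [h.dStarEta_eq hy he]
  linarith

theorem differentiableAt_sStar : DifferentiableAt ℝ D.sStar y := by
  have h1 : D.sStar =ᶠ[nhds y] fun z => contract (D.g z) fun a b => D.ricStarForm z a b := by
    filter_upwards [h.nhds_mem hy] with z hz
    simp only [sStar, h.ricStar_eq_form hz]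
  have h2 := contDiffAt_contract (h.contDiffAt_g hy) (h.isACM y hy).symm (h.isACM y hy).pos
    (B := fun z a b => D.ricStarForm z a b) fun a b =>
    (((h.smooth_ricStarForm.contDiffAt (h.nhds_mem hy)).clm_apply contDiffAt_const).clm_apply
      contDiffAt_const)
  exact h1.differentiableAt_iff.mpr (h2.differentiableAt (by simp))

theorem lee_zeta : D.g y (D.leeVec y) (D.ζ y) = 0 := by
  have acm := h.isACM y hy
  obtain ⟨e, he⟩ := h.exists_isOrtho hy
  rw [h.leeVec_eq hy he, acm.symm]
  simp [leeRaw, acm.eta_phi, inner_zeta_torsion acm (h.ξ_mem hy)]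

omit hy in
theorem symm_of_einstein (hW : ∀ y ∈ U, ∀ X Y, D.ricStar y X Y =
      D.sStar y / (2 * n) * (D.g y X Y - D.eta y X * D.eta y Y)) :
    ∀ y ∈ U, ∀ X Y, D.ricStar y X Y = D.ricStar y Y X := by
  intro y hy X Y
  rw [hW y hy, hW y hy, (h.isACM y hy).symm X]
  ring

/-- `d^*(Ric^*)^t + ½ ds^*` of a weakly-ac-Einstein structure with `∇_ζ ζ = 0`. -/
theorem dStarRicStarT_of_einstein (hn : 1 ≤ n) (hW : ∀ y ∈ U, ∀ X Y, D.ricStar y X Y =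
      D.sStar y / (2 * n) * (D.g y X Y - D.eta y X * D.eta y Y)) (hζ : D.ξ y (D.ζ y) = 0)
    (X : Model n) : 2 * n * (D.dStarRicStarT y X + 1 / 2 * D.dsStar y X) =
      ((n : ℝ) - 1) * D.dsStar y X
        + (D.dsStar y (D.ζ y) - D.sStar y * D.dStarEta y) * D.eta y X := by
  have acm := h.isACM y hy
  obtain ⟨e, he⟩ := h.exists_isOrtho hy
  have hn0 : (n : ℝ) ≠ 0 := by positivity
  -- The product rule for `(s^*/2n)(g - η ⊗ η)`, with `∇g = 0` and `(∇_Z η)(X) = -⟨ξ_Z ζ, X⟩`.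
  have h1 : ∀ Z X Y, 2 * n * D.covForm D.ricStarForm y Z X Y =
      D.dsStar y Z * (D.g y X Y - D.eta y X * D.eta y Y) + D.sStar y *
        (D.g y (D.ξ y Z (D.ζ y)) X * D.eta y Y + D.eta y X * D.g y (D.ξ y Z (D.ζ y)) Y) := by
    intro Z X Y
    have i1 : (fun z => D.ricStarForm z X Y) =ᶠ[nhds y] fun z =>
        D.sStar z * ((2 * n : ℝ)⁻¹ * (D.g z X Y - D.eta z X * D.eta z Y)) := by
      filter_upwards [h.nhds_mem hy] with z hz
      rw [← h.ricStar_eq_form hz, hW z hz]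
      ring
    have i2 : fderiv ℝ D.ricStarForm y Z X Y = fderiv ℝ (fun z => D.ricStarForm z X Y) y Z := by
      have hd := h.differentiableAt_ricStarForm hy
      rw [fderiv_apply_const (hd.clm_apply (differentiableAt_const X)), fderiv_apply_const hd]
    have d1 : DifferentiableAt ℝ (fun z => D.g z X Y) y :=
      ((h.differentiableAt_g hy).clm_apply (differentiableAt_const X)).clm_apply
        (differentiableAt_const Y)
    have d2 := (h.differentiableAt_eta hy X).fun_mul (h.differentiableAt_eta hy Y)
    have i3 := h.fderiv_inner hy (differentiableAt_const X) (differentiableAt_const Y) Z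
    rw [covForm, i2, i1.fderiv_eq, fderiv_fun_mul (h.differentiableAt_sStar hy)
      ((d1.fun_sub d2).const_mul _), fderiv_const_mul (d1.fun_sub d2), fderiv_fun_sub d1 d2,
      fderiv_fun_mul (h.differentiableAt_eta hy X) (h.differentiableAt_eta hy Y)]
    rw [← h.ricStar_eq_form hy, ← h.ricStar_eq_form hy, hW y hy, hW y hy]
    simp only [add_apply, sub_apply, smul_apply, smul_eq_mul, i3, h.fderiv_eta hy,
      fderiv_fun_const, Pi.zero_apply, zero_apply, zero_add]
    change _ = fderiv ℝ D.sStar y Z * _ + _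
    simp only [eta]
    field_simp
    ring
  have h2 : ∑ a, (2 * n * D.covForm D.ricStarForm y (e a) (e a) X) =
      D.dsStar y X - D.dsStar y (D.ζ y) * D.eta y X
        + D.sStar y * (D.dStarEta y * D.eta y X) := by
    have j1 := he.sum_smul' acm.symm (fun v => D.dsStar y v) (by simp [dsStar]) (by simp [dsStar]) X
    have j2 := he.sum_smul' acm.symm (fun v => D.dsStar y v) (by simp [dsStar]) (by simp [dsStar])
      (D.ζ y)
    have j3 := he.sum_zeta acm (B := fun a b => D.g y (D.ξ y a (D.ζ y)) b)
      ⟨by simp, by simp, by simp, by simp⟩ X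
    rw [hζ] at j3
    simp only [smul_eq_mul, LinearMap.zero_apply, map_zero, zero_apply] at j1 j2 j3
    have j4 : ∀ a, 2 * n * D.covForm D.ricStarForm y (e a) (e a) X =
        D.g y X (e a) * D.dsStar y (e a) - D.g y (D.ζ y) (e a) * D.dsStar y (e a) * D.eta y X
        + D.sStar y * (D.g y (D.ξ y (e a) (D.ζ y)) (e a) * D.eta y X
          + D.g y (D.ζ y) (e a) * D.g y (D.ξ y (e a) (D.ζ y)) X) := fun a => by
      rw [h1, acm.symm X]
      simp only [eta]
      ring
    simp only [j4, Finset.sum_add_distrib, Finset.sum_sub_distrib, ← Finset.mul_sum,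
      ← Finset.sum_mul, j1, j2, j3, ← h.dStarEta_eq hy he, add_zero]
  rw [h.dStarRicStarT_of_symm (h.symm_of_einstein hW) hy, h.dStarRicStar_eq hy he]
  rw [← Finset.mul_sum] at h2
  linear_combination -h2

omit hy in
/-- The Euler-Lagrange equation of a weakly-ac-Einstein structure. -/
theorem euler_lagrange_of_einstein (hn : 2 ≤ n) (hW : ∀ y ∈ U, ∀ X Y, D.ricStar y X Y =
      D.sStar y / (2 * n) * (D.g y X Y - D.eta y X * D.eta y Y))
    (hζ : ∀ y ∈ U, D.ξ y (D.ζ y) = 0) (q : Model n → Model n → ℝ) :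
    (∀ y ∈ U, ∀ X, D.dStarRicStarT y X + 1 / 2 * D.dsStar y X = q y X) ↔
    ∀ y ∈ U, ∀ X, ((n : ℝ) - 1) * D.dsStar y X = 2 * n * q y X
      + (((n : ℝ) - 1) / n * D.sStar y * D.dStarEta y - 2 * q y (D.ζ y)) * D.eta y X := by
  have hn2 : (2 : ℝ) ≤ n := by exact_mod_cast hn
  have hn0 : (n : ℝ) ≠ 0 := by positivity
  have hn1 : (n : ℝ) - 1 ≠ 0 := by linarith
  refine forall₂_congr fun y hy => ?_
  have acm := h.isACM y hy
  have h1 := h.dStarRicStarT_of_einstein hy (by omega) hW (hζ y hy)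
  have hu : D.eta y (D.ζ y) = 1 := acm.unit
  have h2 := h1 (D.ζ y)
  rw [hu] at h2
  constructor
  · intro H X
    have h3 := h1 X
    rw [H] at h2 h3
    -- At `X = ζ` the coefficients `n - 1` and `1` of `ds^*(ζ)` add up to `n`, so the equation can
    -- be solved for `ds^*(ζ)`.
    have h4 : D.dsStar y (D.ζ y) = 2 * q y (D.ζ y) + D.sStar y * D.dStarEta y / n := by
      field_simp
      linarith
    rw [h4] at h3
    field_simp
    field_simp at h3
    linarith
  · intro H X
    have h3 := h1 X
    have h4 := H (D.ζ y)
    rw [hu] at h4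
    -- At `ζ` the target equation carries the factor `n - 1`; `n ≥ 2` permits its cancellation.
    have h5 : ((n : ℝ) - 1) * (D.dsStar y (D.ζ y) - 2 * q y (D.ζ y)
        - D.sStar y * D.dStarEta y / n) = 0 := by
      rw [mul_sub, mul_sub, h4]
      ring
    have h6 := (mul_eq_zero.mp h5).resolve_left hn1
    have h7 : D.dsStar y (D.ζ y) = 2 * q y (D.ζ y) + D.sStar y * D.dStarEta y / n := by linarith
    rw [H X, h7] at h3
    have h8 : 2 * n * (D.dStarRicStarT y X + 1 / 2 * D.dsStar y X) = 2 * n * q y X := by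
      rw [h3]
      field_simp
      ring
    exact mul_left_cancel₀ (by positivity) h8

end IsGood

end LocalData

/-! ### Totally skew-symmetric torsion and nearly-K-cosymplectic structures. -/

section SkewTorsion

variable {n : ℕ} {G : Form n} {φ : Model n →L[ℝ] Model n} {ζ : Model n}
  {e : Fin (2 * n + 1) → Model n} {R : Curv n} {ξ : Tors n} {T : Model n → Tors n}
  {E : Model n → Model n → Model n →ₗ[ℝ] Model n}

/-- A totally skew-symmetric torsion pairs to zero with the curvature. -/
theorem curvTors_of_skew (hR : IsCurv G R) (symm : ∀ X Y, G X Y = G Y X) (he : IsOrtho G e)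
    (hξ : ∀ X Y Z, G (ξ X Y) Z = -G Y (ξ X Z)) (hs : ∀ X Y, ξ X Y = -ξ Y X) (X : Model n) :
    curvTors G R e ξ X = 0 := by
  have h1 := hR.two_mul_sum_swap symm he hξ X
  have h2 : ∑ i, ∑ j, G (R (e i) X (ξ (e j) (e i))) (e j) = curvTors G R e ξ X := by
    refine Finset.sum_congr rfl fun i _ => Finset.sum_congr rfl fun j _ => ?_
    rw [hs (e j) (e i), map_neg, map_neg, neg_apply, hR.inner_skew, neg_neg]
  rw [h2, ← curvTors] at h1
  linarith

/-- The divergence of a torsion with values in `𝒞_1` vanishes. -/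
theorem CurvSplit.sum_eq_zero_of_skew (hs : CurvSplit G φ ζ R ξ T E) (h : IsACM G φ ζ)
    (he : IsOrtho G e) (hR : IsCurv G R) (hξ : ξ ∈ horizontalPart G φ ζ)
    (hξs : ∀ X Y, ξ X Y = -ξ Y X) (hT : ∀ Z, T Z ∈ horizontalPart G φ ζ)
    (hTs : ∀ Z X Y, T Z X Y = -T Z Y X)
    (hP : ∀ Y, curvPhi R φ e (φ Y) - φ (curvPhi R φ e Y) = -(4 : ℝ) • ∑ i, T (e i) (e i) Y)
    (Y : Model n) : ∑ i, T (e i) (e i) Y = 0 := by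
  have hself : ∀ {S : Tors n}, (∀ X Y, S X Y = -S Y X) → ∀ X, S X X = 0 := fun hS X => by
    have h1 := hS X X
    rw [eq_neg_iff_add_eq_zero, ← two_smul ℝ] at h1
    exact (smul_eq_zero.mp h1).resolve_left two_ne_zero
  -- Conjugation by `φ` reverses the sign of terms linear in a horizontal torsion. It preserves the
  -- stabiliser part (`hE`) and the quadratic part (`hq`), so the linear terms survive in `Ric -
  -- Ric^*`.
  have hflip : ∀ {S : Tors n}, S ∈ horizontalPart G φ ζ → ∀ A B C,
      G (S A (φ B)) (φ C) = -G (S A B) C := fun hS A B C => by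
    rw [horizontal_comm h hS, map_neg, neg_apply, h.compat, horizontal_eta h hS, zero_mul,
      sub_zero]
  have hE : ∀ A B C W, G (E A B (φ C)) (φ W) = G (E A B C) W := fun A B C W => by
    have h1 : G ζ (E A B C) = 0 := by
      rw [h.symm, hs.skew, hs.vec, map_zero, neg_zero]
    rw [hs.comm, h.compat, h1, zero_mul, sub_zero]
  have hq : ∀ A B C W, G (ξ A (ξ B (φ C)) - ξ B (ξ A (φ C))) (φ W) =
      G (ξ A (ξ B C) - ξ B (ξ A C)) W := fun A B C W => by
    have h1 : ∀ A B, G (ξ A (ξ B (φ C))) (φ W) = G (ξ A (ξ B C)) W := fun A B => by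
      rw [horizontal_comm h hξ, map_neg, map_neg, neg_apply, hflip hξ, neg_neg]
    rw [map_sub, map_sub, sub_apply, sub_apply, h1, h1]
  have hd : ∀ X Y, ∑ i, G (R (e i) X (e i)) Y - ∑ i, G (R (e i) X (φ (e i))) (φ Y) =
      -2 * G (∑ i, T (e i) (e i) X) Y - 4 * ∑ i, G (ξ (e i) (ξ (e i) X)) Y := fun X Y => by
    rw [map_sum, sum_apply, Finset.mul_sum, Finset.mul_sum, ← Finset.sum_sub_distrib,
      ← Finset.sum_sub_distrib]
    refine Finset.sum_congr rfl fun i _ => ?_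
    have i1 : ξ (ξ (e i) X - ξ X (e i)) (e i) = -(2 : ℝ) • ξ (e i) (ξ (e i) X) := by
      rw [hξs X (e i), hξs _ (e i), sub_neg_eq_add, map_add]
      module
    have i2 : R (e i) X (e i) = -T (e i) (e i) X - (ξ (e i) (ξ X (e i)) - ξ X (ξ (e i) (e i)))
        - (2 : ℝ) • ξ (e i) (ξ (e i) X) - E (e i) X (e i) := by
      rw [hs.split, i1, hTs (e i) X, hself (hTs X)]
      module
    have i3 : G (R (e i) X (φ (e i))) (φ Y) = G (T (e i) (e i) X) Y
        - G (ξ (e i) (ξ X (e i)) - ξ X (ξ (e i) (e i))) Y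
        + 2 * G (ξ (e i) (ξ (e i) X)) Y - G (E (e i) X (e i)) Y := by
      rw [hs.split]
      simp only [map_add, map_sub, add_apply, sub_apply] at hq ⊢
      rw [hE, hflip (hT _), hflip (hT _), hTs (e i) X, hself (hTs X)]
      have i4 := hflip hξ (ξ (e i) X - ξ X (e i)) (e i) Y
      rw [i1] at i4
      simp only [map_sub, map_neg, map_smul, sub_apply, neg_apply, smul_apply, smul_eq_mul,
        map_zero, zero_apply, LinearMap.sub_apply] at i4 ⊢
      linarith [hq (e i) X (e i) Y]
    rw [i2, i3]
    simp only [map_sub, map_neg, map_smul, sub_apply, neg_apply, smul_apply, smul_eq_mul]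
    ring
  have hTk := fun Z => (hT Z).1.1
  -- Let `d` be the divergence. Since `Ric` and the quadratic term are symmetric, `hd` gives
  -- `Ric^*(Y,W) - Ric^*(W,Y) = 4⟨dY, W⟩`. By `hP` the same difference is `-2⟨dY, W⟩`, so `d = 0`.
  refine eq_zero_of_forall_inner h.pos fun W => ?_
  have k1 : ∀ X Y, ∑ i, G (R (e i) X (e i)) Y = ∑ i, G (R (e i) Y (e i)) X := fun X Y =>
    Finset.sum_congr rfl fun i _ => by
      rw [hR.pair, hR.inner_skew_left, hR.inner_skew, neg_neg]
  have k2 : ∀ X Y, G (ξ (e X) (ξ (e X) Y)) W = G (ξ (e X) (ξ (e X) W)) Y := fun X Y => by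
    rw [hξ.1.1, hξ.1.1, neg_neg, h.symm]
  have k3 : ∀ X W, G (∑ i, T (e i) (e i) X) W = -G (∑ i, T (e i) (e i) W) X := fun X W => by
    rw [map_sum, map_sum, sum_apply, sum_apply, ← Finset.sum_neg_distrib]
    refine Finset.sum_congr rfl fun i _ => ?_
    rw [hTk, h.symm]
  have k4 := hd Y W
  have k5 := hd W Y
  have k6 := congrArg (fun v => G v W) (hP Y)
  simp only [map_sub, sub_apply, map_smul, smul_apply, smul_eq_mul] at k6
  rw [sum_curv_phi h he hR] at k4 k5
  have k7 := curvPhi_skew (e := e) (φ := φ) hR h.symm W (φ Y)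
  have k8 := h.skew (curvPhi R φ e Y) W
  have k9 := h.symm W (curvPhi R φ e (φ Y))
  simp only [k2] at k4
  linarith [k1 Y W, k3 Y W]

end SkewTorsion

namespace LocalData

variable {n : ℕ} {D : LocalData n} {U : Set (Model n)} {y : Model n}
  {e : Fin (2 * n + 1) → Model n}

namespace IsGood

variable (h : D.IsGood U)

include h

/-- Total skewness and the vanishing at `ζ` pass to the derivative for the minimal connection.
`CurvSplit.sum_eq_zero_of_skew` then gives `d^*ξ = 0`, as `tr ξ = 0`, and `curvTors_of_skew` removes
the horizontal tension. -/
theorem isHarmonicMapOn_of_nearlyCosymplectic (hT : D.HasType U {1}) : D.IsHarmonicMapOn U := by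
  have hC : ∀ z ∈ U, D.ξ z ∈ C1 (D.g z) (D.φ z) (D.ζ z) := fun z hz => by
    simpa using! hT z hz
  have ht := h.isTwisted_of_quasi_hermitian (hasType_mono (by decide) hT)
  rw [h.isHarmonicMapOn_iff]
  intro y hy
  have acm := h.isACM y hy
  have hU := h.nhds_mem hy
  refine ⟨?_, fun e he X => curvTors_of_skew (h.isCurv hy) acm.symm he (h.ξ_mem hy).1
    (hC y hy).2 X⟩
  obtain ⟨e, he⟩ := h.exists_isOrtho hy
  obtain ⟨E, hE⟩ := h.exists_curvSplit hy
  have hTs : ∀ Z X Y, D.covXi y Z X Y = -D.covXi y Z Y X := fun Z X Y => by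
    obtain ⟨V, rfl, hV⟩ := D.exists_hasCov y X
    obtain ⟨W, rfl, hW⟩ := D.exists_hasCov y Y
    have h1 := (h.hasCov_ξ hy (hV Z) (hW Z)).congr (h.hasCov_ξ hy (hW Z) (hV Z)).neg
      (by filter_upwards [hU] with z hz using (hC z hz).2 _ _)
    simpa using h1
  have hTz : ∀ Z, D.covXi y Z (D.ζ y) = 0 := fun Z => by
    ext1 Y
    obtain ⟨W, rfl, hW⟩ := D.exists_hasCov y Y
    have h1 := (h.hasCov_ξ hy (h.hasCov_ζ hy (Z := Z)) (hW Z)).congr ((hW Z).const_smul 0)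
      (by filter_upwards [hU] with z hz; rw [ht.zeta z hz, zero_smul]; rfl)
    simpa using h1
  have hTh : ∀ Z, D.covXi y Z ∈ horizontalPart (D.g y) (D.φ y) (D.ζ y) := fun Z =>
    ⟨h.covXi_mem hy Z, hTz Z, fun X => by rw [hTs, hTz, LinearMap.zero_apply, neg_zero]⟩
  have hv : ∑ i, D.ξ y (e i) (e i) = 0 :=
    trace_nearly acm he (C1_le acm (hC y hy))
  have h0 := hE.sum_eq_zero_of_skew acm he (h.isCurv hy) (hC y hy).1 (hC y hy).2 hTh hTs fun Y => by
    have h2 := (hE.curvPhi_comm acm he (h.ξ_mem hy) (ht.zeta y hy) (ht.phi y hy) (h.covXi_mem hy)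
      (h.covXi_twist hy ht) (Or.inr rfl) rfl Y).2
    rw [h2, hv]
    simp only [horEnd, map_zero, smul_zero, sub_zero, LinearMap.sum_apply, (hTh _).2.2,
      Finset.sum_const_zero, zero_apply, zero_smul, add_zero, add_neg_cancel]
    module
  intro Y
  rw [h.dStarXi_eq_cov hy he, hv, h0]
  simp

end IsGood

end LocalData

namespace LocalData

variable {n : ℕ} {D : LocalData n} {U : Set (Model n)} {y : Model n}
  {e : Fin (2 * n + 1) → Model n}

namespace IsGood

variable (h : D.IsGood U)

include h

/-! #### The types `𝒞_1 ⊕ 𝒞_2 ⊕ 𝒞_5 ⊕ 𝒞_6 ⊕ 𝒞_7 ⊕ 𝒞_8` -/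

/-- For `ε = -1` the criterion of `ricStar_symm_iff` is literally `d^*ξ = 0` written with the
minimal connection. -/
theorem harmonic_iff_symm_of_quasi_hermitian (hT : D.HasType U {1, 2, 5, 6, 7, 8}) (hy : y ∈ U) :
    (∀ Y, D.dStarXi y Y = 0) ↔ ∀ X Y, D.ricStar y X Y = D.ricStar y Y X := by
  obtain ⟨e, he⟩ := h.exists_isOrtho hy
  have ht : D.IsTwisted U (-1) (- -1) := by simpa using h.isTwisted_of_quasi_hermitian hT
  rw [h.ricStar_symm_iff hy ht (Or.inr rfl) he]
  refine forall_congr' fun Y => ?_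
  rw [h.dStarXi_eq_cov hy he]
  constructor <;> intro H <;> linear_combination (norm := module) -H

theorem isHarmonicMapOn_iff_quasi_hermitian (hT : D.HasType U {1, 2, 5, 6, 7, 8}) :
    D.IsHarmonicMapOn U ↔ (∀ y ∈ U, ∀ X Y, D.ricStar y X Y = D.ricStar y Y X) ∧ ∀ y ∈ U, ∀ X,
      D.dStarRicStar y X + 1 / 2 * D.dsStar y X = 3 * D.curvXi y X := by
  have ht := h.isTwisted_of_quasi_hermitian hT
  rw [h.isHarmonicMapOn_iff_of (A := fun y X => D.dStarRicStarT y X + 1 / 2 * D.dsStar y X)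
    (B := fun y X => 3 * D.curvXi y X) (s := -1) (by norm_num)]
  · have hh : (∀ y ∈ U, ∀ Y, D.dStarXi y Y = 0) ↔
        ∀ y ∈ U, ∀ X Y, D.ricStar y X Y = D.ricStar y Y X :=
      forall₂_congr fun y hy => h.harmonic_iff_symm_of_quasi_hermitian hT hy
    rw [hh]
    refine and_congr_right fun hs => forall₂_congr fun y hy => forall_congr' fun X => ?_
    rw [h.dStarRicStarT_of_symm hs hy]
  · intro y hy hd e he X
    -- Symmetry makes `⟨Ric^*, ξ_X^♭⟩` and `Ric^*(ζ, ·)` vanish, which removes the remaining terms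
    -- of the general formula.
    have hs := (h.harmonic_iff_symm_of_quasi_hermitian hT hy).mp hd
    obtain ⟨a, b, c, m, k, v, ha, hb, hc, hm, hk, hv, hξ, -, hb0, hc0, -, hk0, -⟩ :=
      exists_decomposition (h.isACM y hy) (hT y hy)
    obtain ⟨h1, h2, h3, -, -, -, h7⟩ :=
      h.dStarRicStarT_eq_of_decomposition hy he X ha hb hc hm hk hv hξ
    obtain ⟨z1, z2⟩ := h.curvXiHor_of_zeta hy (ht.zeta y hy) X
    have b0 : curvTors (D.g y) (D.curv y) e b X = 0 := by
      simp [hb0 (by decide), curvTors]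
    have c0 : curvTors (D.g y) (D.curv y) e c X = 0 := by
      simp [hc0 (by decide), curvTors]
    have k0 : curvReeb (D.g y) (D.curv y) e (D.ζ y) k X = 0 := by
      simp [hk0 (by decide) (by decide), curvReeb]
    have h8 : D.ricStar y X (D.leeVec y) = 0 := by
      rw [h7 (hc0 (by decide)), h.ricStar_eq_form hy, map_zero]
    have h9 : D.ricStar y X (D.ξ y (D.ζ y) (D.ζ y)) = 0 := by
      rw [ht.zeta y hy, LinearMap.zero_apply, h.ricStar_eq_form hy, map_zero]
    rw [z1] at h3
    rw [h1, h2, h8, h9, h3, z2, h.ricStarXi_of_symm hs hy, hs, h.ricStar_zeta hy, b0, c0, k0]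
    ring

theorem isHarmonicMapOn_iff_quasi_hermitian_einstein (hn : 2 ≤ n)
    (hT : D.HasType U {1, 2, 5, 6, 7, 8})
    (hW : ∀ y ∈ U, ∀ X Y, D.ricStar y X Y =
      D.sStar y / (2 * n) * (D.g y X Y - D.eta y X * D.eta y Y)) :
    D.IsHarmonicMapOn U ↔ ∀ y ∈ U, ∀ X, ((n : ℝ) - 1) * D.dsStar y X = 6 * n * D.curvXi y X
      + (((n : ℝ) - 1) / n * D.sStar y * D.dStarEta y - 6 * D.curvXi y (D.ζ y)) * D.eta y X := by
  have hs := h.symm_of_einstein hW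
  have h1 := h.euler_lagrange_of_einstein hn hW (h.isTwisted_of_quasi_hermitian hT).zeta
    fun y X => 3 * D.curvXi y X
  rw [h.isHarmonicMapOn_iff_quasi_hermitian hT, and_iff_right hs]
  refine Iff.trans (forall₂_congr fun y hy => forall_congr' fun X => ?_)
    (h1.trans (forall₂_congr fun y hy => forall_congr' fun X => ?_))
  · rw [h.dStarRicStarT_of_symm hs hy]
  · ring_nf

/-! #### The types `𝒞_1 ⊕ 𝒞_2 ⊕ 𝒞_9 ⊕ 𝒞_10` -/

/-- Here `ε + δ ≠ 0`, so harmonicity does not give full symmetry of `Ric^*`. It still reduces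
`⟨Ric^*, ξ_X^♭⟩` to a value at `ζ`. -/
theorem isHarmonicMapOn_iff_quasi_antihermitian (hT : D.HasType U {1, 2, 9, 10}) :
    D.IsHarmonicMapOn U ↔ (∀ y ∈ U, ∀ Y, D.dStarXi y Y = 0) ∧ ∀ y ∈ U, ∀ X,
      D.dStarRicStarT y X + 1 / 2 * D.dsStar y X =
        2 * D.ricStar y (D.ζ y) (D.ξ y X (D.ζ y)) + D.curvXi y X := by
  have ht := h.isTwisted_of_quasi_antihermitian hT
  refine h.isHarmonicMapOn_iff_of (s := -1) (by norm_num) fun y hy hd e he X => ?_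
  obtain ⟨a, b, c, m, k, v, ha, hb, hc, hm, hk, hv, hξ, -, hb0, hc0, hm0, -, -⟩ :=
    exists_decomposition (h.isACM y hy) (hT y hy)
  obtain ⟨h1, h2, h3, -, h5, -, h7⟩ :=
    h.dStarRicStarT_eq_of_decomposition hy he X ha hb hc hm hk hv hξ
  obtain ⟨z1, z2⟩ := h.curvXiHor_of_zeta hy (ht.zeta y hy) X
  have b0 : curvTors (D.g y) (D.curv y) e b X = 0 := by
    simp [hb0 (by decide), curvTors]
  have c0 : curvTors (D.g y) (D.curv y) e c X = 0 := by
    simp [hc0 (by decide), curvTors]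
  have m0 := hm0 (by decide) (by decide) (by decide) (by decide)
  have m1 : curvReeb (D.g y) (D.curv y) e (D.ζ y) m X = 0 := by
    simp [m0, curvReeb]
  have h8 : D.ricStar y X (D.leeVec y) = 0 := by
    rw [h7 (hc0 (by decide)), h.ricStar_eq_form hy, map_zero]
  have h9 : D.ricStar y X (D.ξ y (D.ζ y) (D.ζ y)) = 0 := by
    rw [ht.zeta y hy, LinearMap.zero_apply, h.ricStar_eq_form hy, map_zero]
  rw [z1] at h3
  rw [h1, h2, h8, h9, h3, z2, h.ricStarXi_of_harmonic hy ht hd, h5 m0, b0, c0, m1]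
  ring

theorem isHarmonicMapOn_iff_quasi_antihermitian_einstein (hn : 2 ≤ n)
    (hT : D.HasType U {1, 2, 9, 10})
    (hW : ∀ y ∈ U, ∀ X Y, D.ricStar y X Y =
      D.sStar y / (2 * n) * (D.g y X Y - D.eta y X * D.eta y Y)) :
    D.IsHarmonicMapOn U ↔ (∀ y ∈ U, ∀ Y, D.dStarXi y Y = 0) ∧ ∀ y ∈ U, ∀ X,
      ((n : ℝ) - 1) * D.dsStar y X =
        2 * n * D.curvXi y X - 2 * D.curvXi y (D.ζ y) * D.eta y X := by
  have hs := h.symm_of_einstein hW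
  have ht := h.isTwisted_of_quasi_antihermitian hT
  have h1 := h.euler_lagrange_of_einstein hn hW ht.zeta fun y X => D.curvXi y X
  rw [h.isHarmonicMapOn_iff_quasi_antihermitian hT]
  refine and_congr_right fun _ => Iff.trans (forall₂_congr fun y hy => forall_congr' fun X => ?_)
    (h1.trans (forall₂_congr fun y hy => forall_congr' fun X => ?_))
  · rw [hs y hy, h.ricStar_zeta hy, mul_zero, zero_add]
  · rw [h.dStarEta_of_twisted hy ht]
    ring_nf

/-! #### The types `𝒞_3 ⊕ 𝒞_4 ⊕ 𝒞_5 ⊕ 𝒞_6 ⊕ 𝒞_7 ⊕ 𝒞_8` -/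

theorem torsion_zeta_of_integrable_hermitian (hT : D.HasType U {3, 4, 5, 6, 7, 8}) :
    ∀ z ∈ U, D.ξ z (D.ζ z) = 0 := fun z hz => by
  have acm := h.isACM z hz
  obtain ⟨a, b, c, m, k, v, -, hb, hc, hm, -, -, hξ, ha0, -, -, -, hk0, hv0⟩ :=
    exists_decomposition acm (hT z hz)
  rw [hξ, ha0 (by decide) (by decide), hk0 (by decide) (by decide), hv0 (by decide) (by decide)]
  simp [(C3_le acm hb).1.2.1, (C4_le acm hc).1.2.1, hm.1.2.1]

theorem isHarmonicMapOn_iff_integrable_hermitian (hT : D.HasType U {3, 4, 5, 6, 7, 8}) :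
    D.IsHarmonicMapOn U ↔ (∀ y ∈ U, ∀ Y, D.dStarXi y Y = 0) ∧ ∀ y ∈ U, ∀ X,
      D.dStarRicStarT y X + 1 / 2 * D.dsStar y X =
        -((n : ℝ) - 1) * D.ricStar y X (D.leeVec y) + 2 * D.ricStarXi y X
        - D.dStarF y (D.ζ y) * D.ricStar y (D.ζ y) (D.φ y X) - D.curvXi y X := by
  have hz := h.torsion_zeta_of_integrable_hermitian hT
  rw [h.isHarmonicMapOn_iff_integrable_hermitian_vertical (hasType_mono (by decide) hT)]
  refine and_congr_right fun _ => forall₂_congr fun y hy => forall_congr' fun X => ?_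
  obtain ⟨z1, z2⟩ := h.curvXiHor_of_zeta hy (hz y hy) X
  have h9 : D.ricStar y X (D.ξ y (D.ζ y) (D.ζ y)) = 0 := by
    rw [hz y hy, LinearMap.zero_apply, h.ricStar_eq_form hy, map_zero]
  rw [z1, z2, h9, sub_zero, sub_zero]

theorem ricStar_lee_of_einstein (hy : y ∈ U) (hW : ∀ y ∈ U, ∀ X Y, D.ricStar y X Y =
      D.sStar y / (2 * n) * (D.g y X Y - D.eta y X * D.eta y Y)) (X : Model n) :
    D.ricStar y X (D.leeVec y) = D.sStar y / (2 * n) * D.lee y X := by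
  have acm := h.isACM y hy
  have h1 : D.eta y (D.leeVec y) = 0 := by
    rw [eta, acm.symm, h.lee_zeta hy]
  rw [hW y hy, h1, mul_zero, sub_zero, acm.symm, lee]

theorem isHarmonicMapOn_iff_integrable_hermitian_einstein (hn : 2 ≤ n)
    (hT : D.HasType U {3, 4, 5, 6, 7, 8})
    (hW : ∀ y ∈ U, ∀ X Y, D.ricStar y X Y =
      D.sStar y / (2 * n) * (D.g y X Y - D.eta y X * D.eta y Y)) :
    D.IsHarmonicMapOn U ↔ (∀ y ∈ U, ∀ Y, D.dStarXi y Y = 0) ∧ ∀ y ∈ U, ∀ X,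
      ((n : ℝ) - 1) * D.dsStar y X =
        -((n : ℝ) - 1) * D.sStar y * D.lee y X - 2 * n * D.curvXi y X
        + (((n : ℝ) - 1) / n * D.sStar y * D.dStarEta y + 2 * D.curvXi y (D.ζ y))
          * D.eta y X := by
  have hs := h.symm_of_einstein hW
  have h1 := h.euler_lagrange_of_einstein hn hW
    (h.torsion_zeta_of_integrable_hermitian hT) fun y X =>
    -((n : ℝ) - 1) * D.ricStar y X (D.leeVec y) - D.curvXi y X
  have hn0 : (n : ℝ) ≠ 0 := by positivity
  rw [h.isHarmonicMapOn_iff_integrable_hermitian hT]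
  refine and_congr_right fun _ => Iff.trans (forall₂_congr fun y hy => forall_congr' fun X => ?_)
    (h1.trans (forall₂_congr fun y hy => forall_congr' fun X => ?_))
  · rw [h.ricStarXi_of_symm (hs y hy) hy, hs y hy (D.ζ y), h.ricStar_zeta hy]
    ring_nf
  · rw [h.ricStar_lee_of_einstein hy hW, hs y hy (D.ζ y), h.ricStar_zeta hy]
    refine Iff.of_eq (congrArg _ ?_)
    field_simp
    ring

/-! #### The types `𝒞_3 ⊕ 𝒞_4 ⊕ 𝒞_9 ⊕ 𝒞_10` -/

theorem isHarmonicMapOn_iff_integrable_antihermitian (hT : D.HasType U {3, 4, 9, 10}) :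
    D.IsHarmonicMapOn U ↔ (∀ y ∈ U, ∀ Y, D.dStarXi y Y = 0) ∧ ∀ y ∈ U, ∀ X,
      D.dStarRicStarT y X + 1 / 2 * D.dsStar y X =
        -((n : ℝ) - 1) * D.ricStar y X (D.leeVec y) + 2 * D.ricStarXi y X
        - 3 * D.curvXi y X := by
  have hz := (h.isTwisted_of_integrable_antihermitian hT).zeta
  rw [h.isHarmonicMapOn_iff_integrable_antihermitian_vertical (hasType_mono (by decide) hT)]
  refine and_congr_right fun _ => forall₂_congr fun y hy => forall_congr' fun X => ?_
  obtain ⟨z1, z2⟩ := h.curvXiHor_of_zeta hy (hz y hy) X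
  have h9 : D.ricStar y X (D.ξ y (D.ζ y) (D.ζ y)) = 0 := by
    rw [hz y hy, LinearMap.zero_apply, h.ricStar_eq_form hy, map_zero]
  rw [z1, z2, h9, sub_zero, sub_zero]

/-- `(n - 1)θ^♯` is `2 tr ξ` up to a multiple of `ζ`, and `ξ_ζ = 0`. -/
theorem torsion_leeVec (hy : y ∈ U) (hζ : D.ξ y (D.ζ y) = 0) (he : IsOrtho (D.g y) e)
    (hl : ((n : ℝ) - 1) • D.leeVec y = leeRaw (D.φ y) (D.ζ y) e (D.ξ y)) :
    ((n : ℝ) - 1) • D.ξ y (D.leeVec y) = (2 : ℝ) • D.ξ y (∑ i, D.ξ y (e i) (e i)) := by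
  have acm := h.isACM y hy
  rw [leeRaw_eq acm he (h.ξ_mem hy), acm.sq, hζ] at hl
  rw [← map_smul, hl]
  simp only [LinearMap.zero_apply, smul_zero, sub_zero, map_neg, map_smul, map_add, hζ, add_zero,
    smul_neg, neg_neg]

/-- For `ε = 1` symmetry says that the divergence for the minimal connection is `ξ_{tr ξ}`. Hence
`d^*ξ = -2 ξ_{tr ξ} = -(n - 1) ξ_{θ^♯}`. -/
theorem harmonic_iff_of_symm_of_integrable (hT : D.HasType U {3, 4, 9, 10}) (hy : y ∈ U)
    (hs : ∀ X Y, D.ricStar y X Y = D.ricStar y Y X) :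
    (∀ Y, D.dStarXi y Y = 0) ↔ ∀ Y, D.ξ y (D.leeVec y) Y = 0 := by
  obtain ⟨e, he⟩ := h.exists_isOrtho hy
  have ht := h.isTwisted_of_integrable_antihermitian hT
  have h1 := (h.ricStar_symm_iff hy ht (Or.inl rfl) he).mp hs
  obtain ⟨a, b, c, m, k, v, ha, hb, hc, hm, hk, hv, hξ, -⟩ :=
    exists_decomposition (h.isACM y hy) (hT y hy)
  obtain ⟨-, -, -, -, -, h6, -⟩ :=
    h.dStarRicStarT_eq_of_decomposition hy he 0 ha hb hc hm hk hv hξ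
  have h2 := h.torsion_leeVec hy (ht.zeta y hy) he h6
  refine forall_congr' fun Y => ?_
  have h3 := congrArg (fun f => f Y) h2
  simp only [LinearMap.smul_apply] at h3
  rw [h.dStarXi_eq_cov hy he, h1]
  constructor
  · intro H
    have h4 : D.ξ y (∑ i, D.ξ y (e i) (e i)) Y = 0 := by
      have : (-2 : ℝ) • D.ξ y (∑ i, D.ξ y (e i) (e i)) Y = 0 := by rw [← H]; module
      exact (smul_eq_zero.mp this).resolve_left (by norm_num)
    rw [h4, smul_zero, smul_eq_zero] at h3
    -- If `n = 1`, the default value of the inverse makes the Lee vector zero.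
    refine h3.elim (fun h5 => ?_) id
    rw [h.leeVec_eq hy he, h5, inv_zero, zero_smul, map_zero, LinearMap.zero_apply]
  · intro H
    rw [H, smul_zero] at h3
    linear_combination (norm := module) h3

theorem isHarmonicMapOn_iff_integrable_antihermitian_symm (hT : D.HasType U {3, 4, 9, 10})
    (hs : ∀ y ∈ U, ∀ X Y, D.ricStar y X Y = D.ricStar y Y X) :
    D.IsHarmonicMapOn U ↔ (∀ y ∈ U, ∀ Y, D.ξ y (D.leeVec y) Y = 0) ∧ ∀ y ∈ U, ∀ X,
      D.dStarRicStar y X + 1 / 2 * D.dsStar y X =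
        -((n : ℝ) - 1) * D.ricStar y (D.leeVec y) X - 3 * D.curvXi y X := by
  have hh : (∀ y ∈ U, ∀ Y, D.dStarXi y Y = 0) ↔ ∀ y ∈ U, ∀ Y, D.ξ y (D.leeVec y) Y = 0 :=
    forall₂_congr fun y hy => h.harmonic_iff_of_symm_of_integrable hT hy (hs y hy)
  rw [h.isHarmonicMapOn_iff_integrable_antihermitian hT, hh]
  refine and_congr_right fun _ => forall₂_congr fun y hy => forall_congr' fun X => ?_
  rw [h.dStarRicStarT_of_symm hs hy, h.ricStarXi_of_symm (hs y hy) hy, hs y hy X, mul_zero,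
    add_zero]

theorem isHarmonicMapOn_iff_integrable_antihermitian_einstein (hn : 2 ≤ n)
    (hT : D.HasType U {3, 4, 9, 10})
    (hW : ∀ y ∈ U, ∀ X Y, D.ricStar y X Y =
      D.sStar y / (2 * n) * (D.g y X Y - D.eta y X * D.eta y Y)) :
    D.IsHarmonicMapOn U ↔ (∀ y ∈ U, ∀ Y, D.ξ y (D.leeVec y) Y = 0) ∧ ∀ y ∈ U, ∀ X,
      ((n : ℝ) - 1) * D.dsStar y X =
        -((n : ℝ) - 1) * D.sStar y * D.lee y X - 6 * n * D.curvXi y X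
        + 6 * D.curvXi y (D.ζ y) * D.eta y X := by
  have hs := h.symm_of_einstein hW
  have ht := h.isTwisted_of_integrable_antihermitian hT
  have h1 := h.euler_lagrange_of_einstein hn hW ht.zeta fun y X =>
    -((n : ℝ) - 1) * D.ricStar y X (D.leeVec y) - 3 * D.curvXi y X
  have hn0 : (n : ℝ) ≠ 0 := by positivity
  rw [h.isHarmonicMapOn_iff_integrable_antihermitian_symm hT hs]
  refine and_congr_right fun _ => Iff.trans (forall₂_congr fun y hy => forall_congr' fun X => ?_)
    (h1.trans (forall₂_congr fun y hy => forall_congr' fun X => ?_))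
  · rw [h.dStarRicStarT_of_symm hs hy, hs y hy X]
  · rw [h.ricStar_lee_of_einstein hy hW, hs y hy (D.ζ y), h.ricStar_zeta hy,
      h.dStarEta_of_twisted hy ht]
    refine Iff.of_eq (congrArg _ ?_)
    field_simp
    ring

theorem leeVec_of_balanced (hT : D.HasType U {3, 9, 10}) (hy : y ∈ U) : D.leeVec y = 0 := by
  obtain ⟨e, he⟩ := h.exists_isOrtho hy
  obtain ⟨a, b, c, m, k, v, ha, hb, hc, hm, hk, hv, hξ, -, -, hc0, -⟩ :=
    exists_decomposition (h.isACM y hy) (hT y hy)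
  obtain ⟨-, -, -, -, -, -, h7⟩ :=
    h.dStarRicStarT_eq_of_decomposition hy he 0 ha hb hc hm hk hv hξ
  exact h7 (hc0 (by decide))

/-- Without `𝒞_4` the Lee vector is zero and `ξ_{tr ξ} = 0`. Harmonicity and symmetry then both say
that the divergence for the minimal connection vanishes. -/
theorem harmonic_iff_symm_of_balanced (hT : D.HasType U {3, 9, 10}) (hy : y ∈ U) :
    (∀ Y, D.dStarXi y Y = 0) ↔ ∀ X Y, D.ricStar y X Y = D.ricStar y Y X := by
  have hT' : D.HasType U {3, 4, 9, 10} := hasType_mono (by decide) hT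
  obtain ⟨e, he⟩ := h.exists_isOrtho hy
  have ht := h.isTwisted_of_integrable_antihermitian hT'
  obtain ⟨a, b, c, m, k, v, ha, hb, hc, hm, hk, hv, hξ, -⟩ :=
    exists_decomposition (h.isACM y hy) (hT y hy)
  obtain ⟨-, -, -, -, -, h6, -⟩ :=
    h.dStarRicStarT_eq_of_decomposition hy he 0 ha hb hc hm hk hv hξ
  have h2 := h.torsion_leeVec hy (ht.zeta y hy) he h6
  rw [h.leeVec_of_balanced hT hy, map_zero, smul_zero, eq_comm, smul_eq_zero] at h2
  have h3 := h2.resolve_left two_ne_zero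
  rw [h.ricStar_symm_iff hy ht (Or.inl rfl) he]
  refine forall_congr' fun Y => ?_
  rw [h.dStarXi_eq_cov hy he, h3, LinearMap.zero_apply, smul_zero, sub_zero, neg_eq_zero]

theorem isHarmonicMapOn_iff_balanced (hT : D.HasType U {3, 9, 10}) :
    D.IsHarmonicMapOn U ↔ (∀ y ∈ U, ∀ X Y, D.ricStar y X Y = D.ricStar y Y X) ∧ ∀ y ∈ U, ∀ X,
      D.dStarRicStar y X + 1 / 2 * D.dsStar y X = -3 * D.curvXi y X := by
  have hh : (∀ y ∈ U, ∀ Y, D.dStarXi y Y = 0) ↔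
      ∀ y ∈ U, ∀ X Y, D.ricStar y X Y = D.ricStar y Y X :=
    forall₂_congr fun y hy => h.harmonic_iff_symm_of_balanced hT hy
  rw [h.isHarmonicMapOn_iff_integrable_antihermitian (hasType_mono (by decide) hT), hh]
  refine and_congr_right fun hs => forall₂_congr fun y hy => forall_congr' fun X => ?_
  rw [h.dStarRicStarT_of_symm hs hy, h.ricStarXi_of_symm (hs y hy) hy, hs y hy X,
    h.leeVec_of_balanced hT hy, h.ricStar_eq_form hy, map_zero, zero_apply]
  ring_nf

theorem isHarmonicMapOn_iff_balanced_einstein (hn : 2 ≤ n) (hT : D.HasType U {3, 9, 10})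
    (hW : ∀ y ∈ U, ∀ X Y, D.ricStar y X Y =
      D.sStar y / (2 * n) * (D.g y X Y - D.eta y X * D.eta y Y)) :
    D.IsHarmonicMapOn U ↔ ∀ y ∈ U, ∀ X, ((n : ℝ) - 1) * D.dsStar y X =
      -6 * n * D.curvXi y X + 6 * D.curvXi y (D.ζ y) * D.eta y X := by
  have hs := h.symm_of_einstein hW
  have ht := h.isTwisted_of_integrable_antihermitian (hasType_mono (by decide) hT)
  have h1 := h.euler_lagrange_of_einstein hn hW ht.zeta fun y X => -3 * D.curvXi y X
  rw [h.isHarmonicMapOn_iff_balanced hT, and_iff_right hs]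
  refine Iff.trans (forall₂_congr fun y hy => forall_congr' fun X => ?_)
    (h1.trans (forall₂_congr fun y hy => forall_congr' fun X => ?_))
  · rw [h.dStarRicStarT_of_symm hs hy]
  · rw [h.dStarEta_of_twisted hy ht]
    ring_nf

end IsGood

end LocalData

/-! ### From charts to the manifold. -/

section TangentMap

variable {E H M E' H' M' E'' H'' N : Type*} [NormedAddCommGroup E] [NormedSpace ℝ E]
  [TopologicalSpace H] {I : ModelWithCorners ℝ E H} [TopologicalSpace M] [ChartedSpace H M]
  [IsManifold I ∞ M] [NormedAddCommGroup E'] [NormedSpace ℝ E']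
  [TopologicalSpace H'] {I' : ModelWithCorners ℝ E' H'} [TopologicalSpace M'] [ChartedSpace H' M']
  [IsManifold I' ∞ M'] [NormedAddCommGroup E''] [NormedSpace ℝ E'']
  [TopologicalSpace H''] {J : ModelWithCorners ℝ E'' H''} [TopologicalSpace N] [ChartedSpace H'' N]

/-- The derivative of a smooth map sends smooth vector fields along a map to smooth ones. -/
theorem contMDiffOn_mfderiv_apply {f : M → M'} {s : Set M} (hf : ContMDiffOn I I' ∞ f s)
    (hs : IsOpen s) {t : Set N} {b : N → M} {V : ∀ x, TangentSpace I (b x)}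
    (hV : ContMDiffOn J I.tangent ∞ (fun x => (⟨b x, V x⟩ : TangentBundle I M)) t)
    (hb : ∀ x ∈ t, b x ∈ s) :
    ContMDiffOn J I'.tangent ∞
      (fun x => (⟨f (b x), mfderiv I I' f (b x) (V x)⟩ : TangentBundle I' M')) t := by
  have h1 := (hf.contMDiffOn_tangentMapWithin (m := ∞) (by simp) hs.uniqueMDiffOn).comp hV
    fun x hx => hb x hx
  refine h1.congr fun x hx => ?_
  have h2 := tangentMapWithin_eq_tangentMap (I := I) (I' := I') (f := f)
    (p := (⟨b x, V x⟩ : TangentBundle I M)) (hs.uniqueMDiffOn _ (hb x hx))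
    (((hf _ (hb x hx)).contMDiffAt (hs.mem_nhds (hb x hx))).mdifferentiableAt (by simp))
  exact h2.symm

end TangentMap

theorem isACM_pullback {n : ℕ} {P : Type*} [AddCommGroup P] [Module ℝ P] [TopologicalSpace P]
    [IsTopologicalAddGroup P] [ContinuousConstSMul ℝ P]
    {G : P →L[ℝ] P →L[ℝ] ℝ} {φ : P →L[ℝ] P} {ζ : P} (symm : ∀ X Y, G X Y = G Y X)
    (pos : ∀ X, X ≠ 0 → 0 < G X X) (unit : G ζ ζ = 1) (sq : ∀ X, φ (φ X) = -X + G ζ X • ζ)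
    (compat : ∀ X Y, G (φ X) (φ Y) = G X Y - G ζ X * G ζ Y)
    {T : Model n →L[ℝ] P} {T' : P →L[ℝ] Model n} (h1 : ∀ v, T' (T v) = v) (h2 : ∀ v, T (T' v) = v) :
    IsACM ((ContinuousLinearMap.precomp ℝ T).comp (G.comp T)) ((T'.comp φ).comp T) (T' ζ) where
  symm X Y := symm _ _
  pos X hX := pos _ fun h0 => hX (by rw [← h1 X, show T X = 0 from h0, map_zero])
  unit := by
    change G (T (T' ζ)) (T (T' ζ)) = 1
    rw [h2, unit]
  sq X := by
    change T' (φ (T (T' (φ (T X))))) = -X + G (T (T' ζ)) (T X) • T' ζ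
    rw [h2, h2, sq, map_add, map_neg, map_smul, h1]
  compat X Y := by
    change G (T (T' (φ (T X)))) (T (T' (φ (T Y)))) =
      G (T X) (T Y) - G (T (T' ζ)) (T X) * G (T (T' ζ)) (T Y)
    rw [h2, h2, h2, compat]

namespace AlmostContactMetricStructure

variable {n : ℕ} {M : Type*} [TopologicalSpace M] [ChartedSpace (Model n) M]
  [IsManifold 𝓘(ℝ, Model n) ∞ M] (S : AlmostContactMetricStructure n M)
  {e : OpenPartialHomeomorph M (Model n)}

theorem contMDiffOn_coordField (he : e ∈ atlas (Model n) M) (v : Model n) :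
    ContMDiffOn 𝓘(ℝ, Model n) 𝓘(ℝ, Model n).tangent ∞
      (fun y => (⟨e.symm y, mfderiv 𝓘(ℝ, Model n) 𝓘(ℝ, Model n) e.symm y v⟩ :
        TangentBundle 𝓘(ℝ, Model n) M)) e.target := by
  have h1 : ContMDiffOn 𝓘(ℝ, Model n) 𝓘(ℝ, Model n).tangent ∞
      (fun y : Model n => (⟨y, v⟩ : TangentBundle 𝓘(ℝ, Model n) (Model n))) e.target :=
    contMDiffOn_vectorSpace_iff_contDiffOn.mpr contDiffOn_const
  exact contMDiffOn_mfderiv_apply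
    (contMDiffOn_symm_of_mem_maximalAtlas (IsManifold.subset_maximalAtlas he)) e.open_target h1
    fun x hx => hx

theorem contDiffOn_coordRepr (he : e ∈ atlas (Model n) M)
    {V : ∀ y : Model n, TangentSpace 𝓘(ℝ, Model n) (e.symm y)}
    (hV : ContMDiffOn 𝓘(ℝ, Model n) 𝓘(ℝ, Model n).tangent ∞
      (fun y => (⟨e.symm y, V y⟩ : TangentBundle 𝓘(ℝ, Model n) M)) e.target) :
    ContDiffOn ℝ ∞ (fun y => (mfderiv 𝓘(ℝ, Model n) 𝓘(ℝ, Model n) e (e.symm y) (V y) : Model n))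
      e.target := by
  have h1 := contMDiffOn_mfderiv_apply
    (contMDiffOn_of_mem_maximalAtlas (IsManifold.subset_maximalAtlas (n := ∞) he)) e.open_source hV
    fun x hx => e.map_target hx
  exact ((contMDiff_snd_tangentBundle_modelSpace (Model n) 𝓘(ℝ, Model n)).comp_contMDiffOn
    h1).contDiffOn

/-- The coordinate expressions are the smooth sections evaluated on the smooth coordinate fields.
The differentials of `e` and `e.symm` are mutually inverse, which transports the algebraic
identities. -/
theorem inChart_isGood (he : e ∈ atlas (Model n) M) : (S.inChart e).IsGood e.target := by
  have : IsManifold 𝓘(ℝ, Model n) 1 M := IsManifold.of_le (n := ∞) (by simp)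
  have hd := mdifferentiable_of_mem_atlas (I := 𝓘(ℝ, Model n)) he
  have hs : ContMDiffOn 𝓘(ℝ, Model n) 𝓘(ℝ, Model n) ∞ e.symm e.target :=
    contMDiffOn_symm_of_mem_maximalAtlas (IsManifold.subset_maximalAtlas he)
  have h1 : ∀ y ∈ e.target, ∀ v : Model n, mfderiv 𝓘(ℝ, Model n) 𝓘(ℝ, Model n) e (e.symm y)
      (mfderiv 𝓘(ℝ, Model n) 𝓘(ℝ, Model n) e.symm y v) = v := fun y hy v =>
    DFunLike.congr_fun (hd.comp_symm_deriv hy) v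
  have h2 : ∀ y ∈ e.target, ∀ v : TangentSpace 𝓘(ℝ, Model n) (e.symm y),
      mfderiv 𝓘(ℝ, Model n) 𝓘(ℝ, Model n) e.symm y
        (mfderiv 𝓘(ℝ, Model n) 𝓘(ℝ, Model n) e (e.symm y) v) = v := fun y hy v => by
    have h3 := DFunLike.congr_fun (hd.symm_comp_deriv (e.map_target hy)) v
    have h4 : e (e.symm y) = y := e.right_inv hy
    rw [h4] at h3
    exact h3
  refine ⟨e.open_target, ?_, ?_, ?_, fun y hy => ?_⟩
  · refine contDiffOn_clm₂ fun v w => ?_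
    have h3 : ContMDiffOn 𝓘(ℝ, Model n) (𝓘(ℝ, Model n).prod 𝓘(ℝ)) ∞
      (fun y => Bundle.TotalSpace.mk' ℝ (E := Bundle.Trivial M ℝ) (e.symm y)
        (S.g.inner (e.symm y) (mfderiv 𝓘(ℝ, Model n) 𝓘(ℝ, Model n) e.symm y v)
          (mfderiv 𝓘(ℝ, Model n) 𝓘(ℝ, Model n) e.symm y w))) e.target := by
      apply ContMDiffOn.clm_bundle_apply₂ (F₁ := Model n) (F₂ := Model n)
      · exact S.g.contMDiff.comp_contMDiffOn hs
      · exact contMDiffOn_coordField he v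
      · exact contMDiffOn_coordField he w
    have h4 : ContMDiffOn 𝓘(ℝ, Model n) 𝓘(ℝ) ∞ (fun y =>
        (S.g.inner (e.symm y) (mfderiv 𝓘(ℝ, Model n) 𝓘(ℝ, Model n) e.symm y v)
          (mfderiv 𝓘(ℝ, Model n) 𝓘(ℝ, Model n) e.symm y w))) e.target := by
      intro y hy
      have h5 := h3 y hy
      simp only [Bundle.contMDiffWithinAt_totalSpace] at h5
      exact h5.2
    exact h4.contDiffOn
  · refine contDiffOn_clm_apply.mpr fun v => ?_
    refine contDiffOn_coordRepr he
      (V := fun y => S.φ (e.symm y) (mfderiv 𝓘(ℝ, Model n) 𝓘(ℝ, Model n) e.symm y v)) ?_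
    exact ContMDiffOn.clm_bundle_apply (F₁ := Model n) (F₂ := Model n)
      (S.smooth_φ.comp_contMDiffOn hs) (contMDiffOn_coordField he v)
  · exact contDiffOn_coordRepr he (V := fun y => S.ζ (e.symm y)) (S.smooth_ζ.comp_contMDiffOn hs)
  · exact isACM_pullback (P := TangentSpace 𝓘(ℝ, Model n) (e.symm y)) (S.g.symm _) (S.g.pos _)
      (S.unit_ζ _) (S.φ_sq _) (S.compat _) (h1 y hy) (h2 y hy)

/-- Both the harmonic map condition and `Holds` quantify over charts, so chartwise equivalences
suffice. -/
theorem isHarmonicMap_iff_and {P Q : LocalData n → Model n → Prop}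
    (h : ∀ e ∈ atlas (Model n) M, (S.inChart e).IsHarmonicMapOn e.target ↔
      (∀ y ∈ e.target, P (S.inChart e) y) ∧ ∀ y ∈ e.target, Q (S.inChart e) y) :
    S.IsHarmonicMap ↔ S.Holds P ∧ S.Holds Q :=
  (forall₂_congr h).trans
    ⟨fun hPQ => ⟨fun e he => (hPQ e he).1, fun e he => (hPQ e he).2⟩,
      fun hPQ e he => ⟨hPQ.1 e he, hPQ.2 e he⟩⟩

end AlmostContactMetricStructure

end AlmostContact

end

theorem theorem5p8 {n : ℕ} (hn : 1 ≤ n) {M : Type*} [TopologicalSpace M]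
    [ChartedSpace (AlmostContact.Model n) M]
    [IsManifold 𝓘(ℝ, AlmostContact.Model n) ∞ M]
    (S : AlmostContact.AlmostContactMetricStructure n M) :
    (S.IsOfType {1, 2, 4, 5, 6, 7, 8, 11, 12} →
      (S.IsHarmonicMap ↔ S.IsHarmonic ∧ S.Holds fun D y => ∀ X,
        D.dStarRicStarT y X + 1 / 2 * D.dsStar y X =
          D.ric y X (D.leeVec y) - n * D.ricStar y X (D.leeVec y) + 2 * D.ricStarXi y X
          - D.dStarF y (D.ζ y) * D.ricStar y (D.ζ y) (D.φ y X)
          - D.ricStar y X (D.ξ y (D.ζ y) (D.ζ y))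
          - D.g y (D.R y (D.ζ y) X (D.ζ y)) (D.leeVec y)
          + 3 * D.curvXiHor y X + D.curvZetaXi y X)) ∧
    (S.IsOfType {1, 2, 4, 9, 10, 11, 12} →
      (S.IsHarmonicMap ↔ S.IsHarmonic ∧ S.Holds fun D y => ∀ X,
        D.dStarRicStarT y X + 1 / 2 * D.dsStar y X =
          D.ric y X (D.leeVec y) - n * D.ricStar y X (D.leeVec y) + 2 * D.ricStarXi y X
          - D.ricStar y X (D.ξ y (D.ζ y) (D.ζ y))
          - D.g y (D.R y (D.ζ y) X (D.ζ y)) (D.leeVec y)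
          + D.curvXiHor y X + D.curvZetaXi y X)) ∧
    (S.IsOfType {1, 2, 5, 6, 7, 8} →
      (S.IsHarmonicMap ↔ S.RicStarSymm ∧ S.Holds fun D y => ∀ X,
        D.dStarRicStar y X + 1 / 2 * D.dsStar y X = 3 * D.curvXi y X)) ∧
    -- nearly-K-cosymplectic structures
    (S.IsOfType {1} → S.IsHarmonicMap) ∧
    (2 ≤ n → S.IsOfType {1, 2, 5, 6, 7, 8} → S.WeaklyAcEinstein →
      (S.IsHarmonicMap ↔ S.Holds fun D y => ∀ X,
        ((n : ℝ) - 1) * D.dsStar y X = 6 * n * D.curvXi y X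
          + (((n : ℝ) - 1) / n * D.sStar y * D.dStarEta y - 6 * D.curvXi y (D.ζ y))
            * D.eta y X)) ∧
    (S.IsOfType {1, 2, 9, 10} →
      (S.IsHarmonicMap ↔ S.IsHarmonic ∧ S.Holds fun D y => ∀ X,
        D.dStarRicStarT y X + 1 / 2 * D.dsStar y X =
          2 * D.ricStar y (D.ζ y) (D.ξ y X (D.ζ y)) + D.curvXi y X)) ∧
    (2 ≤ n → S.IsOfType {1, 2, 9, 10} → S.WeaklyAcEinstein →
      (S.IsHarmonicMap ↔ S.IsHarmonic ∧ S.Holds fun D y => ∀ X,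
        ((n : ℝ) - 1) * D.dsStar y X =
          2 * n * D.curvXi y X - 2 * D.curvXi y (D.ζ y) * D.eta y X)) ∧
    (S.IsOfType {3, 4, 5, 6, 7, 8, 11, 12} →
      (S.IsHarmonicMap ↔ S.IsHarmonic ∧ S.Holds fun D y => ∀ X,
        D.dStarRicStarT y X + 1 / 2 * D.dsStar y X =
          -((n : ℝ) - 1) * D.ricStar y X (D.leeVec y) + 2 * D.ricStarXi y X
          - D.dStarF y (D.ζ y) * D.ricStar y (D.ζ y) (D.φ y X)
          - D.ricStar y X (D.ξ y (D.ζ y) (D.ζ y))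
          - D.curvXiHor y X - D.curvZetaXi y X)) ∧
    (S.IsOfType {3, 4, 5, 6, 7, 8} →
      (S.IsHarmonicMap ↔ S.IsHarmonic ∧ S.Holds fun D y => ∀ X,
        D.dStarRicStarT y X + 1 / 2 * D.dsStar y X =
          -((n : ℝ) - 1) * D.ricStar y X (D.leeVec y) + 2 * D.ricStarXi y X
          - D.dStarF y (D.ζ y) * D.ricStar y (D.ζ y) (D.φ y X) - D.curvXi y X)) ∧
    (2 ≤ n → S.IsOfType {3, 4, 5, 6, 7, 8} → S.WeaklyAcEinstein →
      (S.IsHarmonicMap ↔ S.IsHarmonic ∧ S.Holds fun D y => ∀ X,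
        ((n : ℝ) - 1) * D.dsStar y X =
          -((n : ℝ) - 1) * D.sStar y * D.lee y X - 2 * n * D.curvXi y X
          + (((n : ℝ) - 1) / n * D.sStar y * D.dStarEta y + 2 * D.curvXi y (D.ζ y))
            * D.eta y X)) ∧
    (S.IsOfType {3, 4, 9, 10, 11, 12} →
      (S.IsHarmonicMap ↔ S.IsHarmonic ∧ S.Holds fun D y => ∀ X,
        D.dStarRicStarT y X + 1 / 2 * D.dsStar y X =
          -((n : ℝ) - 1) * D.ricStar y X (D.leeVec y) + 2 * D.ricStarXi y X
          - D.ricStar y X (D.ξ y (D.ζ y) (D.ζ y))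
          - 3 * D.curvXiHor y X - D.curvZetaXi y X)) ∧
    (S.IsOfType {3, 4, 9, 10} →
      (S.IsHarmonicMap ↔ S.IsHarmonic ∧ S.Holds fun D y => ∀ X,
        D.dStarRicStarT y X + 1 / 2 * D.dsStar y X =
          -((n : ℝ) - 1) * D.ricStar y X (D.leeVec y) + 2 * D.ricStarXi y X
          - 3 * D.curvXi y X)) ∧
    (S.IsOfType {3, 4, 9, 10} → S.RicStarSymm →
      (S.IsHarmonicMap ↔ (S.Holds fun D y => ∀ Y, D.ξ y (D.leeVec y) Y = 0) ∧
        S.Holds fun D y => ∀ X,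
          D.dStarRicStar y X + 1 / 2 * D.dsStar y X =
            -((n : ℝ) - 1) * D.ricStar y (D.leeVec y) X - 3 * D.curvXi y X)) ∧
    (2 ≤ n → S.IsOfType {3, 4, 9, 10} → S.WeaklyAcEinstein →
      (S.IsHarmonicMap ↔ (S.Holds fun D y => ∀ Y, D.ξ y (D.leeVec y) Y = 0) ∧
        S.Holds fun D y => ∀ X,
          ((n : ℝ) - 1) * D.dsStar y X =
            -((n : ℝ) - 1) * D.sStar y * D.lee y X - 6 * n * D.curvXi y X
            + 6 * D.curvXi y (D.ζ y) * D.eta y X)) ∧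
    (S.IsOfType {3, 9, 10} →
      (S.IsHarmonicMap ↔ S.RicStarSymm ∧ S.Holds fun D y => ∀ X,
        D.dStarRicStar y X + 1 / 2 * D.dsStar y X = -3 * D.curvXi y X)) ∧
    (2 ≤ n → S.IsOfType {3, 9, 10} → S.WeaklyAcEinstein →
      (S.IsHarmonicMap ↔ S.Holds fun D y => ∀ X,
        ((n : ℝ) - 1) * D.dsStar y X =
          -6 * n * D.curvXi y X + 6 * D.curvXi y (D.ζ y) * D.eta y X)) := by
  refine ⟨fun hT => ?_, fun hT => ?_, fun hT => ?_, fun hT => ?_, fun hn2 hT hW => ?_,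
    fun hT => ?_, fun hn2 hT hW => ?_, fun hT => ?_, fun hT => ?_, fun hn2 hT hW => ?_,
    fun hT => ?_, fun hT => ?_, fun hT hs => ?_, fun hn2 hT hW => ?_, fun hT => ?_,
    fun hn2 hT hW => ?_⟩
  · exact S.isHarmonicMap_iff_and fun e he =>
      (S.inChart_isGood he).isHarmonicMapOn_iff_quasi_hermitian_vertical (hT e he)
  · exact S.isHarmonicMap_iff_and fun e he =>
      (S.inChart_isGood he).isHarmonicMapOn_iff_quasi_antihermitian_vertical (hT e he)
  · exact S.isHarmonicMap_iff_and fun e he =>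
      (S.inChart_isGood he).isHarmonicMapOn_iff_quasi_hermitian (hT e he)
  · exact fun e he => (S.inChart_isGood he).isHarmonicMapOn_of_nearlyCosymplectic (hT e he)
  · exact forall₂_congr fun e he =>
      (S.inChart_isGood he).isHarmonicMapOn_iff_quasi_hermitian_einstein hn2 (hT e he) (hW e he)
  · exact S.isHarmonicMap_iff_and fun e he =>
      (S.inChart_isGood he).isHarmonicMapOn_iff_quasi_antihermitian (hT e he)
  · exact S.isHarmonicMap_iff_and fun e he =>
      (S.inChart_isGood he).isHarmonicMapOn_iff_quasi_antihermitian_einstein hn2 (hT e he) (hW e he)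
  · exact S.isHarmonicMap_iff_and fun e he =>
      (S.inChart_isGood he).isHarmonicMapOn_iff_integrable_hermitian_vertical (hT e he)
  · exact S.isHarmonicMap_iff_and fun e he =>
      (S.inChart_isGood he).isHarmonicMapOn_iff_integrable_hermitian (hT e he)
  · exact S.isHarmonicMap_iff_and fun e he =>
      (S.inChart_isGood he).isHarmonicMapOn_iff_integrable_hermitian_einstein
        hn2 (hT e he) (hW e he)
  · exact S.isHarmonicMap_iff_and fun e he =>
      (S.inChart_isGood he).isHarmonicMapOn_iff_integrable_antihermitian_vertical (hT e he)
  · exact S.isHarmonicMap_iff_and fun e he =>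
      (S.inChart_isGood he).isHarmonicMapOn_iff_integrable_antihermitian (hT e he)
  · exact S.isHarmonicMap_iff_and fun e he =>
      (S.inChart_isGood he).isHarmonicMapOn_iff_integrable_antihermitian_symm (hT e he) (hs e he)
  · exact S.isHarmonicMap_iff_and fun e he =>
      (S.inChart_isGood he).isHarmonicMapOn_iff_integrable_antihermitian_einstein
        hn2 (hT e he) (hW e he)
  · exact S.isHarmonicMap_iff_and fun e he =>
      (S.inChart_isGood he).isHarmonicMapOn_iff_balanced (hT e he)
  · exact forall₂_congr fun e he =>
      (S.inChart_isGood he).isHarmonicMapOn_iff_balanced_einstein hn2 (hT e he) (hW e he)
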